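/- Let $(X,g)$ be a complete smooth Riemannian manifold without boundary, of dimension $m\ge 2$. For an open set $U\subseteq X$ let $\mathsf H^1_0(U)$ be the completion of $C_c^\infty(U)$ (complex-valued) in the energy norm $\|f\|_1^2=\int_U(|f|^2+|df|_g^2)\,dg$, let $\mathsf H^1(X)=\mathsf H^1_0(X)$, and let the Dirichlet energy form be $\mathfrak d_U(f)=\int_U|df|_g^2\,dg$ with domain $\mathsf H^1_0(U)$ in $L^2(U)$. Let $\Delta\ge 0$ be the self-adjoint operator associated with the energy form $\mathfrak d_X$ of $X$; for $k\ge 0$ put $\mathsf H^k(\Delta)=\operatorname{dom}(\Delta+1)^{k/2}$ and $\|f\|_k=\|(\Delta+1)^{k/2}f\|_{L^2(X)}$. Let $\mathsf H^2(X)$ be the space of $f\in L^2(X)$ with weak derivatives $df,\nabla^2f\in L^2$, with norm $\|f\|_{\mathsf H^2(X)}^2=\|f\|^2+\|df\|^2+\|\nabla^2f\|^2$. Let $k\ge 2$ and $\varepsilon_0>0$, let $B_\varepsilon\subseteq X$ be closed for $\varepsilon\in(0,\varepsilon_0]$, and let $X_\varepsilon=X\setminus B_\varepsilon$. Suppose that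 $(B_\varepsilon)_\varepsilon$ is Dirichlet-asymptotically fading of order $k$, that is, there are Lipschitz functions $\chi_\varepsilon\colon X\to[0,1]$ with $\operatorname{supp}\chi_\varepsilon\subseteq X_\varepsilon$ such that, with $B_\varepsilon^+=\operatorname{supp}(1-\chi_\varepsilon)$: 1. (non-concentration) there are $\delta'_\varepsilon>0$ with $\delta'_\varepsilon\to 0$ as $\varepsilon\to 0$ and $\|f\|_{L^2(B_\varepsilon^+)}\le\delta'_\varepsilon\|f\|_{1}$ for all $f\in\mathsf H^1(X)$; 2. (elliptic regularity) there is $C_{\mathrm{ell.reg}}\ge 1$ such that every $f\in\operatorname{dom}\Delta$ lies in $\mathsf H^2(X)$ and satisfies $\|f\|_{\mathsf H^2(X)}\le C_{\mathrm{ell.reg}}\|(\Delta+1)f\|_{L^2(X)}$; 3. (moderate decay) the operator $\mathsf H^k(\Delta)\to L^2(T^*B_\varepsilon^+)$, $f\mapsto f\restriction_{B_\varepsilon^+}d\chi_\varepsilon$, is bounded, with norm $\delta_\varepsilon^+$, and $\delta_\varepsilon^+\to 0$ as $\varepsilon\to 0$. Then for every $\varepsilon\in(0,\varepsilon_0]$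 the energy form $\mathfrak d=\mathfrak d_X$ in $\mathcal H=L^2(X)$ with domain $\mathcal H^1=\mathsf H^1(X)$, and the Dirichlet energy form $\widetilde{\mathfrak d}=\mathfrak d_{X_\varepsilon}$ in $\widetilde{\mathcal H}=L^2(X_\varepsilon)$ with domain $\widetilde{\mathcal H}^1=\mathsf H^1_0(X_\varepsilon)$, are $\delta_\varepsilon$-quasi-unitarily equivalent of order $k$ with $$\delta_\varepsilon=\max\{\delta'_\varepsilon,\;C_{\mathrm{ell.reg}}\,\delta'_\varepsilon+\delta_\varepsilon^+\}.$$ This means that, with $\delta=\delta_\varepsilon$, there are bounded linear operators $J\colon\mathcal H\to\widetilde{\mathcal H}$, $J'\colon\widetilde{\mathcal H}\to\mathcal H$, $J^1\colon\mathcal H^1\to\widetilde{\mathcal H}^1$ and $J'^1\colon\widetilde{\mathcal H}^1\to\mathcal H^1$ such that - $\|Jf\|\le(1+\delta)\|f\|$ and $|\langle Jf,u\rangle-\langle f,J'u\rangle|\le\delta\|f\|\|u\|$ for $f\in\mathcal H$, $u\in\widetilde{\mathcal H}$; - $\|f-J'Jf\|\le\delta\|f\|_1$ and $\|u-JJ'u\|\le\delta\|u\|_1$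 for $f\in\mathcal H^1$, $u\in\widetilde{\mathcal H}^1$; - $\|J^1f-Jf\|\le\delta\|f\|_1$ and $\|J'^1u-J'u\|\le\delta\|u\|_1$ for $f\in\mathcal H^1$, $u\in\widetilde{\mathcal H}^1$; - $|\widetilde{\mathfrak d}(J^1f,u)-\mathfrak d(f,J'^1u)|\le\delta\|f\|_k\|u\|_1$ for $f\in\mathsf H^k(\Delta)$, $u\in\widetilde{\mathcal H}^1$. -/

import Mathlib

open Bundle MeasureTheory Manifold Filter Topology Set TopologicalSpace
open scoped ENNReal ContDiff ComplexConjugate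

noncomputable section

namespace Obstacle

set_option linter.unusedSectionVars false

/-! ### Energy forms and quasi-unitary equivalence

An energy form in a Hilbert space `H` is given by its form domain `V` (the Hilbert space `H^1`, with
norm `‖f‖_1^2 = ‖f‖^2 + d(f)`) and by the inclusion `ι : V → H`. -/

section Abstract

variable {H V H' V' : Type*}
  [NormedAddCommGroup H] [InnerProductSpace ℂ H] [CompleteSpace H]
  [NormedAddCommGroup V] [InnerProductSpace ℂ V] [CompleteSpace V]
  [NormedAddCommGroup H'] [InnerProductSpace ℂ H'] [CompleteSpace H']
  [NormedAddCommGroup V'] [InnerProductSpace ℂ V'] [CompleteSpace V']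

/-- The sesquilinear form `d(f, g) = ⟨f, g⟩_1 - ⟨f, g⟩`. -/
def form (ι : V →L[ℂ] H) (f g : V) : ℂ := inner ℂ f g - inner ℂ (ι f) (ι g)

/-- `f ∈ dom Δ` and `Δ f = h`, where `Δ` is the energy operator of the form. -/
def IsEnergyOperator (ι : V →L[ℂ] H) (f : V) (h : H) : Prop :=
  ∀ w : V, form ι f w = inner ℂ h (ι w)

/-- The resolvent `R = (Δ + 1)⁻¹` as an operator in `H`, see `isEnergyOperator_iff`. -/
def energyResolvent (ι : V →L[ℂ] H) : H →L[ℂ] H := ι ∘L ContinuousLinearMap.adjoint ι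

/-- The vector `ι† g` of the form domain, which `ι` sends to `R g`, is the solution of
`(Δ + 1) f = g`. -/
theorem isEnergyOperator_iff (ι : V →L[ℂ] H) (f : V) (h : H) :
    IsEnergyOperator ι f h ↔ ContinuousLinearMap.adjoint ι (h + ι f) = f := by
  constructor
  · intro hf
    refine ext_inner_right ℂ fun w => ?_
    have := hf w
    rw [form, sub_eq_iff_eq_add] at this
    rw [ContinuousLinearMap.adjoint_inner_left, inner_add_left, this]
  · intro hf w
    have := congrArg (fun v => inner ℂ v w) hf
    simp only [ContinuousLinearMap.adjoint_inner_left, inner_add_left] at this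
    rw [form, ← this]
    ring

/-- `f ∈ H^k = dom (Δ + 1)^{k/2}` and `(Δ + 1)^{k/2} f = g`, so that `‖f‖_k = ‖g‖`; here
`k > 0`, and `R^{k/2}` is the power of the positive operator `R` in the continuous functional
calculus. -/
def HasShiftedPower (ι : V →L[ℂ] H) (k : ℝ) (f g : H) : Prop :=
  (energyResolvent ι ^ (k / 2)) g = f

/-- `J` is `δ`-quasi-unitary with `δ`-quasi-adjoint `J'`. -/
def IsQuasiUnitary (ι : V →L[ℂ] H) (ι' : V' →L[ℂ] H') (δ : ℝ) (J : H →L[ℂ] H')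
    (J' : H' →L[ℂ] H) : Prop :=
  (∀ f, ‖J f‖ ≤ (1 + δ) * ‖f‖) ∧
  (∀ f u, ‖inner ℂ (J f) u - inner ℂ f (J' u)‖ ≤ δ * ‖f‖ * ‖u‖) ∧
  (∀ f : V, ‖ι f - J' (J (ι f))‖ ≤ δ * ‖f‖) ∧
  (∀ u : V', ‖ι' u - J (J' (ι' u))‖ ≤ δ * ‖u‖)

/-- `J₁` and `J₁'` are `δ`-compatible with `J` and `J'`. -/
def IsCompatible (ι : V →L[ℂ] H) (ι' : V' →L[ℂ] H') (δ : ℝ) (J : H →L[ℂ] H')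
    (J' : H' →L[ℂ] H) (J₁ : V →L[ℂ] V') (J₁' : V' →L[ℂ] V) : Prop :=
  (∀ f : V, ‖ι' (J₁ f) - J (ι f)‖ ≤ δ * ‖f‖) ∧
  (∀ u : V', ‖ι (J₁' u) - J' (ι' u)‖ ≤ δ * ‖u‖)

/-- The energy forms are `δ`-close of order `k` with respect to `J₁` and `J₁'`. -/
def IsCloseOfOrder (ι : V →L[ℂ] H) (ι' : V' →L[ℂ] H') (δ k : ℝ) (J₁ : V →L[ℂ] V')
    (J₁' : V' →L[ℂ] V) : Prop :=
  ∀ (f : V) (g : H) (u : V'), HasShiftedPower ι k (ι f) g →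
    ‖form ι' (J₁ f) u - form ι f (J₁' u)‖ ≤ δ * ‖g‖ * ‖u‖

/-- The energy forms are `δ`-quasi-unitarily equivalent of order `k ≥ 1`. -/
def QuasiUnitarilyEquivalent (ι : V →L[ℂ] H) (ι' : V' →L[ℂ] H') (δ k : ℝ) : Prop :=
  0 ≤ δ ∧ ∃ (J : H →L[ℂ] H') (J' : H' →L[ℂ] H) (J₁ : V →L[ℂ] V') (J₁' : V' →L[ℂ] V),
    IsQuasiUnitary ι ι' δ J J' ∧ IsCompatible ι ι' δ J J' J₁ J₁' ∧
      IsCloseOfOrder ι ι' δ k J₁ J₁'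

end Abstract

/-! ### Riemannian measure -/

section Geometry

variable {m : ℕ} {X : Type*} [EMetricSpace X] [ChartedSpace (EuclideanSpace ℝ (Fin m)) X]
  [RiemannianBundle (fun x : X => TangentSpace (𝓡 m) x)]

instance instFiniteDimensionalTangentSpace (x : X) :
    FiniteDimensional ℝ (TangentSpace (𝓡 m) x) :=
  inferInstanceAs (FiniteDimensional ℝ (EuclideanSpace ℝ (Fin m)))

/-- The preferred chart at `p`, as an open partial homeomorphism onto an open set of `ℝ^m`. -/
abbrev chart (m : ℕ) {X : Type*} [EMetricSpace X] [ChartedSpace (EuclideanSpace ℝ (Fin m)) X]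
    (p : X) : OpenPartialHomeomorph X (EuclideanSpace ℝ (Fin m)) :=
  chartAt (EuclideanSpace ℝ (Fin m)) p

/-- The `i`-th coordinate vector field `∂_i` of the chart at `p`, at the point with coordinates
`y`. -/
def coordField (p : X) (y : EuclideanSpace ℝ (Fin m)) (i : Fin m) :
    TangentSpace (𝓡 m) ((chart m p).symm y) :=
  mfderiv (𝓡 m) (𝓡 m) (chart m p).symm y (EuclideanSpace.single i (1 : ℝ))

/-- The components `g_{ij}` of the metric in the chart at `p`. -/
def gram (p : X) (y : EuclideanSpace ℝ (Fin m)) : Matrix (Fin m) (Fin m) ℝ :=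
  Matrix.of fun i j => inner ℝ (coordField p y i) (coordField p y j)

/-- The image on the chart domain at `p` of the measure `√(det g_{ij}) dy`. -/
def chartMeasure (m : ℕ) {X : Type*} [EMetricSpace X]
    [ChartedSpace (EuclideanSpace ℝ (Fin m)) X]
    [RiemannianBundle (fun x : X => TangentSpace (𝓡 m) x)] [MeasurableSpace X] (p : X) :
    Measure X :=
  Measure.map (chart m p).symm
    ((volume.restrict (chart m p).target).withDensity
      fun y => ENNReal.ofReal (√(gram p y).det))

/-- The Riemannian measure: the least measure that dominates `√(det g_{ij}) dy` in every chart.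
It coincides with that measure on each chart domain, see `riemannianMeasure_apply`. -/
def riemannianMeasure (m : ℕ) (X : Type*) [EMetricSpace X]
    [ChartedSpace (EuclideanSpace ℝ (Fin m)) X]
    [RiemannianBundle (fun x : X => TangentSpace (𝓡 m) x)] [MeasurableSpace X] : Measure X :=
  ⨆ p : X, chartMeasure m p

variable [IsManifold (𝓡 m) ∞ X]
  [IsContMDiffRiemannianBundle (𝓡 m) ∞ (EuclideanSpace ℝ (Fin m))
    (fun x : X => TangentSpace (𝓡 m) x)]

lemma continuousOn_coordField (p : X) (i : Fin m) :
    ContinuousOn (fun y => (⟨(chart m p).symm y, coordField p y i⟩ :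
      TotalSpace (EuclideanSpace ℝ (Fin m)) (fun x : X => TangentSpace (𝓡 m) x)))
      (chart m p).target := by
  have h1 : ContMDiffOn (𝓡 m) (𝓡 m) 1 (chart m p).symm (chart m p).target :=
    contMDiffOn_chart_symm
  have h2 := h1.continuousOn_tangentMapWithin le_rfl
    (chart m p).open_target.uniqueMDiffOn
  have h3 : ContinuousOn (fun y : EuclideanSpace ℝ (Fin m) =>
      (⟨y, EuclideanSpace.single i (1 : ℝ)⟩ : TangentBundle (𝓡 m) (EuclideanSpace ℝ (Fin m))))
      (chart m p).target := by
    apply Continuous.continuousOn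
    exact (tangentBundleModelSpaceHomeomorph (𝓡 m)).symm.continuous.comp
      (continuous_id.prodMk continuous_const)
  refine (h2.comp h3 (fun y hy => hy)).congr fun y hy => ?_
  simp only [Function.comp, tangentMapWithin, coordField]
  rw [mfderivWithin_of_isOpen (chart m p).open_target hy]

lemma isContinuousRiemannianBundle_tangent :
    IsContinuousRiemannianBundle (EuclideanSpace ℝ (Fin m))
      (fun x : X => TangentSpace (𝓡 m) x) := by
  obtain ⟨g, hg, h⟩ := IsContMDiffRiemannianBundle.exists_contMDiff (IB := 𝓡 m) (n := ∞)
    (F := EuclideanSpace ℝ (Fin m)) (E := fun x : X => TangentSpace (𝓡 m) x)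
  exact ⟨g, hg.continuous, h⟩

lemma continuousOn_gram (p : X) (i j : Fin m) :
    ContinuousOn (fun y => gram p y i j) (chart m p).target := by
  have := isContinuousRiemannianBundle_tangent (m := m) (X := X)
  exact ContinuousOn.inner_bundle (F := EuclideanSpace ℝ (Fin m))
    (continuousOn_coordField p i) (continuousOn_coordField p j)

/-- The change of charts from `p` to `q`. -/
def transition (p q : X) (y : EuclideanSpace ℝ (Fin m)) : EuclideanSpace ℝ (Fin m) :=
  chart m q ((chart m p).symm y)

lemma hasFDerivAt_transition {p q : X} {y : EuclideanSpace ℝ (Fin m)}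
    (hy : y ∈ (chart m p).target) (hq : (chart m p).symm y ∈ (chart m q).source) :
    HasFDerivAt (transition p q) (fderiv ℝ (transition p q) y) y := by
  have h1 := (mdifferentiable_chart (I := 𝓡 m) p).mdifferentiableAt_symm hy
  have h2 := (mdifferentiable_chart (I := 𝓡 m) q).mdifferentiableAt hq
  exact (h2.comp y h1).differentiableAt.hasFDerivAt

lemma coordField_transition {p q : X} {y : EuclideanSpace ℝ (Fin m)}
    (hy : y ∈ (chart m p).target) (hq : (chart m p).symm y ∈ (chart m q).source) (i : Fin m) :
    (coordField p y i : EuclideanSpace ℝ (Fin m)) =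
      ∑ a, (fderiv ℝ (transition p q) y (EuclideanSpace.single i 1)) a •
        (coordField q (transition p q y) a : EuclideanSpace ℝ (Fin m)) := by
  have h0 : transition p q y ∈ (chart m q).target := (chart m q).map_source hq
  have h1 := ((mdifferentiable_chart (I := 𝓡 m) q).mdifferentiableAt_symm h0).hasMFDerivAt
  have h2 : HasMFDerivAt (𝓡 m) (𝓡 m) (transition p q) y (fderiv ℝ (transition p q) y) :=
    (hasFDerivAt_transition hy hq).hasMFDerivAt
  have h3 := h1.comp y h2
  have h4 : (chart m q).symm ∘ transition p q =ᶠ[𝓝 y] (chart m p).symm := by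
    have : (chart m p).target ∩ (chart m p).symm ⁻¹' (chart m q).source ∈ 𝓝 y :=
      ((chart m p).isOpen_inter_preimage_symm (chart m q).open_source).mem_nhds ⟨hy, hq⟩
    filter_upwards [this] with z hz
    exact (chart m q).left_inv hz.2
  have h5 := (h3.congr_of_eventuallyEq h4.symm).mfderiv
  have h6 : ∀ v : EuclideanSpace ℝ (Fin m), v = ∑ a, v a • EuclideanSpace.single a (1 : ℝ) := by
    intro v
    ext b
    simp [Finset.sum_apply, Pi.single_apply]
  let L : EuclideanSpace ℝ (Fin m) →L[ℝ] EuclideanSpace ℝ (Fin m) :=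
    mfderiv (𝓡 m) (𝓡 m) (chart m q).symm (transition p q y)
  have h7 : (coordField p y i : EuclideanSpace ℝ (Fin m)) =
      L (fderiv ℝ (transition p q) y (EuclideanSpace.single i 1)) :=
    DFunLike.congr_fun (F := EuclideanSpace ℝ (Fin m) →L[ℝ] EuclideanSpace ℝ (Fin m)) h5
      (EuclideanSpace.single i 1)
  rw [h7]
  conv_lhs => rw [h6 (fderiv ℝ (transition p q) y (EuclideanSpace.single i 1))]
  rw [map_sum]
  exact Finset.sum_congr rfl fun a _ => map_smul L _ _

/-- The Jacobi matrix of the change of charts. -/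
def jacobi (p q : X) (y : EuclideanSpace ℝ (Fin m)) : Matrix (Fin m) (Fin m) ℝ :=
  Matrix.of fun a i => fderiv ℝ (transition p q) y (EuclideanSpace.single i 1) a

lemma gram_transition {p q : X} {y : EuclideanSpace ℝ (Fin m)}
    (hy : y ∈ (chart m p).target) (hq : (chart m p).symm y ∈ (chart m q).source) :
    gram p y = (jacobi p q y).transpose * gram q (transition p q y) * jacobi p q y := by
  let g : X → EuclideanSpace ℝ (Fin m) → EuclideanSpace ℝ (Fin m) → ℝ :=
    fun x v w => @inner ℝ (TangentSpace (𝓡 m) x) _ v w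
  have hg : ∀ x (c d : Fin m → ℝ) (v w : Fin m → EuclideanSpace ℝ (Fin m)),
      g x (∑ a, c a • v a) (∑ b, d b • w b) = ∑ a, ∑ b, c a * d b * g x (v a) (w b) := by
    intro x c d v w
    let v' : Fin m → TangentSpace (𝓡 m) x := v
    let w' : Fin m → TangentSpace (𝓡 m) x := w
    change inner ℝ (∑ a, c a • v' a) (∑ b, d b • w' b) =
      ∑ a, ∑ b, c a * d b * inner ℝ (v' a) (w' b)
    simp only [sum_inner, inner_sum, real_inner_smul_left, real_inner_smul_right]
    rw [Finset.sum_comm]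
    exact Finset.sum_congr rfl fun a _ => Finset.sum_congr rfl fun b _ => by ring
  have hx : (chart m q).symm (transition p q y) = (chart m p).symm y := (chart m q).left_inv hq
  ext i j
  have h1 : gram p y i j = g ((chart m p).symm y) (coordField p y i) (coordField p y j) := rfl
  have h2 : ∀ a b, gram q (transition p q y) a b = g ((chart m p).symm y)
      (coordField q (transition p q y) a) (coordField q (transition p q y) b) := by
    intro a b
    rw [← hx]
    rfl
  let cf : Fin m → EuclideanSpace ℝ (Fin m) := fun a => coordField q (transition p q y) a
  have h3 : gram p y i j = g ((chart m p).symm y) (∑ a, jacobi p q y a i • cf a)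
      (∑ b, jacobi p q y b j • cf b) := by
    rw [h1]
    exact congrArg₂ (g ((chart m p).symm y)) (coordField_transition hy hq i)
      (coordField_transition hy hq j)
  rw [h3, hg]
  simp only [Matrix.mul_apply, Matrix.transpose_apply, h2, Finset.sum_mul]
  rw [Finset.sum_comm]
  refine Finset.sum_congr rfl fun a _ => Finset.sum_congr rfl fun b _ => ?_
  change _ = _ * g _ (cf b) (cf a) * _
  ring

lemma det_jacobi (p q : X) (y : EuclideanSpace ℝ (Fin m)) :
    (jacobi p q y).det = (fderiv ℝ (transition p q) y).det := by
  have : jacobi p q y = LinearMap.toMatrix (EuclideanSpace.basisFun (Fin m) ℝ).toBasis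
      (EuclideanSpace.basisFun (Fin m) ℝ).toBasis
      (fderiv ℝ (transition p q) y : EuclideanSpace ℝ (Fin m) →ₗ[ℝ] EuclideanSpace ℝ (Fin m)) := by
    ext a i
    simp [jacobi, LinearMap.toMatrix_apply]
  rw [this, LinearMap.det_toMatrix]

lemma sqrt_det_gram_transition {p q : X} {y : EuclideanSpace ℝ (Fin m)}
    (hy : y ∈ (chart m p).target) (hq : (chart m p).symm y ∈ (chart m q).source) :
    √(gram p y).det =
      |(fderiv ℝ (transition p q) y).det| * √(gram q (transition p q y)).det := by
  rw [gram_transition hy hq, Matrix.det_mul, Matrix.det_mul, Matrix.det_transpose, ← det_jacobi,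
    mul_comm _ (jacobi p q y).det, ← mul_assoc, ← sq, Real.sqrt_mul (sq_nonneg _),
    Real.sqrt_sq_eq_abs]

lemma continuousOn_sqrt_det_gram (p : X) :
    ContinuousOn (fun y => √(gram p y).det) (chart m p).target := by
  have : ContinuousOn (fun y => gram p y) (chart m p).target :=
    continuousOn_pi.2 fun i => continuousOn_pi.2 fun j => continuousOn_gram p i j
  exact ContinuousOn.sqrt
    ((Continuous.matrix_det continuous_id).comp_continuousOn this)

variable [MeasurableSpace X] [BorelSpace X]

lemma aemeasurable_chart_symm (p : X) (ρ : EuclideanSpace ℝ (Fin m) → ℝ≥0∞) :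
    AEMeasurable (chart m p).symm ((volume.restrict (chart m p).target).withDensity ρ) :=
  ((chart m p).continuousOn_symm.aemeasurable
    (chart m p).open_target.measurableSet).mono_ac (withDensity_absolutelyContinuous _ _)

lemma measurableSet_inter_preimage_symm (p : X) {A : Set X} (hA : MeasurableSet A) :
    MeasurableSet ((chart m p).target ∩ (chart m p).symm ⁻¹' A) := by
  have h1 := ((continuousOn_iff_continuous_domRestrict.1
    (chart m p).continuousOn_symm).measurable hA)
  have h2 := MeasurableSet.subtype_image (chart m p).open_target.measurableSet h1
  convert h2 using 1
  ext y
  simp [and_comm]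

lemma chartMeasure_apply (p : X) {A : Set X} (hA : MeasurableSet A) :
    chartMeasure m p A = ∫⁻ y in (chart m p).target ∩ (chart m p).symm ⁻¹' A,
      ENNReal.ofReal (√(gram p y).det) := by
  have h0 := measurableSet_inter_preimage_symm (m := m) p hA
  have h1 : ((chart m p).symm ⁻¹' A) ∩ (chart m p).target =
      (chart m p).target ∩ (chart m p).symm ⁻¹' A := inter_comm _ _
  have h2 : ((volume.restrict (chart m p).target).withDensity
      fun y => ENNReal.ofReal (√(gram p y).det)) =
      (volume.withDensity fun y => ENNReal.ofReal (√(gram p y).det)).restrict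
        (chart m p).target :=
    (restrict_withDensity (chart m p).open_target.measurableSet _).symm
  rw [chartMeasure, Measure.map_apply_of_aemeasurable (aemeasurable_chart_symm p _) hA, h2,
    Measure.restrict_apply' (chart m p).open_target.measurableSet, h1, withDensity_apply _ h0]

lemma chartMeasure_eq_of_subset {p q : X} {A : Set X} (hA : MeasurableSet A)
    (hp : A ⊆ (chart m p).source) (hq : A ⊆ (chart m q).source) :
    chartMeasure m p A = chartMeasure m q A := by
  have hs := measurableSet_inter_preimage_symm (m := m) p hA
  rw [chartMeasure_apply p hA, chartMeasure_apply q hA]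
  have himg : (chart m q).target ∩ (chart m q).symm ⁻¹' A =
      transition p q '' ((chart m p).target ∩ (chart m p).symm ⁻¹' A) := by
    ext z
    constructor
    · rintro ⟨hz, hzA⟩
      refine ⟨chart m p ((chart m q).symm z), ⟨(chart m p).map_source (hp hzA), ?_⟩, ?_⟩
      · rw [mem_preimage, (chart m p).left_inv (hp hzA)]
        exact hzA
      · rw [transition, (chart m p).left_inv (hp hzA), (chart m q).right_inv hz]
    · rintro ⟨y, ⟨hy, hyA⟩, rfl⟩
      refine ⟨(chart m q).map_source (hq hyA), ?_⟩
      rw [mem_preimage, transition, (chart m q).left_inv (hq hyA)]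
      exact hyA
  rw [himg, lintegral_image_eq_lintegral_abs_det_fderiv_mul volume hs
    (fun y hy => (hasFDerivAt_transition hy.1 (hq hy.2)).hasFDerivWithinAt)]
  · refine setLIntegral_congr_fun hs fun y hy => ?_
    rw [sqrt_det_gram_transition hy.1 (hq hy.2), ENNReal.ofReal_mul (abs_nonneg _)]
  · intro y hy z hz h
    have h' := congrArg (chart m q).symm h
    rw [transition, transition, (chart m q).left_inv (hq hy.2),
      (chart m q).left_inv (hq hz.2)] at h'
    exact (chart m p).symm.injOn hy.1 hz.1 h'

lemma chartMeasure_compl_source (p : X) : chartMeasure m p (chart m p).sourceᶜ = 0 := by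
  rw [chartMeasure_apply p (chart m p).open_source.measurableSet.compl]
  have : (chart m p).target ∩ (chart m p).symm ⁻¹' (chart m p).sourceᶜ = ∅ := by
    ext y
    simp only [mem_inter_iff, mem_preimage, mem_compl_iff, mem_empty_iff_false, iff_false, not_and,
      not_not]
    exact fun hy => (chart m p).map_target hy
  rw [this]
  simp

/-- On every chart domain the Riemannian measure is `√(det g_{ij}) dy`. -/
theorem riemannianMeasure_apply [SecondCountableTopology X] (p : X) {A : Set X}
    (hA : MeasurableSet A) (hp : A ⊆ (chart m p).source) :
    riemannianMeasure m X A = ∫⁻ y in (chart m p).target ∩ (chart m p).symm ⁻¹' A,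
      ENNReal.ofReal (√(gram p y).det) := by
  rw [← chartMeasure_apply p hA]
  refine le_antisymm ?_ (le_iSup (fun p : X => chartMeasure m p) p A)
  obtain ⟨s, hs, hcov⟩ := TopologicalSpace.countable_cover_nhds
    (fun x : X => (chart m x).open_source.mem_nhds (mem_chart_source _ x))
  have hne : s.Nonempty := by
    rcases s.eq_empty_or_nonempty with h | h
    · rw [h] at hcov
      have : p ∈ (univ : Set X) := mem_univ p
      rw [← hcov] at this
      simp at this
    · exact h
  obtain ⟨f, rfl⟩ := hs.exists_eq_range hne
  let D : ℕ → Set X := disjointed fun n => (chart m (f n)).source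
  have hDm : ∀ n, MeasurableSet (D n) := fun n =>
    MeasurableSet.disjointed (fun n => (chart m (f n)).open_source.measurableSet) n
  have hDs : ∀ n, D n ⊆ (chart m (f n)).source := fun n => disjointed_subset _ n
  have hDU : ⋃ n, D n = univ := by
    rw [iUnion_disjointed, ← hcov, biUnion_range]
  let ν : Measure X := Measure.sum fun n => (chartMeasure m (f n)).restrict (D n)
  have key : ∀ (q : X) (S : Set X), MeasurableSet S → S ⊆ (chart m q).source →
      ν S = chartMeasure m q S := by
    intro q S hS hSq
    have : ∀ n, (chartMeasure m (f n)).restrict (D n) S = chartMeasure m q (S ∩ D n) := by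
      intro n
      rw [Measure.restrict_apply hS]
      exact chartMeasure_eq_of_subset (hS.inter (hDm n)) (inter_subset_right.trans (hDs n))
        (inter_subset_left.trans hSq)
    simp only [ν]
    rw [Measure.sum_apply _ hS]
    simp only [this]
    rw [← measure_iUnion _ (fun n => hS.inter (hDm n)), ← inter_iUnion, hDU, inter_univ]
    exact fun i j hij => ((disjoint_disjointed _) hij).mono inter_subset_right inter_subset_right
  have hle : riemannianMeasure m X ≤ ν := by
    refine iSup_le fun q => Measure.le_iff.2 fun S hS => ?_
    have hso := (chart m q).open_source.measurableSet
    calc chartMeasure m q S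
        ≤ chartMeasure m q (S ∩ (chart m q).source) + chartMeasure m q (chart m q).sourceᶜ := by
          rw [← measure_inter_add_sdiff S hso]
          exact add_le_add le_rfl (measure_mono fun x hx => hx.2)
      _ = ν (S ∩ (chart m q).source) := by
          rw [chartMeasure_compl_source, add_zero, key q _ (hS.inter hso) inter_subset_right]
      _ ≤ ν S := measure_mono inter_subset_left
  exact (hle A).trans (key p A hA hp).le

instance instIsLocallyFiniteRiemannianMeasure [SecondCountableTopology X] :
    IsLocallyFiniteMeasure (riemannianMeasure m X) := by
  refine ⟨fun p => ?_⟩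
  have h0 : chart m p p ∈ (chart m p).target := mem_chart_target _ p
  have hc := (continuousOn_sqrt_det_gram p).continuousAt ((chart m p).open_target.mem_nhds h0)
  have hlt : √(gram p (chart m p p)).det < √(gram p (chart m p p)).det + 1 := by linarith
  have hN : {y | y ∈ (chart m p).target ∧ √(gram p y).det < √(gram p (chart m p p)).det + 1} ∩
      Metric.ball (chart m p p) 1 ∈ 𝓝 (chart m p p) :=
    inter_mem (inter_mem ((chart m p).open_target.mem_nhds h0)
      (hc.eventually_lt_const hlt)) (Metric.ball_mem_nhds _ one_pos)
  obtain ⟨U, hU, hUo, hpU⟩ := mem_nhds_iff.1 hN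
  have hV : (chart m p).source ∩ chart m p ⁻¹' U ∈ 𝓝 p :=
    ((chart m p).isOpen_inter_preimage hUo).mem_nhds ⟨mem_chart_source _ p, hpU⟩
  refine ⟨_, hV, ?_⟩
  rw [riemannianMeasure_apply p ((chart m p).isOpen_inter_preimage hUo).measurableSet
    inter_subset_left]
  have hsub : (chart m p).target ∩ (chart m p).symm ⁻¹' ((chart m p).source ∩ chart m p ⁻¹' U) ⊆
      U := by
    rintro y ⟨hy, -, hy'⟩
    rw [mem_preimage, (chart m p).right_inv hy] at hy'
    exact hy'
  calc _ ≤ ∫⁻ y in U, ENNReal.ofReal (√(gram p y).det) := lintegral_mono_set hsub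
    _ ≤ ∫⁻ _ in U, ENNReal.ofReal (√(gram p (chart m p p)).det + 1) :=
        setLIntegral_mono' hUo.measurableSet fun y hy =>
          ENNReal.ofReal_le_ofReal (hU hy).1.2.le
    _ < ⊤ := by
        rw [setLIntegral_const]
        refine ENNReal.mul_lt_top ENNReal.ofReal_lt_top ?_
        exact (measure_mono (fun y hy => (hU hy).2)).trans_lt measure_ball_lt_top

end Geometry

section Covectors

variable {m : ℕ} {X : Type*} [EMetricSpace X] [ChartedSpace (EuclideanSpace ℝ (Fin m)) X]
  [RiemannianBundle (fun x : X => TangentSpace (𝓡 m) x)]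
  {F : Type*} [NormedAddCommGroup F] [NormedSpace ℝ F]

/-- An orthonormal basis of the tangent space at `x`. -/
def tangentBasis (m : ℕ) {X : Type*} [EMetricSpace X]
    [ChartedSpace (EuclideanSpace ℝ (Fin m)) X]
    [RiemannianBundle (fun x : X => TangentSpace (𝓡 m) x)] (x : X) :
    OrthonormalBasis (Fin (Module.finrank ℝ (TangentSpace (𝓡 m) x))) ℝ
      (TangentSpace (𝓡 m) x) :=
  stdOrthonormalBasis ℝ (TangentSpace (𝓡 m) x)

/-- The differential of a function on `X`, as a covector at `x`. -/
def differential (m : ℕ) {X : Type*} [EMetricSpace X]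
    [ChartedSpace (EuclideanSpace ℝ (Fin m)) X] (φ : X → F) (x : X) :
    TangentSpace (𝓡 m) x →ₗ[ℝ] F :=
  ContinuousLinearMap.toLinearMap (M₂ := F) (mfderiv (𝓡 m) 𝓘(ℝ, F) φ x)

/-- The Hermitian inner product of complex covectors induced by the metric. -/
def covectorInner {x : X} (α β : TangentSpace (𝓡 m) x →ₗ[ℝ] ℂ) : ℂ :=
  ∑ i, conj (α (tangentBasis m x i)) * β (tangentBasis m x i)

/-- The squared norm `|α|_g^2` of a (real or complex) covector. -/
def covectorNormSq {x : X} (α : TangentSpace (𝓡 m) x →ₗ[ℝ] F) : ℝ :=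
  ∑ i, ‖α (tangentBasis m x i)‖ ^ 2

/-- The squared norm `|T|_g^2` of a complex `2`-tensor. -/
def tensorNormSq {x : X} (T : TangentSpace (𝓡 m) x →ₗ[ℝ] TangentSpace (𝓡 m) x →ₗ[ℝ] ℂ) : ℝ :=
  ∑ i, ∑ j, ‖T (tangentBasis m x i) (tangentBasis m x j)‖ ^ 2

lemma differential_add [IsManifold (𝓡 m) ∞ X] {φ ψ : X → F} {x : X}
    (hφ : MDifferentiableAt (𝓡 m) 𝓘(ℝ, F) φ x) (hψ : MDifferentiableAt (𝓡 m) 𝓘(ℝ, F) ψ x) :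
    differential m (φ + ψ) x = differential m φ x + differential m ψ x := by
  have h := (hφ.hasMFDerivAt.add hψ.hasMFDerivAt).mfderiv
  ext v
  exact DFunLike.congr_fun (F := TangentSpace (𝓡 m) x →L[ℝ] F) h v

lemma differential_smul {φ : X → ℂ} {x : X} (c : ℂ)
    (hφ : MDifferentiableAt (𝓡 m) 𝓘(ℝ, ℂ) φ x) (v : TangentSpace (𝓡 m) x) :
    differential m (c • φ) x v = c * differential m φ x v := by
  have h1 : HasFDerivAt (fun z : ℂ => c * z) (c • ContinuousLinearMap.id ℝ ℂ) (φ x) :=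
    (hasFDerivAt_id (𝕜 := ℝ) (φ x)).const_mul c
  have h := (h1.hasMFDerivAt.comp x hφ.hasMFDerivAt).mfderiv
  exact DFunLike.congr_fun (F := TangentSpace (𝓡 m) x →L[ℝ] ℂ) h v

lemma differential_coordField [IsManifold (𝓡 m) ∞ X] {φ : X → F} (p : X)
    {y : EuclideanSpace ℝ (Fin m)} (hy : y ∈ (chart m p).target)
    (hφ : MDifferentiableAt (𝓡 m) 𝓘(ℝ, F) φ ((chart m p).symm y)) (i : Fin m) :
    differential m φ ((chart m p).symm y) (coordField p y i) =
      fderiv ℝ (φ ∘ (chart m p).symm) y (EuclideanSpace.single i 1) := by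
  have h1 := ((mdifferentiable_chart (I := 𝓡 m) p).mdifferentiableAt_symm hy).hasMFDerivAt
  have h := (hφ.hasMFDerivAt.comp y h1).mfderiv
  rw [mfderiv_eq_fderiv] at h
  exact (DFunLike.congr_fun (F := EuclideanSpace ℝ (Fin m) →L[ℝ] F) h
    (EuclideanSpace.single i 1)).symm

lemma covectorInner_add_left {x : X} (α β γ : TangentSpace (𝓡 m) x →ₗ[ℝ] ℂ) :
    covectorInner (α + β) γ = covectorInner α γ + covectorInner β γ := by
  simp [covectorInner, add_mul, Finset.sum_add_distrib]

lemma conj_covectorInner {x : X} (α β : TangentSpace (𝓡 m) x →ₗ[ℝ] ℂ) :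
    conj (covectorInner α β) = covectorInner β α := by
  simp [covectorInner, mul_comm]

lemma covectorInner_self {x : X} (α : TangentSpace (𝓡 m) x →ₗ[ℝ] ℂ) :
    covectorInner α α = (covectorNormSq α : ℂ) := by
  simp [covectorInner, covectorNormSq, Complex.conj_mul']

lemma exists_coord [IsManifold (𝓡 m) ∞ X] (p : X) {y : EuclideanSpace ℝ (Fin m)}
    (hy : y ∈ (chart m p).target) (v : TangentSpace (𝓡 m) ((chart m p).symm y)) :
    ∃ c : Fin m → ℝ, v = ∑ i, c i • coordField p y i := by
  have h1 := (mdifferentiable_chart (I := 𝓡 m) p).symm.mfderiv_surjective hy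
  obtain ⟨w, rfl⟩ := h1 v
  let w' : EuclideanSpace ℝ (Fin m) := w
  refine ⟨fun i => w' i, ?_⟩
  have h6 : w' = ∑ a, w' a • EuclideanSpace.single a (1 : ℝ) := by
    ext b
    simp [Finset.sum_apply, Pi.single_apply]
  let L : EuclideanSpace ℝ (Fin m) →L[ℝ] TangentSpace (𝓡 m) ((chart m p).symm y) :=
    mfderiv (𝓡 m) (𝓡 m) (chart m p).symm y
  change L w' = ∑ i, w' i • L (EuclideanSpace.single i 1)
  conv_lhs => rw [h6]
  rw [map_sum]
  exact Finset.sum_congr rfl fun a _ => map_smul L _ _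

/-- In a chart, the inner product of covectors is `∑ g^{ij} conj(α_i) β_j`. -/
lemma covectorInner_eq [IsManifold (𝓡 m) ∞ X] (p : X) {y : EuclideanSpace ℝ (Fin m)}
    (hy : y ∈ (chart m p).target)
    (α β : TangentSpace (𝓡 m) ((chart m p).symm y) →ₗ[ℝ] ℂ) :
    (gram p y).det ≠ 0 ∧ covectorInner α β =
      ∑ i, ∑ j, (((gram p y)⁻¹ i j : ℝ) : ℂ) *
        (conj (α (coordField p y i)) * β (coordField p y j)) := by
  have hm : Module.finrank ℝ (TangentSpace (𝓡 m) ((chart m p).symm y)) = m :=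
    finrank_euclideanSpace_fin (𝕜 := ℝ)
  let e := (tangentBasis m ((chart m p).symm y)).reindex (finCongr hm)
  choose c hc using fun k => exists_coord p hy (e k)
  let P : Matrix (Fin m) (Fin m) ℝ := Matrix.of c
  have h1 : P * gram p y * P.transpose = 1 := by
    ext k l
    have := orthonormal_iff_ite.1 e.orthonormal k l
    rw [hc k, hc l] at this
    simp only [sum_inner, inner_sum, real_inner_smul_left, real_inner_smul_right] at this
    rw [Matrix.one_apply, ← this]
    simp only [Matrix.mul_apply, Matrix.transpose_apply, Finset.sum_mul]
    refine Finset.sum_congr rfl fun a _ => Finset.sum_congr rfl fun b _ => ?_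
    change c k b * gram p y b a * c l a = c l a * (c k b * gram p y b a)
    ring
  have hG : (gram p y)⁻¹ = P.transpose * P := by
    have h2 : P.transpose * (P * gram p y) = 1 := by
      rw [mul_eq_one_comm]
      exact h1
    exact Matrix.inv_eq_left_inv (by rw [Matrix.mul_assoc]; exact h2)
  have hdet : (gram p y).det ≠ 0 := by
    intro h0
    have := congrArg Matrix.det h1
    simp [h0] at this
  refine ⟨hdet, ?_⟩
  have h3 : covectorInner α β = ∑ k, conj (α (e k)) * β (e k) := by
    simp only [e, OrthonormalBasis.reindex_apply]
    exact (Equiv.sum_comp (finCongr hm).symm fun i => conj (α (tangentBasis m _ i)) *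
      β (tangentBasis m _ i)).symm
  rw [h3, hG]
  have h4 : ∀ (γ : TangentSpace (𝓡 m) ((chart m p).symm y) →ₗ[ℝ] ℂ) (k : Fin m),
      γ (e k) = ∑ i, (c k i : ℂ) * γ (coordField p y i) := by
    intro γ k
    rw [hc k, map_sum]
    simp
  simp only [h4, map_sum, map_mul, Complex.conj_ofReal, Matrix.mul_apply, Matrix.transpose_apply,
    Complex.ofReal_sum, Complex.ofReal_mul, Finset.sum_mul, Finset.mul_sum]
  rw [Finset.sum_comm]
  conv_rhs => rw [Finset.sum_comm]
  refine Finset.sum_congr rfl fun j _ => ?_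
  rw [Finset.sum_comm]
  refine Finset.sum_congr rfl fun i _ => Finset.sum_congr rfl fun k _ => ?_
  change _ = (c k i : ℂ) * (c k j : ℂ) * _
  ring

end Covectors

section TestFunctions

variable {m : ℕ} {X : Type*} [EMetricSpace X] [ChartedSpace (EuclideanSpace ℝ (Fin m)) X]

/-- The space `C_c^∞(U)` of smooth complex functions on `X` with compact support in the open set
`U`. -/
def testSubmodule (m : ℕ) {X : Type*} [EMetricSpace X]
    [ChartedSpace (EuclideanSpace ℝ (Fin m)) X] (U : Opens X) : Submodule ℂ (X → ℂ) where
  carrier := {φ | ContMDiff (𝓡 m) 𝓘(ℝ, ℂ) ∞ φ ∧ HasCompactSupport φ ∧ tsupport φ ⊆ U}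
  zero_mem' := ⟨contMDiff_const, HasCompactSupport.zero, by simp [tsupport]⟩
  add_mem' := fun hφ hψ => ⟨hφ.1.add hψ.1, hφ.2.1.add hψ.2.1,
    (tsupport_add _ _).trans (union_subset hφ.2.2 hψ.2.2)⟩
  smul_mem' := fun c φ hφ => ⟨((contDiff_const.mul contDiff_id).contMDiff (f := fun z : ℂ => c * z)).comp hφ.1,
    hφ.2.1.smul_left,
    (closure_mono (Function.support_const_smul_subset c φ)).trans hφ.2.2⟩

/-- The space `C_c^∞(U)`, to be equipped with the energy inner product. -/
def TestFunction (m : ℕ) {X : Type*} [EMetricSpace X]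
    [ChartedSpace (EuclideanSpace ℝ (Fin m)) X] (U : Opens X) : Type _ :=
  testSubmodule m U

instance instAddCommGroupTestFunction (U : Opens X) : AddCommGroup (TestFunction m U) :=
  inferInstanceAs (AddCommGroup (testSubmodule m U))

instance instModuleTestFunction (U : Opens X) : Module ℂ (TestFunction m U) :=
  inferInstanceAs (Module ℂ (testSubmodule m U))

/-- The underlying function of a test function. -/
def TestFunction.toFun {U : Opens X} (φ : TestFunction m U) : X → ℂ := φ.1

lemma TestFunction.contMDiff {U : Opens X} (φ : TestFunction m U) :
    ContMDiff (𝓡 m) 𝓘(ℝ, ℂ) ∞ φ.toFun :=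
  (show φ.toFun ∈ testSubmodule m U from φ.2).1

lemma TestFunction.hasCompactSupport {U : Opens X} (φ : TestFunction m U) :
    HasCompactSupport φ.toFun :=
  (show φ.toFun ∈ testSubmodule m U from φ.2).2.1

lemma TestFunction.mdifferentiable {U : Opens X} (φ : TestFunction m U) :
    MDifferentiable (𝓡 m) 𝓘(ℝ, ℂ) φ.toFun := φ.contMDiff.mdifferentiable (by simp)

lemma TestFunction.differential_eq_zero {U : Opens X} (φ : TestFunction m U) {x : X}
    (hx : x ∉ tsupport φ.toFun) : differential m φ.toFun x = 0 := by
  have h1 : φ.toFun =ᶠ[𝓝 x] fun _ => (0 : ℂ) := notMem_tsupport_iff_eventuallyEq.1 hx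
  have h2 := h1.mfderiv_eq (I := 𝓡 m) (I' := 𝓘(ℝ, ℂ))
  rw [mfderiv_const] at h2
  ext v
  exact DFunLike.congr_fun (F := TangentSpace (𝓡 m) x →L[ℝ] ℂ) h2 v

variable [RiemannianBundle (fun x : X => TangentSpace (𝓡 m) x)] [IsManifold (𝓡 m) ∞ X]
  [IsContMDiffRiemannianBundle (𝓡 m) ∞ (EuclideanSpace ℝ (Fin m))
    (fun x : X => TangentSpace (𝓡 m) x)]

lemma continuous_covectorInner {φ ψ : X → ℂ} (hφ : ContMDiff (𝓡 m) 𝓘(ℝ, ℂ) ∞ φ)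
    (hψ : ContMDiff (𝓡 m) 𝓘(ℝ, ℂ) ∞ ψ) :
    Continuous fun x => covectorInner (differential m φ x) (differential m ψ x) := by
  refine continuous_iff_continuousAt.2 fun p => ?_
  have hd : ∀ (η : X → ℂ), ContMDiff (𝓡 m) 𝓘(ℝ, ℂ) ∞ η → ∀ i : Fin m,
      ContinuousOn (fun y => fderiv ℝ (η ∘ (chart m p).symm) y (EuclideanSpace.single i 1))
        (chart m p).target := by
    intro η hη i
    have h1 : ContMDiffOn (𝓡 m) (𝓡 m) ∞ (chart m p).symm (chart m p).target :=
      contMDiffOn_chart_symm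
    have h2 : ContDiffOn ℝ ∞ (η ∘ (chart m p).symm) (chart m p).target :=
      contMDiffOn_iff_contDiffOn.1 (hη.comp_contMDiffOn h1)
    exact (h2.continuousOn_fderiv_of_isOpen (chart m p).open_target (by simp)).clm_apply
      continuousOn_const
  have hG : ContinuousOn (fun y => gram p y) (chart m p).target :=
    continuousOn_pi.2 fun i => continuousOn_pi.2 fun j => continuousOn_gram p i j
  have hI : ∀ i j, ContinuousOn (fun y => (gram p y)⁻¹ i j) (chart m p).target := by
    intro i j
    have h1 : ContinuousOn (fun y => ((gram p y).det)⁻¹ * (gram p y).adjugate i j)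
        (chart m p).target := by
      refine ContinuousOn.mul (ContinuousOn.inv₀ ?_ fun y hy => ?_) ?_
      · exact (Continuous.matrix_det continuous_id).comp_continuousOn hG
      · exact (covectorInner_eq p hy 0 0).1
      · exact ((Continuous.matrix_adjugate continuous_id).matrix_elem i j).comp_continuousOn hG
    refine h1.congr fun y hy => ?_
    simp [Matrix.inv_def]
  have hF : ContinuousOn (fun y => ∑ i, ∑ j, (((gram p y)⁻¹ i j : ℝ) : ℂ) *
      (conj (fderiv ℝ (φ ∘ (chart m p).symm) y (EuclideanSpace.single i 1)) *
        fderiv ℝ (ψ ∘ (chart m p).symm) y (EuclideanSpace.single j 1))) (chart m p).target := by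
    refine continuousOn_finsetSum _ fun i _ => continuousOn_finsetSum _ fun j _ => ?_
    exact (Complex.continuous_ofReal.comp_continuousOn (hI i j)).mul
      ((Complex.continuous_conj.comp_continuousOn (hd φ hφ i)).mul (hd ψ hψ j))
  have h0 : chart m p p ∈ (chart m p).target := mem_chart_target _ p
  have h1 := (hF.continuousAt ((chart m p).open_target.mem_nhds h0)).comp
    ((chart m p).continuousAt (mem_chart_source _ p))
  refine h1.congr ?_
  filter_upwards [(chart m p).open_source.mem_nhds (mem_chart_source _ p)] with x hx
  have hy : chart m p x ∈ (chart m p).target := (chart m p).map_source hx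
  have h2 : ∀ z, (chart m p).symm (chart m p x) = z →
      covectorInner (differential m φ z) (differential m ψ z) =
      covectorInner (differential m φ ((chart m p).symm (chart m p x)))
        (differential m ψ ((chart m p).symm (chart m p x))) := by
    rintro z rfl
    rfl
  rw [h2 x ((chart m p).left_inv hx), (covectorInner_eq p hy _ _).2]
  refine Finset.sum_congr rfl fun i _ => Finset.sum_congr rfl fun j _ => ?_
  rw [differential_coordField p hy (hφ.mdifferentiable (by simp) _),
    differential_coordField p hy (hψ.mdifferentiable (by simp) _)]

variable [MeasurableSpace X] [BorelSpace X] [SecondCountableTopology X]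

/-- The energy inner product `∫_U (conj(φ) ψ + ⟨dφ, dψ⟩_g)` of two test functions. -/
def energyInner {U : Opens X} (φ ψ : TestFunction m U) : ℂ :=
  ∫ x in U, (conj (φ.toFun x) * ψ.toFun x +
    covectorInner (differential m φ.toFun x) (differential m ψ.toFun x)) ∂(riemannianMeasure m X)

lemma integrable_energy {U : Opens X} (φ ψ : TestFunction m U) :
    Integrable (fun x => conj (φ.toFun x) * ψ.toFun x +
      covectorInner (differential m φ.toFun x) (differential m ψ.toFun x))
      ((riemannianMeasure m X).restrict U) := by
  refine (Continuous.integrable_of_hasCompactSupport ?_ ?_).restrict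
  · exact ((Complex.continuous_conj.comp φ.contMDiff.continuous).mul ψ.contMDiff.continuous).add
      (continuous_covectorInner φ.contMDiff ψ.contMDiff)
  · refine HasCompactSupport.intro φ.hasCompactSupport fun x hx => ?_
    rw [φ.differential_eq_zero hx, image_eq_zero_of_notMem_tsupport hx]
    simp [covectorInner]

instance instCoreTestFunction (U : Opens X) : PreInnerProductSpace.Core ℂ (TestFunction m U) where
  inner := energyInner
  conj_inner_symm φ ψ := by
    change conj (energyInner ψ φ) = energyInner φ ψ
    rw [energyInner, ← integral_conj]
    refine integral_congr_ae (Eventually.of_forall fun x => ?_)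
    simp only [map_add, map_mul, Complex.conj_conj, conj_covectorInner]
    ring
  re_inner_nonneg φ := by
    change 0 ≤ (energyInner φ φ).re
    have h : energyInner φ φ = ((∫ x in U, (‖φ.toFun x‖ ^ 2 +
        covectorNormSq (differential m φ.toFun x)) ∂(riemannianMeasure m X) : ℝ) : ℂ) := by
      rw [energyInner, ← integral_complex_ofReal]
      refine integral_congr_ae (Eventually.of_forall fun x => ?_)
      simp [covectorInner_self, Complex.conj_mul']
    rw [h, Complex.ofReal_re]
    exact integral_nonneg fun x => add_nonneg (sq_nonneg _)
      (Finset.sum_nonneg fun i _ => sq_nonneg _)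
  add_left φ ψ η := by
    change energyInner (φ + ψ) η = energyInner φ η + energyInner ψ η
    rw [energyInner, energyInner, energyInner, ← integral_add (integrable_energy φ η)
      (integrable_energy ψ η)]
    refine integral_congr_ae (Eventually.of_forall fun x => ?_)
    have h1 : (φ + ψ).toFun = φ.toFun + ψ.toFun := rfl
    simp only [h1]
    rw [differential_add (φ.mdifferentiable x) (ψ.mdifferentiable x), covectorInner_add_left,
      Pi.add_apply, map_add]
    ring
  smul_left φ ψ c := by
    change energyInner (c • φ) ψ = conj c * energyInner φ ψ
    rw [energyInner, energyInner, ← integral_const_mul]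
    refine integral_congr_ae (Eventually.of_forall fun x => ?_)
    have h1 : (c • φ).toFun = c • φ.toFun := rfl
    simp only [h1]
    have h2 : covectorInner (differential m (c • φ.toFun) x) (differential m ψ.toFun x) =
        conj c * covectorInner (differential m φ.toFun x) (differential m ψ.toFun x) := by
      simp only [covectorInner, differential_smul c (φ.mdifferentiable x), map_mul,
        Finset.mul_sum, mul_assoc]
    rw [h2, Pi.smul_apply, smul_eq_mul, map_mul]
    ring

instance instSeminormedTestFunction (U : Opens X) : SeminormedAddCommGroup (TestFunction m U) :=
  InnerProductSpace.Core.toSeminormedAddCommGroup (𝕜 := ℂ)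

instance instInnerProductSpaceTestFunction (U : Opens X) :
    InnerProductSpace ℂ (TestFunction m U) :=
  InnerProductSpace.ofCore (instCoreTestFunction U)

/-- The space `L^2(U)`. -/
abbrev L2 (m : ℕ) {X : Type*} [EMetricSpace X] [ChartedSpace (EuclideanSpace ℝ (Fin m)) X]
    [RiemannianBundle (fun x : X => TangentSpace (𝓡 m) x)] [MeasurableSpace X]
    (U : Opens X) : Type _ :=
  Lp ℂ 2 ((riemannianMeasure m X).restrict U)

/-- The first Sobolev space: the completion of `C_c^∞(U)` with respect to the energy norm
`(∫_U |φ|^2 + |dφ|_g^2)^{1/2}`. -/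
abbrev FormDomain (m : ℕ) {X : Type*} [EMetricSpace X]
    [ChartedSpace (EuclideanSpace ℝ (Fin m)) X]
    [RiemannianBundle (fun x : X => TangentSpace (𝓡 m) x)] [IsManifold (𝓡 m) ∞ X]
    [IsContMDiffRiemannianBundle (𝓡 m) ∞ (EuclideanSpace ℝ (Fin m))
      (fun x : X => TangentSpace (𝓡 m) x)]
    [MeasurableSpace X] [BorelSpace X] [SecondCountableTopology X] (U : Opens X) : Type _ :=
  UniformSpace.Completion (TestFunction m U)

lemma memLp_testFunction {U : Opens X} (φ : TestFunction m U) :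
    MemLp φ.toFun 2 ((riemannianMeasure m X).restrict U) :=
  (φ.contMDiff.continuous.memLp_of_hasCompactSupport φ.hasCompactSupport).restrict _

lemma norm_toLp_le {U : Opens X} (φ : TestFunction m U) :
    ‖(memLp_testFunction φ).toLp φ.toFun‖ ≤ ‖φ‖ := by
  refine abs_le_of_sq_le_sq' ?_ (norm_nonneg _) |>.2
  rw [← inner_self_eq_norm_sq (𝕜 := ℂ) φ, ← inner_self_eq_norm_sq (𝕜 := ℂ), L2.inner_def]
  change RCLike.re (∫ x in U, _ ∂(riemannianMeasure m X)) ≤ RCLike.re (energyInner φ φ)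
  have hφ := memLp_testFunction φ
  have h1 : ∫ x in U, inner ℂ (hφ.toLp φ.toFun x) (hφ.toLp φ.toFun x) ∂(riemannianMeasure m X) =
      ((∫ x in U, ‖φ.toFun x‖ ^ 2 ∂(riemannianMeasure m X) : ℝ) : ℂ) := by
    rw [← integral_complex_ofReal]
    refine integral_congr_ae (hφ.coeFn_toLp.mono fun x hx => ?_)
    simp only [hx, inner_self_eq_norm_sq_to_K]
    simp
  have h2 : ∀ x, conj (φ.toFun x) * φ.toFun x +
      covectorInner (differential m φ.toFun x) (differential m φ.toFun x) =
      ((‖φ.toFun x‖ ^ 2 + covectorNormSq (differential m φ.toFun x) : ℝ) : ℂ) := by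
    intro x
    simp [covectorInner_self, Complex.conj_mul']
  have h3 := integrable_energy φ φ
  simp only [h2] at h3
  rw [h1, energyInner]
  simp only [h2]
  rw [integral_complex_ofReal]
  simp only [RCLike.re_to_complex, Complex.ofReal_re]
  refine integral_mono_of_nonneg (Eventually.of_forall fun x => sq_nonneg _)
    h3.re (Eventually.of_forall fun x => ?_)
  exact le_add_of_nonneg_right (Finset.sum_nonneg fun i _ => sq_nonneg _)

/-- The class in `L^2(U)` of a test function. -/
def testToL2 (U : Opens X) : TestFunction m U →L[ℂ] L2 m U :=
  LinearMap.mkContinuous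
    { toFun := fun φ => (memLp_testFunction φ).toLp φ.toFun
      map_add' := fun φ ψ => MemLp.toLp_add (memLp_testFunction φ) (memLp_testFunction ψ)
      map_smul' := fun c φ => MemLp.toLp_const_smul c (memLp_testFunction φ) }
    1 fun φ => (norm_toLp_le φ).trans_eq (one_mul _).symm

/-- The inclusion of the first Sobolev space in `L^2(U)`. -/
def embedding (m : ℕ) {X : Type*} [EMetricSpace X]
    [ChartedSpace (EuclideanSpace ℝ (Fin m)) X]
    [RiemannianBundle (fun x : X => TangentSpace (𝓡 m) x)] [IsManifold (𝓡 m) ∞ X]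
    [IsContMDiffRiemannianBundle (𝓡 m) ∞ (EuclideanSpace ℝ (Fin m))
      (fun x : X => TangentSpace (𝓡 m) x)]
    [MeasurableSpace X] [BorelSpace X] [SecondCountableTopology X] (U : Opens X) :
    FormDomain m U →L[ℂ] L2 m U :=
  (testToL2 U).extend UniformSpace.Completion.toComplL

lemma embedding_coe {U : Opens X} (φ : TestFunction m U) :
    embedding m U (φ : FormDomain m U) = testToL2 U φ := by
  exact ContinuousLinearMap.extend_eq _ (UniformSpace.Completion.denseRange_coe)
    (UniformSpace.Completion.isUniformInducing_coe _) φ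

end TestFunctions

/-! ### Second order Sobolev norm -/

section SobolevTwo

variable {m : ℕ} {X : Type*} [EMetricSpace X] [ChartedSpace (EuclideanSpace ℝ (Fin m)) X]
  [RiemannianBundle (fun x : X => TangentSpace (𝓡 m) x)]

/-- The Christoffel symbols `Γ^k_{ij}` of the Levi-Civita connection in the chart at `p`. -/
def christoffel (p : X) (y : EuclideanSpace ℝ (Fin m)) (k i j : Fin m) : ℝ :=
  ∑ l, (gram p y)⁻¹ k l / 2 *
    (fderiv ℝ (fun z => gram p z j l) y (EuclideanSpace.single i 1) +
      fderiv ℝ (fun z => gram p z i l) y (EuclideanSpace.single j 1) -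
      fderiv ℝ (fun z => gram p z i j) y (EuclideanSpace.single l 1))

/-- The covector field `α` is the weak differential of the function `f`: in every chart,
`∫ f ∂_i ψ dy = - ∫ α_i ψ dy` for all test functions `ψ`. -/
def IsWeakDifferential (f : X → ℂ) (α : ∀ x : X, TangentSpace (𝓡 m) x →ₗ[ℝ] ℂ) : Prop :=
  ∀ (p : X) (i : Fin m),
    LocallyIntegrableOn (fun y => f ((chart m p).symm y)) (chart m p).target volume ∧
    LocallyIntegrableOn (fun y => α ((chart m p).symm y) (coordField p y i))
      (chart m p).target volume ∧
    ∀ ψ : EuclideanSpace ℝ (Fin m) → ℂ, ContDiff ℝ ∞ ψ → HasCompactSupport ψ →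
      tsupport ψ ⊆ (chart m p).target →
      ∫ y in (chart m p).target,
          f ((chart m p).symm y) * fderiv ℝ ψ y (EuclideanSpace.single i 1) =
        -∫ y in (chart m p).target, α ((chart m p).symm y) (coordField p y i) * ψ y

/-- The tensor field `T` is the weak covariant derivative `∇α` of the covector field `α`: in every
chart, `T_{ij} = ∂_i α_j - ∑_k Γ^k_{ij} α_k` weakly. -/
def IsWeakCovariantDerivative (α : ∀ x : X, TangentSpace (𝓡 m) x →ₗ[ℝ] ℂ)
    (T : ∀ x : X, TangentSpace (𝓡 m) x →ₗ[ℝ] TangentSpace (𝓡 m) x →ₗ[ℝ] ℂ) : Prop :=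
  ∀ (p : X) (i j : Fin m),
    LocallyIntegrableOn (fun y => T ((chart m p).symm y) (coordField p y i) (coordField p y j))
      (chart m p).target volume ∧
    ∀ ψ : EuclideanSpace ℝ (Fin m) → ℂ, ContDiff ℝ ∞ ψ → HasCompactSupport ψ →
      tsupport ψ ⊆ (chart m p).target →
      ∫ y in (chart m p).target, α ((chart m p).symm y) (coordField p y j) *
          fderiv ℝ ψ y (EuclideanSpace.single i 1) =
        -∫ y in (chart m p).target,
          (T ((chart m p).symm y) (coordField p y i) (coordField p y j) +
            ∑ k, (christoffel p y k i j : ℂ) *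
              α ((chart m p).symm y) (coordField p y k)) * ψ y

/-- The norm `(‖f‖^2 + ‖df‖^2 + ‖∇²f‖^2)^{1/2}` of the second Sobolev space `H^2(X)`, with weak
derivatives; it is `⊤` if `f` is not in `H^2(X)`. -/
def eSobolevTwoNorm (m : ℕ) {X : Type*} [EMetricSpace X]
    [ChartedSpace (EuclideanSpace ℝ (Fin m)) X]
    [RiemannianBundle (fun x : X => TangentSpace (𝓡 m) x)] [MeasurableSpace X]
    (f : X → ℂ) : ℝ≥0∞ :=
  ⨅ (α : ∀ x : X, TangentSpace (𝓡 m) x →ₗ[ℝ] ℂ)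
    (T : ∀ x : X, TangentSpace (𝓡 m) x →ₗ[ℝ] TangentSpace (𝓡 m) x →ₗ[ℝ] ℂ)
    (_ : IsWeakDifferential f α ∧ IsWeakCovariantDerivative α T),
    (∫⁻ x, ENNReal.ofReal (‖f x‖ ^ 2 + covectorNormSq (α x) + tensorNormSq (T x))
      ∂(riemannianMeasure m X)) ^ (1 / 2 : ℝ)

end SobolevTwo

/-! ### Fading Dirichlet obstacles -/

section Fading

variable (m : ℕ) {X : Type*} [EMetricSpace X] [ChartedSpace (EuclideanSpace ℝ (Fin m)) X]
  [RiemannianBundle (fun x : X => TangentSpace (𝓡 m) x)] [IsManifold (𝓡 m) ∞ X]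
  [IsContMDiffRiemannianBundle (𝓡 m) ∞ (EuclideanSpace ℝ (Fin m))
    (fun x : X => TangentSpace (𝓡 m) x)]
  [MeasurableSpace X] [BorelSpace X] [SecondCountableTopology X]

/-- The pair `(A, X)` is `δ`-non-concentrating: `‖f‖_{L^2(A)} ≤ δ ‖f‖_{H^1(X)}` for all
`f ∈ H^1(X)`. -/
def IsNonConcentrating (A : Set X) (δ : ℝ) : Prop :=
  0 < δ ∧ ∀ f : FormDomain m (⊤ : Opens X),
    eLpNorm (embedding m ⊤ f) 2 ((riemannianMeasure m X).restrict A) ≤ ENNReal.ofReal (δ * ‖f‖)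

variable (X) in
/-- Elliptic regularity of `X` with constant `C`: `‖f‖_{H^2(X)} ≤ C ‖(Δ + 1) f‖` for all
`f ∈ dom Δ`. -/
def IsEllipticallyRegular (C : ℝ) : Prop :=
  1 ≤ C ∧ ∀ (f : FormDomain m (⊤ : Opens X)) (h : L2 m (⊤ : Opens X)),
    IsEnergyOperator (embedding m ⊤) f h →
      eSobolevTwoNorm m (embedding m ⊤ f : X → ℂ) ≤ ENNReal.ofReal (C * ‖h + embedding m ⊤ f‖)

/-- The norm of `f dχ` in `L^2(T^*A)`. -/
def eDecayNorm (A : Set X) (χ : X → ℝ) (f : X → ℂ) : ℝ≥0∞ :=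
  (∫⁻ x in A, ENNReal.ofReal (‖f x‖ ^ 2 * covectorNormSq (differential m χ x))
    ∂(riemannianMeasure m X)) ^ (1 / 2 : ℝ)

/-- The operator `f ↦ f dχ` from `H^k(Δ)` to `L^2(T^*A)` is bounded with norm `c`. -/
def HasDecayNorm (k : ℝ) (A : Set X) (χ : X → ℝ) (c : ℝ) : Prop :=
  IsLeast {b : ℝ | 0 ≤ b ∧ ∀ f g : L2 m (⊤ : Opens X), HasShiftedPower (embedding m ⊤) k f g →
    eDecayNorm m A χ f ≤ ENNReal.ofReal (b * ‖g‖)} c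

/-- The obstacles `B ε`, `0 < ε ≤ ε₀`, are Dirichlet-asymptotically fading of order `k`, with
cut-off functions `χ ε`, non-concentration constants `δ' ε` of
`(supp (1 - χ ε), X)`, constant `C` of elliptic regularity, and norms `δp ε` of `f ↦ f d(χ ε)`. -/
structure IsDirichletFading (k ε₀ : ℝ) (B : ℝ → Closeds X) (χ : ℝ → X → ℝ) (δ' : ℝ → ℝ) (C : ℝ)
    (δp : ℝ → ℝ) : Prop where
  lipschitz : ∀ ε ∈ Ioc 0 ε₀, ∃ K, LipschitzWith K (χ ε)
  mem_Icc : ∀ ε ∈ Ioc 0 ε₀, ∀ x, χ ε x ∈ Icc (0 : ℝ) 1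
  tsupport_subset : ∀ ε ∈ Ioc 0 ε₀, tsupport (χ ε) ⊆ (B ε : Set X)ᶜ
  nonConcentrating : ∀ ε ∈ Ioc 0 ε₀,
    IsNonConcentrating m (tsupport fun x => 1 - χ ε x) (δ' ε)
  tendsto_nonConcentrating : Tendsto δ' (𝓝[>] 0) (𝓝 0)
  ellipticallyRegular : IsEllipticallyRegular m X C
  moderateDecay : ∀ ε ∈ Ioc 0 ε₀,
    HasDecayNorm m k (tsupport fun x => 1 - χ ε x) (χ ε) (δp ε)
  tendsto_moderateDecay : Tendsto δp (𝓝[>] 0) (𝓝 0)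

end Fading

end Obstacle

end

/-! Write U = X ∖ B_ε, χ = χ_ε and A = supp(1 - χ). The operators are the natural ones: `J`
restricts functions to U, `J'` extends them by zero, J'¹ extends elements of H¹₀(U) by zero, and J¹
is multiplication by χ. Then `J'` is the adjoint of `J`, and on the form domain of U both u = JJ'u
and J'¹u = J'u hold exactly. The errors f - J'Jf and J¹f - Jf vanish outside A and are dominated by
|f| on A, so non-concentration bounds them by δ'‖f‖₁. For the forms, d(χf) - df = (χ - 1) df + f dχ,
hence the difference of the two forms is the inner product of this covector field with du. The term
f dχ is controlled by moderate decay, and the term (χ - 1) df by the norm of df on A.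

The heart of the matter is therefore ‖df‖_{L²(A)} ≤ δ'‖f‖_{H²}, while the hypothesis only concerns
functions. It is applied to |α| with α = df, since by Kato's inequality |d|α|| ≤ |∇α|. As |α| need
not be smooth where α vanishes, it is replaced by √(s² + |α|²) - s, whose differential is Re⟨α,
∇α⟩/√(s² + |α|²) because the Levi-Civita connection is metric (`fderiv_componentNormSq`,
`isWeakDifferential_regularizedNorm`). As H¹(X) is a completion of C_c^∞(X), this function must also
be cut off. Completeness enters here: by Hopf and Rinow closed balls are compact, which yields
compactly supported cut-offs with Lipschitz constant 1/(n+1) tending pointwise to 1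
(`exists_lipschitz_cutoffs`). Taking s = 1/(n+1) as well, the energies of the resulting functions
are at most 1 + o(1) times ‖α‖² + ‖∇α‖², and Fatou's lemma gives the bound without loss in the
constant (`IsNonConcentrating.lintegral_coords_le`). Elliptic regularity turns the H² norm into
C‖(Δ+1)f‖. For k ≥ 2 the latter is at most ‖f‖_k, because the resolvent is a positive contraction
and (Δ+1)f = R^{k/2-1} g when f = R^{k/2} g.

The rest connects the abstract completion with functions on X. An element of the form domain is
determined by a pair (value, gradient) in L², the gradient being the weak differential of the value;
conversely, limits of such pairs come from the form domain (`exists_formDomain_of_approx`), and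
mollification in charts shows that weakly differentiable functions with compact support belong to it
(`exists_formDomain_of_compact`). Covector fields are treated as ℂ^m-valued functions through an
orthonormal frame that depends measurably on the point. -/

noncomputable section

namespace Obstacle

set_option linter.unusedSectionVars false

/-! ### Weak partial derivatives in Euclidean space -/

section Euclidean

variable {E : Type*} [NormedAddCommGroup E] [InnerProductSpace ℝ E] [FiniteDimensional ℝ E]
  [MeasurableSpace E] [BorelSpace E]

/-- `k` is the weak derivative of `h` in the direction `v` on the open set `Ω`. -/
def HasWeakPartial (Ω : Set E) (v : E) (h k : E → ℂ) : Prop :=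
  LocallyIntegrableOn h Ω volume ∧ LocallyIntegrableOn k Ω volume ∧
    ∀ ψ : E → ℂ, ContDiff ℝ ∞ ψ → HasCompactSupport ψ → tsupport ψ ⊆ Ω →
      ∫ y in Ω, h y * fderiv ℝ ψ y v = -∫ y in Ω, k y * ψ y

lemma setIntegral_mul_eq_integral {Ω : Set E} (h ψ : E → ℂ) (hψ : tsupport ψ ⊆ Ω) :
    ∫ y in Ω, h y * ψ y = ∫ y, h y * ψ y := by
  refine setIntegral_eq_integral_of_forall_compl_eq_zero fun y hy => ?_
  rw [image_eq_zero_of_notMem_tsupport fun h => hy (hψ h), mul_zero]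

lemma tsupport_fderiv_apply_subset (ψ : E → ℂ) (v : E) :
    tsupport (fun y => fderiv ℝ ψ y v) ⊆ tsupport ψ := _root_.tsupport_fderiv_apply_subset ℝ v

lemma integrable_mul_of_tsupport_subset {Ω : Set E} {h ψ : E → ℂ}
    (hh : LocallyIntegrableOn h Ω volume) (hψ : Continuous ψ) (hc : HasCompactSupport ψ)
    (hs : tsupport ψ ⊆ Ω) : Integrable (fun y => h y * ψ y) := by
  have h1 : IntegrableOn h (tsupport ψ) := hh.integrableOn_compact_subset hs hc
  obtain ⟨C, hC⟩ := hc.exists_bound_of_continuous hψ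
  have h2 : IntegrableOn (fun y => h y * ψ y) (tsupport ψ) :=
    Integrable.mul_bdd h1 hψ.aestronglyMeasurable (Eventually.of_forall hC)
  refine (integrableOn_iff_integrable_of_support_subset ?_).1 h2
  intro y hy
  by_contra h'
  exact hy (by simp [image_eq_zero_of_notMem_tsupport h'])

lemma contDiff_mul_of_tsupport_subset {Ω : Set E} (hΩ : IsOpen Ω) {ρ ψ : E → ℂ}
    (hρ : ContDiffOn ℝ ∞ ρ Ω) (hψ : ContDiff ℝ ∞ ψ) (hs : tsupport ψ ⊆ Ω) :
    ContDiff ℝ ∞ (fun y => ρ y * ψ y) := by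
  refine contDiff_iff_contDiffAt.2 fun y => ?_
  by_cases hy : y ∈ tsupport ψ
  · exact (hρ.contDiffAt (hΩ.mem_nhds (hs hy))).mul hψ.contDiffAt
  · have h1 : (fun y => ρ y * ψ y) =ᶠ[𝓝 y] fun _ => 0 := by
      filter_upwards [notMem_tsupport_iff_eventuallyEq.1 hy] with z hz
      simp [hz]
    exact contDiffAt_const.congr_of_eventuallyEq h1

lemma tsupport_mul_subset_snd (ρ ψ : E → ℂ) : tsupport (fun y => ρ y * ψ y) ⊆ tsupport ψ :=
  tsupport_mul_subset_right

lemma continuous_fderiv_apply_const {ψ : E → ℂ} (hψ : ContDiff ℝ ∞ ψ) (v : E) :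
    Continuous fun y => fderiv ℝ ψ y v :=
  (hψ.continuous_fderiv (by simp)).clm_apply continuous_const

lemma hasCompactSupport_fderiv_apply_const {ψ : E → ℂ} (hψ : HasCompactSupport ψ) (v : E) :
    HasCompactSupport fun y => fderiv ℝ ψ y v :=
  hψ.of_isClosed_subset (isClosed_tsupport _) (tsupport_fderiv_apply_subset ψ v)

/-- The product ρψ is again an admissible test function, although ρ is smooth on Ω only, because ψ
is supported in Ω. Testing against ρψ and expanding by the Leibniz rule gives the formula. -/
lemma HasWeakPartial.mul_smooth {Ω : Set E} (hΩ : IsOpen Ω) {v : E} {h k ρ : E → ℂ}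
    (hk : HasWeakPartial Ω v h k) (hρ : ContDiffOn ℝ ∞ ρ Ω) :
    HasWeakPartial Ω v (fun y => ρ y * h y) (fun y => ρ y * k y + fderiv ℝ ρ y v * h y) := by
  obtain ⟨h1, h2, h3⟩ := hk
  have hd : ContinuousOn (fun y => fderiv ℝ ρ y v) Ω :=
    (hρ.continuousOn_fderiv_of_isOpen hΩ (by simp)).clm_apply continuousOn_const
  refine ⟨h1.continuousOn_mul hρ.continuousOn hΩ.isLocallyClosed,
    (h2.continuousOn_mul hρ.continuousOn hΩ.isLocallyClosed).add
      (h1.continuousOn_mul hd hΩ.isLocallyClosed), fun ψ hψ hc hs => ?_⟩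
  have hs' := (tsupport_mul_subset_snd ρ ψ).trans hs
  have hψ' := contDiff_mul_of_tsupport_subset hΩ hρ hψ hs
  have hc' : HasCompactSupport fun y => ρ y * ψ y := hc.mul_left
  have h4 := h3 _ hψ' hc' hs'
  have h5 : ∀ y ∈ Ω, h y * fderiv ℝ (fun y => ρ y * ψ y) y v =
      ρ y * h y * fderiv ℝ ψ y v + fderiv ℝ ρ y v * h y * ψ y := by
    intro y hy
    have e1 : DifferentiableAt ℝ ρ y :=
      (hρ.contDiffAt (hΩ.mem_nhds hy)).differentiableAt (by simp)
    have e2 : DifferentiableAt ℝ ψ y := hψ.contDiffAt.differentiableAt (by simp)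
    rw [fderiv_fun_mul e1 e2]
    simp
    ring
  rw [setIntegral_congr_fun hΩ.measurableSet h5, integral_add, ← eq_sub_iff_add_eq] at h4
  · rw [h4, ← neg_add', ← integral_add]
    · congr 2
      ext y
      ring
    · simp_rw [← mul_assoc]
      have := (integrable_mul_of_tsupport_subset h2 hψ'.continuous hc' hs').integrableOn (s := Ω)
      refine this.congr (Eventually.of_forall fun y => ?_)
      simp only; ring
    · exact (integrable_mul_of_tsupport_subset
        (h1.continuousOn_mul hd hΩ.isLocallyClosed) hψ.continuous hc hs).integrableOn
  · exact (integrable_mul_of_tsupport_subset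
      (h1.continuousOn_mul hρ.continuousOn hΩ.isLocallyClosed) (continuous_fderiv_apply_const hψ v)
      (hasCompactSupport_fderiv_apply_const hc v)
      ((tsupport_fderiv_apply_subset ψ v).trans hs)).integrableOn
  · exact (integrable_mul_of_tsupport_subset
        (h1.continuousOn_mul hd hΩ.isLocallyClosed) hψ.continuous hc hs).integrableOn

lemma HasWeakPartial.congr {Ω : Set E} {v : E} {h k h' k' : E → ℂ}
    (hk : HasWeakPartial Ω v h k) (e1 : h =ᵐ[volume.restrict Ω] h')
    (e2 : k =ᵐ[volume.restrict Ω] k') : HasWeakPartial Ω v h' k' := by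
  obtain ⟨h1, h2, h3⟩ := hk
  refine ⟨h1.congr ?_, h2.congr ?_, fun ψ hψ hc hs => ?_⟩
  · exact e1
  · exact e2
  · have := h3 ψ hψ hc hs
    have a1 : ∫ y in Ω, h y * fderiv ℝ ψ y v = ∫ y in Ω, h' y * fderiv ℝ ψ y v :=
      integral_congr_ae (e1.mono fun y hy => by simp [hy])
    have a2 : ∫ y in Ω, k y * ψ y = ∫ y in Ω, k' y * ψ y :=
      integral_congr_ae (e2.mono fun y hy => by simp [hy])
    rw [← a1, ← a2, this]

/-- Fundamental lemma of the calculus of variations; real test functions, viewed as complex ones,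
suffice. -/
lemma HasWeakPartial.unique {Ω : Set E} (hΩ : IsOpen Ω) {v : E} {h k k' : E → ℂ}
    (hk : HasWeakPartial Ω v h k) (hk' : HasWeakPartial Ω v h k') :
    k =ᵐ[volume.restrict Ω] k' := by
  have hl : LocallyIntegrableOn (k - k') Ω volume := hk.2.1.sub hk'.2.1
  have := hΩ.ae_eq_zero_of_integral_contDiff_smul_eq_zero hl fun g hg hc hs => ?_
  · rw [EventuallyEq, ae_restrict_iff' hΩ.measurableSet]
    filter_upwards [this] with y hy hyΩ
    exact sub_eq_zero.1 (hy hyΩ)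
  · let ψ : E → ℂ := fun y => (g y : ℂ)
    have hψ : ContDiff ℝ ∞ ψ := Complex.ofRealCLM.contDiff.comp hg
    have hs1 : tsupport ψ ⊆ tsupport g := closure_mono fun y hy => by
      simpa [ψ] using hy
    have hc1 : HasCompactSupport ψ := hc.of_isClosed_subset (isClosed_tsupport _) hs1
    have e1 := hk.2.2 ψ hψ hc1 (hs1.trans hs)
    rw [hk'.2.2 ψ hψ hc1 (hs1.trans hs), neg_inj,
      setIntegral_mul_eq_integral _ _ (hs1.trans hs),
      setIntegral_mul_eq_integral _ _ (hs1.trans hs)] at e1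
    have e2 : ∀ y, g y • (k - k') y = k y * ψ y - k' y * ψ y := by
      intro y
      simp [ψ]; ring
    simp_rw [e2]
    rw [integral_sub, e1, sub_self]
    · exact integrable_mul_of_tsupport_subset hk.2.1 hψ.continuous hc1 (hs1.trans hs)
    · exact integrable_mul_of_tsupport_subset hk'.2.1 hψ.continuous hc1 (hs1.trans hs)

lemma norm_integral_mul_le {K : Set E} {h ψ : E → ℂ} {C : ℝ}
    (hC : ∀ y, ‖ψ y‖ ≤ C) (hs : tsupport ψ ⊆ K) {ε : ℝ} (hε : 0 ≤ ε)
    (hh : ∫⁻ y in K, ‖h y‖ₑ ≤ ENNReal.ofReal ε) : ‖∫ y, h y * ψ y‖ ≤ ε * C := by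
  have hC0 : 0 ≤ C := (norm_nonneg _).trans (hC 0)
  rw [← setIntegral_mul_eq_integral h ψ hs]
  refine ENNReal.ofReal_le_ofReal_iff (by positivity) |>.1 ?_
  rw [ofReal_norm]
  refine (enorm_integral_le_lintegral_enorm _).trans ?_
  calc ∫⁻ y in K, ‖h y * ψ y‖ₑ ≤ ∫⁻ y in K, ‖h y‖ₑ * ENNReal.ofReal C := by
        refine lintegral_mono fun y => ?_
        rw [enorm_mul]
        gcongr
        rw [← ofReal_norm]
        exact ENNReal.ofReal_le_ofReal (hC y)
    _ = (∫⁻ y in K, ‖h y‖ₑ) * ENNReal.ofReal C := lintegral_mul_const' _ _ ENNReal.ofReal_ne_top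
    _ ≤ _ := by
        rw [ENNReal.ofReal_mul hε]
        gcongr

/-- A pair that is a local `L^1` limit of pairs of functions and weak derivatives is itself such
a pair. -/
lemma HasWeakPartial.of_approx {Ω : Set E} {v : E} {h k : E → ℂ}
    (h1 : LocallyIntegrableOn h Ω volume) (h2 : LocallyIntegrableOn k Ω volume)
    (H : ∀ K ⊆ Ω, IsCompact K → ∀ ε > 0, ∃ (Ω' : Set E) (h' k' : E → ℂ), K ⊆ Ω' ∧
      HasWeakPartial Ω' v h' k' ∧ ∫⁻ y in K, ‖h y - h' y‖ₑ ≤ ENNReal.ofReal ε ∧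
      ∫⁻ y in K, ‖k y - k' y‖ₑ ≤ ENNReal.ofReal ε) :
    HasWeakPartial Ω v h k := by
  refine ⟨h1, h2, fun ψ hψ hc hs => ?_⟩
  have hsd := tsupport_fderiv_apply_subset ψ v
  have hcd := hasCompactSupport_fderiv_apply_const hc v
  rw [setIntegral_mul_eq_integral _ _ hs, setIntegral_mul_eq_integral _ _ (hsd.trans hs)]
  obtain ⟨C, hC⟩ := hc.exists_bound_of_continuous hψ.continuous
  obtain ⟨D, hD⟩ := hcd.exists_bound_of_continuous (continuous_fderiv_apply_const hψ v)
  have hC0 : 0 ≤ C := (norm_nonneg _).trans (hC 0)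
  have hD0 : 0 ≤ D := (norm_nonneg _).trans (hD 0)
  rw [eq_neg_iff_add_eq_zero, ← norm_le_zero_iff]
  refine le_of_forall_pos_le_add fun η hη => ?_
  rw [zero_add]
  -- The total error is the L¹ error times C + D, where C and D bound ψ and its derivative; the
  -- added 1 keeps the denominator positive.
  obtain ⟨Ω', h', k', hK, ⟨g1, g2, g3⟩, a1, a2⟩ := H _ hs hc (η / (C + D + 1)) (by positivity)
  have g4 := g3 ψ hψ hc hK
  rw [setIntegral_mul_eq_integral _ _ hK, setIntegral_mul_eq_integral _ _ (hsd.trans hK),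
    eq_neg_iff_add_eq_zero] at g4
  have i1 := integrable_mul_of_tsupport_subset h1 (continuous_fderiv_apply_const hψ v) hcd
    (hsd.trans hs)
  have i2 := integrable_mul_of_tsupport_subset h2 hψ.continuous hc hs
  have i3 := integrable_mul_of_tsupport_subset g1 (continuous_fderiv_apply_const hψ v) hcd
    (hsd.trans hK)
  have i4 := integrable_mul_of_tsupport_subset g2 hψ.continuous hc hK
  have e : (∫ y, h y * fderiv ℝ ψ y v) + ∫ y, k y * ψ y =
      (∫ y, (h y - h' y) * fderiv ℝ ψ y v) + ∫ y, (k y - k' y) * ψ y := by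
    simp_rw [sub_mul]
    rw [integral_sub i1 i3, integral_sub i2 i4, sub_add_sub_comm, g4, sub_zero]
  rw [e]
  refine (norm_add_le _ _).trans ?_
  have b1 := norm_integral_mul_le (h := fun y => h y - h' y) hD hsd (by positivity) a1
  have b2 := norm_integral_mul_le (h := fun y => k y - k' y) hC subset_rfl (by positivity) a2
  calc _ ≤ η / (C + D + 1) * D + η / (C + D + 1) * C := add_le_add b1 b2
    _ = η * ((C + D) / (C + D + 1)) := by ring
    _ ≤ η * 1 := by
        gcongr
        rw [div_le_one (by positivity)]
        linarith
    _ = η := mul_one _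

/-- A locally Lipschitz function is weakly differentiable. -/
lemma hasWeakPartial_of_locallyLipschitzOn {Ω : Set E} (hΩ : IsOpen Ω) {f : E → ℝ}
    (hf : LocallyLipschitzOn Ω f) (v : E) :
    HasWeakPartial Ω v (fun y => (f y : ℂ)) (fun y => (fderiv ℝ f y v : ℂ)) := by
  have hl1 : LocallyIntegrableOn (fun y => (f y : ℂ)) Ω volume :=
    (Complex.continuous_ofReal.comp_continuousOn hf.continuousOn).locallyIntegrableOn
      hΩ.measurableSet
  have hl2 : LocallyIntegrableOn (fun y => (fderiv ℝ f y v : ℂ)) Ω volume := by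
    intro x hx
    obtain ⟨K, t, ht, hK⟩ := hf hx
    rw [hΩ.nhdsWithin_eq hx] at ht
    obtain ⟨r, hr, hrt⟩ := Metric.mem_nhds_iff.1 ht
    refine ⟨Metric.ball x r, mem_nhdsWithin_of_mem_nhds (Metric.ball_mem_nhds x hr), ?_⟩
    refine Measure.integrableOn_of_bounded (M := K * ‖v‖) measure_ball_lt_top.ne ?_ ?_
    · exact (Complex.measurable_ofReal.comp
        (measurable_fderiv_apply_const ℝ f v)).aestronglyMeasurable
    · refine ae_restrict_of_forall_mem measurableSet_ball fun y hy => ?_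
      rw [Complex.norm_real]
      refine ((fderiv ℝ f y).le_opNorm v).trans ?_
      gcongr
      exact norm_fderiv_le_of_lipschitzOn ℝ (Metric.isOpen_ball.mem_nhds hy) (hK.mono hrt)
  refine ⟨hl1, hl2, fun ψ hψ hc hs => ?_⟩
  -- On a compact neighbourhood of supp ψ the function f is Lipschitz and extends to a Lipschitz
  -- function g on the whole space. Rademacher's theorem and integration by parts apply to g, and f
  -- = g near supp ψ.
  obtain ⟨K, hK, hsK, hKΩ⟩ := exists_compact_between hc hΩ hs
  obtain ⟨L, hL⟩ := LocallyLipschitzOn.exists_lipschitzOnWith_of_compact hK (hf.mono hKΩ)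
  obtain ⟨g, hg, hfg⟩ := hL.extend_real
  -- Integration by parts is done for real test functions; the real and imaginary parts of ψ are
  -- treated separately afterwards.
  have hreal : ∀ ξ : E → ℝ, ContDiff ℝ ∞ ξ → tsupport ξ ⊆ tsupport ψ →
      ∫ y, f y * fderiv ℝ ξ y v = - ∫ y, fderiv ℝ f y v * ξ y := by
    intro ξ hξ hξs
    have hξc : HasCompactSupport ξ := hc.of_isClosed_subset (isClosed_tsupport _) hξs
    obtain ⟨D, hD⟩ := hξ.lipschitzWith_of_hasCompactSupport hξc (by simp)
    have := hg.integral_lineDeriv_mul_eq (μ := volume) hD hξc v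
    have e1 : ∫ y, lineDeriv ℝ g y v * ξ y = ∫ y, fderiv ℝ f y v * ξ y := by
      refine integral_congr_ae ?_
      filter_upwards [hg.ae_differentiableAt] with y hy
      by_cases hyK : y ∈ tsupport ξ
      · have : f =ᶠ[𝓝 y] g := by
          filter_upwards [isOpen_interior.mem_nhds (hsK (hξs hyK))] with z hz
          exact hfg (interior_subset hz)
        rw [this.fderiv_eq, hy.lineDeriv_eq_fderiv]
      · simp [image_eq_zero_of_notMem_tsupport hyK]
    have e2 : ∫ y, lineDeriv ℝ ξ y (-v) * g y = - ∫ y, f y * fderiv ℝ ξ y v := by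
      rw [← integral_neg]
      refine integral_congr_ae (Eventually.of_forall fun y => ?_)
      have : lineDeriv ℝ ξ y (-v) = - fderiv ℝ ξ y v := by
        rw [(hξ.differentiable (by simp) y).lineDeriv_eq_fderiv, map_neg]
      simp only [this]
      by_cases hyK : y ∈ tsupport ξ
      · rw [hfg (interior_subset (hsK (hξs hyK)))]
        ring
      · have : fderiv ℝ ξ y v = 0 := by
          have := image_eq_zero_of_notMem_tsupport (f := fderiv ℝ ξ)
            (fun h => hyK (tsupport_fderiv_subset ℝ h))
          rw [this]; rfl
        simp [this]
    rw [e1, e2] at this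
    rw [this, neg_neg]
  have hre : ∀ y, fderiv ℝ (fun z => (ψ z).re) y v = (fderiv ℝ ψ y v).re := by
    intro y
    have := (Complex.reCLM.hasFDerivAt (x := ψ y)).comp y
      (hψ.differentiable (by simp) y).hasFDerivAt
    rw [show (fun z => (ψ z).re) = Complex.reCLM ∘ ψ from rfl, this.fderiv]
    rfl
  have him : ∀ y, fderiv ℝ (fun z => (ψ z).im) y v = (fderiv ℝ ψ y v).im := by
    intro y
    have := (Complex.imCLM.hasFDerivAt (x := ψ y)).comp y
      (hψ.differentiable (by simp) y).hasFDerivAt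
    rw [show (fun z => (ψ z).im) = Complex.imCLM ∘ ψ from rfl, this.fderiv]
    rfl
  have h1 := hreal (fun z => (ψ z).re) (Complex.reCLM.contDiff.comp hψ)
    (closure_mono fun y hy => by
      intro h0
      simp [h0] at hy)
  have h2 := hreal (fun z => (ψ z).im) (Complex.imCLM.contDiff.comp hψ)
    (closure_mono fun y hy => by
      intro h0
      simp [h0] at hy)
  simp_rw [hre] at h1
  simp_rw [him] at h2
  have hsd := tsupport_fderiv_apply_subset ψ v
  rw [setIntegral_mul_eq_integral _ _ hs, setIntegral_mul_eq_integral _ _ (hsd.trans hs)]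
  have i1 := integrable_mul_of_tsupport_subset hl1 (continuous_fderiv_apply_const hψ v)
    (hasCompactSupport_fderiv_apply_const hc v) (hsd.trans hs)
  have i2 := integrable_mul_of_tsupport_subset hl2 hψ.continuous hc hs
  apply Complex.ext
  · have a1 := integral_re (𝕜 := ℂ) i1
    have a2 := integral_re (𝕜 := ℂ) i2
    simp only [RCLike.re_to_complex, Complex.re_ofReal_mul] at a1 a2
    rw [Complex.neg_re, ← a1, ← a2, h1]
  · have a1 := integral_im (𝕜 := ℂ) i1
    have a2 := integral_im (𝕜 := ℂ) i2
    simp only [RCLike.im_to_complex, Complex.im_ofReal_mul] at a1 a2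
    rw [Complex.neg_im, ← a1, ← a2, h2]

end Euclidean

lemma eLpNorm_two_sq {α F : Type*} [MeasurableSpace α] {μ : Measure α} [TopologicalSpace F]
    [ContinuousENorm F] (f : α → F) : eLpNorm f 2 μ ^ 2 = ∫⁻ x, ‖f x‖ₑ ^ 2 ∂μ := by
  have := eLpNorm_nnreal_pow_eq_lintegral (f := f) (μ := μ) (p := 2) (by norm_num)
  simpa using this

/-! ### Mollification -/

section Mollify

open scoped Convolution
open ContinuousLinearMap

variable {E : Type*} [NormedAddCommGroup E] [InnerProductSpace ℝ E] [FiniteDimensional ℝ E]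
  [MeasurableSpace E] [BorelSpace E]

/-- The convolution with a normed bump function. -/
def mollify (φ : ContDiffBump (0 : E)) (h : E → ℂ) : E → ℂ :=
  φ.normed volume ⋆[lsmul ℝ ℝ, volume] h

lemma mollify_apply (φ : ContDiffBump (0 : E)) (h : E → ℂ) (x : E) :
    mollify φ h x = ∫ t, φ.normed volume t • h (x - t) := rfl

lemma mollify_congr (φ : ContDiffBump (0 : E)) {h h' : E → ℂ} (e : h =ᵐ[volume] h') :
    mollify φ h = mollify φ h' := by
  ext x
  rw [mollify_apply, mollify_apply]
  refine integral_congr_ae ?_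
  have := (quasiMeasurePreserving_sub_left (volume : Measure E) x).ae_eq_comp e
  filter_upwards [this] with t ht
  simp only [Function.comp] at ht
  rw [ht]

/-- The mollification averages translates of h against the probability measure ν with the bump as
density. Comparison of the L¹ and L² norms with respect to ν gives a pointwise bound; Tonelli and
translation invariance integrate it. -/
lemma eLpNorm_mollify_le (φ : ContDiffBump (0 : E)) {h : E → ℂ}
    (hh : AEStronglyMeasurable h volume) :
    eLpNorm (mollify φ h) 2 volume ≤ eLpNorm h 2 volume := by
  -- Tonelli needs (x, t) ↦ h(x - t) to be jointly measurable, so a strongly measurable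
  -- representative is chosen; the mollification does not depend on it.
  wlog hm : StronglyMeasurable h generalizing h
  · have := this hh.stronglyMeasurable_mk.aestronglyMeasurable hh.stronglyMeasurable_mk
    rwa [← mollify_congr φ hh.ae_eq_mk, ← eLpNorm_congr_ae hh.ae_eq_mk] at this
  let w : E → ℝ≥0∞ := fun t => ENNReal.ofReal (φ.normed volume t)
  have hw : Measurable w := ENNReal.measurable_ofReal.comp φ.continuous_normed.measurable
  have hw1 : ∫⁻ t, w t = 1 := by
    rw [← ofReal_integral_eq_lintegral_ofReal φ.integrable_normed
      (Eventually.of_forall φ.nonneg_normed), φ.integral_normed, ENNReal.ofReal_one]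
  let ν : Measure E := volume.withDensity w
  have hν : IsProbabilityMeasure ν := ⟨by simp [ν, hw1]⟩
  have hm2 : Measurable fun z : E => ‖h z‖ₑ := hm.measurable.enorm
  have hpt : ∀ x, ‖mollify φ h x‖ₑ ^ 2 ≤ ∫⁻ t, ‖h (x - t)‖ₑ ^ 2 ∂ν := by
    intro x
    have h1 : ‖mollify φ h x‖ₑ ≤ ∫⁻ t, ‖h (x - t)‖ₑ ∂ν := by
      rw [mollify_apply]
      refine (enorm_integral_le_lintegral_enorm _).trans_eq ?_
      have hm3 : Measurable fun t => ‖h (x - t)‖ₑ := hm2.comp (measurable_const.sub measurable_id)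
      rw [lintegral_withDensity_eq_lintegral_mul _ hw hm3]
      refine lintegral_congr fun t => ?_
      rw [enorm_smul, Pi.mul_apply]
      congr 1
      exact Real.enorm_eq_ofReal (φ.nonneg_normed t)
    have h2 := eLpNorm_le_eLpNorm_of_exponent_le (μ := ν) (f := fun t => h (x - t))
      (p := 1) (q := 2) (by norm_num)
      (hm.measurable.comp (measurable_const.sub measurable_id)).aestronglyMeasurable
    rw [eLpNorm_one_eq_lintegral_enorm] at h2
    rw [← eLpNorm_two_sq (fun t => h (x - t))]
    gcongr
    exact h1.trans h2
  refine (ENNReal.pow_le_pow_left_iff two_ne_zero).1 ?_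
  rw [eLpNorm_two_sq, eLpNorm_two_sq]
  calc _ ≤ ∫⁻ x, ∫⁻ t, ‖h (x - t)‖ₑ ^ 2 ∂ν := lintegral_mono hpt
    _ = ∫⁻ t, ∫⁻ x, ‖h (x - t)‖ₑ ^ 2 ∂volume ∂ν := by
        refine lintegral_lintegral_swap ?_
        exact ((hm2.comp (measurable_fst.sub measurable_snd)).pow_const 2).aemeasurable
    _ = ∫⁻ t, ∫⁻ x, ‖h x‖ₑ ^ 2 ∂volume ∂ν := by
        refine lintegral_congr fun t => ?_
        exact lintegral_sub_right_eq_self (fun x => ‖h x‖ₑ ^ 2) t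
    _ = _ := by simp

lemma mollify_sub (φ : ContDiffBump (0 : E)) {h g : E → ℂ} (hh : LocallyIntegrable h volume)
    (hg : LocallyIntegrable g volume) : mollify φ (h - g) = mollify φ h - mollify φ g := by
  ext x
  have key : ∀ f : E → ℂ, LocallyIntegrable f volume →
      Integrable (fun t => φ.normed volume t • f (x - t)) := fun f hf =>
    φ.hasCompactSupport_normed.convolutionExists_left (lsmul ℝ ℝ) φ.continuous_normed hf x
  rw [Pi.sub_apply, mollify_apply, mollify_apply, mollify_apply, ← integral_sub (key h hh) (key g hg)]
  simp [smul_sub]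

lemma tsupport_mollify_subset (φ : ContDiffBump (0 : E)) {h : E → ℂ} {K : Set E}
    (hh : ∀ x ∉ K, h x = 0) :
    tsupport (mollify φ h) ⊆ Metric.cthickening φ.rOut K := by
  refine closure_minimal (fun x hx => ?_) Metric.isClosed_cthickening
  by_contra hxK
  refine hx ?_
  rw [mollify_apply]
  refine integral_eq_zero_of_ae (Eventually.of_forall fun t => ?_)
  by_cases ht : t ∈ Metric.ball 0 φ.rOut
  · have h2 : h (x - t) = 0 := hh _ fun h1 => ?_
    · simp [h2]
    refine hxK (Metric.mem_cthickening_of_dist_le x _ _ K h1 ?_)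
    simpa [dist_eq_norm] using (mem_ball_zero_iff.1 ht).le
  · have : φ.normed volume t = 0 := by
      rw [← φ.support_normed_eq (μ := volume)] at ht
      exact Function.notMem_support.1 ht
    simp [this]

/-- Approximate h by a continuous g with compact support. For g the convergence is uniform on a
fixed compact set, and the remaining error h - g is not enlarged by mollification. Each of the three
errors is at most ε/3. -/
lemma exists_eLpNorm_mollify_sub_le {h : E → ℂ} (hh : MemLp h 2 volume) {ε : ℝ} (hε : 0 < ε) :
    ∃ δ > 0, ∀ φ : ContDiffBump (0 : E), φ.rOut < δ →
      eLpNorm (mollify φ h - h) 2 volume ≤ ENNReal.ofReal ε := by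
  obtain ⟨g, hgc, hg, hgε⟩ := hh.exist_eLpNorm_sub_le (by norm_num) (by norm_num)
    (show 0 < ε / 3 by positivity)
  have hgm : MemLp g 2 volume := hg.continuous.memLp_of_hasCompactSupport hgc
  set K := Metric.cthickening 1 (tsupport g) with hKdef
  have hK : IsCompact K := IsCompact.cthickening hgc
  set V := (volume K).toReal
  -- A function bounded by η and vanishing outside K has L² norm at most η√vol(K).
  obtain ⟨η, hη, hηV⟩ : ∃ η > 0, η * √V ≤ ε / 3 := by
    refine ⟨ε / 3 / (√V + 1), by positivity, ?_⟩
    rw [div_mul_eq_mul_div, div_le_iff₀ (by positivity)]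
    gcongr
    linarith
  obtain ⟨δ, hδ, hδ'⟩ := Metric.uniformContinuous_iff.1
    (hgc.uniformContinuous_of_continuous hg.continuous) η hη
  -- Radius below δ gives uniform closeness of the mollified g; radius below 1 keeps its support
  -- inside K, the unit thickening of supp g.
  refine ⟨min δ 1, by positivity, fun φ hφ => ?_⟩
  have hle : ∀ x, ‖mollify φ g x - g x‖ ≤ η := by
    intro x
    rw [← dist_eq_norm]
    refine φ.dist_normed_convolution_le hg.continuous.aestronglyMeasurable fun y hy => ?_
    exact (hδ' ((Metric.mem_ball.1 hy).trans (hφ.trans_le (min_le_left _ _)))).le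
  have hsupp : ∀ x ∉ K, mollify φ g x - g x = 0 := by
    intro x hx
    rw [image_eq_zero_of_notMem_tsupport fun h => hx (Metric.self_subset_cthickening _ h),
      image_eq_zero_of_notMem_tsupport (f := mollify φ g), sub_zero]
    intro h
    have := tsupport_mollify_subset φ (fun x hx => image_eq_zero_of_notMem_tsupport hx) h
    exact hx (Metric.cthickening_mono (hφ.le.trans (min_le_right _ _)) _ this)
  have h1 : eLpNorm (mollify φ g - g) 2 volume ≤ ENNReal.ofReal (ε / 3) := by
    refine (ENNReal.pow_le_pow_left_iff two_ne_zero).1 ?_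
    rw [eLpNorm_two_sq]
    calc ∫⁻ x, ‖(mollify φ g - g) x‖ₑ ^ 2 ≤ ∫⁻ x in K, ENNReal.ofReal η ^ 2 := by
          rw [← lintegral_indicator hK.measurableSet]
          refine lintegral_mono fun x => ?_
          by_cases hx : x ∈ K
          · rw [indicator_of_mem hx, ← ofReal_norm]
            gcongr
            exact hle x
          · rw [indicator_of_notMem hx, Pi.sub_apply, hsupp x hx]
            simp
      _ = ENNReal.ofReal (η * √V) ^ 2 := by
          rw [setLIntegral_const, ENNReal.ofReal_mul hη.le, mul_pow, ← ENNReal.ofReal_pow (by positivity) (n := 2) (p := √V),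
            Real.sq_sqrt ENNReal.toReal_nonneg, ENNReal.ofReal_toReal hK.measure_lt_top.ne]
      _ ≤ _ := by gcongr
  have e : mollify φ h - h = mollify φ (h - g) + (mollify φ g - g) - (h - g) := by
    rw [mollify_sub φ (hh.locallyIntegrable (by norm_num)) (hgm.locallyIntegrable (by norm_num))]
    ext x; simp
  have m1 : ∀ f : E → ℂ, LocallyIntegrable f volume → AEStronglyMeasurable (mollify φ f) volume := fun f hf =>
    (φ.hasCompactSupport_normed.continuous_convolution_left (lsmul ℝ ℝ) φ.continuous_normed
      hf).aestronglyMeasurable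
  have hhg : MemLp (h - g) 2 volume := hh.sub hgm
  have a1 := m1 _ (hhg.locallyIntegrable (by norm_num))
  have a2 := m1 _ (hgm.locallyIntegrable (by norm_num))
  rw [e]
  refine (eLpNorm_sub_le (a1.add (a2.sub hgm.1)) hhg.1 (by norm_num)).trans ?_
  refine (add_le_add (eLpNorm_add_le a1 (a2.sub hgm.1) (by norm_num)) hgε).trans ?_
  refine (add_le_add (add_le_add ((eLpNorm_mollify_le φ hhg.1).trans hgε) h1) le_rfl).trans ?_
  rw [← ENNReal.ofReal_add (by positivity) (by positivity),
    ← ENNReal.ofReal_add (by positivity) (by positivity)]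
  gcongr
  linarith

lemma contDiff_mollify (φ : ContDiffBump (0 : E)) {h : E → ℂ} (hh : LocallyIntegrable h volume) :
    ContDiff ℝ ∞ (mollify φ h) :=
  HasCompactSupport.contDiff_convolution_left (f := φ.normed volume) (μ := volume) (lsmul ℝ ℝ)
    φ.hasCompactSupport_normed φ.contDiff_normed hh

/-- Differentiation falls on the bump. For fixed x the function t ↦ bump(x - t) is a test function,
and the definition of the weak derivative moves the derivative from it to h; the sign from x - t
cancels that of the integration by parts. -/
lemma fderiv_mollify (φ : ContDiffBump (0 : E)) {h k : E → ℂ} {v : E}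
    (hk : HasWeakPartial univ v h k) (x : E) :
    fderiv ℝ (mollify φ h) x v = mollify φ k x := by
  have hl := locallyIntegrableOn_univ.1 hk.1
  have hs := φ.hasCompactSupport_normed (μ := volume)
  have h1 := hs.hasFDerivAt_convolution_left (lsmul ℝ ℝ) φ.contDiff_normed hl x
  rw [mollify, h1.fderiv]
  let ψ : E → ℂ := fun t => (φ.normed volume (x - t) : ℂ)
  have hψ : ContDiff ℝ ∞ ψ :=
    Complex.ofRealCLM.contDiff.comp (φ.contDiff_normed.comp (contDiff_const.sub contDiff_id))
  have hc : HasCompactSupport ψ := by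
    have : HasCompactSupport fun t => φ.normed volume (x - t) :=
      φ.hasCompactSupport_normed.comp_homeomorph (Homeomorph.subLeft x)
    exact this.comp_left Complex.ofReal_zero
  have h2 := hk.2.2 ψ hψ hc (subset_univ _)
  simp only [Measure.restrict_univ] at h2
  have hd : ∀ t, fderiv ℝ ψ t v = -(fderiv ℝ (φ.normed volume) (x - t) v : ℂ) := by
    intro t
    have e1 : HasFDerivAt (φ.normed volume) (fderiv ℝ (φ.normed volume) (x - t)) (x - t) :=
      ((φ.contDiff_normed (n := 1)).differentiable (by simp) _).hasFDerivAt
    have e2 := (Complex.ofRealCLM.hasFDerivAt (x := φ.normed volume (x - t))).comp t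
      (e1.comp t ((hasFDerivAt_id t).const_sub x))
    have e3 : fderiv ℝ ψ t = _ := e2.fderiv
    rw [e3]
    simp
  have hci : ConvolutionExistsAt (fderiv ℝ (φ.normed volume)) h x ((lsmul ℝ ℝ).precompL E) volume :=
    (φ.hasCompactSupport_normed.fderiv ℝ).convolutionExists_left _
      ((φ.contDiff_normed (n := 1)).continuous_fderiv (by simp)) hl x
  rw [convolution_def, ContinuousLinearMap.integral_apply hci]
  have e4 : ∀ t, ((((lsmul ℝ ℝ).precompL E : (E →L[ℝ] ℝ) →L[ℝ] ℂ →L[ℝ] E →L[ℝ] ℂ)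
      (fderiv ℝ (φ.normed volume) t)) (h (x - t))) v =
      (fun s => -(h s * fderiv ℝ ψ s v)) (x - t) := by
    intro t
    simp only [ContinuousLinearMap.precompL_apply, lsmul_apply, hd, sub_sub_cancel]
    rw [Complex.real_smul]
    ring
  simp_rw [e4]
  rw [integral_sub_left_eq_self (fun s => -(h s * fderiv ℝ ψ s v)) volume x, integral_neg, h2,
    neg_neg, mollify_apply, ← integral_sub_left_eq_self (fun s => k s * ψ s) volume x]
  refine integral_congr_ae (Eventually.of_forall fun t => ?_)
  simp [ψ, mul_comm]

/-- Smooth approximation in `W^{1,2}` of a function with compact support. -/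
lemma exists_smooth_approx {ι : Type*} [Finite ι] (v : ι → E) {h : E → ℂ} {k : ι → E → ℂ}
    (hw : ∀ i, HasWeakPartial univ (v i) h (k i)) (hh : MemLp h 2 volume)
    (hk : ∀ i, MemLp (k i) 2 volume) {K K' : Set E} (hK : IsCompact K) (hKK : K ⊆ interior K')
    (hs : ∀ x ∉ K, h x = 0) {ε : ℝ} (hε : 0 < ε) :
    ∃ φ : E → ℂ, ContDiff ℝ ∞ φ ∧ tsupport φ ⊆ K' ∧
      eLpNorm (φ - h) 2 volume ≤ ENNReal.ofReal ε ∧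
      ∀ i, eLpNorm ((fun y => fderiv ℝ φ y (v i)) - k i) 2 volume ≤ ENNReal.ofReal ε := by
  cases nonempty_fintype ι
  obtain ⟨δ₀, hδ₀, h0⟩ := exists_eLpNorm_mollify_sub_le hh hε
  choose δ hδ h1 using fun i => exists_eLpNorm_mollify_sub_le (hk i) hε
  obtain ⟨δ₁, hδ₁, h2⟩ := hK.exists_cthickening_subset_open isOpen_interior hKK
  -- One radius serves h, its finitely many derivatives, and the requirement that the support remain
  -- in K'.
  obtain ⟨r, hr, hr0, hr1, hri⟩ : ∃ r > 0, r < δ₀ ∧ r < δ₁ ∧ ∀ i, r < δ i := by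
    have h4 : ∀ d : ℝ, 0 < d → ∀ᶠ r in 𝓝[>] (0 : ℝ), r < d := fun d hd =>
      nhdsWithin_le_nhds (Iio_mem_nhds hd)
    have h5 : ∀ᶠ r in 𝓝[>] (0 : ℝ), r > 0 := self_mem_nhdsWithin
    exact (h5.and ((h4 _ hδ₀).and ((h4 _ hδ₁).and
      (eventually_all.2 fun i => h4 _ (hδ i))))).exists
  let φ : ContDiffBump (0 : E) := ⟨r / 2, r, by positivity, by linarith⟩
  refine ⟨mollify φ h, contDiff_mollify φ (hh.locallyIntegrable (by norm_num)), ?_, h0 φ hr0,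
    fun i => ?_⟩
  · exact (tsupport_mollify_subset φ hs).trans
      ((Metric.cthickening_mono hr1.le _).trans (h2.trans interior_subset))
  · have : (fun y => fderiv ℝ (mollify φ h) y (v i)) = mollify φ (k i) :=
      funext fun y => fderiv_mollify φ (hw i) y
    rw [this]
    exact h1 i φ (hri i)

lemma exists_smooth_cutoff {K Ω : Set E} (hK : IsCompact K) (hΩ : IsOpen Ω) (hs : K ⊆ Ω) :
    ∃ (K' : Set E) (θ : E → ℂ), IsCompact K' ∧ K' ⊆ Ω ∧ ContDiff ℝ ∞ θ ∧ tsupport θ ⊆ K' ∧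
      ∀ᶠ x in 𝓝ˢ K, θ x = 1 := by
  obtain ⟨K', hK', h1, h2⟩ := exists_compact_between hK hΩ hs
  obtain ⟨f, hf1, hf0, -⟩ := exists_contMDiffMap_one_nhds_of_subset_interior (n := (⊤ : ℕ∞)) 𝓘(ℝ, E)
    hK.isClosed h1
  refine ⟨K', fun x => (f x : ℂ), hK', h2, Complex.ofRealCLM.contDiff.comp f.contMDiff.contDiff,
    closure_minimal (fun x hx => ?_) hK'.isClosed, hf1.mono fun x hx => by simp [hx]⟩
  by_contra h
  exact hx (by simp [hf0 x h])

/-- An arbitrary test function may be multiplied by a cut-off θ supported in Ω and equal to 1 near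
K: on K neither its values nor its derivatives change, and elsewhere h and k vanish. -/
lemma HasWeakPartial.univ_of_compact {Ω K : Set E} (hΩ : IsOpen Ω) (hK : IsCompact K) (hs : K ⊆ Ω)
    {v : E} {h k : E → ℂ} (hw : HasWeakPartial Ω v h k) (h0 : ∀ x ∉ K, h x = 0)
    (k0 : ∀ x ∉ K, k x = 0) : HasWeakPartial univ v h k := by
  obtain ⟨K', θ, hK', hKΩ, hθ, hθs, hθ1⟩ := exists_smooth_cutoff hK hΩ hs
  have hl : ∀ f : E → ℂ, LocallyIntegrableOn f Ω volume → (∀ x ∉ K, f x = 0) →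
      LocallyIntegrableOn f univ volume := by
    intro f hf f0
    have := hf.integrableOn_compact_subset hs hK
    rw [integrableOn_iff_integrable_of_support_subset
      (fun x hx => by by_contra h; exact hx (f0 x h))] at this
    exact locallyIntegrableOn_univ.2 this.locallyIntegrable
  refine ⟨hl h hw.1 h0, hl k hw.2.1 k0, fun ψ hψ hc _ => ?_⟩
  have hψ' : ContDiff ℝ ∞ fun y => θ y * ψ y := hθ.mul hψ
  have hs' : tsupport (fun y => θ y * ψ y) ⊆ Ω := tsupport_mul_subset_left.trans (hθs.trans hKΩ)
  have := hw.2.2 _ hψ' hc.mul_left hs'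
  rw [setIntegral_mul_eq_integral _ _ hs', setIntegral_mul_eq_integral _ _
    ((tsupport_fderiv_apply_subset _ v).trans hs')] at this
  simp only [Measure.restrict_univ]
  have e1 : ∀ y, h y * fderiv ℝ (fun y => θ y * ψ y) y v = h y * fderiv ℝ ψ y v := by
    intro y
    by_cases hy : y ∈ K
    · have : (fun y => θ y * ψ y) =ᶠ[𝓝 y] ψ := by
        filter_upwards [eventually_nhdsSet_iff_forall.1 hθ1 y hy] with z hz
        rw [hz, one_mul]
      rw [this.fderiv_eq]
    · simp [h0 y hy]
  have e2 : ∀ y, k y * (θ y * ψ y) = k y * ψ y := by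
    intro y
    by_cases hy : y ∈ K
    · rw [(eventually_nhdsSet_iff_forall.1 hθ1 y hy).self_of_nhds, one_mul]
    · simp [k0 y hy]
  simp_rw [e1, e2] at this
  exact this

/-- Smooth approximation in `W^{1,2}` on compact sets. -/
lemma exists_smooth_approx_local {ι : Type*} [Finite ι] {Ω : Set E} (hΩ : IsOpen Ω) (v : ι → E)
    {h : E → ℂ} {k : ι → E → ℂ} (hw : ∀ i, HasWeakPartial Ω (v i) h (k i))
    (hh : ∀ K ⊆ Ω, IsCompact K → MemLp h 2 (volume.restrict K))
    (hk : ∀ i, ∀ K ⊆ Ω, IsCompact K → MemLp (k i) 2 (volume.restrict K))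
    {K : Set E} (hK : IsCompact K) (hs : K ⊆ Ω) {ε : ℝ} (hε : 0 < ε) :
    ∃ φ : E → ℂ, ContDiff ℝ ∞ φ ∧ eLpNorm (φ - h) 2 (volume.restrict K) ≤ ENNReal.ofReal ε ∧
      ∀ i, eLpNorm ((fun y => fderiv ℝ φ y (v i)) - k i) 2 (volume.restrict K) ≤
        ENNReal.ofReal ε := by
  obtain ⟨K', θ, hK', hKΩ, hθ, hθs, hθ1⟩ := exists_smooth_cutoff hK hΩ hs
  have hθ0 : ∀ x ∉ K', θ x = 0 := fun x hx => image_eq_zero_of_notMem_tsupport fun h => hx (hθs h)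
  have hθd0 : ∀ i, ∀ x ∉ K', fderiv ℝ θ x (v i) = 0 := fun i x hx =>
    image_eq_zero_of_notMem_tsupport (f := fun y => fderiv ℝ θ y (v i)) fun h =>
      hx (hθs (tsupport_fderiv_apply_subset θ (v i) h))
  have hθc : HasCompactSupport θ := hK'.of_isClosed_subset (isClosed_tsupport _) hθs
  have hb : ∀ (f g : E → ℂ), (∀ K ⊆ Ω, IsCompact K → MemLp f 2 (volume.restrict K)) →
      Continuous g → HasCompactSupport g → (∀ x ∉ K', g x = 0) →
      MemLp (fun y => g y * f y) 2 volume := by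
    intro f g hf hg hgc hg0
    obtain ⟨C, hC⟩ := hgc.exists_bound_of_continuous hg
    have h1 : MemLp (fun y => g y * f y) 2 (volume.restrict K') := by
      refine MemLp.of_le_mul (hf K' hKΩ hK') (hg.aestronglyMeasurable.mul (hf K' hKΩ hK').1)
        (Eventually.of_forall fun y => ?_) (c := C)
      rw [norm_mul]
      gcongr
      exact hC y
    rw [← memLp_indicator_iff_restrict hK'.measurableSet] at h1
    refine h1.ae_eq (Eventually.of_forall fun y => ?_)
    by_cases hy : y ∈ K'
    · simp [hy]
    · simp [hy, hg0 y hy]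
  -- The global approximation is applied to θh. Since θ = 1 near K, the term containing the
  -- derivative of θ disappears on K, and there the errors are those of h and k i.
  have w1 : ∀ i, HasWeakPartial univ (v i) (fun y => θ y * h y)
      (fun y => θ y * k i y + fderiv ℝ θ y (v i) * h y) := fun i =>
    ((hw i).mul_smooth hΩ hθ.contDiffOn).univ_of_compact hΩ hK' hKΩ
      (fun x hx => by simp [hθ0 x hx]) (fun x hx => by simp [hθ0 x hx, hθd0 i x hx])
  obtain ⟨K'', hK'', hKK, -⟩ := exists_compact_between hK' isOpen_univ (subset_univ _)
  obtain ⟨φ, hφ, -, a1, a2⟩ := exists_smooth_approx v w1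
    (hb h θ hh hθ.continuous hθc hθ0)
    (fun i => (hb (k i) θ (hk i) hθ.continuous hθc hθ0).add (hb h _ hh
      (continuous_fderiv_apply_const hθ _) (hasCompactSupport_fderiv_apply_const hθc _) (hθd0 i)))
    hK' hKK (fun x hx => by simp [hθ0 x hx]) hε
  refine ⟨φ, hφ, ?_, fun i => ?_⟩
  · refine (Eq.trans_le ?_ (eLpNorm_mono_measure _ (Measure.restrict_le_self (s := K)))).trans a1
    refine eLpNorm_congr_ae (ae_restrict_of_forall_mem hK.measurableSet fun y hy => ?_)
    simp [(eventually_nhdsSet_iff_forall.1 hθ1 y hy).self_of_nhds]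
  · refine (Eq.trans_le ?_ (eLpNorm_mono_measure _ (Measure.restrict_le_self (s := K)))).trans (a2 i)
    refine eLpNorm_congr_ae (ae_restrict_of_forall_mem hK.measurableSet fun y hy => ?_)
    have e := eventually_nhdsSet_iff_forall.1 hθ1 y hy
    have : fderiv ℝ θ y = 0 := by
      rw [Filter.EventuallyEq.fderiv_eq (f := fun _ => (1 : ℂ)) e]
      simp
    simp [e.self_of_nhds, this]

end Mollify

/-! ### Compactness of balls in complete length spaces -/

section HopfRinow

open scoped NNReal

variable {X : Type*} [EMetricSpace X]

/-- The theorem of Hopf and Rinow: in a complete locally compact length space closed balls of finite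
radius are compact. -/
lemma isCompact_closedEBall_of_length [CompleteSpace X] [LocallyCompactSpace X]
    (hL : ∀ (x y : X) (a b : ℝ≥0∞), edist x y < a + b → 0 < b → ∃ z, edist x z ≤ a ∧ edist z y < b)
    (x : X) (r : ℝ≥0) : IsCompact (Metric.closedEBall x (r : ℝ≥0∞)) := by
  by_contra hr
  -- The radii of compact balls form an interval starting at 0. If it is bounded, its supremum s
  -- belongs to it, and then so does a larger radius, which is absurd.
  let S : Set ℝ≥0∞ := {r | IsCompact (Metric.closedEBall x r)}
  have hdown : ∀ a b, a ≤ b → b ∈ S → a ∈ S := fun a b hab hb =>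
    IsCompact.of_isClosed_subset hb Metric.isClosed_closedEBall
      (Metric.closedEBall_subset_closedEBall hab)
  have hbdd : ∀ a ∈ S, a ≤ r := fun a ha => le_of_not_ge fun h => hr (hdown _ _ h ha)
  have h0 : (0 : ℝ≥0∞) ∈ S := by
    have : Metric.closedEBall x 0 = {x} := by
      ext y; simp
    change IsCompact (Metric.closedEBall x 0)
    rw [this]
    exact isCompact_singleton
  set s := sSup S with hs
  have hsr : s ≤ r := sSup_le hbdd
  have hsfin : s ≠ ⊤ := (hsr.trans_lt ENNReal.coe_lt_top).ne
  have hsS : IsCompact (Metric.closedEBall x s) := by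
    -- The length property puts every point of the ball of radius s within ε/2 of a compact ball of
    -- radius q, with s < q + ε/2; a finite ε/2-net of that smaller ball is a finite ε-net of the
    -- larger one.
    refine TotallyBounded.isCompact_of_isClosed ?_ Metric.isClosed_closedEBall
    refine EMetric.totallyBounded_iff.2 fun ε hε => ?_
    have hε2 : 0 < ε / 2 := ENNReal.half_pos hε.ne'
    obtain ⟨q, hq, hqs⟩ : ∃ q ∈ S, s < q + ε / 2 := by
      rcases eq_or_ne s 0 with h | h
      · exact ⟨0, h0, by rw [h, zero_add]; exact hε2⟩
      · obtain ⟨q, hq, hq'⟩ := lt_sSup_iff.1 (ENNReal.sub_lt_self hsfin h hε2.ne')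
        exact ⟨q, hq, lt_of_not_ge fun h' => absurd hq' (not_lt.2
          (ENNReal.le_sub_of_add_le_right
            (ne_top_of_le_ne_top hsfin (le_add_self.trans h')) h'))⟩
    obtain ⟨t, ht, htc⟩ := EMetric.totallyBounded_iff.1 (IsCompact.totallyBounded hq) _ hε2
    refine ⟨t, ht, fun y hy => ?_⟩
    obtain ⟨z, hz, hzy⟩ := hL x y q (ε / 2)
      ((Metric.mem_closedEBall'.1 hy).trans_lt hqs) hε2
    obtain ⟨c, hc, hzc⟩ := mem_iUnion₂.1 (htc (Metric.mem_closedEBall'.2 hz))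
    refine mem_iUnion₂.2 ⟨c, hc, ?_⟩
    rw [Metric.mem_eball] at hzc ⊢
    calc edist y c ≤ edist y z + edist z c := edist_triangle _ _ _
      _ < ε / 2 + ε / 2 := ENNReal.add_lt_add (by rwa [edist_comm]) hzc
      _ = ε := ENNReal.add_halves ε
  -- By local compactness the ball of radius s has a compact neighbourhood K, which contains a
  -- δ-thickening of the ball. By the length property this thickening contains the ball of radius s
  -- + δ/2.
  obtain ⟨K, hK, hKs, -⟩ := exists_compact_between hsS isOpen_univ (subset_univ _)
  obtain ⟨δ, hδ, hδK⟩ := hsS.exists_thickening_subset_open isOpen_interior hKs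
  have hδ2 : (0 : ℝ≥0∞) < ENNReal.ofReal δ := ENNReal.ofReal_pos.2 hδ
  have h1 : s + ENNReal.ofReal δ / 2 ∈ S := by
    refine IsCompact.of_isClosed_subset hK Metric.isClosed_closedEBall fun y hy => ?_
    have h2 : edist x y < s + ENNReal.ofReal δ :=
      (Metric.mem_closedEBall'.1 hy).trans_lt
        (ENNReal.add_lt_add_left hsfin (ENNReal.half_lt_self hδ2.ne' ENNReal.ofReal_ne_top))
    obtain ⟨z, hz, hzy⟩ := hL x y s _ h2 hδ2
    refine interior_subset (hδK ?_)
    rw [Metric.mem_thickening_iff_exists_edist_lt]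
    exact ⟨z, Metric.mem_closedEBall'.2 hz, by rwa [edist_comm]⟩
  have h2 : s + ENNReal.ofReal δ / 2 ≤ s := le_sSup h1
  have h3 : s < s + ENNReal.ofReal δ / 2 :=
    ENNReal.lt_add_right hsfin (ENNReal.half_pos hδ2.ne').ne'
  exact absurd h2 (not_le.2 h3)

/-- In a separable space with compact balls there are cut-off functions with compact support and
small Lipschitz constant. -/
lemma exists_lipschitz_cutoffs [SecondCountableTopology X]
    (hK : ∀ (x : X) (r : ℝ≥0), IsCompact (Metric.closedEBall x (r : ℝ≥0∞))) :
    ∃ η : ℕ → X → ℝ, (∀ n : ℕ, LipschitzWith ((n : ℝ≥0) + 1)⁻¹ (η n)) ∧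
      (∀ n x, η n x ∈ Icc (0 : ℝ) 1) ∧ (∀ n, HasCompactSupport (η n)) ∧
      ∀ x, Tendsto (fun n => η n x) atTop (𝓝 1) := by
  rcases isEmpty_or_nonempty X with hX | hX
  · exact ⟨fun _ _ => 0, fun n => LipschitzWith.const' _, fun n x => hX.elim x,
      fun n => HasCompactSupport.zero, fun x => hX.elim x⟩
  let F : ℕ → Set X := fun n => denseSeq X '' Iic n
  -- Distances may be infinite when X is not connected, so the first n + 1 points of a dense
  -- sequence replace a single base point, and the distance is truncated at n + 1. Then η n = 1 - d
  -- n/(n+1) vanishes outside finitely many compact balls. At a fixed x one has d n x ≤ 1 for large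
  -- n, so η n x tends to 1.
  let d : ℕ → X → ℝ≥0∞ := fun n x => min (Metric.infEDist x (F n)) (n + 1 : ℝ≥0∞)
  have hdf : ∀ n x, d n x ≠ ⊤ := fun n x =>
    ((min_le_right _ _).trans_lt (by finiteness)).ne
  have hdd : ∀ n x y, d n x ≤ d n y + edist x y := by
    intro n x y
    have h1 : Metric.infEDist x (F n) ≤ Metric.infEDist y (F n) + edist x y :=
      Metric.infEDist_le_infEDist_add_edist
    simp only [d]
    rcases le_total (Metric.infEDist y (F n)) (n + 1 : ℝ≥0∞) with h | h
    · rw [min_eq_left h]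
      exact (min_le_left _ _).trans h1
    · rw [min_eq_right h]
      exact (min_le_right _ _).trans le_self_add
  let η : ℕ → X → ℝ := fun n x => 1 - ((n : ℝ) + 1)⁻¹ * (d n x).toReal
  have hpos : ∀ n : ℕ, (0 : ℝ) < (n : ℝ) + 1 := fun n => by positivity
  have hd1 : ∀ n x, (d n x).toReal ≤ (n : ℝ) + 1 := by
    intro n x
    have := ENNReal.toReal_mono (by finiteness) (min_le_right (Metric.infEDist x (F n)) (n + 1 : ℝ≥0∞))
    refine this.trans_eq ?_
    rw [ENNReal.toReal_add (by finiteness) (by finiteness)]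
    simp
  refine ⟨η, fun n => ?_, fun n x => ?_, fun n => ?_, fun x => ?_⟩
  · have h1 : LipschitzWith 1 fun x => (d n x).toReal := by
      intro x y
      rw [ENNReal.coe_one, one_mul, edist_dist, Real.dist_eq]
      by_cases hxy : edist x y = ⊤
      · rw [hxy]; exact le_top
      refine ENNReal.ofReal_le_of_le_toReal (abs_le.2 ⟨?_, ?_⟩)
      · have := ENNReal.toReal_mono (ENNReal.add_ne_top.2 ⟨hdf n x, by rwa [edist_comm]⟩) (hdd n y x)
        rw [ENNReal.toReal_add (hdf n x) (by rwa [edist_comm]), edist_comm] at this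
        linarith
      · have := ENNReal.toReal_mono (ENNReal.add_ne_top.2 ⟨hdf n y, hxy⟩) (hdd n x y)
        rw [ENNReal.toReal_add (hdf n y) hxy] at this
        linarith
    have h2 : LipschitzWith ((n : ℝ≥0) + 1)⁻¹ fun t : ℝ => 1 - ((n : ℝ) + 1)⁻¹ * t := by
      refine LipschitzWith.of_dist_le_mul fun s t => ?_
      rw [Real.dist_eq, Real.dist_eq, NNReal.coe_inv, NNReal.coe_add, NNReal.coe_one,
        NNReal.coe_natCast, ← abs_of_pos (inv_pos.2 (hpos n)), ← abs_mul, abs_sub_comm]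
      rw [abs_of_pos (inv_pos.2 (hpos n))]
      exact le_of_eq (congrArg _ (by ring))
    exact (mul_one ((n : ℝ≥0) + 1)⁻¹) ▸ h2.comp h1
  · have h1 := hd1 n x
    have h2 : 0 ≤ (d n x).toReal := ENNReal.toReal_nonneg
    have h3 : ((n : ℝ) + 1)⁻¹ * (d n x).toReal ≤ 1 := by
      rw [inv_mul_le_iff₀ (hpos n)]
      linarith
    have h4 : 0 ≤ ((n : ℝ) + 1)⁻¹ * (d n x).toReal := mul_nonneg (inv_nonneg.2 (hpos n).le) h2
    exact ⟨by simp only [η]; linarith, by simp only [η]; linarith⟩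
  · have h1 : IsCompact (⋃ i ∈ Iic n, Metric.closedEBall (denseSeq X i) ((n + 1 : ℝ≥0) : ℝ≥0∞)) :=
      (finite_Iic n).isCompact_biUnion fun i _ => hK _ _
    refine HasCompactSupport.intro h1 fun x hx => ?_
    have h2 : (n + 1 : ℝ≥0∞) ≤ Metric.infEDist x (F n) := by
      by_contra h
      obtain ⟨y, ⟨i, hi, rfl⟩, hy⟩ := Metric.infEDist_lt_iff.1 (not_le.1 h)
      refine hx (mem_iUnion₂.2 ⟨i, hi, ?_⟩)
      simpa using hy.le
    simp only [η, d]
    rw [min_eq_right h2, ENNReal.toReal_add (by finiteness) (by finiteness)]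
    simp [(hpos n).ne']
  · obtain ⟨N, hy⟩ := (denseRange_denseSeq X).exists_mem_open Metric.isOpen_eball
      ⟨x, Metric.mem_eball_self (one_pos : (0 : ℝ≥0∞) < 1)⟩
    have h1 : ∀ n ≥ N, (d n x).toReal ≤ 1 := by
      intro n hn
      refine ENNReal.toReal_le_of_le_ofReal zero_le_one ((min_le_left _ _).trans ?_)
      rw [ENNReal.ofReal_one]
      refine (Metric.infEDist_le_edist_of_mem (mem_image_of_mem _ (mem_Iic.2 hn))).trans ?_
      rw [edist_comm]
      exact (Metric.mem_eball.1 hy).le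
    have h2 : Tendsto (fun n : ℕ => ((n : ℝ) + 1)⁻¹ * (d n x).toReal) atTop (𝓝 0) := by
      refine squeeze_zero' (Eventually.of_forall fun n =>
        mul_nonneg (inv_nonneg.2 (hpos n).le) ENNReal.toReal_nonneg) ?_
        (tendsto_one_div_add_atTop_nhds_zero_nat (𝕜 := ℝ))
      filter_upwards [eventually_ge_atTop N] with n hn
      rw [one_div]
      exact mul_le_of_le_one_right (inv_nonneg.2 (hpos n).le) (h1 n hn)
    simpa [η] using h2.const_sub 1

end HopfRinow

/-! ### Lipschitz functions on a Riemannian manifold -/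

section Riemannian

open scoped NNReal

variable {m : ℕ} {X : Type*} [EMetricSpace X] [ChartedSpace (EuclideanSpace ℝ (Fin m)) X]
  [IsManifold (𝓡 m) ∞ X] [RiemannianBundle (fun x : X => TangentSpace (𝓡 m) x)]
  [IsContMDiffRiemannianBundle (𝓡 m) ∞ (EuclideanSpace ℝ (Fin m))
    (fun x : X => TangentSpace (𝓡 m) x)]
  [IsRiemannianManifold (𝓡 m) X]

/-- The Riemannian distance is an infimum of lengths: a curve from x to y of length less than a + b
is cut where its distance from x equals a. The first piece has length at least a, so the second is
shorter than b. -/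
lemma exists_edist_le_edist_lt (m : ℕ) {X : Type*} [EMetricSpace X]
    [ChartedSpace (EuclideanSpace ℝ (Fin m)) X] [IsManifold (𝓡 m) ∞ X]
    [RiemannianBundle (fun x : X => TangentSpace (𝓡 m) x)] [IsRiemannianManifold (𝓡 m) X] (x y : X) (a b : ℝ≥0∞) (hab : edist x y < a + b) (hb : 0 < b) :
    ∃ z, edist x z ≤ a ∧ edist z y < b := by
  rw [IsRiemannianManifold.out (I := 𝓡 m) x y] at hab
  obtain ⟨γ, h0, h1, hγ, hlen⟩ := exists_lt_of_riemannianEDist_lt hab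
  rcases le_or_gt (edist x y) a with h | h
  · exact ⟨y, h, by simpa using hb⟩
  have hc : ContinuousOn (fun t => edist x (γ t)) (Icc 0 1) :=
    fun t ht => tendsto_const_nhds.edist (hγ.continuousOn t ht)
  obtain ⟨t, ht, hta⟩ := intermediate_value_Icc zero_le_one hc
    (show a ∈ Icc (edist x (γ 0)) (edist x (γ 1)) by
      rw [h0, h1, edist_self]; exact ⟨zero_le, h.le⟩)
  refine ⟨γ t, hta.le, ?_⟩
  have h2 : a ≤ pathELength (𝓡 m) γ 0 t := by
    rw [← hta]
    simp only
    rw [IsRiemannianManifold.out (I := 𝓡 m) x (γ t)]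
    exact riemannianEDist_le_pathELength (hγ.mono (Icc_subset_Icc le_rfl ht.2)) h0 rfl ht.1
  have h3 : edist (γ t) y ≤ pathELength (𝓡 m) γ t 1 := by
    rw [IsRiemannianManifold.out (I := 𝓡 m) (γ t) y]
    exact riemannianEDist_le_pathELength (hγ.mono (Icc_subset_Icc ht.1 le_rfl)) rfl h1 ht.2
  rw [← pathELength_add ht.1 ht.2] at hlen
  have hafin : a ≠ ⊤ := (h.trans_le le_top).ne
  refine h3.trans_lt ?_
  exact (ENNReal.add_lt_add_iff_left hafin).1 ((add_le_add_left h2 _).trans_lt hlen)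

lemma norm_sq_mfderiv_chart_symm (p : X) (y w : EuclideanSpace ℝ (Fin m)) :
    ‖mfderiv (𝓡 m) (𝓡 m) (chart m p).symm y w‖ ^ 2 = ∑ i, ∑ j, w i * w j * gram p y i j := by
  let L : EuclideanSpace ℝ (Fin m) →L[ℝ] TangentSpace (𝓡 m) ((chart m p).symm y) :=
    mfderiv (𝓡 m) (𝓡 m) (chart m p).symm y
  have h6 : w = ∑ a, w a • EuclideanSpace.single a (1 : ℝ) := by
    ext b
    simp [Finset.sum_apply, Pi.single_apply]
  change ‖L w‖ ^ 2 = ∑ i, ∑ j, w i * w j *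
    inner ℝ (L (EuclideanSpace.single i 1)) (L (EuclideanSpace.single j 1))
  rw [← real_inner_self_eq_norm_sq]
  conv_lhs => rw [h6]
  simp only [map_sum, map_smul, sum_inner, inner_sum, real_inner_smul_left, real_inner_smul_right]
  rw [Finset.sum_comm]
  refine Finset.sum_congr rfl fun i _ => Finset.sum_congr rfl fun j _ => by ring

lemma continuousOn_norm_mfderiv_chart_symm (p : X) (w : EuclideanSpace ℝ (Fin m)) :
    ContinuousOn (fun y => ‖mfderiv (𝓡 m) (𝓡 m) (chart m p).symm y w‖) (chart m p).target := by
  have h : (fun y => ‖mfderiv (𝓡 m) (𝓡 m) (chart m p).symm y w‖) =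
      fun y => √(∑ i, ∑ j, w i * w j * gram p y i j) := by
    ext y
    rw [← norm_sq_mfderiv_chart_symm, Real.sqrt_sq (norm_nonneg _)]
  rw [h]
  exact ContinuousOn.sqrt (continuousOn_finsetSum _ fun i _ => continuousOn_finsetSum _ fun j _ =>
    continuousOn_const.mul (continuousOn_gram p i j))

/-- The image of the straight segment in the chart is a competitor for the distance, with speed
bounded by M over a unit time interval. -/
lemma edist_chart_symm_le (p : X) {y z : EuclideanSpace ℝ (Fin m)}
    (hs : segment ℝ y z ⊆ (chart m p).target) {M : ℝ≥0}
    (hM : ∀ q ∈ segment ℝ y z, ‖mfderiv (𝓡 m) (𝓡 m) (chart m p).symm q (z - y)‖ ≤ M) :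
    edist ((chart m p).symm y) ((chart m p).symm z) ≤ M := by
  let η : ℝ → EuclideanSpace ℝ (Fin m) := fun t => y + t • (z - y)
  have hη : ∀ t ∈ Icc (0 : ℝ) 1, η t ∈ segment ℝ y z := fun t ht => by
    rw [segment_eq_image']; exact ⟨t, ht, rfl⟩
  have hηd : ∀ t, HasFDerivAt η ((1 : ℝ →L[ℝ] ℝ).smulRight (z - y)) t := fun t =>
    (((hasFDerivAt_id t).smul_const (z - y)).const_add y)
  have hηs : ContMDiff 𝓘(ℝ, ℝ) (𝓡 m) 1 η := by
    rw [contMDiff_iff_contDiff]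
    exact contDiff_const.add (contDiff_id.smul contDiff_const)
  have h1 : ContMDiffOn (𝓡 m) (𝓡 m) 1 (chart m p).symm (chart m p).target :=
    contMDiffOn_chart_symm
  have hγ : ContMDiffOn 𝓘(ℝ, ℝ) (𝓡 m) 1 ((chart m p).symm ∘ η) (Icc 0 1) :=
    h1.comp hηs.contMDiffOn fun t ht => hs (hη t ht)
  rw [IsRiemannianManifold.out (I := 𝓡 m)]
  refine (riemannianEDist_le_pathELength hγ (by simp [η]) (by simp [η]) zero_le_one).trans ?_
  rw [pathELength_eq_lintegral_mfderiv_Icc]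
  calc _ ≤ ∫⁻ t in Icc (0 : ℝ) 1, (M : ℝ≥0∞) := by
        refine setLIntegral_mono' measurableSet_Icc fun t ht => ?_
        have h2 := ((mdifferentiable_chart (I := 𝓡 m) p).mdifferentiableAt_symm
          (hs (hη t ht))).hasMFDerivAt
        have h3 := (h2.comp t (hηd t).hasMFDerivAt).mfderiv
        have h4 : mfderiv 𝓘(ℝ, ℝ) (𝓡 m) ((chart m p).symm ∘ η) t (1 : ℝ) =
            mfderiv (𝓡 m) (𝓡 m) (chart m p).symm (η t) (z - y) := by
          have h5 := DFunLike.congr_fun (F := ℝ →L[ℝ] EuclideanSpace ℝ (Fin m)) h3 (1 : ℝ)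
          refine h5.trans ?_
          change (mfderiv (𝓡 m) (𝓡 m) (chart m p).symm (η t) :
            EuclideanSpace ℝ (Fin m) →L[ℝ] EuclideanSpace ℝ (Fin m)) ((1 : ℝ) • (z - y)) = _
          rw [one_smul]
        refine (le_of_eq (congrArg (fun v : TangentSpace (𝓡 m) ((chart m p).symm (η t)) => ‖v‖ₑ)
          h4)).trans ?_
        have h5 := hM _ (hη t ht)
        refine (ofReal_norm (mfderiv (𝓡 m) (𝓡 m) (chart m p).symm (η t) (z - y))).symm.trans_le ?_
        exact ENNReal.ofReal_le_of_le_toReal (by simpa using h5)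
    _ = M := by simp

/-- On a small ball the metric coefficients are bounded and |w|_g² ≤ |w|² ∑|g_ij|. The ball is
convex, so segments stay in it and the length estimate applies. -/
lemma exists_lipschitzOnWith_chart_symm (p : X) {y : EuclideanSpace ℝ (Fin m)}
    (hy : y ∈ (chart m p).target) :
    ∃ (C : ℝ≥0), ∃ U ∈ 𝓝 y, LipschitzOnWith C (chart m p).symm U := by
  have hc : ContinuousAt (fun z => √(∑ i, ∑ j, |gram p z i j|)) y :=
    (ContinuousOn.sqrt (continuousOn_finsetSum _ fun i _ => continuousOn_finsetSum _ fun j _ =>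
      (continuousOn_gram p i j).abs)).continuousAt ((chart m p).open_target.mem_nhds hy)
  obtain ⟨C, hC⟩ : ∃ C : ℝ≥0, √(∑ i, ∑ j, |gram p y i j|) < C :=
    ⟨Real.toNNReal (√(∑ i, ∑ j, |gram p y i j|) + 1), by
      rw [Real.coe_toNNReal _ (by positivity)]; exact lt_add_one _⟩
  obtain ⟨r, hr, hrs⟩ := Metric.mem_nhds_iff.1 (inter_mem ((chart m p).open_target.mem_nhds hy)
    (hc.eventually_lt_const hC))
  have key : ∀ (a : ℝ) (G : Fin m → Fin m → ℝ), ∑ i, ∑ j, a * a * |G i j| =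
      a ^ 2 * √(∑ i, ∑ j, |G i j|) ^ 2 := by
    intro a G
    rw [Real.sq_sqrt (Finset.sum_nonneg fun i _ => Finset.sum_nonneg fun j _ => abs_nonneg _)]
    simp only [Finset.mul_sum, sq]
  refine ⟨C, Metric.ball y r, Metric.ball_mem_nhds y hr, fun u hu v hv => ?_⟩
  have hseg := (convex_ball y r).segment_subset hu hv
  have h1 : ∀ q ∈ segment ℝ u v, ‖mfderiv (𝓡 m) (𝓡 m) (chart m p).symm q (v - u)‖ ≤
      ((C * nndist u v : ℝ≥0) : ℝ) := by
    intro q hq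
    refine le_of_sq_le_sq ?_ (by positivity)
    rw [norm_sq_mfderiv_chart_symm]
    have hw : ∀ i, |(v - u) i| ≤ ‖v - u‖ := fun i => PiLp.norm_apply_le (v - u) i
    calc _ ≤ ∑ i, ∑ j, ‖v - u‖ * ‖v - u‖ * |gram p q i j| := by
          refine Finset.sum_le_sum fun i _ => Finset.sum_le_sum fun j _ => ?_
          refine (le_abs_self _).trans ?_
          rw [abs_mul, abs_mul]
          gcongr
          · exact hw i
          · exact hw j
      _ = ‖v - u‖ ^ 2 * √(∑ i, ∑ j, |gram p q i j|) ^ 2 := key _ _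
      _ ≤ ‖v - u‖ ^ 2 * C ^ 2 := by
          gcongr
          exact (hrs (hseg hq)).2.le
      _ = _ := by
          rw [NNReal.coe_mul, coe_nndist, dist_comm, dist_eq_norm]
          ring
  have h2 := edist_chart_symm_le p (fun q hq => (hrs (hseg hq)).1) h1
  rw [ENNReal.coe_mul, ← edist_nndist] at h2
  exact h2

lemma locallyLipschitzOn_comp_chart_symm {χ : X → ℝ} {K : ℝ≥0} (hχ : LipschitzWith K χ) (p : X) :
    LocallyLipschitzOn (chart m p).target (χ ∘ (chart m p).symm) := by
  intro y hy
  obtain ⟨C, U, hU, hC⟩ := exists_lipschitzOnWith_chart_symm p hy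
  exact ⟨K * C, U, mem_nhdsWithin_of_mem_nhds hU, hχ.comp_lipschitzOnWith hC⟩

/-- By continuity of the metric the segment from y to y + tw has length at most t(|w|_g + ε') for
small t, which bounds the difference quotients. The constant is K itself, independent of the chart;
the cut-offs with small Lipschitz constant rely on this. -/
lemma abs_fderiv_comp_chart_symm_le {χ : X → ℝ} {K : ℝ≥0} (hχ : LipschitzWith K χ) (p : X)
    {y : EuclideanSpace ℝ (Fin m)} (hy : y ∈ (chart m p).target)
    (hd : DifferentiableAt ℝ (χ ∘ (chart m p).symm) y) (w : EuclideanSpace ℝ (Fin m)) :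
    |fderiv ℝ (χ ∘ (chart m p).symm) y w| ≤
      K * ‖mfderiv (𝓡 m) (𝓡 m) (chart m p).symm y w‖ := by
  set c := ‖mfderiv (𝓡 m) (𝓡 m) (chart m p).symm y w‖
  refine le_of_forall_pos_le_add fun ε hε => ?_
  obtain ⟨ε', hε', hKε⟩ : ∃ ε' > 0, K * ε' ≤ ε := by
    refine ⟨ε / (K + 1), by positivity, ?_⟩
    rw [mul_div_assoc', div_le_iff₀ (by positivity)]
    nlinarith [K.2]
  have hc := (continuousOn_norm_mfderiv_chart_symm p w).continuousAt
    ((chart m p).open_target.mem_nhds hy)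
  obtain ⟨r, hr, hrs⟩ := Metric.mem_nhds_iff.1 (inter_mem ((chart m p).open_target.mem_nhds hy)
    (hc.eventually_lt_const (show c < c + ε' by linarith)))
  have hlim := hd.hasFDerivAt.hasLineDerivAt w |>.tendsto_slope_zero_right
  have hev : ∀ᶠ t : ℝ in 𝓝[>] 0,
      |t⁻¹ • ((χ ∘ (chart m p).symm) (y + t • w) - (χ ∘ (chart m p).symm) y)| ≤
        K * (c + ε') := by
    have h1 : Tendsto (fun t : ℝ => y + t • w) (𝓝[>] 0) (𝓝 y) := by
      have : Tendsto (fun t : ℝ => y + t • w) (𝓝 0) (𝓝 (y + (0 : ℝ) • w)) :=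
        (Continuous.tendsto (by fun_prop) 0)
      simp only [zero_smul, add_zero] at this
      exact this.mono_left nhdsWithin_le_nhds
    filter_upwards [self_mem_nhdsWithin, h1 (Metric.ball_mem_nhds y hr)] with t ht hty
    have ht0 : (0 : ℝ) < t := ht
    have hseg := (convex_ball y r).segment_subset (Metric.mem_ball_self hr) hty
    have hcε : 0 ≤ c + ε' := add_nonneg (norm_nonneg _) hε'.le
    have h2 := edist_chart_symm_le (M := NNReal.mk (t * (c + ε')) (mul_nonneg ht0.le hcε)) p
      (fun q hq => (hrs (hseg hq)).1) (fun q hq => by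
        have h3 : ‖mfderiv (𝓡 m) (𝓡 m) (chart m p).symm q w‖ < c + ε' := (hrs (hseg hq)).2
        let L : EuclideanSpace ℝ (Fin m) →L[ℝ] TangentSpace (𝓡 m) ((chart m p).symm q) :=
          mfderiv (𝓡 m) (𝓡 m) (chart m p).symm q
        change ‖L (y + t • w - y)‖ ≤ t * (c + ε')
        rw [add_sub_cancel_left, map_smul, norm_smul, Real.norm_of_nonneg ht0.le]
        have h4 : ‖L w‖ < c + ε' := h3
        gcongr)
    have h3 := hχ ((chart m p).symm (y + t • w)) ((chart m p).symm y)
    rw [edist_comm ((chart m p).symm (y + t • w))] at h3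
    have h4 := h3.trans (mul_le_mul_right h2 (K : ℝ≥0∞))
    rw [← ENNReal.coe_mul, edist_dist, Real.dist_eq] at h4
    have h5 : |χ ((chart m p).symm (y + t • w)) - χ ((chart m p).symm y)| ≤
        K * (t * (c + ε')) := by
      have := (ENNReal.ofReal_le_iff_le_toReal ENNReal.coe_ne_top).1 h4
      simpa using this
    rw [smul_eq_mul, abs_mul, abs_of_pos (inv_pos.2 ht0), inv_mul_le_iff₀ ht0]
    refine h5.trans_eq ?_
    ring
  have h6 := le_of_tendsto hlim.abs hev
  refine h6.trans ?_
  rw [mul_add]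
  gcongr

end Riemannian

/-! ### The Riemannian measure in charts -/

section ChartMeasure

variable {m : ℕ} {X : Type*} [EMetricSpace X] [ChartedSpace (EuclideanSpace ℝ (Fin m)) X]
  [RiemannianBundle (fun x : X => TangentSpace (𝓡 m) x)] [IsManifold (𝓡 m) ∞ X]
  [IsContMDiffRiemannianBundle (𝓡 m) ∞ (EuclideanSpace ℝ (Fin m))
    (fun x : X => TangentSpace (𝓡 m) x)]
  [MeasurableSpace X] [BorelSpace X] [SecondCountableTopology X]

lemma posSemidef_gram (p : X) (y : EuclideanSpace ℝ (Fin m)) : (gram p y).PosSemidef :=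
  Matrix.posSemidef_gram ℝ (coordField p y)

lemma det_gram_pos (p : X) {y : EuclideanSpace ℝ (Fin m)} (hy : y ∈ (chart m p).target) :
    0 < (gram p y).det :=
  lt_of_le_of_ne (posSemidef_gram p y).det_nonneg (covectorInner_eq p hy 0 0).1.symm

/-- The density of the Riemannian measure in the chart at `p`. -/
def chartDensity (p : X) (y : EuclideanSpace ℝ (Fin m)) : ℝ≥0∞ := ENNReal.ofReal (√(gram p y).det)

lemma chartDensity_pos (p : X) {y : EuclideanSpace ℝ (Fin m)} (hy : y ∈ (chart m p).target) :
    0 < chartDensity p y :=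
  ENNReal.ofReal_pos.2 (Real.sqrt_pos.2 (det_gram_pos p hy))

lemma aemeasurable_chartDensity (p : X) :
    AEMeasurable (chartDensity p : EuclideanSpace ℝ (Fin m) → ℝ≥0∞)
      (volume.restrict (chart m p).target) :=
  ((continuousOn_sqrt_det_gram p).aemeasurable (chart m p).open_target.measurableSet).ennreal_ofReal

lemma restrict_source_eq_chartMeasure (p : X) :
    (riemannianMeasure m X).restrict (chart m p).source = chartMeasure m p := by
  ext A hA
  have hs := (chart m p).open_source.measurableSet
  rw [Measure.restrict_apply hA, riemannianMeasure_apply p (hA.inter hs) inter_subset_right,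
    chartMeasure_apply p hA]
  congr 2
  ext y
  simp only [mem_inter_iff, mem_preimage]
  exact ⟨fun h => ⟨h.1, h.2.1⟩, fun h => ⟨h.1, h.2, (chart m p).map_target h.1⟩⟩

/-- Change of variables in a chart. The density is positive on the chart target, so measurability
with respect to the weighted measure passes back to Lebesgue measure. -/
lemma setLIntegral_source (p : X) {F : X → ℝ≥0∞} (hF : AEMeasurable F (riemannianMeasure m X)) :
    ∫⁻ x in (chart m p).source, F x ∂(riemannianMeasure m X) =
      ∫⁻ y in (chart m p).target, F ((chart m p).symm y) * chartDensity p y := by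
  have h1 : AEMeasurable F (chartMeasure m p) := by
    rw [← restrict_source_eq_chartMeasure]
    exact hF.restrict
  rw [restrict_source_eq_chartMeasure, chartMeasure, lintegral_map' h1 (aemeasurable_chart_symm p _)]
  have h2 := lintegral_withDensity_eq_lintegral_mul₀ (μ := volume.restrict (chart m p).target)
    (aemeasurable_chartDensity p) (g := fun y => F ((chart m p).symm y)) ?_
  · refine h2.trans ?_
    simp [mul_comm]
  · have h3 : AEMeasurable (F ∘ (chart m p).symm) ((volume.restrict (chart m p).target).withDensity
      (chartDensity p)) := h1.comp_aemeasurable (aemeasurable_chart_symm p _)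
    refine h3.mono_ac (withDensity_absolutelyContinuous' (aemeasurable_chartDensity p) ?_)
    exact ae_restrict_of_forall_mem (chart m p).open_target.measurableSet
      fun y hy => (chartDensity_pos p hy).ne'

lemma ae_chart_of_ae {P : X → Prop} (p : X)
    (h : ∀ᵐ x ∂((riemannianMeasure m X).restrict (chart m p).source), P x) :
    ∀ᵐ y ∂(volume.restrict (chart m p).target), P ((chart m p).symm y) := by
  rw [restrict_source_eq_chartMeasure, chartMeasure] at h
  have h1 := (Measure.tendsto_ae_map (aemeasurable_chart_symm p _)).eventually h
  refine (withDensity_absolutelyContinuous' (aemeasurable_chartDensity p) ?_).ae_le h1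
  exact ae_restrict_of_forall_mem (chart m p).open_target.measurableSet
      fun y hy => (chartDensity_pos p hy).ne'

lemma aemeasurable_chart (p : X) :
    AEMeasurable (chart m p) ((riemannianMeasure m X).restrict (chart m p).source) :=
  (chart m p).continuousOn.aemeasurable (chart m p).open_source.measurableSet

lemma map_chart_absolutelyContinuous (p : X) :
    Measure.map (chart m p) ((riemannianMeasure m X).restrict (chart m p).source) ≪
      volume.restrict (chart m p).target := by
  refine Measure.AbsolutelyContinuous.mk fun A hA h0 => ?_
  have hs := (chart m p).open_source.measurableSet
  rw [Measure.map_apply_of_aemeasurable (aemeasurable_chart p) hA, Measure.restrict_apply' hs]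
  have hm : MeasurableSet ((chart m p) ⁻¹' A ∩ (chart m p).source) := by
    have h1 := ((continuousOn_iff_continuous_domRestrict.1 (chart m p).continuousOn).measurable hA)
    have h2 := MeasurableSet.subtype_image hs h1
    convert h2 using 1
    ext y
    simp
  rw [riemannianMeasure_apply p hm inter_subset_right]
  refine setLIntegral_measure_zero _ _ (measure_mono_null (t := A ∩ (chart m p).target) ?_ ?_)
  · rintro y ⟨hy, hyA, -⟩
    rw [mem_preimage, (chart m p).right_inv hy] at hyA
    exact ⟨hyA, hy⟩
  · rwa [Measure.restrict_apply hA] at h0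

lemma ae_of_ae_chart {P : X → Prop} (p : X)
    (h : ∀ᵐ y ∂(volume.restrict (chart m p).target), P ((chart m p).symm y)) :
    ∀ᵐ x ∂((riemannianMeasure m X).restrict (chart m p).source), P x := by
  have h1 := (Measure.tendsto_ae_map (aemeasurable_chart p)).eventually
    ((map_chart_absolutelyContinuous p).ae_le h)
  filter_upwards [h1, ae_restrict_mem (chart m p).open_source.measurableSet] with x hx hxs
  rwa [(chart m p).left_inv hxs] at hx

variable (m X) in
lemma exists_countable_chart_cover :
    ∃ s : Set X, s.Countable ∧ ⋃ p ∈ s, (chart m p).source = univ :=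
  TopologicalSpace.countable_cover_nhds
    (fun x : X => (chart m x).open_source.mem_nhds (mem_chart_source _ x))

/-- In each chart the Riemannian measure and Lebesgue measure have the same null sets, and countably
many charts cover X. -/
lemma ae_iff_chart {P : X → Prop} : (∀ᵐ x ∂(riemannianMeasure m X), P x) ↔
    ∀ p : X, ∀ᵐ y ∂(volume.restrict (chart m p).target), P ((chart m p).symm y) := by
  refine ⟨fun h p => ae_chart_of_ae p (ae_restrict_of_ae h), fun h => ?_⟩
  obtain ⟨s, hs, hcov⟩ := exists_countable_chart_cover m X
  rw [← Measure.restrict_univ (μ := riemannianMeasure m X), ← hcov,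
    ae_restrict_biUnion_iff _ hs]
  exact fun p _ => ae_of_ae_chart p (h p)

lemma AEStronglyMeasurable.comp_chart_symm {F : Type*} [TopologicalSpace F]
    [PseudoMetrizableSpace F] {g : X → F}
    (hg : AEStronglyMeasurable g (riemannianMeasure m X)) (p : X) :
    AEStronglyMeasurable (fun y => g ((chart m p).symm y)) (volume.restrict (chart m p).target) := by
  have h1 : AEMeasurable (chart m p).symm (volume.restrict (chart m p).target) :=
    (chart m p).continuousOn_symm.aemeasurable (chart m p).open_target.measurableSet
  exact (hg.stronglyMeasurable_mk.aestronglyMeasurable.comp_aemeasurable h1).congr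
    ((ae_iff_chart.1 hg.ae_eq_mk p).mono fun y hy => hy.symm)

lemma aestronglyMeasurable_of_chart {F : Type*} [TopologicalSpace F]
    [PseudoMetrizableSpace F] {g : X → F}
    (hg : ∀ p : X, AEStronglyMeasurable (fun y => g ((chart m p).symm y))
      (volume.restrict (chart m p).target)) :
    AEStronglyMeasurable g (riemannianMeasure m X) := by
  obtain ⟨s, hs, hcov⟩ := exists_countable_chart_cover m X
  rw [← Measure.restrict_univ (μ := riemannianMeasure m X), ← hcov]
  have : Countable s := hs
  rw [biUnion_eq_iUnion, aestronglyMeasurable_iUnion_iff]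
  rintro ⟨p, -⟩
  have h1 := (hg p).stronglyMeasurable_mk.aestronglyMeasurable.comp_aemeasurable
    (aemeasurable_chart p)
  refine h1.congr (ae_of_ae_chart p ?_)
  filter_upwards [(hg p).ae_eq_mk, ae_restrict_mem (chart m p).open_target.measurableSet]
    with y hy hyt
  simp only [Function.comp]
  rw [(chart m p).right_inv hyt, hy]

/-- The density √det g is continuous and positive, so it has a positive minimum on K; the reverse
comparison in `exists_lintegral_le_chart` uses its maximum. -/
lemma exists_setLIntegral_chart_le (p : X) {K : Set (EuclideanSpace ℝ (Fin m))} (hK : IsCompact K)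
    (hs : K ⊆ (chart m p).target) :
    ∃ C : ℝ≥0∞, C ≠ ⊤ ∧ ∀ F : X → ℝ≥0∞, AEMeasurable F (riemannianMeasure m X) →
      ∫⁻ y in K, F ((chart m p).symm y) ≤ C * ∫⁻ x, F x ∂(riemannianMeasure m X) := by
  obtain ⟨c, hc, hcK⟩ : ∃ c > 0, ∀ y ∈ K, c ≤ √(gram p y).det := by
    rcases K.eq_empty_or_nonempty with rfl | hne
    · exact ⟨1, one_pos, by simp⟩
    · obtain ⟨y₀, hy₀, h⟩ := hK.exists_isMinOn hne ((continuousOn_sqrt_det_gram p).mono hs)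
      exact ⟨_, Real.sqrt_pos.2 (det_gram_pos p (hs hy₀)), fun y hy => h hy⟩
  have hc' : ENNReal.ofReal c ≠ 0 := (ENNReal.ofReal_pos.2 hc).ne'
  refine ⟨(ENNReal.ofReal c)⁻¹, ENNReal.inv_ne_top.2 hc', fun F hF => ?_⟩
  calc ∫⁻ y in K, F ((chart m p).symm y)
      = (ENNReal.ofReal c)⁻¹ * ∫⁻ y in K, F ((chart m p).symm y) * ENNReal.ofReal c := by
        rw [lintegral_mul_const' _ _ ENNReal.ofReal_ne_top, mul_comm (∫⁻ y in K, _), ← mul_assoc,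
          ENNReal.inv_mul_cancel hc' ENNReal.ofReal_ne_top, one_mul]
    _ ≤ (ENNReal.ofReal c)⁻¹ * ∫⁻ y in K, F ((chart m p).symm y) * chartDensity p y := by
        gcongr (ENNReal.ofReal c)⁻¹ * ?_
        refine setLIntegral_mono' hK.measurableSet fun y hy => ?_
        gcongr
        exact ENNReal.ofReal_le_ofReal (hcK y hy)
    _ ≤ (ENNReal.ofReal c)⁻¹ * ∫⁻ y in (chart m p).target,
          F ((chart m p).symm y) * chartDensity p y := by
        gcongr (ENNReal.ofReal c)⁻¹ * ?_
        exact lintegral_mono_set hs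
    _ ≤ _ := by
        rw [← setLIntegral_source p hF]
        gcongr (ENNReal.ofReal c)⁻¹ * ?_
        exact setLIntegral_le_lintegral _ _

lemma exists_lintegral_le_chart (p : X) {K : Set (EuclideanSpace ℝ (Fin m))} (hK : IsCompact K)
    (hs : K ⊆ (chart m p).target) :
    ∃ C : ℝ≥0∞, C ≠ ⊤ ∧ ∀ F : X → ℝ≥0∞, AEMeasurable F (riemannianMeasure m X) →
      (∀ x ∉ (chart m p).symm '' K, F x = 0) →
      ∫⁻ x, F x ∂(riemannianMeasure m X) ≤ C * ∫⁻ y in K, F ((chart m p).symm y) := by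
  obtain ⟨c, hcK⟩ : ∃ c, ∀ y ∈ K, ‖√(gram p y).det‖ ≤ c :=
    hK.exists_bound_of_continuousOn ((continuousOn_sqrt_det_gram p).mono hs)
  refine ⟨ENNReal.ofReal c, ENNReal.ofReal_ne_top, fun F hF h0 => ?_⟩
  have h1 : ∫⁻ x, F x ∂(riemannianMeasure m X) =
      ∫⁻ x in (chart m p).source, F x ∂(riemannianMeasure m X) := by
    rw [← lintegral_indicator (chart m p).open_source.measurableSet]
    refine lintegral_congr fun x => ?_
    by_cases hx : x ∈ (chart m p).source
    · rw [indicator_of_mem hx]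
    · rw [indicator_of_notMem hx, h0]
      rintro ⟨y, hy, rfl⟩
      exact hx ((chart m p).map_target (hs hy))
  rw [h1, setLIntegral_source p hF]
  calc _ ≤ ∫⁻ y in K, F ((chart m p).symm y) * chartDensity p y := by
        rw [← lintegral_indicator (chart m p).open_target.measurableSet,
          ← lintegral_indicator hK.measurableSet]
        refine lintegral_mono fun y => ?_
        by_cases hy : y ∈ (chart m p).target
        · by_cases hyK : y ∈ K
          · simp [hy, hyK]
          · rw [indicator_of_mem hy, h0, zero_mul]
            · exact zero_le
            rintro ⟨z, hz, hzy⟩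
            exact hyK ((chart m p).symm.injOn (hs hz) hy hzy ▸ hz)
        · simp [hy]
    _ ≤ ∫⁻ y in K, F ((chart m p).symm y) * ENNReal.ofReal c := by
        refine setLIntegral_mono' hK.measurableSet fun y hy => ?_
        gcongr
        exact ENNReal.ofReal_le_ofReal ((le_abs_self _).trans (hcK y hy))
    _ = _ := by rw [lintegral_mul_const' _ _ ENNReal.ofReal_ne_top, mul_comm]

lemma le_mul_of_sq_le {a b C : ℝ≥0∞} (h : a ^ 2 ≤ C * b ^ 2) : a ≤ (C + 1) * b := by
  refine (ENNReal.pow_le_pow_left_iff two_ne_zero).1 (h.trans ?_)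
  rw [mul_pow]
  gcongr
  calc C ≤ C + 1 := le_self_add
    _ = (C + 1) * 1 := (mul_one _).symm
    _ ≤ (C + 1) * (C + 1) := by gcongr; exact le_add_self
    _ = (C + 1) ^ 2 := (sq _).symm

lemma exists_eLpNorm_chart_le (p : X) {K : Set (EuclideanSpace ℝ (Fin m))} (hK : IsCompact K)
    (hs : K ⊆ (chart m p).target) {F : Type*} [NormedAddCommGroup F] :
    ∃ C : ℝ≥0∞, C ≠ ⊤ ∧ ∀ g : X → F, AEStronglyMeasurable g (riemannianMeasure m X) →
      eLpNorm (fun y => g ((chart m p).symm y)) 2 (volume.restrict K) ≤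
        C * eLpNorm g 2 (riemannianMeasure m X) := by
  obtain ⟨C, hC, h⟩ := exists_setLIntegral_chart_le p hK hs
  refine ⟨C + 1, by finiteness, fun g hg => le_mul_of_sq_le ?_⟩
  rw [eLpNorm_two_sq, eLpNorm_two_sq]
  exact h _ (hg.enorm.pow_const 2)

lemma exists_eLpNorm_le_chart (p : X) {K : Set (EuclideanSpace ℝ (Fin m))} (hK : IsCompact K)
    (hs : K ⊆ (chart m p).target) {F : Type*} [NormedAddCommGroup F] :
    ∃ C : ℝ≥0∞, C ≠ ⊤ ∧ ∀ g : X → F, AEStronglyMeasurable g (riemannianMeasure m X) →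
      (∀ x ∉ (chart m p).symm '' K, g x = 0) →
      eLpNorm g 2 (riemannianMeasure m X) ≤
        C * eLpNorm (fun y => g ((chart m p).symm y)) 2 (volume.restrict K) := by
  obtain ⟨C, hC, h⟩ := exists_lintegral_le_chart p hK hs
  refine ⟨C + 1, by finiteness, fun g hg h0 => le_mul_of_sq_le ?_⟩
  rw [eLpNorm_two_sq, eLpNorm_two_sq]
  exact h _ (hg.enorm.pow_const 2) fun x hx => by simp [h0 x hx]

end ChartMeasure

/-! ### A measurable orthonormal frame -/

section GramSchmidt

variable {S : Type*} [TopologicalSpace S] {ι : Type*} [LinearOrder ι] [LocallyFiniteOrderBot ι]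
  [WellFoundedLT ι] {T : S → Type*} [∀ x, NormedAddCommGroup (T x)]
  [∀ x, InnerProductSpace ℝ (T x)]

/-- The projection subtracted from the i-th vector is orthogonal to the i-th Gram-Schmidt vector.
All coefficients of the recursion are thus expressed through inner products of Gram-Schmidt vectors
with the given vectors. -/
lemma inner_gramSchmidt_self {F : Type*} [NormedAddCommGroup F] [InnerProductSpace ℝ F]
    (f : ι → F) (i : ι) :
    inner ℝ (InnerProductSpace.gramSchmidt ℝ f i) (f i) =
      ‖InnerProductSpace.gramSchmidt ℝ f i‖ ^ 2 := by
  conv_lhs => rw [InnerProductSpace.gramSchmidt_def'' ℝ f i]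
  rw [inner_add_right, inner_sum, Finset.sum_eq_zero, add_zero, real_inner_self_eq_norm_sq]
  intro j hj
  rw [inner_smul_right, InnerProductSpace.gramSchmidt_orthogonal ℝ f (Finset.mem_Iio.1 hj).ne',
    mul_zero]

/-- The vectors at different points lie in different spaces, so continuity is stated for scalar
products with the given vectors only. These satisfy the Gram-Schmidt recursion, whose denominators
do not vanish by linear independence, and strong induction applies. -/
lemma continuousOn_inner_gramSchmidt {A : Set S} (v : ∀ x, ι → T x)
    (hv : ∀ i j, ContinuousOn (fun x => (inner ℝ (v x i) (v x j) : ℝ)) A)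
    (hl : ∀ x ∈ A, LinearIndependent ℝ (v x)) (i : ι) : ∀ k,
    ContinuousOn (fun x => (inner ℝ (InnerProductSpace.gramSchmidt ℝ (v x) i) (v x k) : ℝ)) A := by
  induction i using WellFoundedLT.induction with
  | ind i ih =>
    intro k
    have h1 : ∀ x, (inner ℝ (InnerProductSpace.gramSchmidt ℝ (v x) i) (v x k) : ℝ) =
        inner ℝ (v x i) (v x k) - ∑ j ∈ Finset.Iio i,
          inner ℝ (InnerProductSpace.gramSchmidt ℝ (v x) j) (v x i) /
            inner ℝ (InnerProductSpace.gramSchmidt ℝ (v x) j) (v x j) *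
              inner ℝ (InnerProductSpace.gramSchmidt ℝ (v x) j) (v x k) := by
      intro x
      have h2 := congrArg (fun w => (inner ℝ w (v x k) : ℝ))
        (InnerProductSpace.gramSchmidt_def'' ℝ (v x) i)
      simp only [inner_add_left, sum_inner, real_inner_smul_left] at h2
      rw [h2]
      simp only [inner_gramSchmidt_self]
      simp
    simp_rw [h1]
    refine (hv i k).sub (continuousOn_finsetSum _ fun j hj => ?_)
    have hj' := Finset.mem_Iio.1 hj
    refine ((ih j hj' i).div (ih j hj' j) fun x hx => ?_).mul (ih j hj' k)
    rw [inner_gramSchmidt_self]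
    exact pow_ne_zero 2 (norm_ne_zero_iff.2
      (InnerProductSpace.gramSchmidt_ne_zero (𝕜 := ℝ) j (hl x hx)))

lemma continuousOn_inner_gramSchmidtNormed {A : Set S} (v : ∀ x, ι → T x)
    (hv : ∀ i j, ContinuousOn (fun x => (inner ℝ (v x i) (v x j) : ℝ)) A)
    (hl : ∀ x ∈ A, LinearIndependent ℝ (v x)) (i k : ι) :
    ContinuousOn (fun x => (inner ℝ (InnerProductSpace.gramSchmidtNormed ℝ (v x) i) (v x k) : ℝ))
      A := by
  have h1 : ∀ x, (inner ℝ (InnerProductSpace.gramSchmidtNormed ℝ (v x) i) (v x k) : ℝ) =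
      (√(inner ℝ (InnerProductSpace.gramSchmidt ℝ (v x) i) (v x i)))⁻¹ *
        inner ℝ (InnerProductSpace.gramSchmidt ℝ (v x) i) (v x k) := by
    intro x
    rw [inner_gramSchmidt_self, Real.sqrt_sq (norm_nonneg _),
      InnerProductSpace.gramSchmidtNormed, real_inner_smul_left]
    rfl
  simp_rw [h1]
  refine ContinuousOn.mul (ContinuousOn.inv₀ (continuousOn_inner_gramSchmidt v hv hl i i).sqrt
    fun x hx => ?_) (continuousOn_inner_gramSchmidt v hv hl i k)
  rw [inner_gramSchmidt_self, Real.sqrt_sq (norm_nonneg _)]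
  exact norm_ne_zero_iff.2 (InnerProductSpace.gramSchmidt_ne_zero (𝕜 := ℝ) i (hl x hx))

end GramSchmidt

/-! ### The frame obtained by Gram-Schmidt in a measurably chosen chart -/

section Frame

variable {m : ℕ} {X : Type*} [EMetricSpace X] [ChartedSpace (EuclideanSpace ℝ (Fin m)) X]
  [RiemannianBundle (fun x : X => TangentSpace (𝓡 m) x)] [IsManifold (𝓡 m) ∞ X]
  [IsContMDiffRiemannianBundle (𝓡 m) ∞ (EuclideanSpace ℝ (Fin m))
    (fun x : X => TangentSpace (𝓡 m) x)]
  [MeasurableSpace X] [BorelSpace X] [SecondCountableTopology X]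

-- Of a sequence of charts covering X, the first that contains x is taken. The choice has countably
-- many values and measurable fibres, and on each fibre the frame below comes from a single chart.
variable (m X) in
lemma exists_measurable_chart_selection :
    ∃ N : X → X, (range N).Countable ∧ (∀ q, MeasurableSet (N ⁻¹' {q})) ∧
      ∀ x, x ∈ (chart m (N x)).source := by
  classical
  obtain ⟨s, hs, hcov⟩ := exists_countable_chart_cover m X
  rcases s.eq_empty_or_nonempty with h | hne
  · have hX : IsEmpty X := by
      rw [h] at hcov
      exact ⟨fun x => by simpa using (hcov.symm ▸ mem_univ x : x ∈ ⋃ p ∈ (∅ : Set X), _)⟩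
    exact ⟨id, Set.to_countable _, fun q => hX.elim q, fun x => hX.elim x⟩
  obtain ⟨f, rfl⟩ := hs.exists_eq_range hne
  have hex : ∀ x, ∃ n, x ∈ (chart m (f n)).source := by
    intro x
    have : x ∈ ⋃ p ∈ range f, (chart m p).source := hcov ▸ mem_univ x
    simpa using this
  let n : X → ℕ := fun x => Nat.find (hex x)
  have hn : Measurable n := measurable_find hex fun k => (chart m (f k)).open_source.measurableSet
  refine ⟨f ∘ n, (countable_range f).mono (range_comp_subset_range n f), fun q => ?_,
    fun x => Nat.find_spec (hex x)⟩
  rw [preimage_comp]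
  exact hn (MeasurableSet.of_discrete)

/-- The chart centre chosen at `x`. -/
def chartIndex (m : ℕ) {X : Type*} [EMetricSpace X] [ChartedSpace (EuclideanSpace ℝ (Fin m)) X]
    [RiemannianBundle (fun x : X => TangentSpace (𝓡 m) x)] [IsManifold (𝓡 m) ∞ X]
    [IsContMDiffRiemannianBundle (𝓡 m) ∞ (EuclideanSpace ℝ (Fin m))
      (fun x : X => TangentSpace (𝓡 m) x)]
    [MeasurableSpace X] [BorelSpace X] [SecondCountableTopology X] : X → X :=
  (exists_measurable_chart_selection m X).choose

lemma countable_range_chartIndex : (range (chartIndex m : X → X)).Countable :=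
  (exists_measurable_chart_selection m X).choose_spec.1

lemma measurableSet_preimage_chartIndex (q : X) :
    MeasurableSet ((chartIndex m : X → X) ⁻¹' {q}) :=
  (exists_measurable_chart_selection m X).choose_spec.2.1 q

lemma mem_source_chartIndex (x : X) : x ∈ (chart m (chartIndex m x)).source :=
  (exists_measurable_chart_selection m X).choose_spec.2.2 x

/-- The coordinate vector field of the chart at `q`, as a vector at `x`. -/
def chartVector (q x : X) (i : Fin m) : TangentSpace (𝓡 m) x :=
  (coordField q (chart m q x) i : EuclideanSpace ℝ (Fin m))

lemma chartVector_symm (p : X) {y : EuclideanSpace ℝ (Fin m)} (hy : y ∈ (chart m p).target)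
    (i : Fin m) : chartVector p ((chart m p).symm y) i = coordField p y i := by
  rw [chartVector, (chart m p).right_inv hy]

lemma inner_chartVector (q : X) {x : X} (hx : x ∈ (chart m q).source) (i j : Fin m) :
    (inner ℝ (chartVector q x i) (chartVector q x j) : ℝ) = gram q (chart m q x) i j := by
  -- The two sides live in the tangent spaces at x and at symm (chart x); generalizing the base
  -- point allows substitution along the equality of the two points.
  have h : ∀ z, (chart m q).symm (chart m q x) = z →
      (@inner ℝ (TangentSpace (𝓡 m) z) _ (coordField q (chart m q x) i : EuclideanSpace ℝ (Fin m))
        (coordField q (chart m q x) j : EuclideanSpace ℝ (Fin m)) : ℝ) =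
        gram q (chart m q x) i j := by
    rintro z rfl
    rfl
  exact h x ((chart m q).left_inv hx)

lemma continuousOn_inner_chartVector (q : X) (i j : Fin m) :
    ContinuousOn (fun x => (inner ℝ (chartVector q x i) (chartVector q x j) : ℝ))
      (chart m q).source := by
  refine ((continuousOn_gram q i j).comp (chart m q).continuousOn
    fun x hx => (chart m q).map_source hx).congr fun x hx => ?_
  exact inner_chartVector q hx i j

/-- A linear relation between the vectors lies in the kernel of their Gram matrix, whose determinant
is positive. -/
lemma linearIndependent_chartVector (q : X) {x : X} (hx : x ∈ (chart m q).source) :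
    LinearIndependent ℝ (chartVector q x : Fin m → TangentSpace (𝓡 m) x) := by
  rw [Fintype.linearIndependent_iff]
  intro c hc
  have h1 : Matrix.mulVec (gram q (chart m q x)) c = 0 := by
    ext i
    have h2 : (inner ℝ (chartVector q x i) (∑ j, c j • chartVector q x j) : ℝ) = 0 := by
      rw [hc, inner_zero_right]
    simp only [inner_sum, real_inner_smul_right, inner_chartVector q hx] at h2
    rw [Matrix.mulVec, dotProduct, Pi.zero_apply, ← h2]
    exact Finset.sum_congr rfl fun j _ => mul_comm _ _
  have h3 := Matrix.eq_zero_of_mulVec_eq_zero (det_gram_pos q ((chart m q).map_source hx)).ne' h1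
  exact fun i => congrFun h3 i

lemma chartVector_transition {p q x : X} (hp : x ∈ (chart m p).source)
    (hq : x ∈ (chart m q).source) (k : Fin m) :
    chartVector p x k = ∑ a, jacobi p q (chart m p x) a k • chartVector q x a := by
  have h1 := coordField_transition (m := m) (p := p) (q := q) ((chart m p).map_source hp)
    (by rwa [(chart m p).left_inv hp]) k
  have h2 : transition p q (chart m p x) = chart m q x := by
    rw [transition, (chart m p).left_inv hp]
  rw [h2] at h1
  exact h1

lemma continuousOn_jacobi (p q : X) (a k : Fin m) :
    ContinuousOn (fun x => jacobi p q (chart m p x) a k)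
      ((chart m p).source ∩ (chart m q).source) := by
  let O := (chart m p).target ∩ (chart m p).symm ⁻¹' (chart m q).source
  have hO : IsOpen O := (chart m p).isOpen_inter_preimage_symm (chart m q).open_source
  have h1 : ContMDiffOn (𝓡 m) (𝓡 m) ∞ (chart m p).symm (chart m p).target :=
    contMDiffOn_chart_symm
  have h2 : ContMDiffOn (𝓡 m) (𝓡 m) ∞ (chart m q) (chart m q).source := contMDiffOn_chart
  have h3 : ContDiffOn ℝ ∞ (transition p q) O :=
    contMDiffOn_iff_contDiffOn.1 (h2.comp (h1.mono inter_subset_left) fun y hy => hy.2)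
  have h4 : ContinuousOn (fun y => fderiv ℝ (transition p q) y (EuclideanSpace.single k 1)) O :=
    (h3.continuousOn_fderiv_of_isOpen hO (by simp)).clm_apply continuousOn_const
  have h5 : ContinuousOn (fun y => jacobi p q y a k) O :=
    (EuclideanSpace.proj a : EuclideanSpace ℝ (Fin m) →L[ℝ] ℝ).continuous.comp_continuousOn h4
  refine h5.comp ((chart m p).continuousOn.mono inter_subset_left) fun x hx =>
    ⟨(chart m p).map_source hx.1, ?_⟩
  rw [mem_preimage, (chart m p).left_inv hx.1]
  exact hx.2

/-- An orthonormal basis of the tangent space at `x` that depends measurably on `x`. -/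
def frame (m : ℕ) {X : Type*} [EMetricSpace X] [ChartedSpace (EuclideanSpace ℝ (Fin m)) X]
    [RiemannianBundle (fun x : X => TangentSpace (𝓡 m) x)] [IsManifold (𝓡 m) ∞ X]
    [IsContMDiffRiemannianBundle (𝓡 m) ∞ (EuclideanSpace ℝ (Fin m))
      (fun x : X => TangentSpace (𝓡 m) x)]
    [MeasurableSpace X] [BorelSpace X] [SecondCountableTopology X] (x : X) :
    OrthonormalBasis (Fin m) ℝ (TangentSpace (𝓡 m) x) :=
  InnerProductSpace.gramSchmidtOrthonormalBasis
    ((finrank_euclideanSpace_fin (𝕜 := ℝ)).trans (Fintype.card_fin m).symm :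
      Module.finrank ℝ (TangentSpace (𝓡 m) x) = Fintype.card (Fin m))
    (chartVector (chartIndex m x) x)

lemma frame_apply (x : X) (i : Fin m) :
    frame m x i = InnerProductSpace.gramSchmidtNormed ℝ (chartVector (chartIndex m x) x) i := by
  refine InnerProductSpace.gramSchmidtOrthonormalBasis_apply _ ?_
  have h1 := linearIndependent_chartVector (chartIndex m x)
    (mem_source_chartIndex x)
  have h2 := InnerProductSpace.gramSchmidtNormed_unit_length (𝕜 := ℝ) i h1
  intro h
  rw [h, norm_zero] at h2
  exact zero_ne_one h2

/-- The chart target splits into countably many measurable pieces on which the chosen chart is a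
fixed q. On each piece the coordinate fields of p are combinations of those of q with coefficients
in the Jacobi matrix, and their inner products with the frame are continuous. -/
lemma aestronglyMeasurable_inner_frame (p : X) (i k : Fin m) :
    AEStronglyMeasurable (fun y => (inner ℝ (frame m ((chart m p).symm y) i) (coordField p y k) : ℝ))
      (volume.restrict (chart m p).target) := by
  have hm : ∀ q : X, MeasurableSet ((chart m p).target ∩ (chart m p).symm ⁻¹' (chartIndex m ⁻¹' {q})) :=
    fun q => measurableSet_inter_preimage_symm p (measurableSet_preimage_chartIndex q)
  have hcov : (chart m p).target = ⋃ q : range (chartIndex m : X → X),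
      (chart m p).target ∩ (chart m p).symm ⁻¹' (chartIndex m ⁻¹' {q.1}) := by
    ext y
    simp only [mem_iUnion, mem_inter_iff, mem_preimage, mem_singleton_iff]
    exact ⟨fun h => ⟨⟨_, mem_range_self _⟩, h, rfl⟩, fun ⟨_, h, _⟩ => h⟩
  have : Countable (range (chartIndex m : X → X)) := countable_range_chartIndex
  rw [hcov, aestronglyMeasurable_iUnion_iff]
  rintro ⟨q, -⟩
  have h1 : ∀ a, ContinuousOn (fun x => (inner ℝ (InnerProductSpace.gramSchmidtNormed ℝ
      (chartVector q x : Fin m → TangentSpace (𝓡 m) x) i) (chartVector q x a) : ℝ))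
      (chart m q).source := fun a =>
    continuousOn_inner_gramSchmidtNormed (T := fun x : X => TangentSpace (𝓡 m) x) (chartVector q)
      (continuousOn_inner_chartVector q) (fun x hx => linearIndependent_chartVector q hx) i a
  have h2 : ContinuousOn (fun x => (inner ℝ (InnerProductSpace.gramSchmidtNormed ℝ
      (chartVector q x : Fin m → TangentSpace (𝓡 m) x) i) (chartVector p x k) : ℝ))
      ((chart m p).source ∩ (chart m q).source) := by
    refine (continuousOn_finsetSum Finset.univ fun a _ => (continuousOn_jacobi p q a k).mul
      ((h1 a).mono inter_subset_right)).congr fun x hx => ?_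
    rw [chartVector_transition hx.1 hx.2, inner_sum]
    simp only [real_inner_smul_right]
    rfl
  have h3 : ContinuousOn (fun y => (inner ℝ (frame m ((chart m p).symm y) i) (coordField p y k) : ℝ))
      ((chart m p).target ∩ (chart m p).symm ⁻¹' (chartIndex m ⁻¹' {q})) := by
    have hq : ∀ y ∈ (chart m p).symm ⁻¹' (chartIndex m ⁻¹' {q}),
        (chart m p).symm y ∈ (chart m q).source := by
      intro y hy
      have := mem_source_chartIndex (m := m) ((chart m p).symm y)
      rwa [show chartIndex m ((chart m p).symm y) = q from hy] at this
    refine (h2.comp ((chart m p).continuousOn_symm.mono inter_subset_left) fun y hy =>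
      ⟨(chart m p).map_target hy.1, hq y hy.2⟩).congr fun y hy => ?_
    simp only [Function.comp]
    rw [chartVector_symm p hy.1, frame_apply,
      show chartIndex m ((chart m p).symm y) = q from hy.2]
  exact h3.aestronglyMeasurable (hm q)

end Frame

/-! ### Covector fields in the measurable frame -/

section OrthonormalBases

variable {T : Type*} [NormedAddCommGroup T] [InnerProductSpace ℝ T] {ι ι' : Type*} [Fintype ι]
  [Fintype ι']

/-- Parseval. The norms and inner products of covectors are defined with an arbitrarily chosen
orthonormal basis at every point, about whose dependence on the point nothing is known; this permits
passing to the measurable frame. -/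
lemma sum_conj_mul_orthonormalBasis (b : OrthonormalBasis ι ℝ T) (b' : OrthonormalBasis ι' ℝ T)
    (α β : T →ₗ[ℝ] ℂ) :
    ∑ i, conj (α (b i)) * β (b i) = ∑ j, conj (α (b' j)) * β (b' j) := by
  classical
  have h : ∀ (γ : T →ₗ[ℝ] ℂ) i, γ (b i) = ∑ j, ((inner ℝ (b' j) (b i) : ℝ) : ℂ) * γ (b' j) := by
    intro γ i
    conv_lhs => rw [← b'.sum_repr' (b i), map_sum]
    simp
  simp only [h, map_sum, map_mul, Complex.conj_ofReal, Finset.sum_mul, Finset.mul_sum]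
  have h1 : ∀ j k, ∑ i, ((inner ℝ (b' j) (b i) : ℝ) : ℂ) * ((inner ℝ (b' k) (b i) : ℝ) : ℂ) =
      if j = k then 1 else 0 := by
    intro j k
    have h2 := b.sum_inner_mul_inner (b' j) (b' k)
    rw [orthonormal_iff_ite.1 b'.orthonormal j k] at h2
    have h3 := congrArg (fun r : ℝ => (r : ℂ)) h2
    simp only [Complex.ofReal_sum, Complex.ofReal_mul] at h3
    rw [show ((if j = k then (1 : ℝ) else 0 : ℝ) : ℂ) = if j = k then 1 else 0 by
      split_ifs <;> simp] at h3
    rw [← h3]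
    exact Finset.sum_congr rfl fun i _ => by rw [real_inner_comm (b i) (b' k)]
  have h4 : ∀ j k, ∑ i, ((inner ℝ (b' j) (b i) : ℝ) : ℂ) * conj (α (b' j)) *
      (((inner ℝ (b' k) (b i) : ℝ) : ℂ) * β (b' k)) =
      (if j = k then 1 else 0) * (conj (α (b' j)) * β (b' k)) := by
    intro j k
    rw [← h1, Finset.sum_mul]
    exact Finset.sum_congr rfl fun i _ => by ring
  rw [Finset.sum_comm]
  refine Finset.sum_congr rfl fun j _ => ?_
  rw [Finset.sum_comm]
  trans ∑ k, (if k = j then 1 else 0) * (conj (α (b' k)) * β (b' j))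
  · exact Finset.sum_congr rfl fun k _ => h4 k j
  · simp

lemma sum_norm_sq_orthonormalBasis (b : OrthonormalBasis ι ℝ T) (b' : OrthonormalBasis ι' ℝ T)
    (α : T →ₗ[ℝ] ℂ) : ∑ i, ‖α (b i)‖ ^ 2 = ∑ j, ‖α (b' j)‖ ^ 2 := by
  have h := sum_conj_mul_orthonormalBasis b b' α α
  simp only [Complex.conj_mul'] at h
  exact_mod_cast h

end OrthonormalBases

/-! ### Components of covectors in the frame, compared with components in charts -/

section Coordinates

variable {m : ℕ} {X : Type*} [EMetricSpace X] [ChartedSpace (EuclideanSpace ℝ (Fin m)) X]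
  [RiemannianBundle (fun x : X => TangentSpace (𝓡 m) x)] [IsManifold (𝓡 m) ∞ X]
  [IsContMDiffRiemannianBundle (𝓡 m) ∞ (EuclideanSpace ℝ (Fin m))
    (fun x : X => TangentSpace (𝓡 m) x)]
  [MeasurableSpace X] [BorelSpace X] [SecondCountableTopology X]

/-- The components of a covector in the measurable frame. -/
def coords {x : X} (α : TangentSpace (𝓡 m) x →ₗ[ℝ] ℂ) : EuclideanSpace ℂ (Fin m) :=
  WithLp.toLp 2 fun i => α (frame m x i)

/-- The covector with given components in the measurable frame. -/
def ofCoords (x : X) (b : EuclideanSpace ℂ (Fin m)) : TangentSpace (𝓡 m) x →ₗ[ℝ] ℂ where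
  toFun v := ∑ i, b i * ((inner ℝ (frame m x i) v : ℝ) : ℂ)
  map_add' v w := by simp [inner_add_right, mul_add, Finset.sum_add_distrib]
  map_smul' c v := by
    simp only [real_inner_smul_right, Complex.ofReal_mul, RingHom.id_apply, Complex.real_smul,
      Finset.mul_sum]
    exact Finset.sum_congr rfl fun i _ => by ring

@[simp] lemma coords_apply {x : X} (α : TangentSpace (𝓡 m) x →ₗ[ℝ] ℂ) (i : Fin m) :
    coords α i = α (frame m x i) := rfl

@[simp] lemma coords_zero {x : X} : coords (0 : TangentSpace (𝓡 m) x →ₗ[ℝ] ℂ) = 0 := by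
  ext i; simp

lemma coords_add {x : X} (α β : TangentSpace (𝓡 m) x →ₗ[ℝ] ℂ) :
    coords (α + β) = coords α + coords β := by
  ext i; simp

lemma coords_sub {x : X} (α β : TangentSpace (𝓡 m) x →ₗ[ℝ] ℂ) :
    coords (α - β) = coords α - coords β := by
  ext i; simp

lemma coords_smul {x : X} (c : ℂ) (α : TangentSpace (𝓡 m) x →ₗ[ℝ] ℂ) :
    coords (c • α) = c • coords α := by
  ext i; simp

lemma ofCoords_apply (x : X) (b : EuclideanSpace ℂ (Fin m)) (v : TangentSpace (𝓡 m) x) :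
    ofCoords x b v = ∑ i, b i * ((inner ℝ (frame m x i) v : ℝ) : ℂ) := rfl

@[simp] lemma coords_ofCoords (x : X) (b : EuclideanSpace ℂ (Fin m)) :
    coords (ofCoords x b) = b := by
  ext i
  simp only [coords_apply, ofCoords_apply, orthonormal_iff_ite.1 (frame m x).orthonormal]
  rw [Finset.sum_eq_single i (fun j _ hj => by simp [hj]) (by simp)]
  simp

lemma coords_injective {x : X} :
    Function.Injective (coords : (TangentSpace (𝓡 m) x →ₗ[ℝ] ℂ) → _) := fun α β h =>
  (frame m x).toBasis.ext fun i => by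
    simpa using congrArg (fun b : EuclideanSpace ℂ (Fin m) => b i) h

@[simp] lemma ofCoords_coords {x : X} (α : TangentSpace (𝓡 m) x →ₗ[ℝ] ℂ) :
    ofCoords x (coords α) = α := coords_injective (coords_ofCoords x _)

lemma covectorInner_eq_inner {x : X} (α β : TangentSpace (𝓡 m) x →ₗ[ℝ] ℂ) :
    covectorInner α β = inner ℂ (coords α) (coords β) := by
  rw [covectorInner, sum_conj_mul_orthonormalBasis _ (frame m x), PiLp.inner_apply]
  exact Finset.sum_congr rfl fun i _ => by simp [mul_comm]

lemma covectorNormSq_eq {x : X} (α : TangentSpace (𝓡 m) x →ₗ[ℝ] ℂ) :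
    covectorNormSq α = ‖coords α‖ ^ 2 := by
  rw [covectorNormSq, sum_norm_sq_orthonormalBasis _ (frame m x), EuclideanSpace.norm_sq_eq]
  rfl

lemma norm_coords_sq {x : X} (α : TangentSpace (𝓡 m) x →ₗ[ℝ] ℂ) :
    ‖coords α‖ ^ 2 = ∑ i, ‖α (frame m x i)‖ ^ 2 := by
  rw [EuclideanSpace.norm_sq_eq]
  rfl

lemma tensorNormSq_eq {x : X} (T : TangentSpace (𝓡 m) x →ₗ[ℝ] TangentSpace (𝓡 m) x →ₗ[ℝ] ℂ) :
    tensorNormSq T = ∑ i, ‖coords (T (frame m x i))‖ ^ 2 := by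
  simp only [norm_coords_sq, tensorNormSq]
  rw [Finset.sum_congr rfl fun i _ =>
    sum_norm_sq_orthonormalBasis (tangentBasis m x) (frame m x) (T (tangentBasis m x i)),
    Finset.sum_comm]
  rw [Finset.sum_comm (t := (Finset.univ : Finset (Fin m)))
    (f := fun i j => ‖T (frame m x i) (frame m x j)‖ ^ 2)]
  exact Finset.sum_congr rfl fun j _ =>
    sum_norm_sq_orthonormalBasis (tangentBasis m x) (frame m x) (T.flip (frame m x j))

lemma norm_apply_le {x : X} (α : TangentSpace (𝓡 m) x →ₗ[ℝ] ℂ) (v : TangentSpace (𝓡 m) x) :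
    ‖α v‖ ≤ ‖coords α‖ * ‖v‖ := by
  have h1 : α v = ∑ i, coords α i * ((inner ℝ (frame m x i) v : ℝ) : ℂ) := by
    rw [← ofCoords_apply, ofCoords_coords]
  have h2 : ‖v‖ ^ 2 = ∑ i, ‖((inner ℝ (frame m x i) v : ℝ) : ℂ)‖ ^ 2 := by
    rw [← (frame m x).sum_sq_norm_inner_right v]
    simp
  rw [← abs_of_nonneg (norm_nonneg (α v)), ← abs_of_nonneg (show 0 ≤ ‖coords α‖ * ‖v‖ by positivity)]
  refine sq_le_sq.1 ?_
  rw [mul_pow, h2, EuclideanSpace.norm_sq_eq, h1]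
  refine (pow_le_pow_left₀ (norm_nonneg _) (norm_sum_le _ _) 2).trans ?_
  simp only [norm_mul]
  exact Finset.sum_mul_sq_le_sq_mul_sq _ _ _

/-- Expansion v = ∑ g^{jk} ⟨v, ∂_k⟩ ∂_j. With v a frame vector it expresses frame components by
chart components with measurable coefficients. -/
lemma apply_eq_sum_gram_inv (p : X) {y : EuclideanSpace ℝ (Fin m)} (hy : y ∈ (chart m p).target)
    (α : TangentSpace (𝓡 m) ((chart m p).symm y) →ₗ[ℝ] ℂ)
    (v : TangentSpace (𝓡 m) ((chart m p).symm y)) :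
    α v = ∑ j, ∑ k, (((gram p y)⁻¹ j k * inner ℝ v (coordField p y k) : ℝ) : ℂ) *
      α (coordField p y j) := by
  obtain ⟨c, hc⟩ := exists_coord p hy v
  have h1 : (fun k => (inner ℝ v (coordField p y k) : ℝ)) = Matrix.vecMul c (gram p y) := by
    ext k
    trans (inner ℝ (∑ i, c i • coordField p y i) (coordField p y k) : ℝ)
    · rw [← hc]
    rw [sum_inner]
    simp only [real_inner_smul_left, Matrix.vecMul, dotProduct]
    rfl
  have hdet : IsUnit (gram p y).det := (det_gram_pos p hy).ne'.isUnit
  have hsymm : (gram p y).transpose = gram p y := by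
    ext i j
    exact real_inner_comm (coordField p y i) (coordField p y j)
  have h2 : ∀ j, c j = ∑ k, (gram p y)⁻¹ j k * inner ℝ v (coordField p y k) := by
    have h3 : Matrix.mulVec (gram p y)⁻¹ (Matrix.vecMul c (gram p y)) = c := by
      rw [← Matrix.mulVec_transpose, hsymm, Matrix.mulVec_mulVec, Matrix.nonsing_inv_mul _ hdet,
        Matrix.one_mulVec]
    intro j
    rw [← congrFun h3 j, ← h1]
    rfl
  conv_lhs => rw [hc, map_sum]
  refine Finset.sum_congr rfl fun j _ => ?_
  rw [map_smul, Complex.real_smul, h2 j, ← Finset.sum_mul, Complex.ofReal_sum]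

lemma continuousOn_gram_inv (p : X) (i j : Fin m) :
    ContinuousOn (fun y => (gram p y)⁻¹ i j) (chart m p).target := by
  have hG : ContinuousOn (fun y => gram p y) (chart m p).target :=
    continuousOn_pi.2 fun i => continuousOn_pi.2 fun j => continuousOn_gram p i j
  have h1 : ContinuousOn (fun y => ((gram p y).det)⁻¹ * (gram p y).adjugate i j)
      (chart m p).target := by
    refine ContinuousOn.mul (ContinuousOn.inv₀ ?_ fun y hy => (det_gram_pos p hy).ne') ?_
    · exact (Continuous.matrix_det continuous_id).comp_continuousOn hG
    · exact ((Continuous.matrix_adjugate continuous_id).matrix_elem i j).comp_continuousOn hG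
  refine h1.congr fun y hy => ?_
  simp [Matrix.inv_def]

lemma norm_coords_sq_chart (p : X) {y : EuclideanSpace ℝ (Fin m)} (hy : y ∈ (chart m p).target)
    (α : TangentSpace (𝓡 m) ((chart m p).symm y) →ₗ[ℝ] ℂ) :
    ((‖coords α‖ ^ 2 : ℝ) : ℂ) = ∑ i, ∑ j, (((gram p y)⁻¹ i j : ℝ) : ℂ) *
        (conj (α (coordField p y i)) * α (coordField p y j)) := by
  rw [← covectorNormSq_eq, ← covectorInner_self, (covectorInner_eq p hy α α).2]

lemma aestronglyMeasurable_euclidean {S : Type*} [MeasurableSpace S] {μ : Measure S}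
    {g : S → EuclideanSpace ℂ (Fin m)} (h : ∀ i, AEStronglyMeasurable (fun s => g s i) μ) :
    AEStronglyMeasurable g μ := by
  have h1 : AEStronglyMeasurable (fun s i => g s i) μ := by
    refine (aemeasurable_pi_iff.2 fun i => (h i).aemeasurable).aestronglyMeasurable
  exact (PiLp.continuous_toLp 2 (fun _ : Fin m => ℂ)).comp_aestronglyMeasurable h1

lemma aestronglyMeasurable_coords {α : ∀ x : X, TangentSpace (𝓡 m) x →ₗ[ℝ] ℂ}
    (h : ∀ (p : X) i, AEStronglyMeasurable (fun y => α ((chart m p).symm y) (coordField p y i))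
      (volume.restrict (chart m p).target)) :
    AEStronglyMeasurable (fun x => coords (α x)) (riemannianMeasure m X) := by
  refine aestronglyMeasurable_euclidean fun i => aestronglyMeasurable_of_chart fun p => ?_
  have hm := (chart m p).open_target.measurableSet
  have h1 : AEStronglyMeasurable (fun y => ∑ j, ∑ k, (((gram p y)⁻¹ j k *
      inner ℝ (frame m ((chart m p).symm y) i) (coordField p y k) : ℝ) : ℂ) *
        α ((chart m p).symm y) (coordField p y j)) (volume.restrict (chart m p).target) := by
    refine Finset.aestronglyMeasurable_fun_sum _ fun j _ =>
      Finset.aestronglyMeasurable_fun_sum _ fun k _ => AEStronglyMeasurable.mul ?_ (h p j)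
    exact Complex.continuous_ofReal.comp_aestronglyMeasurable
      (((continuousOn_gram_inv p j k).aestronglyMeasurable hm).mul
        (aestronglyMeasurable_inner_frame p i k))
  refine h1.congr (ae_restrict_of_forall_mem hm fun y hy => ?_)
  exact (apply_eq_sum_gram_inv p hy _ _).symm

lemma aestronglyMeasurable_chart_of_coords {α : ∀ x : X, TangentSpace (𝓡 m) x →ₗ[ℝ] ℂ}
    (h : AEStronglyMeasurable (fun x => coords (α x)) (riemannianMeasure m X)) (p : X) (i : Fin m) :
    AEStronglyMeasurable (fun y => α ((chart m p).symm y) (coordField p y i))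
      (volume.restrict (chart m p).target) := by
  have h1 : AEStronglyMeasurable (fun y => ∑ j, coords (α ((chart m p).symm y)) j *
      ((inner ℝ (frame m ((chart m p).symm y) j) (coordField p y i) : ℝ) : ℂ))
      (volume.restrict (chart m p).target) := by
    refine Finset.aestronglyMeasurable_fun_sum _ fun j _ => AEStronglyMeasurable.mul ?_ ?_
    · exact (EuclideanSpace.proj j : EuclideanSpace ℂ (Fin m) →L[ℂ] ℂ).continuous.comp_aestronglyMeasurable
        (AEStronglyMeasurable.comp_chart_symm h p)
    · exact Complex.continuous_ofReal.comp_aestronglyMeasurable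
        (aestronglyMeasurable_inner_frame p j i)
  refine h1.congr (Eventually.of_forall fun y => ?_)
  simp only []
  rw [← ofCoords_apply, ofCoords_coords]

lemma exists_norm_coordField_le (p : X) {K : Set (EuclideanSpace ℝ (Fin m))} (hK : IsCompact K)
    (hs : K ⊆ (chart m p).target) (i : Fin m) : ∃ C : ℝ, 0 ≤ C ∧ ∀ y ∈ K, ‖coordField p y i‖ ≤ C := by
  obtain ⟨C, hC⟩ := hK.exists_bound_of_continuousOn
    ((continuousOn_gram p i i).mono hs).sqrt
  refine ⟨max C 0, le_max_right _ _, fun y hy => le_max_of_le_left ?_⟩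
  have h1 : gram p y i i = ‖coordField p y i‖ ^ 2 := real_inner_self_eq_norm_sq (coordField p y i)
  have h2 := hC y hy
  rwa [h1, Real.sqrt_sq (norm_nonneg _), norm_norm] at h2

/-- Local bound of the chart components of a covector field by its global norm. -/
lemma exists_eLpNorm_component_le (p : X) {K : Set (EuclideanSpace ℝ (Fin m))} (hK : IsCompact K)
    (hs : K ⊆ (chart m p).target) (i : Fin m) :
    ∃ C : ℝ≥0∞, C ≠ ⊤ ∧ ∀ α : ∀ x : X, TangentSpace (𝓡 m) x →ₗ[ℝ] ℂ,
      AEStronglyMeasurable (fun x => coords (α x)) (riemannianMeasure m X) →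
      eLpNorm (fun y => α ((chart m p).symm y) (coordField p y i)) 2 (volume.restrict K) ≤
        C * eLpNorm (fun x => coords (α x)) 2 (riemannianMeasure m X) := by
  obtain ⟨C, hC, h⟩ : ∃ C : ℝ≥0∞, C ≠ ⊤ ∧ ∀ g : X → EuclideanSpace ℂ (Fin m),
      AEStronglyMeasurable g (riemannianMeasure m X) →
      eLpNorm (fun y => g ((chart m p).symm y)) 2 (volume.restrict K) ≤
        C * eLpNorm g 2 (riemannianMeasure m X) := exists_eLpNorm_chart_le p hK hs
  obtain ⟨c, hc0, hc⟩ := exists_norm_coordField_le p hK hs i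
  refine ⟨ENNReal.ofReal c * C, ENNReal.mul_ne_top ENNReal.ofReal_ne_top hC, fun α hα => ?_⟩
  have h1 : ∀ᵐ y ∂(volume.restrict K), ‖α ((chart m p).symm y) (coordField p y i)‖ ≤
      c * ‖coords (α ((chart m p).symm y))‖ := by
    refine ae_restrict_of_forall_mem hK.measurableSet fun y hy => ?_
    have h2 := norm_apply_le (α ((chart m p).symm y)) (coordField p y i)
    have h3 := mul_le_mul_of_nonneg_left (hc y hy) (norm_nonneg (coords (α ((chart m p).symm y))))
    exact (h2.trans h3).trans_eq (mul_comm _ _)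
  have h4 := eLpNorm_le_mul_eLpNorm_of_ae_le_mul h1 2
  rw [mul_assoc]
  exact h4.trans (mul_le_mul_right (h _ hα) _)

lemma exists_norm_coords_le (p : X) {K : Set (EuclideanSpace ℝ (Fin m))} (hK : IsCompact K)
    (hs : K ⊆ (chart m p).target) : ∃ C : ℝ, 0 ≤ C ∧ ∀ y ∈ K,
      ∀ α : TangentSpace (𝓡 m) ((chart m p).symm y) →ₗ[ℝ] ℂ,
        ‖coords α‖ ≤ C * ∑ i, ‖α (coordField p y i)‖ := by
  have h1 : ∀ i j, ∃ c, ∀ y ∈ K, ‖(gram p y)⁻¹ i j‖ ≤ c := fun i j =>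
    hK.exists_bound_of_continuousOn ((continuousOn_gram_inv p i j).mono hs)
  choose c hc using h1
  let C := ∑ i, ∑ j, |c i j|
  have hC : 0 ≤ C := Finset.sum_nonneg fun i _ => Finset.sum_nonneg fun j _ => abs_nonneg _
  -- The bound |α|² = ∑ g^{ij} conj(α_i) α_j ≤ C S² is weakened by C ≤ (C + 1)² to avoid a square
  -- root.
  refine ⟨C + 1, by positivity, fun y hy α => ?_⟩
  set S := ∑ i, ‖α (coordField p y i)‖ with hS
  have hS0 : 0 ≤ S := Finset.sum_nonneg fun i _ => norm_nonneg _
  have hle : ∀ i, ‖α (coordField p y i)‖ ≤ S := fun i =>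
    Finset.single_le_sum (f := fun i => ‖α (coordField p y i)‖) (fun i _ => norm_nonneg _)
      (Finset.mem_univ i)
  have h2 : ‖coords α‖ ^ 2 ≤ C * S ^ 2 := by
    have h3 := norm_coords_sq_chart p (hs hy) α
    have h4 : ‖coords α‖ ^ 2 = ‖((‖coords α‖ ^ 2 : ℝ) : ℂ)‖ := by
      rw [Complex.norm_real, Real.norm_of_nonneg (sq_nonneg _)]
    rw [h4, h3, Finset.sum_mul]
    refine (norm_sum_le _ _).trans (Finset.sum_le_sum fun i _ => ?_)
    rw [Finset.sum_mul]
    refine (norm_sum_le _ _).trans (Finset.sum_le_sum fun j _ => ?_)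
    rw [norm_mul, norm_mul, RCLike.norm_conj, Complex.norm_real, sq]
    exact mul_le_mul ((hc i j y hy).trans (le_abs_self _))
      (mul_le_mul (hle i) (hle j) (norm_nonneg _) hS0) (by positivity) (abs_nonneg _)
  refine abs_le_of_sq_le_sq' (h2.trans ?_) (by positivity) |>.2
  rw [mul_pow]
  gcongr
  nlinarith

end Coordinates

/-! ### Values and gradients of elements of the form domain -/

section Gradient

variable {m : ℕ} {X : Type*} [EMetricSpace X] [ChartedSpace (EuclideanSpace ℝ (Fin m)) X]
  [RiemannianBundle (fun x : X => TangentSpace (𝓡 m) x)] [IsManifold (𝓡 m) ∞ X]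
  [IsContMDiffRiemannianBundle (𝓡 m) ∞ (EuclideanSpace ℝ (Fin m))
    (fun x : X => TangentSpace (𝓡 m) x)]
  [MeasurableSpace X] [BorelSpace X] [SecondCountableTopology X]

lemma continuousOn_fderiv_comp_chart_symm {φ : X → ℂ} (hφ : ContMDiff (𝓡 m) 𝓘(ℝ, ℂ) ∞ φ) (p : X)
    (v : EuclideanSpace ℝ (Fin m)) :
    ContDiffOn ℝ ∞ (φ ∘ (chart m p).symm) (chart m p).target ∧
      ContinuousOn (fun y => fderiv ℝ (φ ∘ (chart m p).symm) y v) (chart m p).target := by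
  have h1 : ContMDiffOn (𝓡 m) (𝓡 m) ∞ (chart m p).symm (chart m p).target :=
    contMDiffOn_chart_symm
  have h2 : ContDiffOn ℝ ∞ (φ ∘ (chart m p).symm) (chart m p).target :=
    contMDiffOn_iff_contDiffOn.1 (hφ.comp_contMDiffOn h1)
  exact ⟨h2, (h2.continuousOn_fderiv_of_isOpen (chart m p).open_target (by simp)).clm_apply
    continuousOn_const⟩

lemma differential_chart {φ : X → ℂ} (hφ : ContMDiff (𝓡 m) 𝓘(ℝ, ℂ) ∞ φ) (p : X)
    {y : EuclideanSpace ℝ (Fin m)} (hy : y ∈ (chart m p).target) (i : Fin m) :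
    differential m φ ((chart m p).symm y) (coordField p y i) =
      fderiv ℝ (φ ∘ (chart m p).symm) y (EuclideanSpace.single i 1) :=
  differential_coordField p hy (hφ.mdifferentiable (by simp) _) i

lemma aestronglyMeasurable_differential {φ : X → ℂ} (hφ : ContMDiff (𝓡 m) 𝓘(ℝ, ℂ) ∞ φ) :
    AEStronglyMeasurable (fun x => coords (differential m φ x)) (riemannianMeasure m X) := by
  refine aestronglyMeasurable_coords fun p i => ?_
  have hm := (chart m p).open_target.measurableSet
  refine ((continuousOn_fderiv_comp_chart_symm hφ p (EuclideanSpace.single i 1)).2.aestronglyMeasurable hm).congr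
    (ae_restrict_of_forall_mem hm fun y hy => ?_)
  exact (differential_chart hφ p hy i).symm

lemma continuous_norm_differential {φ : X → ℂ} (hφ : ContMDiff (𝓡 m) 𝓘(ℝ, ℂ) ∞ φ) :
    Continuous fun x => ‖coords (differential m φ x)‖ := by
  have h1 := Complex.continuous_re.comp (continuous_covectorInner hφ hφ)
  refine h1.sqrt.congr fun x => ?_
  simp only [Function.comp, covectorInner_self, covectorNormSq_eq, Complex.ofReal_re]
  exact Real.sqrt_sq (norm_nonneg _)

lemma memLp_value {U : Opens X} (φ : TestFunction m U) :
    MemLp φ.toFun 2 (riemannianMeasure m X) :=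
  φ.contMDiff.continuous.memLp_of_hasCompactSupport φ.hasCompactSupport

lemma memLp_differential {U : Opens X} (φ : TestFunction m U) :
    MemLp (fun x => coords (differential m φ.toFun x)) 2 (riemannianMeasure m X) := by
  have h := (continuous_norm_differential φ.contMDiff).memLp_of_hasCompactSupport (p := 2)
    (μ := riemannianMeasure m X) (HasCompactSupport.intro φ.hasCompactSupport fun x hx => by
      rw [φ.differential_eq_zero hx, coords_zero, norm_zero])
  exact (memLp_norm_iff (aestronglyMeasurable_differential φ.contMDiff)).1 h

/-- Square integrable covector fields, by their components in the measurable frame. -/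
abbrev L2Covector (m : ℕ) (X : Type*) [EMetricSpace X]
    [ChartedSpace (EuclideanSpace ℝ (Fin m)) X]
    [RiemannianBundle (fun x : X => TangentSpace (𝓡 m) x)] [MeasurableSpace X] : Type _ :=
  Lp (EuclideanSpace ℂ (Fin m)) 2 (riemannianMeasure m X)

/-- The class in `L^2(X)` of a test function. -/
def testValue (U : Opens X) : TestFunction m U →ₗ[ℂ] Lp ℂ 2 (riemannianMeasure m X) where
  toFun φ := (memLp_value φ).toLp φ.toFun
  map_add' φ ψ := MemLp.toLp_add (memLp_value φ) (memLp_value ψ)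
  map_smul' c φ := MemLp.toLp_const_smul c (memLp_value φ)

/-- The class of the differential of a test function. -/
def testGradient (U : Opens X) : TestFunction m U →ₗ[ℂ] L2Covector m X where
  toFun φ := (memLp_differential φ).toLp _
  map_add' φ ψ := by
    rw [← MemLp.toLp_add]
    refine MemLp.toLp_congr _ _ (Eventually.of_forall fun x => ?_)
    change coords (differential m (φ.toFun + ψ.toFun) x) = _
    rw [differential_add (φ.mdifferentiable x) (ψ.mdifferentiable x), coords_add]
    rfl
  map_smul' c φ := by
    rw [RingHom.id_apply, ← MemLp.toLp_const_smul]
    refine MemLp.toLp_congr _ _ (Eventually.of_forall fun x => ?_)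
    change coords (differential m (c • φ.toFun) x) = _
    rw [Pi.smul_apply, ← coords_smul]
    congr 1
    ext v
    exact differential_smul c (φ.mdifferentiable x) v

lemma testValue_ae {U : Opens X} (φ : TestFunction m U) :
    testValue U φ =ᵐ[riemannianMeasure m X] φ.toFun := (memLp_value φ).coeFn_toLp

lemma testGradient_ae {U : Opens X} (φ : TestFunction m U) :
    testGradient U φ =ᵐ[riemannianMeasure m X] fun x => coords (differential m φ.toFun x) :=
  (memLp_differential φ).coeFn_toLp

/-- The energy is an integral over U, but test functions vanish with their differentials outside U,
so the L² spaces over all of X may be used for every U. -/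
lemma inner_testFunction {U : Opens X} (φ ψ : TestFunction m U) :
    inner ℂ φ ψ = inner ℂ (testValue U φ) (testValue U ψ) +
      inner ℂ (testGradient U φ) (testGradient U ψ) := by
  change energyInner φ ψ = _
  rw [L2.inner_def, L2.inner_def, ← integral_add (L2.integrable_inner _ _)
    (L2.integrable_inner _ _), energyInner, setIntegral_eq_integral_of_forall_compl_eq_zero]
  · refine integral_congr_ae ?_
    filter_upwards [testValue_ae φ, testValue_ae ψ, testGradient_ae φ, testGradient_ae ψ]
      with x h1 h2 h3 h4
    rw [h1, h2, h3, h4, covectorInner_eq_inner]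
    simp [mul_comm]
  · intro x hx
    have hx' : x ∉ tsupport φ.toFun := fun h =>
      hx ((show φ.toFun ∈ testSubmodule m U from φ.2).2.2 h)
    rw [φ.differential_eq_zero hx', image_eq_zero_of_notMem_tsupport hx']
    simp [covectorInner]

lemma norm_sq_testFunction {U : Opens X} (φ : TestFunction m U) :
    ‖φ‖ ^ 2 = ‖testValue U φ‖ ^ 2 + ‖testGradient U φ‖ ^ 2 := by
  have h := congrArg RCLike.re (inner_testFunction φ φ)
  simpa only [map_add, inner_self_eq_norm_sq] using h

lemma norm_testValue_le {U : Opens X} (φ : TestFunction m U) : ‖testValue U φ‖ ≤ ‖φ‖ :=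
  abs_le_of_sq_le_sq' (by rw [norm_sq_testFunction φ]; linarith [sq_nonneg ‖testGradient U φ‖])
    (norm_nonneg _) |>.2

lemma norm_testGradient_le {U : Opens X} (φ : TestFunction m U) : ‖testGradient U φ‖ ≤ ‖φ‖ :=
  abs_le_of_sq_le_sq' (by rw [norm_sq_testFunction φ]; linarith [sq_nonneg ‖testValue U φ‖])
    (norm_nonneg _) |>.2

/-- The extension by zero to `X` of an element of the first Sobolev space of `U`. -/
def value (m : ℕ) {X : Type*} [EMetricSpace X] [ChartedSpace (EuclideanSpace ℝ (Fin m)) X]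
    [RiemannianBundle (fun x : X => TangentSpace (𝓡 m) x)] [IsManifold (𝓡 m) ∞ X]
    [IsContMDiffRiemannianBundle (𝓡 m) ∞ (EuclideanSpace ℝ (Fin m))
      (fun x : X => TangentSpace (𝓡 m) x)]
    [MeasurableSpace X] [BorelSpace X] [SecondCountableTopology X] (U : Opens X) :
    FormDomain m U →L[ℂ] Lp ℂ 2 (riemannianMeasure m X) :=
  ((testValue U).mkContinuous 1 fun φ => (norm_testValue_le φ).trans_eq (one_mul _).symm).extend
    UniformSpace.Completion.toComplL

/-- The differential of an element of the first Sobolev space of `U`. -/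
def gradient (m : ℕ) {X : Type*} [EMetricSpace X] [ChartedSpace (EuclideanSpace ℝ (Fin m)) X]
    [RiemannianBundle (fun x : X => TangentSpace (𝓡 m) x)] [IsManifold (𝓡 m) ∞ X]
    [IsContMDiffRiemannianBundle (𝓡 m) ∞ (EuclideanSpace ℝ (Fin m))
      (fun x : X => TangentSpace (𝓡 m) x)]
    [MeasurableSpace X] [BorelSpace X] [SecondCountableTopology X] (U : Opens X) :
    FormDomain m U →L[ℂ] L2Covector m X :=
  ((testGradient U).mkContinuous 1 fun φ =>
    (norm_testGradient_le φ).trans_eq (one_mul _).symm).extend UniformSpace.Completion.toComplL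

lemma value_coe {U : Opens X} (φ : TestFunction m U) :
    value m U (φ : FormDomain m U) = testValue U φ := by
  exact ContinuousLinearMap.extend_eq _ (UniformSpace.Completion.denseRange_coe)
    (UniformSpace.Completion.isUniformInducing_coe _) φ

lemma gradient_coe {U : Opens X} (φ : TestFunction m U) :
    gradient m U (φ : FormDomain m U) = testGradient U φ := by
  exact ContinuousLinearMap.extend_eq _ (UniformSpace.Completion.denseRange_coe)
    (UniformSpace.Completion.isUniformInducing_coe _) φ

lemma inner_formDomain {U : Opens X} (v w : FormDomain m U) :
    inner ℂ v w = inner ℂ (value m U v) (value m U w) + inner ℂ (gradient m U v) (gradient m U w) := by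
  induction v, w using UniformSpace.Completion.induction_on₂ with
  | hp => exact isClosed_eq (by fun_prop) (by fun_prop)
  | ih φ ψ =>
    rw [UniformSpace.Completion.inner_coe, value_coe, value_coe, gradient_coe, gradient_coe,
      inner_testFunction]

lemma norm_sq_formDomain {U : Opens X} (v : FormDomain m U) :
    ‖v‖ ^ 2 = ‖value m U v‖ ^ 2 + ‖gradient m U v‖ ^ 2 := by
  have h := congrArg RCLike.re (inner_formDomain v v)
  simpa only [map_add, inner_self_eq_norm_sq] using h

lemma norm_value_le {U : Opens X} (v : FormDomain m U) : ‖value m U v‖ ≤ ‖v‖ :=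
  abs_le_of_sq_le_sq' (by rw [norm_sq_formDomain v]; linarith [sq_nonneg ‖gradient m U v‖])
    (norm_nonneg _) |>.2

lemma norm_gradient_le {U : Opens X} (v : FormDomain m U) : ‖gradient m U v‖ ≤ ‖v‖ :=
  abs_le_of_sq_le_sq' (by rw [norm_sq_formDomain v]; linarith [sq_nonneg ‖value m U v‖])
    (norm_nonneg _) |>.2

lemma norm_formDomain_le {U : Opens X} (v : FormDomain m U) :
    ‖v‖ ≤ ‖value m U v‖ + ‖gradient m U v‖ :=
  abs_le_of_sq_le_sq' (by
    rw [norm_sq_formDomain v]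
    nlinarith [norm_nonneg (value m U v), norm_nonneg (gradient m U v)]) (by positivity) |>.2

/-- The restriction to `U` of functions on `X`. -/
def restrictL2 (m : ℕ) {X : Type*} [EMetricSpace X] [ChartedSpace (EuclideanSpace ℝ (Fin m)) X]
    [RiemannianBundle (fun x : X => TangentSpace (𝓡 m) x)] [MeasurableSpace X] (U : Opens X) :
    Lp ℂ 2 (riemannianMeasure m X) →L[ℂ] L2 m U :=
  LpToLpRestrictCLM X ℂ ℂ (riemannianMeasure m X) 2 U

lemma restrictL2_ae (U : Opens X) (f : Lp ℂ 2 (riemannianMeasure m X)) :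
    restrictL2 m U f =ᵐ[(riemannianMeasure m X).restrict U] f :=
  LpToLpRestrictCLM_coeFn ℂ (U : Set X) f

lemma embedding_eq {U : Opens X} (v : FormDomain m U) :
    embedding m U v = restrictL2 m U (value m U v) := by
  induction v using UniformSpace.Completion.induction_on with
  | hp => exact isClosed_eq (by fun_prop) (by fun_prop)
  | ih φ =>
    rw [embedding_coe, value_coe]
    refine Lp.ext ?_
    filter_upwards [(memLp_testFunction φ).coeFn_toLp, restrictL2_ae U (testValue U φ),
      ae_restrict_of_ae (testValue_ae φ)] with x h1 h2 h3
    rw [h2, h3]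
    exact h1

lemma embedding_ae {U : Opens X} (v : FormDomain m U) :
    embedding m U v =ᵐ[(riemannianMeasure m X).restrict U] value m U v := by
  rw [embedding_eq]
  exact restrictL2_ae U _

/-- Vanishing outside U is a closed condition that test functions satisfy. -/
lemma value_ae_eq_zero {U : Opens X} (v : FormDomain m U) :
    value m U v =ᵐ[(riemannianMeasure m X).restrict (U : Set X)ᶜ] 0 := by
  have h : LpToLpRestrictCLM X ℂ ℂ (riemannianMeasure m X) 2 (U : Set X)ᶜ (value m U v) = 0 := by
    induction v using UniformSpace.Completion.induction_on with
    | hp => exact isClosed_eq (by fun_prop) (by fun_prop)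
    | ih φ =>
      rw [value_coe]
      refine Lp.ext ?_
      have hm : MeasurableSet (U : Set X)ᶜ := U.isOpen.measurableSet.compl
      filter_upwards [LpToLpRestrictCLM_coeFn ℂ (U : Set X)ᶜ (testValue U φ),
        ae_restrict_of_ae (testValue_ae φ), Lp.coeFn_zero ℂ 2 ((riemannianMeasure m X).restrict
          (U : Set X)ᶜ), ae_restrict_mem hm] with x h1 h2 h3 hx
      rw [h1, h2, h3, Pi.zero_apply]
      exact image_eq_zero_of_notMem_tsupport fun h =>
        hx ((show φ.toFun ∈ testSubmodule m U from φ.2).2.2 h)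
  have h2 := LpToLpRestrictCLM_coeFn ℂ (U : Set X)ᶜ (value m U v)
  rw [h] at h2
  exact h2.symm.trans (Lp.coeFn_zero _ _ _)

lemma form_eq {U : Opens X} (v w : FormDomain m U) :
    form (embedding m U) v w = inner ℂ (gradient m U v) (gradient m U w) := by
  have h : inner ℂ (embedding m U v) (embedding m U w) =
      inner ℂ (value m U v) (value m U w) := by
    rw [L2.inner_def, L2.inner_def,
      ← setIntegral_eq_integral_of_ae_compl_eq_zero (s := (U : Set X)) (f := fun x => inner ℂ (value m U v x) (value m U w x))]
    · refine integral_congr_ae ?_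
      filter_upwards [embedding_ae v, embedding_ae w] with x h1 h2
      rw [h1, h2]
    · have := (ae_restrict_iff' U.isOpen.measurableSet.compl).1 (value_ae_eq_zero v)
      filter_upwards [this] with x hx hxU
      rw [hx hxU, Pi.zero_apply, inner_zero_left]
  rw [form, inner_formDomain, h, add_sub_cancel_left]

/-- Elements of `H^1_0(U)` are found as limits in `L^2` of functions and differentials. -/
lemma exists_formDomain_of_approx {U : Opens X} {f : X → ℂ} {b : X → EuclideanSpace ℂ (Fin m)}
    (hf : MemLp f 2 (riemannianMeasure m X)) (hb : MemLp b 2 (riemannianMeasure m X))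
    (H : ∀ ε : ℝ, 0 < ε → ∃ v : FormDomain m U,
      eLpNorm (fun x => value m U v x - f x) 2 (riemannianMeasure m X) ≤ ENNReal.ofReal ε ∧
      eLpNorm (fun x => gradient m U v x - b x) 2 (riemannianMeasure m X) ≤ ENNReal.ofReal ε) :
    ∃ v : FormDomain m U, value m U v =ᵐ[riemannianMeasure m X] f ∧
      gradient m U v =ᵐ[riemannianMeasure m X] b := by
  let P : FormDomain m U →L[ℂ] Lp ℂ 2 (riemannianMeasure m X) × L2Covector m X :=
    (value m U).prod (gradient m U)
  -- The pair (value, gradient) controls the energy norm, so this map is bounded below and its range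
  -- is closed. The factor 2 arises because the product carries the maximum norm.
  have hP : AntilipschitzWith 2 P := by
    refine AddMonoidHomClass.antilipschitz_of_bound P fun v => ?_
    have h1 := norm_formDomain_le v
    have h2 : ‖value m U v‖ ≤ ‖P v‖ := norm_fst_le (P v)
    have h3 : ‖gradient m U v‖ ≤ ‖P v‖ := norm_snd_le (P v)
    simp only [NNReal.coe_ofNat]
    linarith
  have hcl := hP.isClosed_range P.uniformContinuous
  have hmem : (hf.toLp f, hb.toLp b) ∈ closure (range P) := by
    refine Metric.mem_closure_range_iff.2 fun ε hε => ?_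
    obtain ⟨v, h1, h2⟩ := H (ε / 2) (half_pos hε)
    refine ⟨v, ?_⟩
    rw [dist_comm, Prod.dist_eq]
    refine max_lt (lt_of_le_of_lt ?_ (half_lt_self hε)) (lt_of_le_of_lt ?_ (half_lt_self hε))
    · rw [Lp.dist_def]
      refine ENNReal.toReal_le_of_le_ofReal (half_pos hε).le ((eLpNorm_congr_ae ?_).trans_le h1)
      filter_upwards [hf.coeFn_toLp] with x hx
      simp only [Pi.sub_apply, hx]
      rfl
    · rw [Lp.dist_def]
      refine ENNReal.toReal_le_of_le_ofReal (half_pos hε).le ((eLpNorm_congr_ae ?_).trans_le h2)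
      filter_upwards [hb.coeFn_toLp] with x hx
      simp only [Pi.sub_apply, hx]
      rfl
  rw [hcl.closure_eq] at hmem
  obtain ⟨v, hv⟩ := hmem
  have e1 : value m U v = hf.toLp f := congrArg Prod.fst hv
  have e2 : gradient m U v = hb.toLp b := congrArg Prod.snd hv
  exact ⟨v, e1 ▸ hf.coeFn_toLp, e2 ▸ hb.coeFn_toLp⟩

end Gradient

/-! ### Weak differentials -/

section EuclideanWeak

variable {E : Type*} [NormedAddCommGroup E] [InnerProductSpace ℝ E] [FiniteDimensional ℝ E]
  [MeasurableSpace E] [BorelSpace E]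

lemma exists_setLIntegral_enorm_le {K : Set E} (hK : IsCompact K) {F : Type*}
    [NormedAddCommGroup F] :
    ∃ C : ℝ≥0∞, C ≠ ⊤ ∧ ∀ g : E → F, AEStronglyMeasurable g (volume.restrict K) →
      ∫⁻ y in K, ‖g y‖ₑ ≤ C * eLpNorm g 2 (volume.restrict K) := by
  refine ⟨(volume.restrict K) univ ^ (1 / (1 : ℝ≥0∞).toReal - 1 / (2 : ℝ≥0∞).toReal), ?_,
    fun g hg => ?_⟩
  · refine ENNReal.rpow_ne_top_of_nonneg (by norm_num) ?_
    rw [Measure.restrict_apply_univ]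
    exact hK.measure_lt_top.ne
  · rw [← eLpNorm_one_eq_lintegral_enorm, mul_comm]
    exact eLpNorm_le_eLpNorm_mul_rpow_measure_univ (by norm_num) hg

/-- The constant function 1 is Lipschitz, hence weakly differentiable with derivative 0, and ρ = ρ ·
1. -/
lemma hasWeakPartial_contDiffOn {Ω : Set E} (hΩ : IsOpen Ω) {ρ : E → ℂ} (hρ : ContDiffOn ℝ ∞ ρ Ω)
    (v : E) : HasWeakPartial Ω v ρ (fun y => fderiv ℝ ρ y v) := by
  have h1 := hasWeakPartial_of_locallyLipschitzOn hΩ (f := fun _ : E => (1 : ℝ))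
    ((LocallyLipschitz.const 1).locallyLipschitzOn) v
  refine (h1.mul_smooth hΩ hρ).congr (Eventually.of_forall fun y => ?_)
    (Eventually.of_forall fun y => ?_)
  · simp
  · simp

lemma exists_pos_mul_ofReal_le {C : ℝ≥0∞} (hC : C ≠ ⊤) {ε : ℝ} (hε : 0 < ε) :
    ∃ η : ℝ, 0 < η ∧ C * ENNReal.ofReal η ≤ ENNReal.ofReal ε := by
  refine ⟨ε / (C.toReal + 1), by positivity, ?_⟩
  refine (mul_le_mul_left (ENNReal.ofReal_toReal hC).ge _).trans ?_
  rw [← ENNReal.ofReal_mul ENNReal.toReal_nonneg]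
  refine ENNReal.ofReal_le_ofReal ?_
  rw [mul_div_assoc', div_le_iff₀ (by positivity)]
  nlinarith [ENNReal.toReal_nonneg (a := C)]

end EuclideanWeak

/-! ### Weak differentials on the manifold and the gradient of the form domain -/

section WeakDifferential

variable {m : ℕ} {X : Type*} [EMetricSpace X] [ChartedSpace (EuclideanSpace ℝ (Fin m)) X]
  [RiemannianBundle (fun x : X => TangentSpace (𝓡 m) x)] [IsManifold (𝓡 m) ∞ X]
  [IsContMDiffRiemannianBundle (𝓡 m) ∞ (EuclideanSpace ℝ (Fin m))
    (fun x : X => TangentSpace (𝓡 m) x)]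
  [MeasurableSpace X] [BorelSpace X] [SecondCountableTopology X]

lemma memLp_comp_chart_symm {F : Type*} [NormedAddCommGroup F] {f : X → F}
    (hf : MemLp f 2 (riemannianMeasure m X)) (p : X)
    {K : Set (EuclideanSpace ℝ (Fin m))} (hK : IsCompact K) (hs : K ⊆ (chart m p).target) :
    MemLp (fun y => f ((chart m p).symm y)) 2 (volume.restrict K) := by
  obtain ⟨C, hC, h⟩ := exists_eLpNorm_chart_le (F := F) p hK hs
  refine ⟨(AEStronglyMeasurable.comp_chart_symm hf.1 p).mono_measure (Measure.restrict_mono_set _ hs),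
    (h f hf.1).trans_lt ?_⟩
  exact ENNReal.mul_lt_top hC.lt_top hf.2

lemma memLp_component {α : ∀ x : X, TangentSpace (𝓡 m) x →ₗ[ℝ] ℂ}
    (hα : MemLp (fun x => coords (α x)) 2 (riemannianMeasure m X)) (p : X)
    {K : Set (EuclideanSpace ℝ (Fin m))} (hK : IsCompact K) (hs : K ⊆ (chart m p).target)
    (i : Fin m) :
    MemLp (fun y => α ((chart m p).symm y) (coordField p y i)) 2 (volume.restrict K) := by
  obtain ⟨C, hC, h⟩ := exists_eLpNorm_component_le p hK hs i
  refine ⟨(aestronglyMeasurable_chart_of_coords hα.1 p i).mono_measure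
    (Measure.restrict_mono_set _ hs), (h α hα.1).trans_lt ?_⟩
  exact ENNReal.mul_lt_top hC.lt_top hα.2

lemma locallyIntegrableOn_of_memLp {Ω : Set (EuclideanSpace ℝ (Fin m))} (hΩ : IsOpen Ω)
    {h : EuclideanSpace ℝ (Fin m) → ℂ}
    (hh : ∀ K ⊆ Ω, IsCompact K → MemLp h 2 (volume.restrict K)) :
    LocallyIntegrableOn h Ω volume := by
  refine (locallyIntegrableOn_iff hΩ.isLocallyClosed).2 fun K hs hK => ?_
  have : IsFiniteMeasure (volume.restrict K) := ⟨by
    rw [Measure.restrict_apply_univ]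
    exact hK.measure_lt_top⟩
  exact (hh K hs hK).integrable (by norm_num)

lemma isWeakDifferential_iff {f : X → ℂ} {α : ∀ x : X, TangentSpace (𝓡 m) x →ₗ[ℝ] ℂ} :
    IsWeakDifferential f α ↔ ∀ (p : X) (i : Fin m), HasWeakPartial (chart m p).target
      (EuclideanSpace.single i 1) (fun y => f ((chart m p).symm y))
      (fun y => α ((chart m p).symm y) (coordField p y i)) := Iff.rfl

lemma isWeakDifferential_differential {φ : X → ℂ} (hφ : ContMDiff (𝓡 m) 𝓘(ℝ, ℂ) ∞ φ) :
    IsWeakDifferential φ (differential m φ) := fun p i => by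
  have h := hasWeakPartial_contDiffOn (chart m p).open_target
    (continuousOn_fderiv_comp_chart_symm hφ p 0).1 (EuclideanSpace.single i 1)
  exact h.congr (Eventually.of_forall fun y => rfl)
    (ae_restrict_of_forall_mem (chart m p).open_target.measurableSet fun y hy =>
      (differential_chart hφ p hy i).symm)

lemma eLpNorm_value_sub_le {U : Opens X} (v : FormDomain m U) (φ : TestFunction m U) :
    eLpNorm (fun x => value m U v x - φ.toFun x) 2 (riemannianMeasure m X) ≤
      ENNReal.ofReal ‖v - (φ : FormDomain m U)‖ := by
  refine le_trans (le_of_eq ?_) (ENNReal.ofReal_le_ofReal (norm_value_le (v - (φ : FormDomain m U))))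
  rw [Lp.norm_def, ENNReal.ofReal_toReal (Lp.memLp _).2.ne]
  refine eLpNorm_congr_ae ?_
  rw [map_sub, value_coe]
  filter_upwards [Lp.coeFn_sub (value m U v) (testValue U φ), testValue_ae φ] with x h1 h2
  rw [h1, Pi.sub_apply, h2]

lemma eLpNorm_gradient_sub_le {U : Opens X} (v : FormDomain m U) (φ : TestFunction m U) :
    eLpNorm (fun x => gradient m U v x - coords (differential m φ.toFun x)) 2
      (riemannianMeasure m X) ≤ ENNReal.ofReal ‖v - (φ : FormDomain m U)‖ := by
  refine le_trans (le_of_eq ?_) (ENNReal.ofReal_le_ofReal (norm_gradient_le (v - (φ : FormDomain m U))))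
  rw [Lp.norm_def, ENNReal.ofReal_toReal (Lp.memLp _).2.ne]
  refine eLpNorm_congr_ae ?_
  rw [map_sub, gradient_coe]
  filter_upwards [Lp.coeFn_sub (gradient m U v) (testGradient U φ), testGradient_ae φ] with x h1 h2
  rw [h1, Pi.sub_apply, h2]

lemma exists_testFunction_near {U : Opens X} (v : FormDomain m U) {ε : ℝ} (hε : 0 < ε) :
    ∃ φ : TestFunction m U, ‖v - (φ : FormDomain m U)‖ ≤ ε := by
  obtain ⟨φ, hφ⟩ := (UniformSpace.Completion.denseRange_coe (α := TestFunction m U)).exists_dist_lt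
    v hε
  exact ⟨φ, (dist_eq_norm v _ ▸ hφ).le⟩

/-- The gradient is the weak differential. -/
lemma isWeakDifferential_gradient {U : Opens X} (v : FormDomain m U) :
    IsWeakDifferential (value m U v) (fun x => ofCoords x (gradient m U v x)) := by
  refine isWeakDifferential_iff.2 fun p i => ?_
  have hv : MemLp (value m U v) 2 (riemannianMeasure m X) := Lp.memLp _
  have hg : MemLp (fun x => coords (ofCoords x (gradient m U v x))) 2 (riemannianMeasure m X) := by
    simp only [coords_ofCoords]
    exact Lp.memLp _
  have ho := (chart m p).open_target
  refine HasWeakPartial.of_approx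
    (locallyIntegrableOn_of_memLp ho fun K hs hK => memLp_comp_chart_symm hv p hK hs)
    (locallyIntegrableOn_of_memLp ho fun K hs hK => memLp_component hg p hK hs i) ?_
  intro K hs hK ε hε
  obtain ⟨C₁, hC₁, h₁⟩ := exists_setLIntegral_enorm_le (F := ℂ) hK
  obtain ⟨C₂, hC₂, h₂⟩ := exists_eLpNorm_chart_le (F := ℂ) p hK hs
  obtain ⟨C₃, hC₃, h₃⟩ := exists_eLpNorm_component_le p hK hs i
  -- The factor C₁ passes from L² to L¹ on K, and C₂ and C₃ pass from K to X for functions and for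
  -- chart components of covectors.
  obtain ⟨η, hη, hηε⟩ := exists_pos_mul_ofReal_le (C := C₁ * C₂ + C₁ * C₃)
    (ENNReal.add_ne_top.2 ⟨ENNReal.mul_ne_top hC₁ hC₂, ENNReal.mul_ne_top hC₁ hC₃⟩) hε
  obtain ⟨φ, hφ⟩ := exists_testFunction_near v hη
  refine ⟨_, _, _, hs, isWeakDifferential_differential φ.contMDiff p i, ?_, ?_⟩
  · have hm : AEStronglyMeasurable (fun x => value m U v x - φ.toFun x) (riemannianMeasure m X) :=
      hv.1.sub φ.contMDiff.continuous.aestronglyMeasurable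
    refine (h₁ _ ((AEStronglyMeasurable.comp_chart_symm hm p).mono_measure
      (Measure.restrict_mono_set _ hs))).trans ?_
    calc _ ≤ C₁ * (C₂ * ENNReal.ofReal η) :=
          mul_le_mul_right ((h₂ _ hm).trans (mul_le_mul_right ((eLpNorm_value_sub_le v φ).trans
            (ENNReal.ofReal_le_ofReal hφ)) _)) _
      _ ≤ (C₁ * C₂ + C₁ * C₃) * ENNReal.ofReal η := by
          rw [← mul_assoc]
          exact mul_le_mul_left le_self_add _
      _ ≤ _ := hηε
  · have e1 : ∀ x, coords (ofCoords x (gradient m U v x) - differential m φ.toFun x) =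
        gradient m U v x - coords (differential m φ.toFun x) := fun x => by
      rw [coords_sub, coords_ofCoords]
    have hm : AEStronglyMeasurable (fun x => coords (ofCoords x (gradient m U v x) -
        differential m φ.toFun x)) (riemannianMeasure m X) := by
      simp only [e1]
      exact (Lp.memLp (gradient m U v)).1.sub (aestronglyMeasurable_differential φ.contMDiff)
    have h4 := h₃ _ hm
    simp only [e1] at h4
    refine (h₁ _ ((aestronglyMeasurable_chart_of_coords hm p i).mono_measure
      (Measure.restrict_mono_set _ hs))).trans ?_
    calc _ ≤ C₁ * (C₃ * ENNReal.ofReal η) :=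
          mul_le_mul_right (h4.trans (mul_le_mul_right ((eLpNorm_gradient_sub_le v φ).trans
            (ENNReal.ofReal_le_ofReal hφ)) _)) _
      _ ≤ (C₁ * C₂ + C₁ * C₃) * ENNReal.ofReal η := by
          rw [← mul_assoc]
          exact mul_le_mul_left le_add_self _
      _ ≤ _ := hηε

lemma eq_of_coordField_eq (p : X) {y : EuclideanSpace ℝ (Fin m)} (hy : y ∈ (chart m p).target)
    {α β : TangentSpace (𝓡 m) ((chart m p).symm y) →ₗ[ℝ] ℂ}
    (h : ∀ i, α (coordField p y i) = β (coordField p y i)) : α = β := by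
  ext v
  obtain ⟨c, rfl⟩ := exists_coord p hy v
  simp only [map_sum, map_smul, h]

lemma IsWeakDifferential.unique {f f' : X → ℂ} {α β : ∀ x : X, TangentSpace (𝓡 m) x →ₗ[ℝ] ℂ}
    (h : IsWeakDifferential f α) (h' : IsWeakDifferential f' β)
    (hf : f =ᵐ[riemannianMeasure m X] f') :
    (fun x => coords (α x)) =ᵐ[riemannianMeasure m X] fun x => coords (β x) := by
  refine ae_iff_chart.2 fun p => ?_
  have h1 : ∀ i, ∀ᵐ y ∂(volume.restrict (chart m p).target),
      α ((chart m p).symm y) (coordField p y i) = β ((chart m p).symm y) (coordField p y i) :=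
    fun i => (HasWeakPartial.congr (h p i) (ae_iff_chart.1 hf p) (EventuallyEq.refl _ _)).unique
      (chart m p).open_target (h' p i)
  filter_upwards [ae_all_iff.2 h1, ae_restrict_mem (chart m p).open_target.measurableSet]
    with y hy hyt
  rw [eq_of_coordField_eq p hyt hy]

/-- The gradient is defined by completion; uniqueness of weak differentials identifies it with any
weak differential of a representative of the value. In particular the weak differential in the
definition of the H² norm is the gradient. -/
lemma gradient_ae_eq {U : Opens X} {v : FormDomain m U} {f : X → ℂ}
    {α : ∀ x : X, TangentSpace (𝓡 m) x →ₗ[ℝ] ℂ}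
    (hv : value m U v =ᵐ[riemannianMeasure m X] f) (h : IsWeakDifferential f α) :
    gradient m U v =ᵐ[riemannianMeasure m X] fun x => coords (α x) := by
  have := (isWeakDifferential_gradient v).unique h hv
  simpa only [coords_ofCoords] using this

/-- Closability of the gradient: if the value vanishes, the gradient is a weak differential of 0,
hence 0, and the energy norm vanishes. Thus elements of the completion are determined by their
functions. -/
lemma value_injective (U : Opens X) : Function.Injective (value m U) := by
  refine (injective_iff_map_eq_zero _).2 fun v hv => ?_
  have h1 : value m U v =ᵐ[riemannianMeasure m X] (fun _ => 0 : X → ℂ) := by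
    rw [hv]
    exact Lp.coeFn_zero _ _ _
  have h2 : IsWeakDifferential (fun _ : X => (0 : ℂ)) (differential m (fun _ : X => (0 : ℂ))) :=
    isWeakDifferential_differential contMDiff_const
  have h3 : ∀ x : X, differential m (fun _ : X => (0 : ℂ)) x = 0 := fun x =>
    TestFunction.differential_eq_zero (0 : TestFunction m U) (x := x) (by
      change x ∉ tsupport (0 : X → ℂ)
      simp [tsupport])
  have h4 : gradient m U v = 0 := by
    refine Lp.ext ((gradient_ae_eq h1 h2).trans ?_)
    refine EventuallyEq.trans ?_ (Lp.coeFn_zero _ _ _).symm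
    exact Eventually.of_forall fun x => by simp [h3]
  have h5 := norm_formDomain_le v
  rw [hv, h4, norm_zero, norm_zero, add_zero] at h5
  exact norm_le_zero_iff.1 h5

lemma IsWeakDifferential.mul_smooth {f : X → ℂ} {α : ∀ x : X, TangentSpace (𝓡 m) x →ₗ[ℝ] ℂ}
    (h : IsWeakDifferential f α) {ρ : X → ℂ} (hρ : ContMDiff (𝓡 m) 𝓘(ℝ, ℂ) ∞ ρ) :
    IsWeakDifferential (fun x => ρ x * f x) (fun x => ρ x • α x + f x • differential m ρ x) := by
  refine isWeakDifferential_iff.2 fun p i => ?_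
  have h1 := (isWeakDifferential_iff.1 h p i).mul_smooth (chart m p).open_target
    (continuousOn_fderiv_comp_chart_symm hρ p 0).1
  refine h1.congr (Eventually.of_forall fun y => rfl)
    (ae_restrict_of_forall_mem (chart m p).open_target.measurableSet fun y hy => ?_)
  simp only [LinearMap.add_apply, LinearMap.smul_apply, smul_eq_mul]
  rw [differential_chart hρ p hy i, mul_comm (f _)]
  rfl

lemma exists_eLpNorm_coords_le (p : X) {K : Set (EuclideanSpace ℝ (Fin m))} (hK : IsCompact K)
    (hs : K ⊆ (chart m p).target) :
    ∃ C : ℝ≥0∞, C ≠ ⊤ ∧ ∀ α : ∀ x : X, TangentSpace (𝓡 m) x →ₗ[ℝ] ℂ,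
      AEStronglyMeasurable (fun x => coords (α x)) (riemannianMeasure m X) →
      (∀ x ∉ (chart m p).symm '' K, α x = 0) →
      eLpNorm (fun x => coords (α x)) 2 (riemannianMeasure m X) ≤ C * ∑ i,
        eLpNorm (fun y => α ((chart m p).symm y) (coordField p y i)) 2 (volume.restrict K) := by
  obtain ⟨C, hC, h⟩ := exists_eLpNorm_le_chart (F := EuclideanSpace ℂ (Fin m)) p hK hs
  obtain ⟨c, hc0, hc⟩ := exists_norm_coords_le p hK hs
  refine ⟨C * ENNReal.ofReal c, ENNReal.mul_ne_top hC ENNReal.ofReal_ne_top, fun α hα h0 => ?_⟩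
  refine (h _ hα fun x hx => by rw [h0 x hx, coords_zero]).trans ?_
  rw [mul_assoc]
  refine mul_le_mul_right ?_ _
  have hm : ∀ i, AEStronglyMeasurable (fun y => ‖α ((chart m p).symm y) (coordField p y i)‖)
      (volume.restrict K) := fun i => ((aestronglyMeasurable_chart_of_coords hα p i).mono_measure
        (Measure.restrict_mono_set _ hs)).norm
  have h1 : ∀ᵐ y ∂(volume.restrict K), ‖coords (α ((chart m p).symm y))‖ ≤
      c * ‖∑ i, ‖α ((chart m p).symm y) (coordField p y i)‖‖ := by
    refine ae_restrict_of_forall_mem hK.measurableSet fun y hy => (hc y hy _).trans_eq ?_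
    rw [Real.norm_of_nonneg (Finset.sum_nonneg fun i _ => norm_nonneg _)]
  refine (eLpNorm_le_mul_eLpNorm_of_ae_le_mul h1 2).trans (mul_le_mul_right ?_ _)
  have h2 := eLpNorm_sum_le (s := Finset.univ) (p := 2) (fun i _ => hm i) (by norm_num)
  simp only [eLpNorm_norm] at h2
  refine le_trans (le_of_eq ?_) h2
  congr 1
  ext y
  simp

end WeakDifferential

/-! ### Weakly differentiable functions with compact support -/

lemma Lp_coeFn_finset_sum {S ι F : Type*} [MeasurableSpace S] {μ : Measure S}
    [NormedAddCommGroup F] {p : ℝ≥0∞} (s : Finset ι) (f : ι → Lp F p μ) :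
    (∑ i ∈ s, f i : Lp F p μ) =ᵐ[μ] fun x => ∑ i ∈ s, f i x := by
  classical
  induction s using Finset.induction_on with
  | empty =>
    simp only [Finset.sum_empty]
    exact Lp.coeFn_zero F p μ
  | insert i s hi ih =>
    rw [Finset.sum_insert hi]
    filter_upwards [Lp.coeFn_add (f i) (∑ i ∈ s, f i), ih] with x h1 h2
    rw [h1, Pi.add_apply, h2, Finset.sum_insert hi]

section CompactSupport

variable {m : ℕ} {X : Type*} [EMetricSpace X] [ChartedSpace (EuclideanSpace ℝ (Fin m)) X]
  [RiemannianBundle (fun x : X => TangentSpace (𝓡 m) x)] [IsManifold (𝓡 m) ∞ X]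
  [IsContMDiffRiemannianBundle (𝓡 m) ∞ (EuclideanSpace ℝ (Fin m))
    (fun x : X => TangentSpace (𝓡 m) x)]
  [MeasurableSpace X] [BorelSpace X] [SecondCountableTopology X]

/-- The image of the compact set K is closed in X, so extension by zero off the chart domain is
smooth. -/
lemma exists_testFunction_of_chart (p : X) {U : Opens X} {φ : EuclideanSpace ℝ (Fin m) → ℂ}
    (hφ : ContDiff ℝ ∞ φ) {K : Set (EuclideanSpace ℝ (Fin m))} (hK : IsCompact K)
    (hs : K ⊆ (chart m p).target) (hU : (chart m p).symm '' K ⊆ U) (hφK : tsupport φ ⊆ K) :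
    ∃ ψ : TestFunction m U, (∀ y ∈ (chart m p).target, ψ.toFun ((chart m p).symm y) = φ y) ∧
      ∀ x ∉ (chart m p).symm '' K, ψ.toFun x = 0 ∧ differential m ψ.toFun x = 0 := by
  classical
  let g : X → ℂ := indicator (chart m p).source (φ ∘ chart m p)
  have hL : IsCompact ((chart m p).symm '' K) := hK.image_of_continuousOn
    ((chart m p).continuousOn_symm.mono hs)
  have hLs : (chart m p).symm '' K ⊆ (chart m p).source := by
    rintro _ ⟨y, hy, rfl⟩
    exact (chart m p).map_target (hs hy)
  have h0 : ∀ x ∉ (chart m p).symm '' K, g x = 0 := by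
    intro x hx
    by_cases hxs : x ∈ (chart m p).source
    · rw [show g x = φ (chart m p x) from indicator_of_mem hxs _]
      refine image_eq_zero_of_notMem_tsupport fun h => hx ⟨_, hφK h, (chart m p).left_inv hxs⟩
    · exact indicator_of_notMem hxs _
  have hg : ContMDiff (𝓡 m) 𝓘(ℝ, ℂ) ∞ g := by
    intro x
    by_cases hx : x ∈ (chart m p).source
    · have h1 : ContMDiffOn (𝓡 m) (𝓡 m) ∞ (chart m p) (chart m p).source := contMDiffOn_chart
      have h2 : ContMDiffAt (𝓡 m) 𝓘(ℝ, ℂ) ∞ (φ ∘ chart m p) x :=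
        hφ.contMDiff.contMDiffAt.comp x (h1.contMDiffAt ((chart m p).open_source.mem_nhds hx))
      refine h2.congr_of_eventuallyEq ?_
      filter_upwards [(chart m p).open_source.mem_nhds hx] with z hz
      exact indicator_of_mem hz _
    · refine (contMDiffAt_const (c := (0 : ℂ))).congr_of_eventuallyEq ?_
      filter_upwards [hL.isClosed.isOpen_compl.mem_nhds fun h => hx (hLs h)] with z hz
      exact h0 z hz
  have ht : tsupport g ⊆ (chart m p).symm '' K :=
    closure_minimal (fun x hx => by_contra fun h => hx (h0 x h)) hL.isClosed
  let ψ : TestFunction m U := ⟨g, hg, hL.of_isClosed_subset (isClosed_tsupport _) ht, ht.trans hU⟩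
  refine ⟨ψ, fun y hy => ?_, fun x hx => ⟨h0 x hx, ψ.differential_eq_zero fun h => hx (ht h)⟩⟩
  change g _ = _
  rw [show g ((chart m p).symm y) = φ (chart m p ((chart m p).symm y)) from
    indicator_of_mem ((chart m p).map_target hy) _, (chart m p).right_inv hy]

/-- Read in the chart and extended by zero, f is weakly differentiable on Euclidean space; its
mollifications, carried back to X, are test functions on U that converge together with their
differentials. On a compact set the norms in the chart and on X are comparable. -/
lemma exists_formDomain_of_chart (p : X) {U : Opens X} {K : Set X} (hK : IsCompact K)
    (hp : K ⊆ (chart m p).source) (hU : K ⊆ U) {f : X → ℂ}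
    {α : ∀ x : X, TangentSpace (𝓡 m) x →ₗ[ℝ] ℂ} (h : IsWeakDifferential f α)
    (hf : MemLp f 2 (riemannianMeasure m X))
    (hα : MemLp (fun x => coords (α x)) 2 (riemannianMeasure m X))
    (hf0 : ∀ x ∉ K, f x = 0) (hα0 : ∀ x ∉ K, α x = 0) :
    ∃ v : FormDomain m U, value m U v =ᵐ[riemannianMeasure m X] f := by
  have ho := (chart m p).open_target
  let Kc := chart m p '' K
  have hKc : IsCompact Kc := hK.image_of_continuousOn ((chart m p).continuousOn.mono hp)
  have hΩ : IsOpen ((chart m p).target ∩ (chart m p).symm ⁻¹' (U : Set X)) :=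
    (chart m p).isOpen_inter_preimage_symm U.isOpen
  have hKΩ : Kc ⊆ (chart m p).target ∩ (chart m p).symm ⁻¹' (U : Set X) := by
    rintro _ ⟨x, hx, rfl⟩
    refine ⟨(chart m p).map_source (hp hx), ?_⟩
    rw [mem_preimage, (chart m p).left_inv (hp hx)]
    exact hU hx
  have hKt : Kc ⊆ (chart m p).target := hKΩ.trans inter_subset_left
  -- The mollified functions have slightly larger support than f; L leaves room for it inside the
  -- part of the chart lying in U.
  obtain ⟨L, hL, hKL, hLΩ⟩ := exists_compact_between hKc hΩ hKΩ
  have hLt : L ⊆ (chart m p).target := hLΩ.trans inter_subset_left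
  have hLU : (chart m p).symm '' L ⊆ U := by
    rintro _ ⟨y, hy, rfl⟩
    exact (hLΩ hy).2
  have hnot : ∀ y ∈ (chart m p).target, y ∉ Kc → (chart m p).symm y ∉ K := fun y hy hyK hx =>
    hyK ⟨_, hx, (chart m p).right_inv hy⟩
  have hnotL : ∀ x ∉ (chart m p).symm '' L, x ∉ K := fun x hx hxK =>
    hx ⟨chart m p x, interior_subset (hKL ⟨x, hxK, rfl⟩), (chart m p).left_inv (hp hxK)⟩
  -- The inverse chart takes arbitrary values outside its target; the indicator makes the extension
  -- zero there and changes nothing inside.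
  let h' : EuclideanSpace ℝ (Fin m) → ℂ := indicator Kc fun y => f ((chart m p).symm y)
  let k' : Fin m → EuclideanSpace ℝ (Fin m) → ℂ := fun i =>
    indicator Kc fun y => α ((chart m p).symm y) (coordField p y i)
  have e1 : ∀ y ∈ (chart m p).target, f ((chart m p).symm y) = h' y := by
    intro y hy
    by_cases hyK : y ∈ Kc
    · exact (indicator_of_mem hyK (fun y => f ((chart m p).symm y))).symm
    · rw [hf0 _ (hnot y hy hyK)]
      exact (indicator_of_notMem hyK _).symm
  have e2 : ∀ i, ∀ y ∈ (chart m p).target,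
      α ((chart m p).symm y) (coordField p y i) = k' i y := by
    intro i y hy
    by_cases hyK : y ∈ Kc
    · exact (indicator_of_mem hyK (fun y => α ((chart m p).symm y) (coordField p y i))).symm
    · rw [hα0 _ (hnot y hy hyK), LinearMap.zero_apply]
      exact (indicator_of_notMem hyK _).symm
  have hw : ∀ i, HasWeakPartial univ (EuclideanSpace.single i 1) h' (k' i) := fun i =>
    HasWeakPartial.univ_of_compact ho hKc hKt
      ((isWeakDifferential_iff.1 h p i).congr (ae_restrict_of_forall_mem ho.measurableSet e1)
        (ae_restrict_of_forall_mem ho.measurableSet (e2 i)))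
      (fun y hy => indicator_of_notMem hy _) (fun y hy => indicator_of_notMem hy _)
  have hh : MemLp h' 2 volume :=
    (memLp_indicator_iff_restrict hKc.measurableSet).2 (memLp_comp_chart_symm hf p hKc hKt)
  have hk : ∀ i, MemLp (k' i) 2 volume := fun i =>
    (memLp_indicator_iff_restrict hKc.measurableSet).2 (memLp_component hα p hKc hKt i)
  obtain ⟨C₁, hC₁, h₁⟩ := exists_eLpNorm_le_chart (F := ℂ) p hL hLt
  obtain ⟨C₂, hC₂, h₂⟩ := exists_eLpNorm_coords_le p hL hLt
  obtain ⟨v, hv, -⟩ := exists_formDomain_of_approx (U := U) hf hα fun ε hε => by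
    obtain ⟨η, hη, hηε⟩ := exists_pos_mul_ofReal_le (C := C₁ + C₂ * m)
      (ENNReal.add_ne_top.2 ⟨hC₁, ENNReal.mul_ne_top hC₂ (ENNReal.natCast_ne_top m)⟩) hε
    obtain ⟨φ, hφ, hφL, hφ1, hφ2⟩ := exists_smooth_approx
      (fun i : Fin m => (EuclideanSpace.single i (1 : ℝ) : EuclideanSpace ℝ (Fin m))) hw hh hk hKc
      hKL (fun y hy => indicator_of_notMem hy _) hη
    obtain ⟨ψ, hψ1, hψ2⟩ := exists_testFunction_of_chart p hφ hL hLt hLU hφL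
    refine ⟨ψ, ?_, ?_⟩
    · have hm : AEStronglyMeasurable (fun x => ψ.toFun x - f x) (riemannianMeasure m X) :=
        ψ.contMDiff.continuous.aestronglyMeasurable.sub hf.1
      calc _ = eLpNorm (fun x => ψ.toFun x - f x) 2 (riemannianMeasure m X) := by
            refine eLpNorm_congr_ae ?_
            rw [value_coe]
            filter_upwards [testValue_ae ψ] with x hx
            rw [hx]
        _ ≤ C₁ * eLpNorm (fun y => ψ.toFun ((chart m p).symm y) - f ((chart m p).symm y)) 2
            (volume.restrict L) := h₁ _ hm fun x hx => by
              rw [(hψ2 x hx).1, hf0 x (hnotL x hx), sub_zero]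
        _ = C₁ * eLpNorm (φ - h') 2 (volume.restrict L) := by
            congr 1
            refine eLpNorm_congr_ae (ae_restrict_of_forall_mem hL.measurableSet fun y hy => ?_)
            simp only [Pi.sub_apply]
            rw [hψ1 y (hLt hy), e1 y (hLt hy)]
        _ ≤ C₁ * ENNReal.ofReal η := mul_le_mul_right
            ((eLpNorm_mono_measure _ Measure.restrict_le_self).trans hφ1) _
        _ ≤ (C₁ + C₂ * m) * ENNReal.ofReal η := mul_le_mul_left le_self_add _
        _ ≤ _ := hηε
    · have em : ∀ x, coords (differential m ψ.toFun x - α x) =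
          coords (differential m ψ.toFun x) - coords (α x) := fun x => coords_sub _ _
      have hm : AEStronglyMeasurable (fun x => coords (differential m ψ.toFun x - α x))
          (riemannianMeasure m X) := by
        simp only [em]
        exact (aestronglyMeasurable_differential ψ.contMDiff).sub hα.1
      have hfd : ∀ y ∈ (chart m p).target, ∀ i, differential m ψ.toFun ((chart m p).symm y)
          (coordField p y i) = fderiv ℝ φ y (EuclideanSpace.single i 1) := by
        intro y hy i
        rw [differential_chart ψ.contMDiff p hy i]
        have : ψ.toFun ∘ (chart m p).symm =ᶠ[𝓝 y] φ := by
          filter_upwards [ho.mem_nhds hy] with z hz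
          exact hψ1 z hz
        rw [this.fderiv_eq]
      calc _ = eLpNorm (fun x => coords (differential m ψ.toFun x - α x)) 2
            (riemannianMeasure m X) := by
            refine eLpNorm_congr_ae ?_
            rw [gradient_coe]
            filter_upwards [testGradient_ae ψ] with x hx
            rw [hx, em]
        _ ≤ C₂ * ∑ i, eLpNorm (fun y => (differential m ψ.toFun ((chart m p).symm y) -
              α ((chart m p).symm y)) (coordField p y i)) 2 (volume.restrict L) :=
            h₂ (fun x => differential m ψ.toFun x - α x) hm fun x hx => by
              rw [(hψ2 x hx).2, hα0 x (hnotL x hx), sub_zero]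
        _ ≤ C₂ * ∑ _i : Fin m, ENNReal.ofReal η := by
            refine mul_le_mul_right (Finset.sum_le_sum fun i _ => ?_) _
            refine le_trans (le_of_eq ?_)
              ((eLpNorm_mono_measure _ (Measure.restrict_le_self (s := L))).trans (hφ2 i))
            refine eLpNorm_congr_ae (ae_restrict_of_forall_mem hL.measurableSet fun y hy => ?_)
            simp only [LinearMap.sub_apply, Pi.sub_apply]
            rw [hfd y (hLt hy), e2 i y (hLt hy)]
        _ = C₂ * m * ENNReal.ofReal η := by
            rw [Finset.sum_const, Finset.card_univ, Fintype.card_fin, nsmul_eq_mul, mul_assoc]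
        _ ≤ (C₁ + C₂ * m) * ENNReal.ofReal η := mul_le_mul_left le_add_self _
        _ ≤ _ := hηε
  exact ⟨v, hv⟩

/-- A square integrable function with compact support in `U` and square integrable weak
differential belongs to `H^1_0(U)`. -/
lemma exists_formDomain_of_compact {U : Opens X} {K : Set X} (hK : IsCompact K)
    (hU : K ⊆ U) {f : X → ℂ} {α : ∀ x : X, TangentSpace (𝓡 m) x →ₗ[ℝ] ℂ}
    (h : IsWeakDifferential f α) (hf : MemLp f 2 (riemannianMeasure m X))
    (hα : MemLp (fun x => coords (α x)) 2 (riemannianMeasure m X))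
    (hf0 : ∀ x ∉ K, f x = 0) (hα0 : ∀ x ∉ K, α x = 0) :
    ∃ v : FormDomain m U, value m U v =ᵐ[riemannianMeasure m X] f ∧
      gradient m U v =ᵐ[riemannianMeasure m X] fun x => coords (α x) := by
  classical
  -- By uniqueness of the weak differential only the value has to be found.
  suffices ∃ v : FormDomain m U, value m U v =ᵐ[riemannianMeasure m X] f by
    obtain ⟨v, hv⟩ := this
    exact ⟨v, hv, gradient_ae_eq hv h⟩
  have := ChartedSpace.locallyCompactSpace (EuclideanSpace ℝ (Fin m)) X
  -- A partition of unity on K subordinate to the charts: only finitely many of its functions meet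
  -- K, and f is the finite sum of the products ρ p · f, each supported in one chart.
  obtain ⟨ρ, hρ⟩ := SmoothPartitionOfUnity.exists_isSubordinate (𝓡 m) (hK.isClosed)
    (fun p : X => (chart m p).source) (fun p => (chart m p).open_source)
    (fun x _ => mem_iUnion.2 ⟨x, mem_chart_source _ x⟩)
  have hfin := ρ.locallyFinite.finite_nonempty_inter_compact hK
  let r : X → X → ℂ := fun p x => (ρ p x : ℂ)
  have hr : ∀ p, ContMDiff (𝓡 m) 𝓘(ℝ, ℂ) ∞ (r p) := fun p =>
    (Complex.ofRealCLM.contDiff.contMDiff (n := ∞)).comp (ρ p).contMDiff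
  have hts : ∀ p, tsupport (r p) ⊆ tsupport (ρ p) := fun p => closure_mono fun x hx h =>
    hx (by simp [r, h])
  have hd0 : ∀ p, ∀ x ∉ tsupport (r p), differential m (r p) x = 0 := by
    intro p x hx
    have h1 : r p =ᶠ[𝓝 x] fun _ => (0 : ℂ) := notMem_tsupport_iff_eventuallyEq.1 hx
    have h2 := h1.mfderiv_eq (I := 𝓡 m) (I' := 𝓘(ℝ, ℂ))
    rw [mfderiv_const] at h2
    ext v
    exact DFunLike.congr_fun (F := TangentSpace (𝓡 m) x →L[ℝ] ℂ) h2 v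
  have hex : ∀ p, ∃ v : FormDomain m U,
      value m U v =ᵐ[riemannianMeasure m X] fun x => r p x * f x := by
    intro p
    have hKp : IsCompact (K ∩ tsupport (r p)) := hK.inter_right (isClosed_tsupport _)
    obtain ⟨c, hc⟩ := hK.exists_bound_of_continuousOn
      (continuous_norm_differential (hr p)).continuousOn
    have hr1 : ∀ x, ‖r p x‖ ≤ 1 := fun x => by
      simp only [r, Complex.norm_real, Real.norm_of_nonneg (ρ.nonneg p x)]
      exact ρ.le_one p x
    refine exists_formDomain_of_chart p hKp
      (inter_subset_right.trans ((hts p).trans (hρ p))) (inter_subset_left.trans hU)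
      (h.mul_smooth (hr p)) ?_ ?_ ?_ ?_
    · refine hf.of_le ((hr p).continuous.aestronglyMeasurable.mul hf.1)
        (Eventually.of_forall fun x => ?_)
      rw [norm_mul]
      exact mul_le_of_le_one_left (norm_nonneg _) (hr1 x)
    · have e : ∀ x, coords (r p x • α x + f x • differential m (r p) x) =
          r p x • coords (α x) + f x • coords (differential m (r p) x) := fun x => by
        rw [coords_add, coords_smul, coords_smul]
      simp only [e]
      refine MemLp.add ?_ ?_
      · refine hα.of_le ((hr p).continuous.aestronglyMeasurable.smul hα.1)
          (Eventually.of_forall fun x => ?_)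
        rw [norm_smul]
        exact mul_le_of_le_one_left (norm_nonneg _) (hr1 x)
      · refine (hf.norm.const_mul c).of_le
          (hf.1.smul (aestronglyMeasurable_differential (hr p))) (Eventually.of_forall fun x => ?_)
        rw [norm_smul]
        by_cases hx : x ∈ K
        · have h1 := hc x hx
          rw [norm_norm] at h1
          refine le_trans ?_ (le_abs_self _)
          rw [mul_comm]
          gcongr
        · rw [hf0 x hx]
          simp
    · intro x hx
      by_cases hxK : x ∈ K
      · rw [image_eq_zero_of_notMem_tsupport fun h => hx ⟨hxK, h⟩, zero_mul]
      · rw [hf0 x hxK, mul_zero]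
    · intro x hx
      by_cases hxK : x ∈ K
      · have hxt : x ∉ tsupport (r p) := fun h => hx ⟨hxK, h⟩
        rw [image_eq_zero_of_notMem_tsupport hxt, hd0 p x hxt, zero_smul, smul_zero, add_zero]
      · rw [hf0 x hxK, hα0 x hxK, zero_smul, smul_zero, add_zero]
  choose v hv using hex
  refine ⟨∑ p ∈ hfin.toFinset, v p, ?_⟩
  rw [map_sum]
  have h1 := Lp_coeFn_finset_sum hfin.toFinset fun p => value m U (v p)
  have h2 : ∀ᵐ x ∂(riemannianMeasure m X), ∀ p ∈ hfin.toFinset,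
      value m U (v p) x = r p x * f x :=
    (ae_ball_iff hfin.toFinset.countable_toSet).2 fun p _ => hv p
  filter_upwards [h1, h2] with x hx1 hx2
  rw [hx1, Finset.sum_congr rfl hx2, ← Finset.sum_mul]
  by_cases hxK : x ∈ K
  · have h3 : ∑ p ∈ hfin.toFinset, ρ p x = 1 := by
      rw [← ρ.sum_eq_one hxK]
      refine (finsum_eq_sum_of_support_subset _ fun p hp => ?_).symm
      simp only [Finite.coe_toFinset, mem_ofPred_eq]
      exact ⟨x, hp, hxK⟩
    have h4 : ∑ p ∈ hfin.toFinset, r p x = 1 := by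
      simp only [r, ← Complex.ofReal_sum, h3, Complex.ofReal_one]
    rw [h4, one_mul]
  · rw [hf0 x hxK, mul_zero]

end CompactSupport

/-! ### Multiplication by Lipschitz functions -/

section Lipschitz

variable {m : ℕ} {X : Type*} [EMetricSpace X] [ChartedSpace (EuclideanSpace ℝ (Fin m)) X]
  [RiemannianBundle (fun x : X => TangentSpace (𝓡 m) x)] [IsManifold (𝓡 m) ∞ X]
  [IsContMDiffRiemannianBundle (𝓡 m) ∞ (EuclideanSpace ℝ (Fin m))
    (fun x : X => TangentSpace (𝓡 m) x)]
  [MeasurableSpace X] [BorelSpace X] [SecondCountableTopology X]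

/-- The differential of a real function, as a complex covector. -/
def realDifferential (m : ℕ) {X : Type*} [EMetricSpace X]
    [ChartedSpace (EuclideanSpace ℝ (Fin m)) X] (χ : X → ℝ) (x : X) :
    TangentSpace (𝓡 m) x →ₗ[ℝ] ℂ :=
  Complex.ofRealCLM.toLinearMap ∘ₗ differential m χ x

lemma realDifferential_apply (χ : X → ℝ) (x : X) (v : TangentSpace (𝓡 m) x) :
    realDifferential m χ x v = (differential m χ x v : ℂ) := rfl

lemma covectorNormSq_differential (χ : X → ℝ) (x : X) :
    covectorNormSq (differential m χ x) = ‖coords (realDifferential m χ x)‖ ^ 2 := by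
  rw [← covectorNormSq_eq, covectorNormSq, covectorNormSq]
  simp [realDifferential_apply]

/-- No differentiability is needed: where χ is not differentiable, neither is its chart
representation, and both derivatives have the default value 0. Hence the differential of any
function is measurable, as the Euclidean derivative is. -/
lemma differential_chart_real (χ : X → ℝ) (p : X) {y : EuclideanSpace ℝ (Fin m)}
    (hy : y ∈ (chart m p).target) (i : Fin m) :
    differential m χ ((chart m p).symm y) (coordField p y i) =
      fderiv ℝ (χ ∘ (chart m p).symm) y (EuclideanSpace.single i 1) := by
  by_cases h : MDifferentiableAt (𝓡 m) 𝓘(ℝ, ℝ) χ ((chart m p).symm y)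
  · exact differential_coordField p hy h i
  · have h1 : ¬ DifferentiableAt ℝ (χ ∘ (chart m p).symm) y := by
      intro hd
      refine h ?_
      have h2 := (mdifferentiable_chart (I := 𝓡 m) p).mdifferentiableAt
        ((chart m p).map_target hy)
      have h3 : MDifferentiableAt (𝓡 m) 𝓘(ℝ, ℝ) (χ ∘ (chart m p).symm)
          (chart m p ((chart m p).symm y)) := by
        rw [(chart m p).right_inv hy]
        exact hd.mdifferentiableAt
      refine (h3.comp _ h2).congr_of_eventuallyEq ?_
      filter_upwards [(chart m p).open_source.mem_nhds ((chart m p).map_target hy)] with z hz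
      simp only [Function.comp, (chart m p).left_inv hz]
    rw [fderiv_zero_of_not_differentiableAt h1, differential, mfderiv_zero_of_not_mdifferentiableAt h]
    rfl

lemma aestronglyMeasurable_realDifferential (χ : X → ℝ) :
    AEStronglyMeasurable (fun x => coords (realDifferential m χ x)) (riemannianMeasure m X) := by
  classical
  refine aestronglyMeasurable_coords fun p i => ?_
  have ho := (chart m p).open_target
  have h1 : Measurable (fun y => fderiv ℝ (χ ∘ (chart m p).symm) y (EuclideanSpace.single i 1)) :=
    measurable_fderiv_apply_const ℝ _ _
  refine (Complex.measurable_ofReal.comp h1).aestronglyMeasurable.congr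
    (ae_restrict_of_forall_mem ho.measurableSet fun y hy => ?_)
  simp only [Function.comp_apply]
  rw [realDifferential_apply, differential_chart_real χ p hy i]

lemma differential_real_eq_zero {χ : X → ℝ} {x : X} {c : ℝ} (h : χ =ᶠ[𝓝 x] fun _ => c) :
    differential m χ x = 0 := by
  have h2 := h.mfderiv_eq (I := 𝓡 m) (I' := 𝓘(ℝ, ℝ))
  rw [mfderiv_const] at h2
  ext v
  exact DFunLike.congr_fun (F := TangentSpace (𝓡 m) x →L[ℝ] ℝ) h2 v

lemma realDifferential_eq_zero {χ : X → ℝ} {x : X} {c : ℝ} (h : χ =ᶠ[𝓝 x] fun _ => c) :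
    realDifferential m χ x = 0 := by
  rw [realDifferential, differential_real_eq_zero h, LinearMap.comp_zero]

variable [IsRiemannianManifold (𝓡 m) X]

lemma abs_differential_le {χ : X → ℝ} {K : NNReal} (hχ : LipschitzWith K χ) (p : X)
    {y : EuclideanSpace ℝ (Fin m)} (hy : y ∈ (chart m p).target)
    (v : TangentSpace (𝓡 m) ((chart m p).symm y)) :
    |differential m χ ((chart m p).symm y) v| ≤ K * ‖v‖ := by
  by_cases h : MDifferentiableAt (𝓡 m) 𝓘(ℝ, ℝ) χ ((chart m p).symm y)
  · have h1 := (mdifferentiable_chart (I := 𝓡 m) p).mdifferentiableAt_symm hy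
    have h2 := h.comp y h1
    obtain ⟨w, rfl⟩ := (mdifferentiable_chart (I := 𝓡 m) p).symm.mfderiv_surjective hy v
    have h3 := abs_fderiv_comp_chart_symm_le hχ p hy h2.differentiableAt w
    have h4 := (h.hasMFDerivAt.comp y h1.hasMFDerivAt).mfderiv
    rw [mfderiv_eq_fderiv] at h4
    rw [h4] at h3
    exact h3
  · rw [differential, mfderiv_zero_of_not_mdifferentiableAt h]
    change |(0 : ℝ)| ≤ _
    rw [abs_zero]
    positivity

/-- The Lipschitz bound is evaluated at the gradient vector v of χ, for which dχ(v) = |v|² = |dχ|²,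
so that |dχ|² ≤ K |dχ|. -/
lemma norm_coords_realDifferential_le {χ : X → ℝ} {K : NNReal} (hχ : LipschitzWith K χ) (x : X) :
    ‖coords (realDifferential m χ x)‖ ≤ K := by
  have key : ∀ v : TangentSpace (𝓡 m) x, |differential m χ x v| ≤ K * ‖v‖ := by
    have : ∀ (p z : X), z ∈ (chart m p).source → ∀ v : TangentSpace (𝓡 m) z,
        |differential m χ z v| ≤ K * ‖v‖ := by
      intro p z hz
      obtain ⟨y, hy, rfl⟩ : ∃ y ∈ (chart m p).target, (chart m p).symm y = z :=
        ⟨_, (chart m p).map_source hz, (chart m p).left_inv hz⟩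
      exact abs_differential_le hχ p hy
    exact this x x (mem_chart_source _ x)
  let v : TangentSpace (𝓡 m) x := ∑ i, differential m χ x (frame m x i) • frame m x i
  have h1 : ‖coords (realDifferential m χ x)‖ ^ 2 = ∑ i, differential m χ x (frame m x i) ^ 2 := by
    rw [norm_coords_sq]
    simp [realDifferential_apply]
  have h2 : ‖v‖ ^ 2 = ∑ i, differential m χ x (frame m x i) ^ 2 := by
    rw [← (frame m x).sum_sq_norm_inner_right v]
    refine Finset.sum_congr rfl fun i _ => ?_
    have : (inner ℝ (frame m x i) v : ℝ) = differential m χ x (frame m x i) := by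
      simp only [v, inner_sum, real_inner_smul_right,
        orthonormal_iff_ite.1 (frame m x).orthonormal]
      simp
    rw [this, Real.norm_eq_abs, sq_abs]
  have h3 : differential m χ x v = ∑ i, differential m χ x (frame m x i) ^ 2 := by
    simp only [v, map_sum, map_smul, smul_eq_mul, sq]
  have h4 := key v
  have h5 : ‖v‖ = ‖coords (realDifferential m χ x)‖ := by
    rw [← abs_of_nonneg (norm_nonneg v), ← abs_of_nonneg (norm_nonneg (coords _))]
    exact (sq_eq_sq_iff_abs_eq_abs _ _).1 (h2.trans h1.symm)
  rw [h3, ← h1, h5, abs_of_nonneg (sq_nonneg _), sq] at h4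
  rcases (norm_nonneg (coords (realDifferential m χ x))).eq_or_lt with h | h
  · rw [← h]
    exact K.2
  · exact le_of_mul_le_mul_right h4 h

lemma isWeakDifferential_lipschitz_mul {χ : X → ℝ} {K : NNReal} (hχ : LipschitzWith K χ)
    {φ : X → ℂ} (hφ : ContMDiff (𝓡 m) 𝓘(ℝ, ℂ) ∞ φ) :
    IsWeakDifferential (fun x => (χ x : ℂ) * φ x)
      (fun x => (χ x : ℂ) • differential m φ x + φ x • realDifferential m χ x) := by
  refine isWeakDifferential_iff.2 fun p i => ?_
  have ho := (chart m p).open_target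
  have h1 := (hasWeakPartial_of_locallyLipschitzOn ho
    (locallyLipschitzOn_comp_chart_symm hχ p) (EuclideanSpace.single i 1)).mul_smooth ho
    (continuousOn_fderiv_comp_chart_symm hφ p 0).1
  refine h1.congr (Eventually.of_forall fun y => mul_comm _ _)
    (ae_restrict_of_forall_mem ho.measurableSet fun y hy => ?_)
  simp only [LinearMap.add_apply, LinearMap.smul_apply, smul_eq_mul, realDifferential_apply]
  rw [differential_chart hφ p hy i, differential_chart_real χ p hy i]
  simp only [Function.comp]
  ring

lemma memLp_two_of_bounded_smul {F : Type*} [NormedAddCommGroup F] [NormedSpace ℂ F]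
    {S : Type*} [MeasurableSpace S] {μ : Measure S} {c : S → ℂ} {g : S → F}
    (hg : MemLp g 2 μ) (hc : AEStronglyMeasurable c μ) (h1 : ∀ x, ‖c x‖ ≤ 1) :
    MemLp (fun x => c x • g x) 2 μ :=
  hg.of_le (hc.smul hg.1) (Eventually.of_forall fun x => by
    rw [norm_smul]
    exact mul_le_of_le_one_left (norm_nonneg _) (h1 x))

lemma memLp_two_smul_realDifferential {χ : X → ℝ} {K : NNReal} (hχ : LipschitzWith K χ)
    {f : X → ℂ} (hf : MemLp f 2 (riemannianMeasure m X)) :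
    MemLp (fun x => f x • coords (realDifferential m χ x)) 2 (riemannianMeasure m X) := by
  refine (hf.norm.const_mul (K : ℝ)).of_le
    (hf.1.smul (aestronglyMeasurable_realDifferential χ))
    (Eventually.of_forall fun x => ?_)
  rw [norm_smul, mul_comm]
  refine le_trans ?_ (le_abs_self _)
  gcongr
  exact norm_coords_realDifferential_le hχ x

/-- The support of χφ is compact because φ has compact support, and it lies in U because χ is
supported there, so the criterion for compactly supported functions applies. -/
lemma exists_lipschitz_mul_test {U : Opens X} {χ : X → ℝ} {K : NNReal} (hχ : LipschitzWith K χ)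
    (h1 : ∀ x, ‖(χ x : ℂ)‖ ≤ 1) (hs : tsupport χ ⊆ U) (φ : TestFunction m (⊤ : Opens X)) :
    ∃ w : FormDomain m U,
      value m U w =ᵐ[riemannianMeasure m X] (fun x => (χ x : ℂ) * φ.toFun x) ∧
      gradient m U w =ᵐ[riemannianMeasure m X] fun x =>
        (χ x : ℂ) • coords (differential m φ.toFun x) + φ.toFun x • coords (realDifferential m χ x) := by
  have e : ∀ x, coords ((χ x : ℂ) • differential m φ.toFun x + φ.toFun x • realDifferential m χ x) =
      (χ x : ℂ) • coords (differential m φ.toFun x) +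
        φ.toFun x • coords (realDifferential m χ x) := fun x => by
    rw [coords_add, coords_smul, coords_smul]
  have hm : AEStronglyMeasurable (fun x => (χ x : ℂ)) (riemannianMeasure m X) :=
    (Complex.continuous_ofReal.comp hχ.continuous).aestronglyMeasurable
  have hK : IsCompact (tsupport φ.toFun ∩ tsupport χ) :=
    IsCompact.inter_right φ.hasCompactSupport (isClosed_tsupport _)
  have h := exists_formDomain_of_compact hK (inter_subset_right.trans hs)
    (isWeakDifferential_lipschitz_mul hχ φ.contMDiff)
    (memLp_two_of_bounded_smul (memLp_value φ) hm h1) (by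
      simp only [e]
      exact (memLp_two_of_bounded_smul (memLp_differential φ) hm h1).add
        (memLp_two_smul_realDifferential hχ (memLp_value φ))) (fun x hx => by
      by_cases hxφ : x ∈ tsupport φ.toFun
      · rw [image_eq_zero_of_notMem_tsupport fun h => hx ⟨hxφ, h⟩, Complex.ofReal_zero, zero_mul]
      · rw [image_eq_zero_of_notMem_tsupport hxφ, mul_zero]) (fun x hx => by
      by_cases hxφ : x ∈ tsupport φ.toFun
      · have hxχ : x ∉ tsupport χ := fun h => hx ⟨hxφ, h⟩
        rw [image_eq_zero_of_notMem_tsupport hxχ, Complex.ofReal_zero, zero_smul,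
          realDifferential_eq_zero (notMem_tsupport_iff_eventuallyEq.1 hxχ), smul_zero, add_zero]
      · rw [image_eq_zero_of_notMem_tsupport hxφ, φ.differential_eq_zero hxφ, zero_smul,
          smul_zero, add_zero])
  simpa only [e] using h

lemma exists_lipschitz_mul {U : Opens X} {χ : X → ℝ} {K : NNReal} (hχ : LipschitzWith K χ)
    (h1 : ∀ x, ‖(χ x : ℂ)‖ ≤ 1) (hs : tsupport χ ⊆ U) (v : FormDomain m (⊤ : Opens X)) :
    ∃ w : FormDomain m U,
      value m U w =ᵐ[riemannianMeasure m X] (fun x => (χ x : ℂ) * value m ⊤ v x) ∧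
      gradient m U w =ᵐ[riemannianMeasure m X] fun x =>
        (χ x : ℂ) • gradient m ⊤ v x + value m ⊤ v x • coords (realDifferential m χ x) := by
  have hm : AEStronglyMeasurable (fun x => (χ x : ℂ)) (riemannianMeasure m X) :=
    (Complex.continuous_ofReal.comp hχ.continuous).aestronglyMeasurable
  have hf : MemLp (fun x => (χ x : ℂ) * value m ⊤ v x) 2 (riemannianMeasure m X) :=
    memLp_two_of_bounded_smul (F := ℂ) (Lp.memLp (value m ⊤ v)) hm h1
  have hb : MemLp (fun x => (χ x : ℂ) • gradient m ⊤ v x +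
      value m ⊤ v x • coords (realDifferential m χ x)) 2 (riemannianMeasure m X) :=
    (memLp_two_of_bounded_smul (Lp.memLp (gradient m ⊤ v)) hm h1).add
      (memLp_two_smul_realDifferential hχ (Lp.memLp (value m ⊤ v)))
  refine exists_formDomain_of_approx hf hb fun ε hε => ?_
  -- Approximation of v within η gives an error of at most η in the value, and in the gradient of at
  -- most η from χ ≤ 1 plus Kη from |dχ| ≤ K.
  obtain ⟨η, hη, hηε⟩ := exists_pos_mul_ofReal_le (C := 1 + K) (by finiteness) hε
  obtain ⟨φ, hφ⟩ := exists_testFunction_near v hη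
  obtain ⟨w, hw1, hw2⟩ := exists_lipschitz_mul_test hχ h1 hs φ
  have hv : eLpNorm (fun x => value m ⊤ v x - φ.toFun x) 2 (riemannianMeasure m X) ≤
      ENNReal.ofReal η := (eLpNorm_value_sub_le v φ).trans (ENNReal.ofReal_le_ofReal hφ)
  have hg : eLpNorm (fun x => gradient m ⊤ v x - coords (differential m φ.toFun x)) 2
      (riemannianMeasure m X) ≤ ENNReal.ofReal η :=
    (eLpNorm_gradient_sub_le v φ).trans (ENNReal.ofReal_le_ofReal hφ)
  refine ⟨w, ?_, ?_⟩
  · calc _ ≤ eLpNorm (fun x => value m ⊤ v x - φ.toFun x) 2 (riemannianMeasure m X) := by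
          refine eLpNorm_mono_ae ?_
          filter_upwards [hw1] with x hx
          rw [hx, ← mul_sub, norm_mul, norm_sub_rev]
          exact mul_le_of_le_one_left (norm_nonneg _) (h1 x)
      _ ≤ 1 * ENNReal.ofReal η := by rwa [one_mul]
      _ ≤ (1 + K) * ENNReal.ofReal η := mul_le_mul_left le_self_add _
      _ ≤ _ := hηε
  · have hmv : AEStronglyMeasurable (fun x => value m ⊤ v x - φ.toFun x) (riemannianMeasure m X) :=
      (Lp.memLp _).1.sub (memLp_value φ).1
    have hmg : AEStronglyMeasurable (fun x => gradient m ⊤ v x - coords (differential m φ.toFun x))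
        (riemannianMeasure m X) := (Lp.memLp _).1.sub (memLp_differential φ).1
    calc _ = eLpNorm ((fun x => (χ x : ℂ) • (gradient m ⊤ v x - coords (differential m φ.toFun x))) +
            fun x => (value m ⊤ v x - φ.toFun x) • coords (realDifferential m χ x)) 2
            (riemannianMeasure m X) := by
          rw [← eLpNorm_neg]
          refine eLpNorm_congr_ae ?_
          filter_upwards [hw2] with x hx
          simp only [Pi.neg_apply, Pi.add_apply, hx, smul_sub, sub_smul]
          abel
      _ ≤ eLpNorm (fun x => (χ x : ℂ) • (gradient m ⊤ v x - coords (differential m φ.toFun x))) 2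
            (riemannianMeasure m X) +
          eLpNorm (fun x => (value m ⊤ v x - φ.toFun x) • coords (realDifferential m χ x)) 2
            (riemannianMeasure m X) := eLpNorm_add_le (hm.smul hmg)
              (hmv.smul (aestronglyMeasurable_realDifferential χ)) (by norm_num)
      _ ≤ ENNReal.ofReal η + K * ENNReal.ofReal η := by
          refine add_le_add (le_trans (eLpNorm_mono fun x => ?_) hg) ?_
          · rw [norm_smul]
            exact mul_le_of_le_one_left (norm_nonneg _) (h1 x)
          · have h2 : ∀ᵐ x ∂(riemannianMeasure m X),
                ‖(value m ⊤ v x - φ.toFun x) • coords (realDifferential m χ x)‖ ≤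
                  (K : ℝ) * ‖value m ⊤ v x - φ.toFun x‖ := by
              refine Eventually.of_forall fun x => ?_
              rw [norm_smul, mul_comm]
              exact mul_le_mul_of_nonneg_right (norm_coords_realDifferential_le hχ x)
                (norm_nonneg _)
            refine (eLpNorm_le_mul_eLpNorm_of_ae_le_mul h2 2).trans ?_
            rw [ENNReal.ofReal_coe_nnreal]
            exact mul_le_mul_right hv _
      _ = (1 + K) * ENNReal.ofReal η := by rw [add_mul, one_mul]
      _ ≤ _ := hηε

/-- Multiplication by a Lipschitz function with support in `U`, as an operator from `H^1(X)` to
`H^1_0(U)`. -/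
lemma exists_lipschitzMul {U : Opens X} {χ : X → ℝ} {K : NNReal} (hχ : LipschitzWith K χ)
    (h1 : ∀ x, ‖(χ x : ℂ)‖ ≤ 1) (hs : tsupport χ ⊆ U) :
    ∃ M : FormDomain m (⊤ : Opens X) →L[ℂ] FormDomain m U, ∀ v,
      value m U (M v) =ᵐ[riemannianMeasure m X] (fun x => (χ x : ℂ) * value m ⊤ v x) ∧
      gradient m U (M v) =ᵐ[riemannianMeasure m X] fun x =>
        (χ x : ℂ) • gradient m ⊤ v x + value m ⊤ v x • coords (realDifferential m χ x) := by
  -- The product is chosen separately for every v; as elements of the form domain are determined by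
  -- their values, the choice is automatically linear.
  choose M hM1 hM2 using exists_lipschitz_mul (m := m) hχ h1 hs
  let L : FormDomain m (⊤ : Opens X) →ₗ[ℂ] FormDomain m U :=
    { toFun := M
      map_add' := fun v w => value_injective U <| Lp.ext <| by
        rw [map_add]
        filter_upwards [hM1 (v + w), hM1 v, hM1 w, Lp.coeFn_add (value m U (M v)) (value m U (M w)),
          Lp.coeFn_add (value m ⊤ v) (value m ⊤ w)] with x a1 a2 a3 a4 a5
        rw [a1, a4, Pi.add_apply, a2, a3, map_add, a5, Pi.add_apply, mul_add]
      map_smul' := fun c v => value_injective U <| Lp.ext <| by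
        rw [RingHom.id_apply, map_smul]
        filter_upwards [hM1 (c • v), hM1 v, Lp.coeFn_smul c (value m U (M v)),
          Lp.coeFn_smul c (value m ⊤ v)] with x a1 a2 a3 a4
        rw [a1, a3, Pi.smul_apply, a2, map_smul, a4, Pi.smul_apply, smul_eq_mul, smul_eq_mul]
        ring }
  refine ⟨L.mkContinuous (2 + K) fun v => ?_, fun v => ⟨hM1 v, hM2 v⟩⟩
  have b1 : ‖value m U (M v)‖ ≤ ‖value m ⊤ v‖ := by
    refine Lp.norm_le_norm_of_ae_le ?_
    filter_upwards [hM1 v] with x hx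
    rw [hx, norm_mul]
    exact mul_le_of_le_one_left (norm_nonneg _) (h1 x)
  have b2 : ‖gradient m U (M v)‖ ≤ ‖gradient m ⊤ v‖ + K * ‖value m ⊤ v‖ := by
    have hv1 := memLp_two_of_bounded_smul (Lp.memLp (gradient m ⊤ v))
      ((Complex.continuous_ofReal.comp hχ.continuous).aestronglyMeasurable) h1
    have hv2 := memLp_two_smul_realDifferential hχ (Lp.memLp (value m ⊤ v))
    have e : gradient m U (M v) = hv1.toLp _ + hv2.toLp _ := by
      rw [← MemLp.toLp_add]
      refine Lp.ext ((hM2 v).trans (MemLp.coeFn_toLp _).symm)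
    rw [e]
    refine (norm_add_le _ _).trans (add_le_add ?_ ?_)
    · refine Lp.norm_le_norm_of_ae_le ?_
      filter_upwards [hv1.coeFn_toLp] with x hx
      rw [hx, norm_smul]
      exact mul_le_of_le_one_left (norm_nonneg _) (h1 x)
    · refine Lp.norm_le_mul_norm_of_ae_le_mul ?_
      filter_upwards [hv2.coeFn_toLp] with x hx
      rw [hx, norm_smul, mul_comm]
      exact mul_le_mul_of_nonneg_right (norm_coords_realDifferential_le hχ x) (norm_nonneg _)
  have b3 := norm_value_le v
  have b4 := norm_gradient_le v
  have b5 : (K : ℝ) * ‖value m ⊤ v‖ ≤ K * ‖v‖ := mul_le_mul_of_nonneg_left b3 K.2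
  calc ‖M v‖ ≤ ‖value m U (M v)‖ + ‖gradient m U (M v)‖ := norm_formDomain_le _
    _ ≤ (2 + K) * ‖v‖ := by linarith

end Lipschitz

/-! ### Metric compatibility of the Christoffel symbols -/

section Matrices

variable {m : ℕ}

/-- If `G` is the inverse of `g`, `dG = - G dg G`, and `Γ = (dg + N) G / 2` with `N` antisymmetric,
then `∑ dG_{jk} P_{jk} = - 2 ∑ G_{jk} Γ_{kl} P_{jl}` for symmetric `P`. -/
lemma trace_metric_compatibility {G dg dG N P : Matrix (Fin m) (Fin m) ℝ} (hG : G.transpose = G)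
    (hdG : dG = -(G * dg * G)) (hN : N.transpose = -N) (hP : P.transpose = P) :
    (dG * P).trace = -2 * (G * ((2⁻¹ : ℝ) • ((dg + N) * G)) * P).trace := by
  -- An antisymmetric matrix has zero trace against the symmetric matrix GPG; this removes N from
  -- the right-hand side.
  have h1 : (N * (G * P * G)).trace = 0 := by
    have h2 : (N * (G * P * G)).trace = -(N * (G * P * G)).trace := by
      conv_lhs => rw [← Matrix.trace_transpose]
      simp only [Matrix.transpose_mul, hG, hN, hP]
      rw [← Matrix.mul_assoc, Matrix.mul_neg, Matrix.trace_neg, Matrix.trace_mul_comm,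
        Matrix.mul_assoc G P G]
    linarith
  have h3 : (G * (N * G) * P).trace = 0 := by
    rw [← h1, Matrix.mul_assoc G, Matrix.trace_mul_comm]
    simp only [Matrix.mul_assoc]
  have h4 : (G * ((2⁻¹ : ℝ) • ((dg + N) * G)) * P).trace = 2⁻¹ * (G * dg * G * P).trace := by
    rw [Matrix.mul_smul, Matrix.smul_mul, Matrix.trace_smul, smul_eq_mul, Matrix.add_mul,
      Matrix.mul_add, Matrix.add_mul, Matrix.trace_add, h3, add_zero]
    simp only [Matrix.mul_assoc]
  rw [h4, hdG, Matrix.neg_mul, Matrix.trace_neg]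
  ring

lemma contDiffOn_det {E : Type*} [NormedAddCommGroup E] [NormedSpace ℝ E] {s : Set E}
    {n : WithTop ℕ∞} {A : E → Matrix (Fin m) (Fin m) ℝ}
    (hA : ∀ i j, ContDiffOn ℝ n (fun y => A y i j) s) : ContDiffOn ℝ n (fun y => (A y).det) s := by
  simp only [Matrix.det_apply]
  refine ContDiffOn.sum fun σ _ => ?_
  exact (contDiffOn_prod fun i _ => hA (σ i) i).const_smul _

end Matrices

/-! ### Smoothness of the metric coefficients and the derivative of the norm of a covector field -/

section Christoffel

variable {m : ℕ} {X : Type*} [EMetricSpace X] [ChartedSpace (EuclideanSpace ℝ (Fin m)) X]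
  [RiemannianBundle (fun x : X => TangentSpace (𝓡 m) x)] [IsManifold (𝓡 m) ∞ X]
  [IsContMDiffRiemannianBundle (𝓡 m) ∞ (EuclideanSpace ℝ (Fin m))
    (fun x : X => TangentSpace (𝓡 m) x)]
  [MeasurableSpace X] [BorelSpace X] [SecondCountableTopology X]

lemma contDiffOn_gram (p : X) (i j : Fin m) :
    ContDiffOn ℝ ∞ (fun y => gram p y i j) (chart m p).target := by
  have key : ∀ i : Fin m, ContMDiffOn (𝓡 m) ((𝓡 m).prod 𝓘(ℝ, EuclideanSpace ℝ (Fin m))) ∞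
      (fun y => (⟨(chart m p).symm y, coordField p y i⟩ :
      TotalSpace (EuclideanSpace ℝ (Fin m)) (fun x : X => TangentSpace (𝓡 m) x)))
      (chart m p).target := by
    intro i
    have h1 : ContMDiffOn (𝓡 m) (𝓡 m) ∞ (chart m p).symm (chart m p).target :=
      contMDiffOn_chart_symm
    have h2 := h1.contMDiffOn_tangentMapWithin (m := ∞) le_rfl
      (chart m p).open_target.uniqueMDiffOn
    have h3 : ContMDiffOn (𝓡 m) (𝓡 m).tangent ∞ (fun y : EuclideanSpace ℝ (Fin m) =>
        (⟨y, EuclideanSpace.single i (1 : ℝ)⟩ : TangentBundle (𝓡 m) (EuclideanSpace ℝ (Fin m))))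
        (chart m p).target :=
      contMDiffOn_vectorSpace_iff_contDiffOn.2 contDiffOn_const
    refine (h2.comp h3 (fun y hy => hy)).congr fun y hy => ?_
    simp only [Function.comp, tangentMapWithin, coordField]
    rw [mfderivWithin_of_isOpen (chart m p).open_target hy]
  have h := ContMDiffOn.inner_bundle (key i) (key j)
  exact contMDiffOn_iff_contDiffOn.1 h

lemma contDiffOn_gram_inv (p : X) (i j : Fin m) :
    ContDiffOn ℝ ∞ (fun y => (gram p y)⁻¹ i j) (chart m p).target := by
  have h1 : ContDiffOn ℝ ∞ (fun y => ((gram p y).det)⁻¹ * (gram p y).adjugate i j)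
      (chart m p).target := by
    refine ContDiffOn.mul (ContDiffOn.inv (contDiffOn_det (contDiffOn_gram p))
      fun y hy => (det_gram_pos p hy).ne') ?_
    simp only [Matrix.adjugate_apply]
    refine contDiffOn_det fun k l => ?_
    by_cases hk : k = j
    · subst hk
      simp only [Matrix.updateRow_self]
      exact contDiffOn_const
    · simp only [Matrix.updateRow_ne hk]
      exact contDiffOn_gram p k l
  refine h1.congr fun y hy => ?_
  simp [Matrix.inv_def]

/-- The derivative of the metric coefficients along `e_i`. -/
def gramDeriv (p : X) (y : EuclideanSpace ℝ (Fin m)) (i : Fin m) : Matrix (Fin m) (Fin m) ℝ :=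
  Matrix.of fun j k => fderiv ℝ (fun z => gram p z j k) y (EuclideanSpace.single i 1)

/-- The derivative of the inverse metric coefficients along `e_i`. -/
def gramInvDeriv (p : X) (y : EuclideanSpace ℝ (Fin m)) (i : Fin m) : Matrix (Fin m) (Fin m) ℝ :=
  Matrix.of fun j k => fderiv ℝ (fun z => (gram p z)⁻¹ j k) y (EuclideanSpace.single i 1)

lemma gram_transpose (p : X) (y : EuclideanSpace ℝ (Fin m)) :
    (gram p y).transpose = gram p y := by
  ext i j
  exact real_inner_comm (coordField p y i) (coordField p y j)

lemma gram_inv_transpose (p : X) (y : EuclideanSpace ℝ (Fin m)) :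
    ((gram p y)⁻¹).transpose = (gram p y)⁻¹ := by
  rw [Matrix.transpose_nonsing_inv, gram_transpose]

/-- Differentiate g g⁻¹ = 1 entrywise and multiply by g⁻¹ from the left. -/
lemma gramInvDeriv_eq (p : X) {y : EuclideanSpace ℝ (Fin m)} (hy : y ∈ (chart m p).target)
    (i : Fin m) :
    gramInvDeriv p y i = -((gram p y)⁻¹ * gramDeriv p y i * (gram p y)⁻¹) := by
  have hn := (chart m p).open_target.mem_nhds hy
  have hdet : IsUnit (gram p y).det := (det_gram_pos p hy).ne'.isUnit
  have h1 : gramDeriv p y i * (gram p y)⁻¹ + gram p y * gramInvDeriv p y i = 0 := by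
    ext j l
    have hg : ∀ k, HasFDerivAt (fun z => gram p z j k * (gram p z)⁻¹ k l)
        (gram p y j k • fderiv ℝ (fun z => (gram p z)⁻¹ k l) y +
          (gram p y)⁻¹ k l • fderiv ℝ (fun z => gram p z j k) y) y := fun k =>
      ((contDiffOn_gram p j k).contDiffAt hn |>.differentiableAt (by simp)).hasFDerivAt.mul
        ((contDiffOn_gram_inv p k l).contDiffAt hn |>.differentiableAt (by simp)).hasFDerivAt
    have hs := HasFDerivAt.fun_sum (u := Finset.univ) fun k _ => hg k
    have hc : HasFDerivAt (fun z => ∑ k, gram p z j k * (gram p z)⁻¹ k l)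
        (0 : EuclideanSpace ℝ (Fin m) →L[ℝ] ℝ) y := by
      refine (hasFDerivAt_const ((1 : Matrix (Fin m) (Fin m) ℝ) j l) y).congr_of_eventuallyEq ?_
      filter_upwards [hn] with z hz
      rw [← Matrix.mul_nonsing_inv (gram p z) (det_gram_pos p hz).ne'.isUnit, Matrix.mul_apply]
    have h2 := congrArg (fun L : EuclideanSpace ℝ (Fin m) →L[ℝ] ℝ =>
      L (EuclideanSpace.single i 1)) (hs.unique hc)
    simp only [sum_apply, add_apply,
      smul_apply, smul_eq_mul, zero_apply,
      Finset.sum_add_distrib] at h2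
    simp only [Matrix.add_apply, Matrix.mul_apply, gramDeriv, gramInvDeriv, Matrix.of_apply,
      Matrix.zero_apply]
    rw [← h2, add_comm]
    congr 1
    exact Finset.sum_congr rfl fun k _ => mul_comm _ _
  have h2 : gram p y * gramInvDeriv p y i = -(gramDeriv p y i * (gram p y)⁻¹) :=
    eq_neg_of_add_eq_zero_right h1
  have h3 := congrArg (fun A => (gram p y)⁻¹ * A) h2
  rw [← Matrix.mul_assoc, Matrix.nonsing_inv_mul _ hdet, Matrix.one_mul, Matrix.mul_neg,
    ← Matrix.mul_assoc] at h3
  exact h3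

/-- The antisymmetric part of the Christoffel symbols. -/
def christoffelSkew (p : X) (y : EuclideanSpace ℝ (Fin m)) (i : Fin m) :
    Matrix (Fin m) (Fin m) ℝ :=
  Matrix.of fun k n => gramDeriv p y k i n - gramDeriv p y n i k

/-- For fixed i the symbols split into ∂_i g and a part antisymmetric in the two remaining lower
indices. This is the form required by `trace_metric_compatibility`. -/
lemma christoffel_eq (p : X) (y : EuclideanSpace ℝ (Fin m)) (i k l : Fin m) :
    christoffel p y l i k =
      ((2⁻¹ : ℝ) • ((gramDeriv p y i + christoffelSkew p y i) * (gram p y)⁻¹)) k l := by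
  have hs : ∀ n, (gram p y)⁻¹ l n = (gram p y)⁻¹ n l := fun n =>
    congrFun (congrFun (gram_inv_transpose p y) n) l
  simp only [christoffel, Matrix.smul_apply, Matrix.mul_apply, smul_eq_mul, Finset.mul_sum,
    Matrix.add_apply, christoffelSkew, gramDeriv, Matrix.of_apply, hs]
  exact Finset.sum_congr rfl fun n _ => by ring

lemma continuousOn_christoffel (p : X) (k i j : Fin m) :
    ContinuousOn (fun y => christoffel p y k i j) (chart m p).target := by
  have h : ∀ a b c : Fin m, ContinuousOn
      (fun y => fderiv ℝ (fun z => gram p z a b) y (EuclideanSpace.single c 1))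
      (chart m p).target := fun a b c =>
    ((contDiffOn_gram p a b).continuousOn_fderiv_of_isOpen (chart m p).open_target
      (by simp)).clm_apply continuousOn_const
  unfold christoffel
  refine continuousOn_finsetSum _ fun l _ => ?_
  exact ((continuousOn_gram_inv p k l).div_const 2).mul (((h j l i).add (h i l j)).sub (h i j l))

/-- The covector with given components in the chart at `p`. -/
def covectorOfComponents (p : X) (y : EuclideanSpace ℝ (Fin m)) (a : Fin m → ℂ) :
    TangentSpace (𝓡 m) ((chart m p).symm y) →ₗ[ℝ] ℂ where
  toFun v := ∑ j, ∑ k, (((gram p y)⁻¹ j k * inner ℝ v (coordField p y k) : ℝ) : ℂ) * a j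
  map_add' v w := by
    simp only [inner_add_left, ← Finset.sum_add_distrib]
    refine Finset.sum_congr rfl fun j _ => Finset.sum_congr rfl fun k _ => ?_
    push_cast
    ring
  map_smul' c v := by
    simp only [real_inner_smul_left, RingHom.id_apply, Complex.real_smul, Finset.mul_sum]
    refine Finset.sum_congr rfl fun j _ => Finset.sum_congr rfl fun k _ => ?_
    push_cast
    ring

lemma covectorOfComponents_coordField (p : X) {y : EuclideanSpace ℝ (Fin m)}
    (hy : y ∈ (chart m p).target) (a : Fin m → ℂ) (i : Fin m) :
    covectorOfComponents p y a (coordField p y i) = a i := by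
  have hdet : IsUnit (gram p y).det := (det_gram_pos p hy).ne'.isUnit
  have h1 : ∀ j, ∑ k, (gram p y)⁻¹ j k * gram p y i k = if j = i then 1 else 0 := by
    intro j
    rw [← Matrix.one_apply, ← Matrix.nonsing_inv_mul _ hdet, Matrix.mul_apply]
    exact Finset.sum_congr rfl fun k _ =>
      congrArg _ (congrFun (congrFun (gram_transpose p y) k) i)
  change ∑ j, ∑ k, (((gram p y)⁻¹ j k * gram p y i k : ℝ) : ℂ) * a j = a i
  have h2 : ∀ j, ∑ k, (((gram p y)⁻¹ j k * gram p y i k : ℝ) : ℂ) * a j =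
      ((if j = i then 1 else 0 : ℝ) : ℂ) * a j := fun j => by
    rw [← h1 j, Complex.ofReal_sum, Finset.sum_mul]
  refine (Finset.sum_congr rfl fun j _ => h2 j).trans ((Finset.sum_eq_single i (fun j _ hj => ?_)
    fun h => (h (Finset.mem_univ i)).elim).trans ?_)
  · rw [if_neg hj, Complex.ofReal_zero, zero_mul]
  · rw [if_pos rfl, Complex.ofReal_one, one_mul]

lemma re_inner_coords (p : X) {y : EuclideanSpace ℝ (Fin m)} (hy : y ∈ (chart m p).target)
    (α β : TangentSpace (𝓡 m) ((chart m p).symm y) →ₗ[ℝ] ℂ) :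
    (inner ℂ (coords α) (coords β)).re = ∑ j, ∑ k, (gram p y)⁻¹ j k *
      ((α (coordField p y j)).re * (β (coordField p y k)).re +
        (α (coordField p y j)).im * (β (coordField p y k)).im) := by
  rw [← covectorInner_eq_inner, (covectorInner_eq p hy α β).2]
  simp only [Complex.re_sum, Complex.re_ofReal_mul]
  refine Finset.sum_congr rfl fun j _ => Finset.sum_congr rfl fun k _ => ?_
  simp [Complex.mul_re]

/-- The components of the covariant derivative along `e_i` of a covector field with components
`φ`. -/
def covariantComponents (p : X) (y : EuclideanSpace ℝ (Fin m)) (i : Fin m)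
    (φ : Fin m → EuclideanSpace ℝ (Fin m) → ℂ) (j : Fin m) : ℂ :=
  fderiv ℝ (φ j) y (EuclideanSpace.single i 1) - ∑ k, (christoffel p y k i j : ℂ) * φ k y

/-- The squared norm of the covector field with components `φ`. -/
def componentNormSq (p : X) (φ : Fin m → EuclideanSpace ℝ (Fin m) → ℂ)
    (y : EuclideanSpace ℝ (Fin m)) : ℝ :=
  ∑ j, ∑ k, (gram p y)⁻¹ j k * ((φ j y).re * (φ k y).re + (φ j y).im * (φ k y).im)

lemma componentNormSq_eq (p : X) {y : EuclideanSpace ℝ (Fin m)} (hy : y ∈ (chart m p).target)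
    (φ : Fin m → EuclideanSpace ℝ (Fin m) → ℂ) :
    componentNormSq p φ y = ‖coords (covectorOfComponents p y fun j => φ j y)‖ ^ 2 := by
  have h := re_inner_coords p hy (covectorOfComponents p y fun j => φ j y)
    (covectorOfComponents p y fun j => φ j y)
  simp only [covectorOfComponents_coordField p hy] at h
  rw [componentNormSq, ← h, ← RCLike.re_to_complex, inner_self_eq_norm_sq]

lemma contDiffOn_componentNormSq (p : X) {φ : Fin m → EuclideanSpace ℝ (Fin m) → ℂ}
    (hφ : ∀ j, ContDiff ℝ ∞ (φ j)) :
    ContDiffOn ℝ ∞ (componentNormSq p φ) (chart m p).target := by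
  unfold componentNormSq
  have hre : ∀ j, ContDiff ℝ ∞ fun y => (φ j y).re := fun j =>
    Complex.reCLM.contDiff.comp (hφ j)
  have him : ∀ j, ContDiff ℝ ∞ fun y => (φ j y).im := fun j =>
    Complex.imCLM.contDiff.comp (hφ j)
  refine ContDiffOn.sum fun j _ => ContDiffOn.sum fun k _ => ?_
  exact (contDiffOn_gram_inv p j k).mul
    (((hre j).mul (hre k)).add ((him j).mul (him k))).contDiffOn

/-- The Leibniz rule yields derivatives of the components and of g^{jk}. Metric compatibility of the
Christoffel symbols says that the derivative of g^{jk}, contracted with the symmetric matrix P,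
supplies exactly the terms that complete the former to covariant derivatives. -/
lemma fderiv_componentNormSq (p : X) {y : EuclideanSpace ℝ (Fin m)} (hy : y ∈ (chart m p).target)
    {φ : Fin m → EuclideanSpace ℝ (Fin m) → ℂ} (hφ : ∀ j, ContDiff ℝ ∞ (φ j)) (i : Fin m) :
    fderiv ℝ (componentNormSq p φ) y (EuclideanSpace.single i 1) =
      2 * (inner ℂ (coords (covectorOfComponents p y fun j => φ j y))
        (coords (covectorOfComponents p y (covariantComponents p y i φ)))).re := by
  have hn := (chart m p).open_target.mem_nhds hy
  set e : EuclideanSpace ℝ (Fin m) := EuclideanSpace.single i 1 with he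
  have hd : ∀ j, HasFDerivAt (φ j) (fderiv ℝ (φ j) y) y := fun j =>
    ((hφ j).differentiable (by simp)).differentiableAt.hasFDerivAt
  have hre : ∀ j, HasFDerivAt (fun y => (φ j y).re) (Complex.reCLM.comp (fderiv ℝ (φ j) y)) y :=
    fun j => Complex.reCLM.hasFDerivAt.comp y (hd j)
  have him : ∀ j, HasFDerivAt (fun y => (φ j y).im) (Complex.imCLM.comp (fderiv ℝ (φ j) y)) y :=
    fun j => Complex.imCLM.hasFDerivAt.comp y (hd j)
  have hG : ∀ j k, HasFDerivAt (fun z => (gram p z)⁻¹ j k)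
      (fderiv ℝ (fun z => (gram p z)⁻¹ j k) y) y := fun j k =>
    ((contDiffOn_gram_inv p j k).contDiffAt hn |>.differentiableAt (by simp)).hasFDerivAt
  have hq := HasFDerivAt.fun_sum (u := Finset.univ) fun j _ =>
    HasFDerivAt.fun_sum (u := Finset.univ) fun k _ => (hG j k).fun_mul
      (((hre j).fun_mul (hre k)).fun_add ((him j).fun_mul (him k)))
  have h1 : fderiv ℝ (componentNormSq p φ) y e = _ := congrArg (fun L => L e) hq.fderiv
  rw [h1, re_inner_coords p hy]
  simp only [covectorOfComponents_coordField p hy]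
  let P : Matrix (Fin m) (Fin m) ℝ := Matrix.of fun j k =>
    (φ j y).re * (φ k y).re + (φ j y).im * (φ k y).im
  have hP : P.transpose = P := by
    ext j k
    simp only [P, Matrix.transpose_apply, Matrix.of_apply]
    ring
  have hN : (christoffelSkew p y i).transpose = -christoffelSkew p y i := by
    ext j k
    simp only [christoffelSkew, Matrix.transpose_apply, Matrix.of_apply, Matrix.neg_apply]
    ring
  have hs : ∀ j k, (gram p y)⁻¹ k j = (gram p y)⁻¹ j k := fun j k =>
    congrFun (congrFun (gram_inv_transpose p y) j) k
  have key := trace_metric_compatibility (gram_inv_transpose p y) (gramInvDeriv_eq p hy i) hN hP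
  let D : Fin m → Fin m → ℝ := fun j k => (φ j y).re * (fderiv ℝ (φ k) y e).re +
    (φ j y).im * (fderiv ℝ (φ k) y e).im
  have k1 : (gramInvDeriv p y i * P).trace = ∑ j, ∑ k, fderiv ℝ (fun z => (gram p z)⁻¹ j k) y e *
      P j k := by
    simp only [Matrix.trace, Matrix.diag_apply, Matrix.mul_apply]
    refine Finset.sum_congr rfl fun j _ => Finset.sum_congr rfl fun k _ => ?_
    rw [← congrFun (congrFun hP j) k]
    rfl
  have k2 : ((gram p y)⁻¹ * ((2⁻¹ : ℝ) • ((gramDeriv p y i + christoffelSkew p y i) *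
      (gram p y)⁻¹)) * P).trace =
      ∑ j, ∑ k, ∑ l, (gram p y)⁻¹ j k * (christoffel p y l i k * P j l) := by
    simp only [Matrix.trace, Matrix.diag_apply, Matrix.mul_apply (M := _ * _), ← christoffel_eq,
      Matrix.mul_apply (M := (gram p y)⁻¹), Finset.sum_mul]
    refine Finset.sum_congr rfl fun j _ => ?_
    rw [Finset.sum_comm]
    refine Finset.sum_congr rfl fun k _ => Finset.sum_congr rfl fun l _ => ?_
    rw [← congrFun (congrFun hP j) l, Matrix.transpose_apply]
    ring
  rw [k1, k2] at key
  have h2 : ∑ j, ∑ k, (gram p y)⁻¹ j k * D k j = ∑ j, ∑ k, (gram p y)⁻¹ j k * D j k := by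
    rw [Finset.sum_comm]
    simp only [hs]
  have h3 : (∑ j, ∑ k, (gram p y)⁻¹ j k * ((φ j y).re * (covariantComponents p y i φ k).re +
      (φ j y).im * (covariantComponents p y i φ k).im)) = ∑ j, ∑ k, (gram p y)⁻¹ j k * D j k -
      ∑ j, ∑ k, ∑ l, (gram p y)⁻¹ j k * (christoffel p y l i k * P j l) := by
    rw [← Finset.sum_sub_distrib]
    refine Finset.sum_congr rfl fun j _ => ?_
    rw [← Finset.sum_sub_distrib]
    refine Finset.sum_congr rfl fun k _ => ?_
    rw [← Finset.mul_sum, ← mul_sub]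
    congr 1
    simp only [covariantComponents, Complex.sub_re, Complex.sub_im, Complex.re_sum, Complex.im_sum,
      Complex.re_ofReal_mul, Complex.im_ofReal_mul, D, P, Matrix.of_apply, mul_sub, mul_add,
      Finset.mul_sum, Finset.sum_add_distrib]
    have e1 : ∀ (r : ℝ) (f : Fin m → ℝ), ∑ l, r * (christoffel p y l i k * f l) =
        ∑ l, christoffel p y l i k * (r * f l) := fun r f =>
      Finset.sum_congr rfl fun l _ => by ring
    rw [e1, e1]
    ring
  rw [h3]
  simp only [sum_apply, add_apply,
    smul_apply, smul_eq_mul, ContinuousLinearMap.comp_apply,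
    Complex.reCLM_apply, Complex.imCLM_apply]
  have h4 : ∀ j k, (gram p y)⁻¹ j k * ((φ j y).re * (fderiv ℝ (φ k) y e).re +
      (φ k y).re * (fderiv ℝ (φ j) y e).re + ((φ j y).im * (fderiv ℝ (φ k) y e).im +
      (φ k y).im * (fderiv ℝ (φ j) y e).im)) + ((φ j y).re * (φ k y).re + (φ j y).im * (φ k y).im) *
      fderiv ℝ (fun z => (gram p z)⁻¹ j k) y e = (gram p y)⁻¹ j k * D j k +
      (gram p y)⁻¹ j k * D k j + fderiv ℝ (fun z => (gram p z)⁻¹ j k) y e * P j k := by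
    intro j k
    simp only [D, P, Matrix.of_apply]
    ring
  simp only [h4, Finset.sum_add_distrib]
  rw [h2, key]
  ring

end Christoffel

/-! ### Regularized norms -/

section Hilbert

variable {H : Type*} [NormedAddCommGroup H] [InnerProductSpace ℂ H]

lemma sqrt_add_sq_pos {s : ℝ} (hs : 0 < s) (x : ℝ) : 0 < √(s ^ 2 + x ^ 2) :=
  Real.sqrt_pos.2 (by positivity)

lemma le_sqrt_add_sq (s x : ℝ) : s ≤ √(s ^ 2 + x ^ 2) :=
  Real.le_sqrt_of_sq_le (by nlinarith [sq_nonneg x])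

lemma le_sqrt_add_sq' (s x : ℝ) : x ≤ √(s ^ 2 + x ^ 2) :=
  Real.le_sqrt_of_sq_le (by nlinarith [sq_nonneg s])

lemma abs_sqrt_sub_sqrt_le {s : ℝ} (hs : 0 < s) {x y : ℝ} (hx : 0 ≤ x) (hy : 0 ≤ y) :
    |√(s ^ 2 + x ^ 2) - √(s ^ 2 + y ^ 2)| ≤ |x - y| := by
  have h1 := sqrt_add_sq_pos hs x
  have h2 := sqrt_add_sq_pos hs y
  have h3 := le_sqrt_add_sq' s x
  have h4 := le_sqrt_add_sq' s y
  have h5 : (√(s ^ 2 + x ^ 2) - √(s ^ 2 + y ^ 2)) * (√(s ^ 2 + x ^ 2) + √(s ^ 2 + y ^ 2)) =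
      (x - y) * (x + y) := by
    have a := Real.sq_sqrt (show 0 ≤ s ^ 2 + x ^ 2 by positivity)
    have b := Real.sq_sqrt (show 0 ≤ s ^ 2 + y ^ 2 by positivity)
    nlinarith
  have h6 := congrArg abs h5
  rw [abs_mul, abs_mul, abs_of_pos (add_pos h1 h2), abs_of_nonneg (add_nonneg hx hy)] at h6
  refine le_of_mul_le_mul_right ?_ (add_pos h1 h2)
  rw [h6]
  exact mul_le_mul_of_nonneg_left (add_le_add h3 h4) (abs_nonneg _)

lemma sqrt_add_sq_sub_mem {s : ℝ} (hs : 0 < s) {x : ℝ} (hx : 0 ≤ x) :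
    0 ≤ √(s ^ 2 + x ^ 2) - s ∧ √(s ^ 2 + x ^ 2) - s ≤ x := by
  refine ⟨sub_nonneg.2 (le_sqrt_add_sq s x), ?_⟩
  have := Real.sqrt_le_sqrt (show s ^ 2 + x ^ 2 ≤ (s + x) ^ 2 by nlinarith)
  rw [Real.sqrt_sq (by positivity)] at this
  linarith

lemma abs_sqrt_norm_sub_le {s : ℝ} (hs : 0 < s) (a b : H) :
    |√(s ^ 2 + ‖a‖ ^ 2) - √(s ^ 2 + ‖b‖ ^ 2)| ≤ ‖a - b‖ :=
  (abs_sqrt_sub_sqrt_le hs (norm_nonneg a) (norm_nonneg b)).trans (abs_norm_sub_norm_le a b)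

/-- Stability of the formula for the differential of √(s² + |a|²) in both arguments. One summand ‖a
- b‖‖t‖/s comes from the numerator and one from the denominator; the positivity of s makes the
denominators at least s. -/
lemma abs_re_inner_div_sub_le {s : ℝ} (hs : 0 < s) (a b t τ : H) :
    |(inner ℂ a t).re / √(s ^ 2 + ‖a‖ ^ 2) - (inner ℂ b τ).re / √(s ^ 2 + ‖b‖ ^ 2)| ≤
      2 / s * ‖a - b‖ * ‖t‖ + ‖t - τ‖ := by
  set A := √(s ^ 2 + ‖a‖ ^ 2) with hA
  set B := √(s ^ 2 + ‖b‖ ^ 2) with hB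
  have hA0 : 0 < A := sqrt_add_sq_pos hs _
  have hB0 : 0 < B := sqrt_add_sq_pos hs _
  have hAs : s ≤ A := le_sqrt_add_sq s _
  have hBb : ‖b‖ ≤ B := le_sqrt_add_sq' s _
  have hAB : |A - B| ≤ ‖a - b‖ := abs_sqrt_norm_sub_le hs a b
  have hd : ∀ c d : H, |(inner ℂ c d).re| ≤ ‖c‖ * ‖d‖ := fun c d =>
    (Complex.abs_re_le_norm _).trans (norm_inner_le_norm c d)
  have e : (inner ℂ a t).re / A - (inner ℂ b τ).re / B =
      (inner ℂ (a - b) t).re / A + (inner ℂ b t).re * ((B - A) / (A * B)) +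
        (inner ℂ b (t - τ)).re / B := by
    simp only [inner_sub_left, inner_sub_right, Complex.sub_re]
    field_simp
    ring
  rw [e]
  have b1 : |(inner ℂ (a - b) t).re / A| ≤ 1 / s * ‖a - b‖ * ‖t‖ := by
    rw [abs_div, abs_of_pos hA0, mul_assoc, one_div_mul_eq_div]
    gcongr
    exact hd _ _
  have b2 : |(inner ℂ b t).re * ((B - A) / (A * B))| ≤ 1 / s * ‖a - b‖ * ‖t‖ := by
    rw [abs_mul, abs_div, abs_of_pos (mul_pos hA0 hB0), abs_sub_comm B A]
    calc |(inner ℂ b t).re| * (|A - B| / (A * B)) ≤ (B * ‖t‖) * (‖a - b‖ / (s * B)) := by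
          gcongr
          exact (hd b t).trans (mul_le_mul_of_nonneg_right hBb (norm_nonneg _))
      _ = 1 / s * ‖a - b‖ * ‖t‖ := by field_simp
  have b3 : |(inner ℂ b (t - τ)).re / B| ≤ ‖t - τ‖ := by
    rw [abs_div, abs_of_pos hB0, div_le_iff₀ hB0, mul_comm]
    exact (hd _ _).trans (mul_le_mul_of_nonneg_right hBb (norm_nonneg _))
  calc _ ≤ |(inner ℂ (a - b) t).re / A| + |(inner ℂ b t).re * ((B - A) / (A * B))| +
        |(inner ℂ b (t - τ)).re / B| := abs_add_three _ _ _
    _ ≤ 1 / s * ‖a - b‖ * ‖t‖ + 1 / s * ‖a - b‖ * ‖t‖ + ‖t - τ‖ := by gcongr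
    _ = _ := by ring

lemma abs_re_inner_div_le {s : ℝ} (hs : 0 < s) (a t : H) :
    |(inner ℂ a t).re / √(s ^ 2 + ‖a‖ ^ 2)| ≤ ‖t‖ := by
  have h0 := sqrt_add_sq_pos hs ‖a‖
  rw [abs_div, abs_of_pos h0, div_le_iff₀ h0, mul_comm]
  exact ((Complex.abs_re_le_norm _).trans (norm_inner_le_norm a t)).trans
    (mul_le_mul_of_nonneg_right (le_sqrt_add_sq' s _) (norm_nonneg _))

end Hilbert

lemma setLIntegral_enorm_mul_le {S : Type*} [MeasurableSpace S] {μ : Measure S} {f g : S → ℝ}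
    (hf : AEStronglyMeasurable f μ) (hg : AEStronglyMeasurable g μ) :
    ∫⁻ y, ‖f y * g y‖ₑ ∂μ ≤ eLpNorm f 2 μ * eLpNorm g 2 μ := by
  have h := eLpNorm_smul_le_mul_eLpNorm (p := 2) (q := 2) (r := 1) hg hf
  rw [eLpNorm_one_eq_lintegral_enorm] at h
  exact h

lemma locallyLipschitzOn_of_contDiffOn {E : Type*} [NormedAddCommGroup E] [NormedSpace ℝ E]
    {Ω : Set E} (hΩ : IsOpen Ω) {f : E → ℝ} (hf : ContDiffOn ℝ 1 f Ω) :
    LocallyLipschitzOn Ω f := by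
  intro x hx
  obtain ⟨K, t, ht, h⟩ := (hf.contDiffAt (hΩ.mem_nhds hx)).exists_lipschitzOnWith
  exact ⟨K, t, mem_nhdsWithin_of_mem_nhds ht, h⟩

/-! ### The differential of the regularized norm: pointwise bound and measurability -/

section Kato

variable {m : ℕ} {X : Type*} [EMetricSpace X] [ChartedSpace (EuclideanSpace ℝ (Fin m)) X]
  [RiemannianBundle (fun x : X => TangentSpace (𝓡 m) x)] [IsManifold (𝓡 m) ∞ X]
  [IsContMDiffRiemannianBundle (𝓡 m) ∞ (EuclideanSpace ℝ (Fin m))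
    (fun x : X => TangentSpace (𝓡 m) x)]
  [MeasurableSpace X] [BorelSpace X] [SecondCountableTopology X]

/-- The differential of `√(s^2 + |α|^2)`, where `T` is the covariant derivative of `α`. -/
def normDifferential (s : ℝ) {x : X} (α : TangentSpace (𝓡 m) x →ₗ[ℝ] ℂ)
    (T : TangentSpace (𝓡 m) x →ₗ[ℝ] TangentSpace (𝓡 m) x →ₗ[ℝ] ℂ) :
    TangentSpace (𝓡 m) x →ₗ[ℝ] ℂ where
  toFun v := (((inner ℂ (coords α) (coords (T v))).re / √(s ^ 2 + ‖coords α‖ ^ 2) : ℝ) : ℂ)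
  map_add' v w := by
    rw [map_add, coords_add, inner_add_right, Complex.add_re, add_div, Complex.ofReal_add]
  map_smul' c v := by
    have : coords (c • T v) = (c : ℂ) • coords (T v) := by
      rw [← coords_smul]
      congr 1
    rw [map_smul, this, inner_smul_right, Complex.re_ofReal_mul, mul_div_assoc, RingHom.id_apply,
      Complex.real_smul, Complex.ofReal_mul]

lemma normDifferential_apply (s : ℝ) {x : X} (α : TangentSpace (𝓡 m) x →ₗ[ℝ] ℂ)
    (T : TangentSpace (𝓡 m) x →ₗ[ℝ] TangentSpace (𝓡 m) x →ₗ[ℝ] ℂ) (v : TangentSpace (𝓡 m) x) :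
    normDifferential s α T v =
      (((inner ℂ (coords α) (coords (T v))).re / √(s ^ 2 + ‖coords α‖ ^ 2) : ℝ) : ℂ) := rfl

/-- Kato's inequality, by Cauchy-Schwarz for every frame vector: the quotient |α|/√(s² + |α|²) is at
most 1, so the bound is uniform in s. -/
lemma norm_sq_normDifferential_le {s : ℝ} (hs : 0 < s) {x : X}
    (α : TangentSpace (𝓡 m) x →ₗ[ℝ] ℂ)
    (T : TangentSpace (𝓡 m) x →ₗ[ℝ] TangentSpace (𝓡 m) x →ₗ[ℝ] ℂ) :
    ‖coords (normDifferential s α T)‖ ^ 2 ≤ tensorNormSq T := by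
  rw [norm_coords_sq, tensorNormSq_eq]
  refine Finset.sum_le_sum fun i _ => pow_le_pow_left₀ (norm_nonneg _) ?_ 2
  rw [normDifferential_apply, Complex.norm_real]
  exact abs_re_inner_div_le hs _ _

lemma tensorNormSq_nonneg {x : X}
    (T : TangentSpace (𝓡 m) x →ₗ[ℝ] TangentSpace (𝓡 m) x →ₗ[ℝ] ℂ) : 0 ≤ tensorNormSq T :=
  Finset.sum_nonneg fun _ _ => Finset.sum_nonneg fun _ _ => sq_nonneg _

lemma norm_tensor_apply_sq_le {x : X}
    (T : TangentSpace (𝓡 m) x →ₗ[ℝ] TangentSpace (𝓡 m) x →ₗ[ℝ] ℂ) (v w : TangentSpace (𝓡 m) x) :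
    ‖T v w‖ ^ 2 ≤ tensorNormSq T * (‖v‖ ^ 2 * ‖w‖ ^ 2) := by
  have h1 : ‖coords (T v)‖ ^ 2 ≤ tensorNormSq T * ‖v‖ ^ 2 := by
    have h2 : tensorNormSq T = ∑ j, ‖coords (T.flip (frame m x j))‖ ^ 2 := by
      simp only [tensorNormSq_eq, norm_coords_sq, LinearMap.flip_apply]
      rw [Finset.sum_comm]
    rw [h2, norm_coords_sq, Finset.sum_mul]
    refine Finset.sum_le_sum fun j _ => ?_
    rw [← mul_pow]
    exact pow_le_pow_left₀ (norm_nonneg _) (norm_apply_le (T.flip (frame m x j)) v) 2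
  calc ‖T v w‖ ^ 2 ≤ (‖coords (T v)‖ * ‖w‖) ^ 2 :=
        pow_le_pow_left₀ (norm_nonneg _) (norm_apply_le (T v) w) 2
    _ = ‖coords (T v)‖ ^ 2 * ‖w‖ ^ 2 := mul_pow _ _ _
    _ ≤ tensorNormSq T * ‖v‖ ^ 2 * ‖w‖ ^ 2 := mul_le_mul_of_nonneg_right h1 (sq_nonneg _)
    _ = _ := mul_assoc _ _ _

lemma aestronglyMeasurable_tensor_frame
    {T : ∀ x : X, TangentSpace (𝓡 m) x →ₗ[ℝ] TangentSpace (𝓡 m) x →ₗ[ℝ] ℂ}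
    (hT : ∀ (p : X) i j, AEStronglyMeasurable
      (fun y => T ((chart m p).symm y) (coordField p y i) (coordField p y j))
      (volume.restrict (chart m p).target)) (i : Fin m) :
    AEStronglyMeasurable (fun x => coords (T x (frame m x i))) (riemannianMeasure m X) := by
  refine aestronglyMeasurable_coords (α := fun x => T x (frame m x i)) fun p j => ?_
  have hm := (chart m p).open_target.measurableSet
  have h1 : AEStronglyMeasurable (fun y => ∑ l, ∑ k, (((gram p y)⁻¹ l k *
      inner ℝ (frame m ((chart m p).symm y) i) (coordField p y k) : ℝ) : ℂ) *
        T ((chart m p).symm y) (coordField p y l) (coordField p y j))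
        (volume.restrict (chart m p).target) := by
    refine Finset.aestronglyMeasurable_fun_sum _ fun l _ =>
      Finset.aestronglyMeasurable_fun_sum _ fun k _ => AEStronglyMeasurable.mul ?_ (hT p l j)
    exact Complex.continuous_ofReal.comp_aestronglyMeasurable
      (((continuousOn_gram_inv p l k).aestronglyMeasurable hm).mul
        (aestronglyMeasurable_inner_frame p i k))
  refine h1.congr (ae_restrict_of_forall_mem hm fun y hy => ?_)
  exact (apply_eq_sum_gram_inv p hy ((T ((chart m p).symm y)).flip (coordField p y j)) _).symm

lemma aemeasurable_tensorNormSq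
    {T : ∀ x : X, TangentSpace (𝓡 m) x →ₗ[ℝ] TangentSpace (𝓡 m) x →ₗ[ℝ] ℂ}
    (hT : ∀ (p : X) i j, AEStronglyMeasurable
      (fun y => T ((chart m p).symm y) (coordField p y i) (coordField p y j))
      (volume.restrict (chart m p).target)) :
    AEMeasurable (fun x => ENNReal.ofReal (tensorNormSq (T x))) (riemannianMeasure m X) := by
  simp only [tensorNormSq_eq]
  refine AEMeasurable.ennreal_ofReal ?_
  exact Finset.aemeasurable_fun_sum _ fun i _ =>
    ((aestronglyMeasurable_tensor_frame hT i).norm.aemeasurable.pow_const 2)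

lemma memLp_tensor_component
    {T : ∀ x : X, TangentSpace (𝓡 m) x →ₗ[ℝ] TangentSpace (𝓡 m) x →ₗ[ℝ] ℂ}
    (hT : ∀ (p : X) i j, AEStronglyMeasurable
      (fun y => T ((chart m p).symm y) (coordField p y i) (coordField p y j))
      (volume.restrict (chart m p).target))
    (hT2 : ∫⁻ x, ENNReal.ofReal (tensorNormSq (T x)) ∂(riemannianMeasure m X) ≠ ⊤) (p : X)
    (i j : Fin m) {K : Set (EuclideanSpace ℝ (Fin m))} (hK : IsCompact K)
    (hs : K ⊆ (chart m p).target) :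
    MemLp (fun y => T ((chart m p).symm y) (coordField p y i) (coordField p y j)) 2
      (volume.restrict K) := by
  obtain ⟨C, hC, h⟩ := exists_setLIntegral_chart_le p hK hs
  obtain ⟨ci, hci0, hci⟩ := exists_norm_coordField_le p hK hs i
  obtain ⟨cj, hcj0, hcj⟩ := exists_norm_coordField_le p hK hs j
  refine ⟨(hT p i j).mono_measure (Measure.restrict_mono_set _ hs), ?_⟩
  have h1 : ∫⁻ y in K, ‖T ((chart m p).symm y) (coordField p y i) (coordField p y j)‖ₑ ^ 2 ≤
      ENNReal.ofReal (ci ^ 2 * cj ^ 2) *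
        (C * ∫⁻ x, ENNReal.ofReal (tensorNormSq (T x)) ∂(riemannianMeasure m X)) := by
    refine le_trans ?_ (mul_le_mul_right (h _ (aemeasurable_tensorNormSq hT)) _)
    rw [← lintegral_const_mul' _ _ ENNReal.ofReal_ne_top]
    refine setLIntegral_mono' hK.measurableSet fun y hy => ?_
    rw [← ofReal_norm, ← ENNReal.ofReal_pow (norm_nonneg _),
      ← ENNReal.ofReal_mul (by positivity)]
    refine ENNReal.ofReal_le_ofReal ((norm_tensor_apply_sq_le _ _ _).trans ?_)
    rw [mul_comm]
    refine mul_le_mul_of_nonneg_right ?_ (tensorNormSq_nonneg _)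
    exact mul_le_mul (pow_le_pow_left₀ (norm_nonneg _) (hci y hy) 2)
      (pow_le_pow_left₀ (norm_nonneg _) (hcj y hy) 2) (by positivity) (by positivity)
  have h2 := h1.trans_lt (ENNReal.mul_lt_top ENNReal.ofReal_lt_top
    (ENNReal.mul_lt_top hC.lt_top hT2.lt_top))
  rw [← eLpNorm_two_sq] at h2
  exact (ENNReal.pow_lt_top_iff.1 h2).resolve_right (by norm_num)

lemma aestronglyMeasurable_normDifferential (s : ℝ)
    {α : ∀ x : X, TangentSpace (𝓡 m) x →ₗ[ℝ] ℂ}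
    (hα : AEStronglyMeasurable (fun x => coords (α x)) (riemannianMeasure m X))
    {T : ∀ x : X, TangentSpace (𝓡 m) x →ₗ[ℝ] TangentSpace (𝓡 m) x →ₗ[ℝ] ℂ}
    (hT : ∀ (p : X) i j, AEStronglyMeasurable
      (fun y => T ((chart m p).symm y) (coordField p y i) (coordField p y j))
      (volume.restrict (chart m p).target)) :
    AEStronglyMeasurable (fun x => coords (normDifferential s (α x) (T x)))
      (riemannianMeasure m X) := by
  refine aestronglyMeasurable_euclidean fun i => ?_
  simp only [coords_apply, normDifferential_apply]
  refine Complex.continuous_ofReal.comp_aestronglyMeasurable ?_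
  have h1 : AEStronglyMeasurable (fun x => (inner ℂ (coords (α x))
      (coords (T x (frame m x i)))).re) (riemannianMeasure m X) :=
    Complex.continuous_re.comp_aestronglyMeasurable
      (hα.inner (𝕜 := ℂ) (aestronglyMeasurable_tensor_frame hT i))
  have h2 : AEMeasurable (fun x => √(s ^ 2 + ‖coords (α x)‖ ^ 2)) (riemannianMeasure m X) :=
    ((hα.norm.aemeasurable.pow_const 2).const_add (s ^ 2)).sqrt
  exact (h1.aemeasurable.div h2).aestronglyMeasurable

end Kato

/-! ### The weak differential of the regularized norm -/

section Kato

variable {m : ℕ} {X : Type*} [EMetricSpace X] [ChartedSpace (EuclideanSpace ℝ (Fin m)) X]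
  [RiemannianBundle (fun x : X => TangentSpace (𝓡 m) x)] [IsManifold (𝓡 m) ∞ X]
  [IsContMDiffRiemannianBundle (𝓡 m) ∞ (EuclideanSpace ℝ (Fin m))
    (fun x : X => TangentSpace (𝓡 m) x)]
  [MeasurableSpace X] [BorelSpace X] [SecondCountableTopology X]

/-- For smooth components the derivative is classical: with s > 0 the square root is taken of a
positive smooth function. -/
lemma hasWeakPartial_componentNorm (p : X) {s : ℝ} (hs : 0 < s)
    {φ : Fin m → EuclideanSpace ℝ (Fin m) → ℂ} (hφ : ∀ j, ContDiff ℝ ∞ (φ j)) (i : Fin m) :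
    HasWeakPartial (chart m p).target (EuclideanSpace.single i 1)
      (fun y => ((√(s ^ 2 + ‖coords (covectorOfComponents p y fun j => φ j y)‖ ^ 2) - s : ℝ) : ℂ))
      (fun y => (((inner ℂ (coords (covectorOfComponents p y fun j => φ j y))
        (coords (covectorOfComponents p y (covariantComponents p y i φ)))).re /
          √(s ^ 2 + ‖coords (covectorOfComponents p y fun j => φ j y)‖ ^ 2) : ℝ) : ℂ)) := by
  have ho := (chart m p).open_target
  have hpos : ∀ y ∈ (chart m p).target, 0 < s ^ 2 + componentNormSq p φ y := fun y hy => by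
    rw [componentNormSq_eq p hy]
    positivity
  have hc : ContDiffOn ℝ ∞ (fun y => √(s ^ 2 + componentNormSq p φ y) - s) (chart m p).target :=
    ((contDiffOn_const.add (contDiffOn_componentNormSq p hφ)).sqrt
      fun y hy => (hpos y hy).ne').sub contDiffOn_const
  have h := hasWeakPartial_of_locallyLipschitzOn ho
    (locallyLipschitzOn_of_contDiffOn ho (hc.of_le (by simp))) (EuclideanSpace.single i 1)
  refine h.congr (ae_restrict_of_forall_mem ho.measurableSet fun y hy => ?_)
    (ae_restrict_of_forall_mem ho.measurableSet fun y hy => ?_)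
  · beta_reduce
    rw [componentNormSq_eq p hy]
  · have hq : HasFDerivAt (componentNormSq p φ) (fderiv ℝ (componentNormSq p φ) y) y :=
      (((contDiffOn_componentNormSq p hφ).contDiffAt (ho.mem_nhds hy)).differentiableAt
        (by simp)).hasFDerivAt
    have h1 := (((hq.const_add (s ^ 2)).sqrt (hpos y hy).ne').sub_const s).fderiv
    beta_reduce
    rw [h1]
    simp only [smul_apply, smul_eq_mul]
    rw [fderiv_componentNormSq p hy hφ i, componentNormSq_eq p hy]
    congr 1
    field_simp

lemma coords_sub_covectorOfComponents_le (p : X) {y : EuclideanSpace ℝ (Fin m)}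
    (hy : y ∈ (chart m p).target) {c : ℝ}
    (hc : ∀ α : TangentSpace (𝓡 m) ((chart m p).symm y) →ₗ[ℝ] ℂ,
        ‖coords α‖ ≤ c * ∑ i, ‖α (coordField p y i)‖)
    (α : TangentSpace (𝓡 m) ((chart m p).symm y) →ₗ[ℝ] ℂ) (a : Fin m → ℂ) :
    ‖coords α - coords (covectorOfComponents p y a)‖ ≤ c * ∑ i, ‖a i - α (coordField p y i)‖ := by
  rw [← coords_sub]
  refine (hc _).trans_eq ?_
  congr 1
  refine Finset.sum_congr rfl fun i _ => ?_
  rw [LinearMap.sub_apply, covectorOfComponents_coordField p hy, norm_sub_rev]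

lemma eLpNorm_sum_norm_le {S : Type*} [MeasurableSpace S] {μ : Measure S} {g : Fin m → S → ℂ}
    (hg : ∀ j, AEStronglyMeasurable (g j) μ) {η : ℝ}
    (h : ∀ j, eLpNorm (g j) 2 μ ≤ ENNReal.ofReal η) :
    eLpNorm (fun y => ∑ j, ‖g j y‖) 2 μ ≤ m * ENNReal.ofReal η := by
  have h1 := eLpNorm_sum_le (s := Finset.univ) (p := 2) (fun j _ => (hg j).norm) (by norm_num)
  simp only [eLpNorm_norm] at h1
  refine le_trans (le_of_eq ?_) (h1.trans ((Finset.sum_le_sum fun j _ => h j).trans_eq ?_))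
  · congr 1
    ext y
    simp
  · simp

/-- Kato: `√(s^2 + |α|^2) - s` has the weak differential `normDifferential s α T`, for covector
fields `α` with weak covariant derivative `T`. -/
lemma isWeakDifferential_regularizedNorm {s : ℝ} (hs : 0 < s)
    {α : ∀ x : X, TangentSpace (𝓡 m) x →ₗ[ℝ] ℂ}
    (hα : MemLp (fun x => coords (α x)) 2 (riemannianMeasure m X))
    {T : ∀ x : X, TangentSpace (𝓡 m) x →ₗ[ℝ] TangentSpace (𝓡 m) x →ₗ[ℝ] ℂ}
    (hT : ∀ (p : X) i j, AEStronglyMeasurable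
      (fun y => T ((chart m p).symm y) (coordField p y i) (coordField p y j))
      (volume.restrict (chart m p).target))
    (hT2 : ∫⁻ x, ENNReal.ofReal (tensorNormSq (T x)) ∂(riemannianMeasure m X) ≠ ⊤)
    (hw : ∀ (p : X) i j, HasWeakPartial (chart m p).target (EuclideanSpace.single i 1)
      (fun y => α ((chart m p).symm y) (coordField p y j))
      (fun y => T ((chart m p).symm y) (coordField p y i) (coordField p y j) +
        ∑ k, (christoffel p y k i j : ℂ) * α ((chart m p).symm y) (coordField p y k)))
    (hu : MemLp (fun x => ((√(s ^ 2 + ‖coords (α x)‖ ^ 2) - s : ℝ) : ℂ)) 2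
      (riemannianMeasure m X))
    (hβ : MemLp (fun x => coords (normDifferential s (α x) (T x))) 2 (riemannianMeasure m X)) :
    IsWeakDifferential (fun x => ((√(s ^ 2 + ‖coords (α x)‖ ^ 2) - s : ℝ) : ℂ))
      (fun x => normDifferential s (α x) (T x)) := by
  refine isWeakDifferential_iff.2 fun p i => ?_
  have ho := (chart m p).open_target
  refine HasWeakPartial.of_approx
    (locallyIntegrableOn_of_memLp ho fun K hK hc => memLp_comp_chart_symm hu p hc hK)
    (locallyIntegrableOn_of_memLp ho fun K hK hc => memLp_component hβ p hc hK i) ?_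
  intro K hK hKc ε hε
  set e : EuclideanSpace ℝ (Fin m) := EuclideanSpace.single i 1 with he
  -- components of `α`, of `T` along `e_i`, and of the weak derivative of `α` along `e_i`
  let a : Fin m → EuclideanSpace ℝ (Fin m) → ℂ := fun j y => α ((chart m p).symm y) (coordField p y j)
  let t : Fin m → EuclideanSpace ℝ (Fin m) → ℂ := fun j y =>
    T ((chart m p).symm y) (coordField p y i) (coordField p y j)
  -- The components of α are smoothed to φ with derivatives close to d. On K the Christoffel symbols
  -- are bounded, so the covariant components of φ are close to t, and the classical formula for φ
  -- passes to the limit.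
  let d : Fin m → EuclideanSpace ℝ (Fin m) → ℂ := fun j y =>
    t j y + ∑ k, (christoffel p y k i j : ℂ) * a k y
  have ha2 : ∀ j, ∀ L ⊆ (chart m p).target, IsCompact L → MemLp (a j) 2 (volume.restrict L) :=
    fun j L hL hLc => memLp_component hα p hLc hL j
  have ht2 : ∀ j, ∀ L ⊆ (chart m p).target, IsCompact L → MemLp (t j) 2 (volume.restrict L) :=
    fun j L hL hLc => memLp_tensor_component hT hT2 p i j hLc hL
  have hΓb : ∀ (L : Set (EuclideanSpace ℝ (Fin m))), L ⊆ (chart m p).target → IsCompact L →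
      ∃ M : ℝ, 0 ≤ M ∧ ∀ y ∈ L, ∀ k j, |christoffel p y k i j| ≤ M := by
    intro L hL hLc
    have : ∀ k j, ∃ M, ∀ y ∈ L, ‖christoffel p y k i j‖ ≤ M := fun k j =>
      hLc.exists_bound_of_continuousOn ((continuousOn_christoffel p k i j).mono hL)
    choose M hM using this
    refine ⟨∑ k, ∑ j, |M k j|, Finset.sum_nonneg fun k _ => Finset.sum_nonneg fun j _ =>
      abs_nonneg _, fun y hy k j => (hM k j y hy).trans ((le_abs_self _).trans ?_)⟩
    refine le_trans ?_ (Finset.single_le_sum (f := fun k => ∑ j, |M k j|)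
      (fun k _ => Finset.sum_nonneg fun j _ => abs_nonneg _) (Finset.mem_univ k))
    exact Finset.single_le_sum (f := fun j => |M k j|) (fun j _ => abs_nonneg _) (Finset.mem_univ j)
  have hd2 : ∀ j, ∀ L ⊆ (chart m p).target, IsCompact L → MemLp (d j) 2 (volume.restrict L) := by
    intro j L hL hLc
    obtain ⟨M, hM0, hM⟩ := hΓb L hL hLc
    refine (ht2 j L hL hLc).add (memLp_finsetSum _ fun k _ => ?_)
    refine ((ha2 k L hL hLc).norm.const_mul M).of_le ?_ ?_
    · exact (Complex.continuous_ofReal.comp_aestronglyMeasurable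
        (((continuousOn_christoffel p k i j).mono hL).aestronglyMeasurable hLc.measurableSet)).mul
        (ha2 k L hL hLc).1
    · refine ae_restrict_of_forall_mem hLc.measurableSet fun y hy => ?_
      rw [norm_mul, Complex.norm_real, norm_mul, norm_norm, Real.norm_of_nonneg hM0]
      exact mul_le_mul_of_nonneg_right (hM y hy k j) (norm_nonneg _)
  obtain ⟨c, hc0, hc⟩ := exists_norm_coords_le p hKc hK
  obtain ⟨M, hM0, hM⟩ := hΓb K hK hKc
  obtain ⟨C₁, hC₁, h₁⟩ := exists_setLIntegral_enorm_le (F := ℝ) hKc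
  let tt : EuclideanSpace ℝ (Fin m) → ℝ := fun y => ∑ j, ‖t j y‖
  have htt : MemLp tt 2 (volume.restrict K) :=
    memLp_finsetSum _ fun j _ => (ht2 j K hK hKc).norm
  let c₁ : ℝ := 2 / s * c * c
  let c₂ : ℝ := c * (m * M)
  have hc₁ : 0 ≤ c₁ := by positivity
  have hc₂ : 0 ≤ c₂ := by positivity
  -- D collects the two L¹ errors per unit of η: the first summand belongs to the function, the
  -- bracket to its derivative. The product of the error of α with T is only integrable, by
  -- Cauchy-Schwarz, whence the norm of tt.
  let D : ℝ≥0∞ := ENNReal.ofReal c * (C₁ * m) + (ENNReal.ofReal c₁ * (m * eLpNorm tt 2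
    (volume.restrict K)) + ENNReal.ofReal c₂ * (C₁ * m) + ENNReal.ofReal c * (C₁ * m))
  have hD : D ≠ ⊤ := by
    have := htt.2.ne
    simp only [D]
    finiteness
  obtain ⟨η, hη, hηε⟩ := exists_pos_mul_ofReal_le hD hε
  have happ : ∀ j, ∃ φ : EuclideanSpace ℝ (Fin m) → ℂ, ContDiff ℝ ∞ φ ∧
      eLpNorm (φ - a j) 2 (volume.restrict K) ≤ ENNReal.ofReal η ∧
      eLpNorm ((fun y => fderiv ℝ φ y e) - d j) 2 (volume.restrict K) ≤ ENNReal.ofReal η := by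
    intro j
    obtain ⟨φ, h1, h2, h3⟩ := exists_smooth_approx_local ho (fun _ : Unit => e)
      (h := a j) (k := fun _ => d j) (fun _ => hw p i j) (ha2 j) (fun _ => hd2 j) hKc hK hη
    exact ⟨φ, h1, h2, h3 ()⟩
  choose φ hφ hφ1 hφ2 using happ
  let ee : EuclideanSpace ℝ (Fin m) → ℝ := fun y => ∑ j, ‖φ j y - a j y‖
  let ff : EuclideanSpace ℝ (Fin m) → ℝ := fun y => ∑ j, ‖fderiv ℝ (φ j) y e - d j y‖
  have hem : ∀ j, AEStronglyMeasurable (fun y => φ j y - a j y) (volume.restrict K) := fun j =>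
    (hφ j).continuous.aestronglyMeasurable.sub (ha2 j K hK hKc).1
  have hfm : ∀ j, AEStronglyMeasurable (fun y => fderiv ℝ (φ j) y e - d j y)
      (volume.restrict K) := fun j =>
    (continuous_fderiv_apply_const (hφ j) e).aestronglyMeasurable.sub (hd2 j K hK hKc).1
  have hee : eLpNorm ee 2 (volume.restrict K) ≤ m * ENNReal.ofReal η := eLpNorm_sum_norm_le hem hφ1
  have hff : eLpNorm ff 2 (volume.restrict K) ≤ m * ENNReal.ofReal η := eLpNorm_sum_norm_le hfm hφ2
  have heem : AEStronglyMeasurable ee (volume.restrict K) :=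
    Finset.aestronglyMeasurable_fun_sum _ fun j _ => (hem j).norm
  have hffm : AEStronglyMeasurable ff (volume.restrict K) :=
    Finset.aestronglyMeasurable_fun_sum _ fun j _ => (hfm j).norm
  have hee0 : ∀ y, 0 ≤ ee y := fun y => Finset.sum_nonneg fun j _ => norm_nonneg _
  have hff0 : ∀ y, 0 ≤ ff y := fun y => Finset.sum_nonneg fun j _ => norm_nonneg _
  have htt0 : ∀ y, 0 ≤ tt y := fun y => Finset.sum_nonneg fun j _ => norm_nonneg _
  have ie : ∫⁻ y in K, ‖ee y‖ₑ ≤ C₁ * m * ENNReal.ofReal η := by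
    refine (h₁ _ heem).trans ?_
    rw [mul_assoc]
    exact mul_le_mul_right hee _
  have jf : ∫⁻ y in K, ‖ff y‖ₑ ≤ C₁ * m * ENNReal.ofReal η := by
    refine (h₁ _ hffm).trans ?_
    rw [mul_assoc]
    exact mul_le_mul_right hff _
  have iet : ∫⁻ y in K, ‖ee y * tt y‖ₑ ≤ m * eLpNorm tt 2 (volume.restrict K) *
      ENNReal.ofReal η := by
    refine (setLIntegral_enorm_mul_le heem htt.1).trans ?_
    calc _ ≤ m * ENNReal.ofReal η * eLpNorm tt 2 (volume.restrict K) := mul_le_mul_left hee _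
      _ = _ := by ring
  have hA : ∀ y ∈ K, ‖coords (α ((chart m p).symm y)) -
      coords (covectorOfComponents p y fun j => φ j y)‖ ≤ c * ee y := fun y hy =>
    coords_sub_covectorOfComponents_le p (hK hy) (hc y hy) _ _
  have hτ : ∀ y ∈ K, ‖coords (T ((chart m p).symm y) (coordField p y i)) -
      coords (covectorOfComponents p y (covariantComponents p y i φ))‖ ≤
        c * ff y + c₂ * ee y := by
    intro y hy
    refine (coords_sub_covectorOfComponents_le p (hK hy) (hc y hy) _ _).trans ?_
    have h1 : ∀ j, ‖covariantComponents p y i φ j -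
        T ((chart m p).symm y) (coordField p y i) (coordField p y j)‖ ≤
        ‖fderiv ℝ (φ j) y e - d j y‖ + M * ee y := by
      intro j
      have h2 : covariantComponents p y i φ j -
          T ((chart m p).symm y) (coordField p y i) (coordField p y j) =
          (fderiv ℝ (φ j) y e - d j y) - ∑ k, (christoffel p y k i j : ℂ) * (φ k y - a k y) := by
        simp only [covariantComponents, d, t, mul_sub, Finset.sum_sub_distrib]
        ring
      rw [h2]
      refine (norm_sub_le _ _).trans (add_le_add le_rfl ((norm_sum_le _ _).trans ?_))
      rw [Finset.mul_sum]
      refine Finset.sum_le_sum fun k _ => ?_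
      rw [norm_mul, Complex.norm_real]
      exact mul_le_mul_of_nonneg_right (hM y hy k j) (norm_nonneg _)
    calc _ ≤ c * ∑ j, (‖fderiv ℝ (φ j) y e - d j y‖ + M * ee y) :=
          mul_le_mul_of_nonneg_left (Finset.sum_le_sum fun j _ => h1 j) hc0
      _ = c * ff y + c₂ * ee y := by
          rw [Finset.sum_add_distrib, Finset.sum_const, Finset.card_univ, Fintype.card_fin,
            nsmul_eq_mul]
          simp only [ff, c₂]
          ring
  refine ⟨_, _, _, hK, hasWeakPartial_componentNorm p hs hφ i, ?_, ?_⟩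
  · calc _ ≤ ∫⁻ y in K, ENNReal.ofReal c * ‖ee y‖ₑ := by
          refine setLIntegral_mono' hKc.measurableSet fun y hy => ?_
          rw [← ofReal_norm, ← ofReal_norm, ← ENNReal.ofReal_mul hc0, ← Complex.ofReal_sub,
            Complex.norm_real, Real.norm_of_nonneg (hee0 y), sub_sub_sub_cancel_right]
          exact ENNReal.ofReal_le_ofReal ((abs_sqrt_norm_sub_le hs _ _).trans (hA y hy))
      _ = ENNReal.ofReal c * ∫⁻ y in K, ‖ee y‖ₑ := lintegral_const_mul' _ _ ENNReal.ofReal_ne_top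
      _ ≤ ENNReal.ofReal c * (C₁ * m * ENNReal.ofReal η) := mul_le_mul_right ie _
      _ ≤ D * ENNReal.ofReal η := by
          rw [← mul_assoc]
          exact mul_le_mul_left le_self_add _
      _ ≤ _ := hηε
  · calc _ ≤ ∫⁻ y in K, (ENNReal.ofReal c₁ * ‖ee y * tt y‖ₑ + ENNReal.ofReal c₂ * ‖ee y‖ₑ +
            ENNReal.ofReal c * ‖ff y‖ₑ) := by
          refine setLIntegral_mono' hKc.measurableSet fun y hy => ?_
          have h3 := abs_re_inner_div_sub_le hs (coords (α ((chart m p).symm y)))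
            (coords (covectorOfComponents p y fun j => φ j y))
            (coords (T ((chart m p).symm y) (coordField p y i)))
            (coords (covectorOfComponents p y (covariantComponents p y i φ)))
          have h4 : ‖coords (T ((chart m p).symm y) (coordField p y i))‖ ≤ c * tt y := hc y hy _
          have h5 := hA y hy
          have h6 := hτ y hy
          rw [← ofReal_norm, ← ofReal_norm, ← ofReal_norm, ← ofReal_norm,
            ← ENNReal.ofReal_mul hc0, ← ENNReal.ofReal_mul hc₁, ← ENNReal.ofReal_mul hc₂,
            Real.norm_of_nonneg (mul_nonneg (hee0 y) (htt0 y)), Real.norm_of_nonneg (hee0 y),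
            Real.norm_of_nonneg (hff0 y),
            ← ENNReal.ofReal_add (mul_nonneg hc₁ (mul_nonneg (hee0 y) (htt0 y)))
              (mul_nonneg hc₂ (hee0 y)),
            ← ENNReal.ofReal_add (add_nonneg (mul_nonneg hc₁ (mul_nonneg (hee0 y) (htt0 y)))
              (mul_nonneg hc₂ (hee0 y))) (mul_nonneg hc0 (hff0 y)),
            normDifferential_apply, ← Complex.ofReal_sub, Complex.norm_real]
          refine ENNReal.ofReal_le_ofReal (h3.trans ?_)
          calc _ ≤ 2 / s * (c * ee y) * (c * tt y) + (c * ff y + c₂ * ee y) := by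
                gcongr
            _ = _ := by
                simp only [c₁]
                ring
      _ = ENNReal.ofReal c₁ * (∫⁻ y in K, ‖ee y * tt y‖ₑ) +
            ENNReal.ofReal c₂ * (∫⁻ y in K, ‖ee y‖ₑ) +
            ENNReal.ofReal c * ∫⁻ y in K, ‖ff y‖ₑ := by
          rw [lintegral_add_right' _ (hffm.enorm.const_mul _),
            lintegral_add_right' _ (heem.enorm.const_mul _),
            lintegral_const_mul' _ _ ENNReal.ofReal_ne_top,
            lintegral_const_mul' _ _ ENNReal.ofReal_ne_top,
            lintegral_const_mul' _ _ ENNReal.ofReal_ne_top]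
      _ ≤ ENNReal.ofReal c₁ * (m * eLpNorm tt 2 (volume.restrict K) * ENNReal.ofReal η) +
            ENNReal.ofReal c₂ * (C₁ * m * ENNReal.ofReal η) +
            ENNReal.ofReal c * (C₁ * m * ENNReal.ofReal η) :=
          add_le_add (add_le_add (mul_le_mul_right iet _) (mul_le_mul_right ie _))
            (mul_le_mul_right jf _)
      _ = (ENNReal.ofReal c₁ * (m * eLpNorm tt 2 (volume.restrict K)) +
            ENNReal.ofReal c₂ * (C₁ * m) + ENNReal.ofReal c * (C₁ * m)) * ENNReal.ofReal η := by
          ring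
      _ ≤ D * ENNReal.ofReal η := mul_le_mul_left le_add_self _
      _ ≤ _ := hηε

end Kato

/-! ### Non-concentration of differentials -/

section Kato

variable {m : ℕ} {X : Type*} [EMetricSpace X] [ChartedSpace (EuclideanSpace ℝ (Fin m)) X]
  [RiemannianBundle (fun x : X => TangentSpace (𝓡 m) x)] [IsManifold (𝓡 m) ∞ X]
  [IsContMDiffRiemannianBundle (𝓡 m) ∞ (EuclideanSpace ℝ (Fin m))
    (fun x : X => TangentSpace (𝓡 m) x)]
  [MeasurableSpace X] [BorelSpace X] [SecondCountableTopology X]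

lemma exists_smooth_one_nhds {K : Set X} (hK : IsCompact K) :
    ∃ (L : Set X) (θ : X → ℂ), IsCompact L ∧ ContMDiff (𝓡 m) 𝓘(ℝ, ℂ) ∞ θ ∧ (∀ x, ‖θ x‖ ≤ 1) ∧
      (∀ x ∈ K, θ =ᶠ[𝓝 x] fun _ => 1) ∧ ∀ x ∉ L, θ x = 0 ∧ differential m θ x = 0 := by
  have := ChartedSpace.locallyCompactSpace (EuclideanSpace ℝ (Fin m)) X
  obtain ⟨L, hL, hKL⟩ := exists_compact_superset hK
  obtain ⟨ρ, h1, h2, h3⟩ := exists_contMDiffMap_one_nhds_of_subset_interior (n := (⊤ : ℕ∞)) (𝓡 m)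
    hK.isClosed hKL
  have hs : tsupport (fun x => (ρ x : ℂ)) ⊆ L :=
    closure_minimal (fun x hx => by
      by_contra h
      exact hx (by simp [h2 x h])) hL.isClosed
  refine ⟨L, fun x => (ρ x : ℂ), hL, (Complex.ofRealCLM.contDiff.contMDiff (n := ∞)).comp
    ρ.contMDiff, fun x => ?_, fun x hx => ?_, fun x hx => ?_⟩
  · rw [Complex.norm_real, Real.norm_of_nonneg (h3 x).1]
    exact (h3 x).2
  · filter_upwards [h1.filter_mono (nhds_le_nhdsSet hx)] with y hy
    rw [hy, Complex.ofReal_one]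
  · have h4 : x ∉ tsupport fun x => (ρ x : ℂ) := fun h => hx (hs h)
    refine ⟨image_eq_zero_of_notMem_tsupport (f := fun x => (ρ x : ℂ)) h4, ?_⟩
    have h5 := (notMem_tsupport_iff_eventuallyEq.1 h4).mfderiv_eq (I := 𝓡 m) (I' := 𝓘(ℝ, ℂ))
    ext v
    refine (DFunLike.congr_fun (F := TangentSpace (𝓡 m) x →L[ℝ] ℂ) h5 v).trans ?_
    exact DFunLike.congr_fun (F := TangentSpace (𝓡 m) x →L[ℝ] ℂ)
      (mfderiv_const (I := 𝓡 m) (I' := 𝓘(ℝ, ℂ)) (c := (0 : ℂ)) (x := x)) v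

lemma enorm_sq_eq_lintegral {F : Type*} [NormedAddCommGroup F] {S : Type*} [MeasurableSpace S]
    {μ : Measure S} (f : Lp F 2 μ) : ENNReal.ofReal (‖f‖ ^ 2) = ∫⁻ x, ‖f x‖ₑ ^ 2 ∂μ := by
  rw [ENNReal.ofReal_pow (norm_nonneg _), ofReal_norm, Lp.enorm_def, eLpNorm_two_sq]

lemma ofReal_norm_sq_formDomain {U : Opens X} (v : FormDomain m U) :
    ENNReal.ofReal (‖v‖ ^ 2) =
      ∫⁻ x, (‖value m U v x‖ₑ ^ 2 + ‖gradient m U v x‖ₑ ^ 2) ∂(riemannianMeasure m X) := by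
  rw [norm_sq_formDomain, ENNReal.ofReal_add (sq_nonneg _) (sq_nonneg _), enorm_sq_eq_lintegral,
    enorm_sq_eq_lintegral, lintegral_add_left']
  exact (Lp.aestronglyMeasurable _).enorm.pow_const 2

lemma embedding_top_ae (v : FormDomain m (⊤ : Opens X)) :
    embedding m ⊤ v =ᵐ[riemannianMeasure m X] value m ⊤ v := by
  filter_upwards [(ae_restrict_iff' (⊤ : Opens X).isOpen.measurableSet).1 (embedding_ae v)]
    with x hx using hx (mem_univ x)

lemma IsNonConcentrating.setLIntegral_le {A : Set X} {δ : ℝ} (h : IsNonConcentrating m A δ)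
    (v : FormDomain m (⊤ : Opens X)) :
    ∫⁻ x in A, ‖value m ⊤ v x‖ₑ ^ 2 ∂(riemannianMeasure m X) ≤
      ENNReal.ofReal δ ^ 2 * ENNReal.ofReal (‖v‖ ^ 2) := by
  have h1 := h.2 v
  rw [eLpNorm_congr_ae (ae_restrict_of_ae (embedding_top_ae v))] at h1
  rw [← eLpNorm_two_sq, ENNReal.ofReal_pow (norm_nonneg _), ← mul_pow, ← ENNReal.ofReal_mul h.1.le]
  exact pow_le_pow_left' h1 2

/-- The energy of a cut-off function: y is a bound for its value, z bounds the differential before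
cutting off, and cy is the contribution of the cut-off. The cross term is split by 2zy ≤ z² + y², so
the constant tends to 1 as c → 0. -/
lemma sq_add_sq_mul_le {c a t y z : ℝ} (hc : 0 ≤ c) (hy0 : 0 ≤ y)
    (hy : y ≤ a) (hz : z ^ 2 ≤ t) :
    y ^ 2 + (z + c * y) ^ 2 ≤ (1 + c + c ^ 2) * (a ^ 2 + t) := by
  have h1 : y ^ 2 ≤ a ^ 2 := pow_le_pow_left₀ hy0 hy 2
  have h2 : (z + c * y) ^ 2 ≤ (1 + c) * z ^ 2 + (c + c ^ 2) * y ^ 2 := by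
    nlinarith [mul_nonneg hc (sq_nonneg (z - y))]
  have h3 : (1 + c) * z ^ 2 ≤ (1 + c) * t := mul_le_mul_of_nonneg_left hz (by positivity)
  have h4 : (c + c ^ 2) * y ^ 2 ≤ (c + c ^ 2) * a ^ 2 :=
    mul_le_mul_of_nonneg_left h1 (by positivity)
  nlinarith [mul_nonneg (sq_nonneg c) ((sq_nonneg z).trans hz)]

lemma tendsto_sqrt_add_sq_sub {ι : Type*} {l : Filter ι} {s η : ι → ℝ} (hs : Tendsto s l (𝓝 0))
    (hη : Tendsto η l (𝓝 1)) {a : ℝ} (ha : 0 ≤ a) :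
    Tendsto (fun n => (η n : ℂ) * ((√(s n ^ 2 + a ^ 2) - s n : ℝ) : ℂ)) l (𝓝 (a : ℂ)) := by
  have h1 : Tendsto (fun n => η n * (√(s n ^ 2 + a ^ 2) - s n)) l
      (𝓝 (1 * (√((0 : ℝ) ^ 2 + a ^ 2) - 0))) :=
    hη.mul ((Real.continuous_sqrt.tendsto _ |>.comp ((hs.pow 2).add_const _)).sub hs)
  have h2 : (1 * (√((0 : ℝ) ^ 2 + a ^ 2) - 0)) = a := by
    rw [one_mul, sub_zero, zero_pow two_ne_zero, zero_add, Real.sqrt_sq ha]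
  rw [h2] at h1
  refine ((Complex.continuous_ofReal.tendsto a).comp h1).congr fun n => ?_
  simp

variable [IsRiemannianManifold (𝓡 m) X]

/-- Here f itself need not belong to H¹(X) as defined by completion. Multiplication by a smooth
compactly supported θ, equal to 1 near supp χ, gives an element of the form domain, and multiplying
by χ then removes every trace of θ. -/
lemma exists_lipschitz_mul_of_compact {χ : X → ℝ} {K : NNReal} (hχ : LipschitzWith K χ)
    (h1 : ∀ x, ‖(χ x : ℂ)‖ ≤ 1) (hs : HasCompactSupport χ) {f : X → ℂ}
    {α : ∀ x : X, TangentSpace (𝓡 m) x →ₗ[ℝ] ℂ} (h : IsWeakDifferential f α)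
    (hf : MemLp f 2 (riemannianMeasure m X))
    (hα : MemLp (fun x => coords (α x)) 2 (riemannianMeasure m X)) :
    ∃ w : FormDomain m (⊤ : Opens X),
      value m ⊤ w =ᵐ[riemannianMeasure m X] (fun x => (χ x : ℂ) * f x) ∧
      gradient m ⊤ w =ᵐ[riemannianMeasure m X] fun x =>
        (χ x : ℂ) • coords (α x) + f x • coords (realDifferential m χ x) := by
  obtain ⟨L, θ, hL, hθ, hθ1, hθK, hθL⟩ := exists_smooth_one_nhds (m := m) hs
  obtain ⟨c, hc⟩ := hL.exists_bound_of_continuousOn (continuous_norm_differential hθ).continuousOn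
  have e : ∀ x, coords (θ x • α x + f x • differential m θ x) =
      θ x • coords (α x) + f x • coords (differential m θ x) := fun x => by
    rw [coords_add, coords_smul, coords_smul]
  have m1 : MemLp (fun x => θ x * f x) 2 (riemannianMeasure m X) :=
    memLp_two_of_bounded_smul (F := ℂ) hf hθ.continuous.aestronglyMeasurable hθ1
  have m2 : MemLp (fun x => coords (θ x • α x + f x • differential m θ x)) 2
      (riemannianMeasure m X) := by
    simp only [e]
    refine (memLp_two_of_bounded_smul hα hθ.continuous.aestronglyMeasurable hθ1).add ?_
    refine (hf.norm.const_mul |c|).of_le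
      (hf.1.smul (aestronglyMeasurable_differential hθ)) (Eventually.of_forall fun x => ?_)
    rw [norm_smul, norm_mul, norm_norm, Real.norm_eq_abs, abs_abs, mul_comm]
    by_cases hx : x ∈ L
    · have := hc x hx
      rw [norm_norm] at this
      exact mul_le_mul_of_nonneg_right (this.trans (le_abs_self c)) (norm_nonneg _)
    · rw [(hθL x hx).2, coords_zero, norm_zero, zero_mul]
      positivity
  obtain ⟨v, hv1, hv2⟩ := exists_formDomain_of_compact (U := (⊤ : Opens X)) hL (subset_univ _)
    (h.mul_smooth hθ) m1 m2 (fun x hx => by rw [(hθL x hx).1, zero_mul]) fun x hx => by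
      rw [(hθL x hx).1, (hθL x hx).2, zero_smul, smul_zero, add_zero]
  obtain ⟨w, hw1, hw2⟩ := exists_lipschitz_mul (U := (⊤ : Opens X)) hχ h1 (subset_univ _) v
  refine ⟨w, ?_, ?_⟩
  · filter_upwards [hw1, hv1] with x a1 a2
    rw [a1, a2]
    by_cases hx : x ∈ tsupport χ
    · rw [(hθK x hx).eq_of_nhds, one_mul]
    · rw [image_eq_zero_of_notMem_tsupport hx, Complex.ofReal_zero, zero_mul, zero_mul]
  · filter_upwards [hw2, hv1, hv2] with x a1 a2 a3
    rw [a1, a2, a3, e]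
    by_cases hx : x ∈ tsupport χ
    · have h5 : differential m θ x = 0 := by
        have h6 := (hθK x hx).mfderiv_eq (I := 𝓡 m) (I' := 𝓘(ℝ, ℂ))
        ext v
        refine (DFunLike.congr_fun (F := TangentSpace (𝓡 m) x →L[ℝ] ℂ) h6 v).trans ?_
        exact DFunLike.congr_fun (F := TangentSpace (𝓡 m) x →L[ℝ] ℂ)
          (mfderiv_const (I := 𝓡 m) (I' := 𝓘(ℝ, ℂ)) (c := (1 : ℂ)) (x := x)) v
      rw [(hθK x hx).eq_of_nhds, h5, coords_zero, smul_zero, add_zero, one_smul, one_mul]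
    · rw [realDifferential_eq_zero (c := 0) (notMem_tsupport_iff_eventuallyEq.1 hx),
        image_eq_zero_of_notMem_tsupport hx, coords_zero, Complex.ofReal_zero]
      simp

/-- The regularized norms of a covector field `α` with weak covariant derivative `T`, cut off by
`η`, have energy bounded by that of `α`. -/
lemma exists_formDomain_regularizedNorm {c : ℝ} (hc : 0 < c) {η : X → ℝ} {K : NNReal}
    (hη : LipschitzWith K η) (hKc : (K : ℝ) ≤ c) (h1 : ∀ x, ‖(η x : ℂ)‖ ≤ 1)
    (hs : HasCompactSupport η) {α : ∀ x : X, TangentSpace (𝓡 m) x →ₗ[ℝ] ℂ}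
    (hα : MemLp (fun x => coords (α x)) 2 (riemannianMeasure m X))
    {T : ∀ x : X, TangentSpace (𝓡 m) x →ₗ[ℝ] TangentSpace (𝓡 m) x →ₗ[ℝ] ℂ}
    (hT : ∀ (p : X) i j, AEStronglyMeasurable
      (fun y => T ((chart m p).symm y) (coordField p y i) (coordField p y j))
      (volume.restrict (chart m p).target))
    (hT2 : ∫⁻ x, ENNReal.ofReal (tensorNormSq (T x)) ∂(riemannianMeasure m X) ≠ ⊤)
    (hw : ∀ (p : X) i j, HasWeakPartial (chart m p).target (EuclideanSpace.single i 1)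
      (fun y => α ((chart m p).symm y) (coordField p y j))
      (fun y => T ((chart m p).symm y) (coordField p y i) (coordField p y j) +
        ∑ k, (christoffel p y k i j : ℂ) * α ((chart m p).symm y) (coordField p y k))) :
    ∃ w : FormDomain m (⊤ : Opens X),
      (value m ⊤ w =ᵐ[riemannianMeasure m X] fun x =>
        (η x : ℂ) * ((√(c ^ 2 + ‖coords (α x)‖ ^ 2) - c : ℝ) : ℂ)) ∧
      ENNReal.ofReal (‖w‖ ^ 2) ≤ ENNReal.ofReal (1 + c + c ^ 2) *
        ∫⁻ x, (‖coords (α x)‖ₑ ^ 2 + ENNReal.ofReal (tensorNormSq (T x)))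
          ∂(riemannianMeasure m X) := by
  have hu : MemLp (fun x => ((√(c ^ 2 + ‖coords (α x)‖ ^ 2) - c : ℝ) : ℂ)) 2
      (riemannianMeasure m X) := by
    refine hα.of_le (Complex.continuous_ofReal.comp_aestronglyMeasurable ?_)
      (Eventually.of_forall fun x => ?_)
    · exact ((((hα.1.norm.aemeasurable.pow_const 2).const_add (c ^ 2)).sqrt).sub_const
        c).aestronglyMeasurable
    · have := sqrt_add_sq_sub_mem hc (norm_nonneg (coords (α x)))
      rw [Complex.norm_real, Real.norm_of_nonneg this.1]
      exact this.2
  have hβ : MemLp (fun x => coords (normDifferential c (α x) (T x))) 2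
      (riemannianMeasure m X) := by
    refine ⟨aestronglyMeasurable_normDifferential c hα.1 hT, ?_⟩
    have h2 : ∫⁻ x, ‖coords (normDifferential c (α x) (T x))‖ₑ ^ 2 ∂(riemannianMeasure m X) ≤
        ∫⁻ x, ENNReal.ofReal (tensorNormSq (T x)) ∂(riemannianMeasure m X) := by
      refine lintegral_mono fun x => ?_
      rw [← ofReal_norm, ← ENNReal.ofReal_pow (norm_nonneg _)]
      exact ENNReal.ofReal_le_ofReal (norm_sq_normDifferential_le hc _ _)
    rw [← eLpNorm_two_sq] at h2
    exact (ENNReal.pow_lt_top_iff.1 (h2.trans_lt hT2.lt_top)).resolve_right (by norm_num)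
  obtain ⟨w, hw1, hw2⟩ := exists_lipschitz_mul_of_compact hη h1 hs
    (isWeakDifferential_regularizedNorm hc hα hT hT2 hw hu hβ) hu hβ
  refine ⟨w, hw1, ?_⟩
  rw [ofReal_norm_sq_formDomain, ← lintegral_const_mul' _ _ ENNReal.ofReal_ne_top]
  refine lintegral_mono_ae ?_
  filter_upwards [hw1, hw2] with x a1 a2
  have b := sqrt_add_sq_sub_mem hc (norm_nonneg (coords (α x)))
  set y := √(c ^ 2 + ‖coords (α x)‖ ^ 2) - c with hy
  have b1 : ‖value m ⊤ w x‖ ≤ y := by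
    rw [a1, norm_mul, Complex.norm_real y, Real.norm_of_nonneg b.1]
    exact mul_le_of_le_one_left b.1 (h1 x)
  have b2 : ‖gradient m ⊤ w x‖ ≤ ‖coords (normDifferential c (α x) (T x))‖ + c * y := by
    rw [a2]
    refine (norm_add_le _ _).trans (add_le_add ?_ ?_)
    · rw [norm_smul]
      exact mul_le_of_le_one_left (norm_nonneg _) (h1 x)
    · rw [norm_smul, Complex.norm_real y, Real.norm_of_nonneg b.1, mul_comm]
      exact mul_le_mul_of_nonneg_right ((norm_coords_realDifferential_le hη x).trans hKc) b.1
  rw [← ofReal_norm, ← ofReal_norm, ← ofReal_norm, ← ENNReal.ofReal_pow (norm_nonneg _),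
    ← ENNReal.ofReal_pow (norm_nonneg _), ← ENNReal.ofReal_pow (norm_nonneg _),
    ← ENNReal.ofReal_add (sq_nonneg _) (sq_nonneg _),
    ← ENNReal.ofReal_add (sq_nonneg _) (tensorNormSq_nonneg _),
    ← ENNReal.ofReal_mul (by positivity)]
  refine ENNReal.ofReal_le_ofReal (le_trans (add_le_add (pow_le_pow_left₀ (norm_nonneg _) b1 2)
    (pow_le_pow_left₀ (norm_nonneg _) b2 2)) ?_)
  exact sq_add_sq_mul_le hc.le b.1 b.2 (norm_sq_normDifferential_le hc _ _)

variable [CompleteSpace X]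

/-- Non-concentration is applied to cut-off regularizations of |α|, which lie in H¹(X) and whose
energy is controlled by Kato's inequality; removing cut-off and regularization together by Fatou's
lemma gives the bound with the same δ. -/
lemma IsNonConcentrating.lintegral_coords_le {A : Set X} {δ : ℝ} (h : IsNonConcentrating m A δ)
    {f : X → ℂ} {α : ∀ x : X, TangentSpace (𝓡 m) x →ₗ[ℝ] ℂ} (hf : IsWeakDifferential f α)
    {T : ∀ x : X, TangentSpace (𝓡 m) x →ₗ[ℝ] TangentSpace (𝓡 m) x →ₗ[ℝ] ℂ}
    (hαT : IsWeakCovariantDerivative α T) :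
    ∫⁻ x in A, ‖coords (α x)‖ₑ ^ 2 ∂(riemannianMeasure m X) ≤ ENNReal.ofReal δ ^ 2 *
      ∫⁻ x, ENNReal.ofReal (‖f x‖ ^ 2 + covectorNormSq (α x) + tensorNormSq (T x))
        ∂(riemannianMeasure m X) := by
  set N := ∫⁻ x, (‖coords (α x)‖ₑ ^ 2 + ENNReal.ofReal (tensorNormSq (T x)))
    ∂(riemannianMeasure m X) with hN
  have hNle : N ≤ ∫⁻ x, ENNReal.ofReal (‖f x‖ ^ 2 + covectorNormSq (α x) + tensorNormSq (T x))
      ∂(riemannianMeasure m X) := by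
    refine lintegral_mono fun x => ?_
    rw [covectorNormSq_eq, ← ofReal_norm, ← ENNReal.ofReal_pow (norm_nonneg _),
      ← ENNReal.ofReal_add (sq_nonneg _) (tensorNormSq_nonneg _)]
    exact ENNReal.ofReal_le_ofReal (by linarith [sq_nonneg ‖f x‖])
  refine le_trans ?_ (mul_le_mul_right hNle _)
  have hδ : ENNReal.ofReal δ ^ 2 ≠ 0 := pow_ne_zero _ (by simpa using h.1)
  -- If the right-hand side is infinite nothing has to be shown, since δ > 0. Otherwise α and T are
  -- square integrable.
  rcases eq_or_ne N ⊤ with hNt | hNt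
  · rw [hNt, ENNReal.mul_top hδ]
    exact le_top
  have hm : ∀ p : X, MeasurableSet (chart m p).target := fun p =>
    (chart m p).open_target.measurableSet
  have hα1 : ∀ (p : X) i, LocallyIntegrableOn
      (fun y => α ((chart m p).symm y) (coordField p y i)) (chart m p).target volume := fun p i =>
    (hf p i).2.1
  have hT : ∀ (p : X) i j, AEStronglyMeasurable
      (fun y => T ((chart m p).symm y) (coordField p y i) (coordField p y j))
      (volume.restrict (chart m p).target) := fun p i j =>
    (hαT p i j).1.aestronglyMeasurable
  have hαm : AEStronglyMeasurable (fun x => coords (α x)) (riemannianMeasure m X) :=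
    aestronglyMeasurable_coords fun p i => (hα1 p i).aestronglyMeasurable
  have hα : MemLp (fun x => coords (α x)) 2 (riemannianMeasure m X) := by
    refine ⟨hαm, ?_⟩
    have h2 : ∫⁻ x, ‖coords (α x)‖ₑ ^ 2 ∂(riemannianMeasure m X) ≤ N :=
      lintegral_mono fun x => le_self_add
    rw [← eLpNorm_two_sq] at h2
    exact (ENNReal.pow_lt_top_iff.1 (h2.trans_lt hNt.lt_top)).resolve_right (by norm_num)
  have hT2 : ∫⁻ x, ENNReal.ofReal (tensorNormSq (T x)) ∂(riemannianMeasure m X) ≠ ⊤ :=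
    ((lintegral_mono fun x => le_add_self).trans_lt hNt.lt_top).ne
  have hw : ∀ (p : X) i j, HasWeakPartial (chart m p).target (EuclideanSpace.single i 1)
      (fun y => α ((chart m p).symm y) (coordField p y j))
      (fun y => T ((chart m p).symm y) (coordField p y i) (coordField p y j) +
        ∑ k, (christoffel p y k i j : ℂ) * α ((chart m p).symm y) (coordField p y k)) := by
    intro p i j
    refine ⟨hα1 p j, (hαT p i j).1.add ?_, (hαT p i j).2⟩
    rw [← Finset.sum_fn]
    refine Finset.sum_induction _ (fun g => LocallyIntegrableOn g (chart m p).target volume)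
      (fun _ _ => LocallyIntegrableOn.add) locallyIntegrableOn_zero fun k _ => ?_
    exact (hα1 p k).continuousOn_mul
      (Complex.continuous_ofReal.comp_continuousOn (continuousOn_christoffel p k i j))
      (chart m p).open_target.isLocallyClosed
  have := ChartedSpace.locallyCompactSpace (EuclideanSpace ℝ (Fin m)) X
  obtain ⟨η, hη, hη1, hηs, hηt⟩ := exists_lipschitz_cutoffs fun (x : X) r =>
    isCompact_closedEBall_of_length (exists_edist_le_edist_lt m) x r
  -- One sequence serves as regularization parameter and as Lipschitz constant of the cut-offs, so
  -- that a single parameter tends to 0.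
  let c : ℕ → ℝ := fun n => ((n : ℝ) + 1)⁻¹
  have hc : ∀ n, 0 < c n := fun n => by positivity
  have hc0 : Tendsto c atTop (𝓝 0) := by
    simpa only [one_div] using tendsto_one_div_add_atTop_nhds_zero_nat (𝕜 := ℝ)
  have hex := fun n => exists_formDomain_regularizedNorm (hc n) (hη n) (by simp [c])
    (fun x => by
      rw [Complex.norm_real, Real.norm_of_nonneg (hη1 n x).1]
      exact (hη1 n x).2) (hηs n) hα hT hT2 hw
  choose w hw1 hw2 using hex
  have hb : ∀ n, ∫⁻ x in A, ‖value m ⊤ (w n) x‖ₑ ^ 2 ∂(riemannianMeasure m X) ≤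
      ENNReal.ofReal δ ^ 2 * (ENNReal.ofReal (1 + c n + c n ^ 2) * N) := fun n =>
    (h.setLIntegral_le (w n)).trans (mul_le_mul_right (hw2 n) _)
  have hlim : Tendsto (fun n => ENNReal.ofReal δ ^ 2 * (ENNReal.ofReal (1 + c n + c n ^ 2) * N))
      atTop (𝓝 (ENNReal.ofReal δ ^ 2 * N)) := by
    have h3 : Tendsto (fun n => ENNReal.ofReal (1 + c n + c n ^ 2)) atTop (𝓝 1) := by
      have := ENNReal.tendsto_ofReal ((hc0.const_add 1).add (hc0.pow 2))
      simpa using this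
    have h4 := ENNReal.Tendsto.mul_const (b := N) h3 (Or.inr hNt)
    rw [one_mul] at h4
    exact ENNReal.Tendsto.const_mul h4 (Or.inr (by finiteness))
  calc ∫⁻ x in A, ‖coords (α x)‖ₑ ^ 2 ∂(riemannianMeasure m X)
      = ∫⁻ x in A, liminf (fun n => ‖value m ⊤ (w n) x‖ₑ ^ 2) atTop ∂(riemannianMeasure m X) := by
        refine lintegral_congr_ae (ae_restrict_of_ae ?_)
        filter_upwards [ae_all_iff.2 hw1] with x hx
        have h5 := tendsto_sqrt_add_sq_sub hc0 (hηt x) (norm_nonneg (coords (α x)))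
        have h6 : Tendsto (fun n => ‖value m ⊤ (w n) x‖ₑ ^ 2) atTop
            (𝓝 (‖(‖coords (α x)‖ : ℂ)‖ₑ ^ 2)) := by
          simp only [hx]
          exact ((ENNReal.continuous_pow 2).comp continuous_enorm).tendsto _ |>.comp h5
        rw [h6.liminf_eq, ← ofReal_norm, ← ofReal_norm, Complex.norm_real, norm_norm]
    _ ≤ liminf (fun n => ∫⁻ x in A, ‖value m ⊤ (w n) x‖ₑ ^ 2 ∂(riemannianMeasure m X)) atTop :=
        lintegral_liminf_le' fun n =>
          ((Lp.aestronglyMeasurable _).mono_measure Measure.restrict_le_self).enorm.pow_const 2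
    _ ≤ liminf (fun n => ENNReal.ofReal δ ^ 2 * (ENNReal.ofReal (1 + c n + c n ^ 2) * N)) atTop :=
        liminf_le_liminf (Eventually.of_forall hb)
    _ = ENNReal.ofReal δ ^ 2 * N := hlim.liminf_eq

/-- Non-concentration of functions in `H^1(X)` implies non-concentration of the differentials of
functions in `H^2(X)`. -/
lemma IsNonConcentrating.eLpNorm_gradient_le {A : Set X} {δ : ℝ} (h : IsNonConcentrating m A δ)
    (v : FormDomain m (⊤ : Opens X)) :
    eLpNorm (gradient m ⊤ v) 2 ((riemannianMeasure m X).restrict A) ≤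
      ENNReal.ofReal δ * eSobolevTwoNorm m (embedding m ⊤ v : X → ℂ) := by
  have hδ0 : ENNReal.ofReal δ ≠ 0 := by simpa using h.1
  -- The H² norm is an infimum over weak derivatives; dividing by δ isolates it on the right, and
  -- each admissible pair is then treated separately.
  rw [mul_comm, ← ENNReal.div_le_iff hδ0 ENNReal.ofReal_ne_top]
  refine le_iInf fun α => le_iInf fun T => le_iInf fun hαT => ?_
  rw [ENNReal.div_le_iff hδ0 ENNReal.ofReal_ne_top, mul_comm]
  have h1 := h.lintegral_coords_le hαT.1 hαT.2
  rw [← eLpNorm_two_sq] at h1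
  rw [eLpNorm_congr_ae (ae_restrict_of_ae
    (gradient_ae_eq (embedding_top_ae v).symm hαT.1))]
  have h2 := ENNReal.rpow_le_rpow h1 (show (0 : ℝ) ≤ 1 / 2 by norm_num)
  rw [ENNReal.mul_rpow_of_nonneg _ _ (by norm_num), ← ENNReal.rpow_natCast,
    ← ENNReal.rpow_natCast, ← ENNReal.rpow_mul, ← ENNReal.rpow_mul] at h2
  simpa using h2

end Kato

/-! ### Powers of the resolvent -/

section Resolvent

variable {H V : Type*} [NormedAddCommGroup H] [InnerProductSpace ℂ H] [CompleteSpace H]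
  [NormedAddCommGroup V] [InnerProductSpace ℂ V] [CompleteSpace V]

-- Functional calculus for x^y = x · x^(y-1) on [0, ∞). With y ≥ 1 this holds at x = 0 too, so R
-- need not be invertible; y = 1 is the case k = 2.
open scoped NNReal in
lemma rpow_eq_mul_rpow_sub_one {R : H →L[ℂ] H} (hR : 0 ≤ R) {y : ℝ} (hy : 1 ≤ y) :
    R ^ y = R * R ^ (y - 1) := by
  have h1 : ContinuousOn (fun x : ℝ≥0 => x ^ (y - 1)) (spectrum ℝ≥0 R) :=
    (NNReal.continuous_rpow_const (by linarith)).continuousOn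
  have h2 := cfc_mul (fun x : ℝ≥0 => x) (fun x : ℝ≥0 => x ^ (y - 1)) R continuousOn_id h1
  rw [cfc_id' ℝ≥0 R] at h2
  rw [CFC.rpow_def, CFC.rpow_def, ← h2]
  refine cfc_congr fun x _ => ?_
  have h3 := NNReal.rpow_add_of_nonneg x zero_le_one (sub_nonneg.2 hy)
  rwa [NNReal.rpow_one, add_sub_cancel] at h3

open scoped NNReal in
lemma norm_rpow_le_one {R : H →L[ℂ] H} (hR : 0 ≤ R) (h1 : ‖R‖ ≤ 1) {y : ℝ} (hy : 0 ≤ y) :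
    ‖R ^ y‖ ≤ 1 := by
  rcases hy.eq_or_lt with rfl | hy
  · rw [CFC.rpow_zero R hR]
    exact ContinuousLinearMap.norm_id_le
  · rw [CFC.norm_rpow R hy hR]
    exact Real.rpow_le_one (norm_nonneg _) h1 hy.le

lemma energyResolvent_nonneg (ι : V →L[ℂ] H) : 0 ≤ energyResolvent ι :=
  (ContinuousLinearMap.nonneg_iff_isPositive _).2 (ContinuousLinearMap.isPositive_self_comp_adjoint ι)

lemma norm_energyResolvent_le {ι : V →L[ℂ] H} (hι : ‖ι‖ ≤ 1) : ‖energyResolvent ι‖ ≤ 1 := by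
  refine (ContinuousLinearMap.opNorm_comp_le _ _).trans ?_
  rw [LinearIsometryEquiv.norm_map]
  exact mul_le_one₀ hι (norm_nonneg _) hι

/-- Elements of `H^k`, `k ≥ 2`, belong to the domain of the energy operator, with control of the
graph norm. -/
lemma HasShiftedPower.exists_isEnergyOperator {ι : V →L[ℂ] H} (hι : ‖ι‖ ≤ 1)
    (hinj : Function.Injective ι) {k : ℝ} (hk : 2 ≤ k) {f : V} {g : H}
    (h : HasShiftedPower ι k (ι f) g) :
    ∃ h' : H, IsEnergyOperator ι f h' ∧ ‖h' + ι f‖ ≤ ‖g‖ := by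
  have hR := energyResolvent_nonneg ι
  -- Since f = R^{k/2} g = R(R^{k/2-1} g), the vector R^{k/2-1} g is (Δ + 1)f. Its norm is at most
  -- ‖g‖, as k/2 - 1 ≥ 0 and ‖R‖ ≤ 1.
  refine ⟨(energyResolvent ι ^ (k / 2 - 1)) g - ι f, ?_, ?_⟩
  · rw [isEnergyOperator_iff, sub_add_cancel]
    refine hinj ?_
    rw [HasShiftedPower, rpow_eq_mul_rpow_sub_one hR (by linarith)] at h
    exact h
  · rw [sub_add_cancel]
    refine (ContinuousLinearMap.le_opNorm _ _).trans (mul_le_of_le_one_left (norm_nonneg _) ?_)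
    exact norm_rpow_le_one hR (norm_energyResolvent_le hι) (by linarith)

end Resolvent

/-! ### Comparison of the form domains -/

section Comparison

variable {m : ℕ} {X : Type*} [EMetricSpace X] [ChartedSpace (EuclideanSpace ℝ (Fin m)) X]
  [RiemannianBundle (fun x : X => TangentSpace (𝓡 m) x)] [IsManifold (𝓡 m) ∞ X]
  [IsContMDiffRiemannianBundle (𝓡 m) ∞ (EuclideanSpace ℝ (Fin m))
    (fun x : X => TangentSpace (𝓡 m) x)]
  [MeasurableSpace X] [BorelSpace X] [SecondCountableTopology X]

/-- Test functions on `U` as test functions on `X`. -/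
def testInclusion (U : Opens X) : TestFunction m U →ₗ[ℂ] TestFunction m (⊤ : Opens X) :=
  Submodule.inclusion (p := testSubmodule m U) (p' := testSubmodule m (⊤ : Opens X))
    fun _ h => ⟨h.1, h.2.1, subset_univ _⟩

lemma testValue_testInclusion {U : Opens X} (φ : TestFunction m U) :
    testValue ⊤ (testInclusion U φ) = testValue U φ := rfl

lemma testGradient_testInclusion {U : Opens X} (φ : TestFunction m U) :
    testGradient ⊤ (testInclusion U φ) = testGradient U φ := rfl

lemma norm_testInclusion {U : Opens X} (φ : TestFunction m U) : ‖testInclusion U φ‖ = ‖φ‖ := by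
  refine (pow_left_inj₀ (norm_nonneg _) (norm_nonneg _) two_ne_zero).1 ?_
  rw [norm_sq_testFunction, norm_sq_testFunction, testValue_testInclusion,
    testGradient_testInclusion]

/-- Extension by zero, from `H^1_0(U)` to `H^1(X)`. -/
def extendZero (U : Opens X) : FormDomain m U →L[ℂ] FormDomain m (⊤ : Opens X) :=
  (UniformSpace.Completion.toComplL ∘L (testInclusion U).mkContinuous 1 fun φ =>
    (norm_testInclusion φ).trans_le (one_mul _).ge).extend UniformSpace.Completion.toComplL

lemma extendZero_coe {U : Opens X} (φ : TestFunction m U) :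
    extendZero U (φ : FormDomain m U) = (testInclusion U φ : FormDomain m (⊤ : Opens X)) := by
  exact ContinuousLinearMap.extend_eq _ (UniformSpace.Completion.denseRange_coe)
    (UniformSpace.Completion.isUniformInducing_coe _) φ

lemma value_extendZero {U : Opens X} (u : FormDomain m U) :
    value m ⊤ (extendZero U u) = value m U u := by
  induction u using UniformSpace.Completion.induction_on with
  | hp => exact isClosed_eq (by fun_prop) (by fun_prop)
  | ih φ => rw [extendZero_coe, value_coe, value_coe, testValue_testInclusion]

lemma gradient_extendZero {U : Opens X} (u : FormDomain m U) :
    gradient m ⊤ (extendZero U u) = gradient m U u := by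
  induction u using UniformSpace.Completion.induction_on with
  | hp => exact isClosed_eq (by fun_prop) (by fun_prop)
  | ih φ => rw [extendZero_coe, gradient_coe, gradient_coe, testGradient_testInclusion]

lemma norm_restrictL2_apply_le (U : Opens X) (f : Lp ℂ 2 (riemannianMeasure m X)) :
    ‖restrictL2 m U f‖ ≤ ‖f‖ := by
  rw [Lp.norm_def, Lp.norm_def]
  refine ENNReal.toReal_mono (Lp.eLpNorm_ne_top f) ?_
  rw [eLpNorm_congr_ae (restrictL2_ae U f)]
  exact eLpNorm_mono_measure _ Measure.restrict_le_self

lemma norm_restrictL2_le (U : Opens X) : ‖restrictL2 m (X := X) U‖ ≤ 1 :=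
  ContinuousLinearMap.opNorm_le_bound _ zero_le_one fun f =>
    (norm_restrictL2_apply_le U f).trans_eq (one_mul _).symm

lemma norm_embedding_le (U : Opens X) : ‖embedding m (X := X) U‖ ≤ 1 :=
  ContinuousLinearMap.opNorm_le_bound _ zero_le_one fun v => by
    rw [embedding_eq, one_mul]
    exact (norm_restrictL2_apply_le U _).trans (norm_value_le v)

/-- The projection `P† P`, where `P` is the restriction to `U`, is multiplication by the indicator
function of `U`. -/
lemma adjoint_restrictL2_restrictL2 (U : Opens X) (f : Lp ℂ 2 (riemannianMeasure m X)) :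
    ContinuousLinearMap.adjoint (restrictL2 m U) (restrictL2 m U f) =
      ((Lp.memLp f).indicator U.isOpen.measurableSet).toLp _ := by
  refine ext_inner_right ℂ fun w => ?_
  rw [ContinuousLinearMap.adjoint_inner_left, L2.inner_def, L2.inner_def]
  calc _ = ∫ x in (U : Set X), inner ℂ (f x) (w x) ∂(riemannianMeasure m X) := by
        refine integral_congr_ae ?_
        filter_upwards [restrictL2_ae U f, restrictL2_ae U w] with x h1 h2
        rw [h1, h2]
    _ = ∫ x, (U : Set X).indicator (fun x => inner ℂ (f x) (w x)) x ∂(riemannianMeasure m X) :=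
        (integral_indicator U.isOpen.measurableSet).symm
    _ = _ := by
        refine integral_congr_ae ?_
        filter_upwards [((Lp.memLp f).indicator U.isOpen.measurableSet).coeFn_toLp] with x h1
        rw [h1]
        by_cases hx : x ∈ (U : Set X)
        · rw [indicator_of_mem hx, indicator_of_mem hx]
        · rw [indicator_of_notMem hx, indicator_of_notMem hx, inner_zero_left]

lemma adjoint_restrictL2_top (f : Lp ℂ 2 (riemannianMeasure m X)) :
    ContinuousLinearMap.adjoint (restrictL2 m (⊤ : Opens X)) (restrictL2 m ⊤ f) = f := by
  rw [adjoint_restrictL2_restrictL2]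
  refine Lp.ext ((MemLp.coeFn_toLp _).trans (Eventually.of_forall fun x => ?_))
  exact indicator_of_mem (mem_univ x) _

lemma adjoint_restrictL2_value {U : Opens X} (u : FormDomain m U) :
    ContinuousLinearMap.adjoint (restrictL2 m U) (restrictL2 m U (value m U u)) = value m U u := by
  rw [adjoint_restrictL2_restrictL2]
  refine Lp.ext ((MemLp.coeFn_toLp _).trans ?_)
  filter_upwards [(ae_restrict_iff' U.isOpen.measurableSet.compl).1 (value_ae_eq_zero u)]
    with x hx
  by_cases h : x ∈ (U : Set X)
  · exact indicator_of_mem h _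
  · rw [indicator_of_notMem h, hx h, Pi.zero_apply]

/-- An `L^2` function dominated by `g` in `A` and zero outside. -/
lemma norm_Lp_le_of_ae_le_indicator {S F G : Type*} [MeasurableSpace S] {μ : Measure S}
    [NormedAddCommGroup F] [NormedAddCommGroup G] {A : Set S} (hA : MeasurableSet A) {w : Lp F 2 μ}
    {g : S → G} {c : ℝ} (hc : 0 ≤ c) (h : ∀ᵐ x ∂μ, ‖w x‖ ≤ ‖A.indicator g x‖)
    (hg : eLpNorm g 2 (μ.restrict A) ≤ ENNReal.ofReal c) : ‖w‖ ≤ c := by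
  rw [Lp.norm_def]
  refine ENNReal.toReal_le_of_le_ofReal hc ((eLpNorm_mono_ae h).trans ?_)
  rwa [eLpNorm_indicator_eq_eLpNorm_restrict hA]

variable [IsRiemannianManifold (𝓡 m) X] [CompleteSpace X]

/-- The energy forms of `X` and of `U` are quasi-unitarily equivalent if a cut-off function `χ` with
support in `U` is given such that `supp (1 - χ)` is non-concentrating and `f ↦ f dχ` is small. -/
lemma quasiUnitarilyEquivalent_of_cutoff {U : Opens X} {χ : X → ℝ} {K : NNReal}
    (hχ : LipschitzWith K χ) (h01 : ∀ x, χ x ∈ Icc (0 : ℝ) 1) (hs : tsupport χ ⊆ U) {δ' C δp k : ℝ}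
    (hk : 2 ≤ k) (hn : IsNonConcentrating m (tsupport fun x => 1 - χ x) δ')
    (he : IsEllipticallyRegular m X C)
    (hd : HasDecayNorm m k (tsupport fun x => 1 - χ x) χ δp) :
    QuasiUnitarilyEquivalent (embedding m (⊤ : Opens X)) (embedding m U)
      (max δ' (C * δ' + δp)) k := by
  set A : Set X := tsupport fun x => 1 - χ x with hA
  have hAm : MeasurableSet A := (isClosed_tsupport _).measurableSet
  have hδ' : 0 < δ' := hn.1
  have hmax : δ' ≤ max δ' (C * δ' + δp) := le_max_left _ _
  have h1 : ∀ x, ‖(χ x : ℂ)‖ ≤ 1 := fun x => by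
    rw [Complex.norm_real, Real.norm_of_nonneg (h01 x).1]
    exact (h01 x).2
  have h1' : ∀ x, ‖(χ x : ℂ) - 1‖ ≤ 1 := fun x => by
    rw [← Complex.ofReal_one, ← Complex.ofReal_sub, Complex.norm_real, Real.norm_eq_abs, abs_le]
    exact ⟨by linarith [(h01 x).1], by linarith [(h01 x).2]⟩
  -- Outside U the cut-off vanishes and 1 - χ = 1: the obstacle is contained in A.
  have hU : ∀ x ∉ (U : Set X), x ∈ A := fun x hx => by
    refine subset_tsupport _ ?_
    rw [Function.mem_support, image_eq_zero_of_notMem_tsupport fun h => hx (hs h)]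
    norm_num
  have hA1 : ∀ x ∉ A, χ =ᶠ[𝓝 x] fun _ => 1 := fun x hx => by
    filter_upwards [notMem_tsupport_iff_eventuallyEq.1 hx] with y hy
    have : 1 - χ y = 0 := hy
    linarith
  have hnc : ∀ v : FormDomain m (⊤ : Opens X),
      eLpNorm (value m ⊤ v) 2 ((riemannianMeasure m X).restrict A) ≤
        ENNReal.ofReal (δ' * ‖v‖) := fun v => by
    have := hn.2 v
    rwa [eLpNorm_congr_ae (ae_restrict_of_ae (embedding_top_ae v))] at this
  obtain ⟨M, hM⟩ := exists_lipschitzMul (m := m) hχ h1 hs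
  let P := restrictL2 m (X := X) U
  let Q := restrictL2 m (X := X) (⊤ : Opens X)
  -- The space L²(X) occurs as L² of the measure restricted to the whole of X; Q is the
  -- identification, with its adjoint as left inverse, and the adjoint of the restriction P is
  -- extension by zero.
  let J : L2 m (⊤ : Opens X) →L[ℂ] L2 m U := P ∘L ContinuousLinearMap.adjoint Q
  let J' : L2 m U →L[ℂ] L2 m (⊤ : Opens X) := Q ∘L ContinuousLinearMap.adjoint P
  have hJι : ∀ v, J (embedding m ⊤ v) = P (value m ⊤ v) := fun v => by
    rw [embedding_eq]
    exact congrArg P (adjoint_restrictL2_top _)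
  have hJ'ι : ∀ u, J' (embedding m U u) = Q (value m U u) := fun u => by
    rw [embedding_eq]
    exact congrArg Q (adjoint_restrictL2_value _)
  have hJn : ∀ f, ‖J f‖ ≤ ‖f‖ := fun f => by
    refine (norm_restrictL2_apply_le U _).trans ((ContinuousLinearMap.le_opNorm _ _).trans ?_)
    rw [LinearIsometryEquiv.norm_map]
    exact mul_le_of_le_one_left (norm_nonneg _) (norm_restrictL2_le _)
  have hadj : ∀ f u, inner ℂ (J f) u = inner ℂ f (J' u) := fun f u => by
    change inner ℂ (P (ContinuousLinearMap.adjoint Q f)) u =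
      inner ℂ f (Q (ContinuousLinearMap.adjoint P u))
    rw [← ContinuousLinearMap.adjoint_inner_right, ContinuousLinearMap.adjoint_inner_left]
  refine ⟨hδ'.le.trans hmax, J, J', M, extendZero U, ⟨?_, ?_, ?_, ?_⟩, ⟨?_, ?_⟩, ?_⟩
  · intro f
    refine (hJn f).trans (le_mul_of_one_le_left (norm_nonneg _) ?_)
    linarith
  · intro f u
    rw [hadj, sub_self, norm_zero]
    exact mul_nonneg (mul_nonneg (hδ'.le.trans hmax) (norm_nonneg _)) (norm_nonneg _)
  · intro f
    refine le_trans ?_ (mul_le_mul_of_nonneg_right hmax (norm_nonneg f))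
    have e : embedding m ⊤ f - J' (J (embedding m ⊤ f)) =
        Q (value m ⊤ f - ContinuousLinearMap.adjoint P (P (value m ⊤ f))) := by
      rw [hJι, map_sub, embedding_eq]
      rfl
    rw [e]
    refine (norm_restrictL2_apply_le _ _).trans ?_
    refine norm_Lp_le_of_ae_le_indicator hAm (by positivity) ?_ (hnc f)
    have e2 : ContinuousLinearMap.adjoint P (P (value m ⊤ f)) = _ :=
      adjoint_restrictL2_restrictL2 U (value m ⊤ f)
    rw [e2]
    filter_upwards [Lp.coeFn_sub (value m ⊤ f) (((Lp.memLp (value m ⊤ f)).indicator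
      U.isOpen.measurableSet).toLp _), ((Lp.memLp (value m ⊤ f)).indicator
      U.isOpen.measurableSet).coeFn_toLp] with x a1 a2
    rw [a1, Pi.sub_apply, a2]
    by_cases hx : x ∈ (U : Set X)
    · rw [indicator_of_mem hx, sub_self, norm_zero]
      exact norm_nonneg _
    · rw [indicator_of_notMem hx, indicator_of_mem (hU x hx), sub_zero]
  · intro u
    have e : embedding m U u - J (J' (embedding m U u)) = 0 := by
      rw [hJ'ι, sub_eq_zero, embedding_eq]
      exact congrArg P (adjoint_restrictL2_top _).symm
    rw [e, norm_zero]
    exact mul_nonneg (hδ'.le.trans hmax) (norm_nonneg _)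
  · intro f
    refine le_trans ?_ (mul_le_mul_of_nonneg_right hmax (norm_nonneg f))
    rw [hJι, embedding_eq, ← map_sub]
    refine (norm_restrictL2_apply_le _ _).trans ?_
    refine norm_Lp_le_of_ae_le_indicator hAm (by positivity) ?_ (hnc f)
    filter_upwards [Lp.coeFn_sub (value m U (M f)) (value m ⊤ f), (hM f).1] with x a1 a2
    rw [a1, Pi.sub_apply, a2, ← sub_one_mul, norm_mul]
    by_cases hx : x ∈ A
    · rw [indicator_of_mem hx]
      exact mul_le_of_le_one_left (norm_nonneg _) (h1' x)
    · rw [(hA1 x hx).eq_of_nhds, Complex.ofReal_one, sub_self, norm_zero, zero_mul]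
      exact norm_nonneg _
  · intro u
    rw [hJ'ι, embedding_eq, value_extendZero, sub_self, norm_zero]
    exact mul_nonneg (hδ'.le.trans hmax) (norm_nonneg _)
  · intro f g u hfg
    obtain ⟨h', hh, hhn⟩ := hfg.exists_isEnergyOperator (norm_embedding_le _) (by
      intro v w hvw
      refine value_injective ⊤ (Lp.ext ?_)
      have e1 := embedding_top_ae v
      rw [hvw] at e1
      exact e1.symm.trans (embedding_top_ae w)) hk
    have hC : 0 ≤ C := zero_le_one.trans he.1
    -- Non-concentration of differentials costs δ', elliptic regularity costs C, and ‖(Δ + 1)f‖ ≤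
    -- ‖g‖ = ‖f‖_k.
    have b1 : eLpNorm (gradient m ⊤ f) 2 ((riemannianMeasure m X).restrict A) ≤
        ENNReal.ofReal (C * δ' * ‖g‖) := by
      refine (hn.eLpNorm_gradient_le f).trans ?_
      refine (mul_le_mul_right (he.2 f h' hh) _).trans ?_
      rw [← ENNReal.ofReal_mul hδ'.le]
      refine ENNReal.ofReal_le_ofReal ?_
      calc δ' * (C * ‖h' + embedding m ⊤ f‖) = C * δ' * ‖h' + embedding m ⊤ f‖ := by ring
        _ ≤ C * δ' * ‖g‖ := mul_le_mul_of_nonneg_left hhn (by positivity)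
    have b2 : eLpNorm (fun x => value m ⊤ f x • coords (realDifferential m χ x)) 2
        ((riemannianMeasure m X).restrict A) ≤ ENNReal.ofReal (δp * ‖g‖) := by
      refine le_trans (le_of_eq ?_) (hd.1.2 _ _ hfg)
      rw [eDecayNorm, eLpNorm_eq_lintegral_rpow_enorm_toReal two_ne_zero ENNReal.ofNat_ne_top,
        ENNReal.toReal_ofNat]
      congr 1
      refine lintegral_congr_ae (ae_restrict_of_ae ?_)
      filter_upwards [embedding_top_ae f] with x hx
      rw [hx, covectorNormSq_differential, ← mul_pow, ← norm_smul, ← ofReal_norm,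
        ENNReal.ofReal_pow (norm_nonneg _)]
      exact ENNReal.rpow_natCast _ 2
    have hδp : 0 ≤ δp := hd.1.1
    have m1 : MemLp (fun x => ((χ x : ℂ) - 1) • gradient m ⊤ f x) 2 (riemannianMeasure m X) :=
      memLp_two_of_bounded_smul (Lp.memLp (gradient m ⊤ f))
        ((Complex.continuous_ofReal.comp hχ.continuous).sub
          continuous_const).aestronglyMeasurable h1'
    have m2 := memLp_two_smul_realDifferential (m := m) hχ (Lp.memLp (value m ⊤ f))
    -- The product rule d(χf) - df = (χ - 1) df + f dχ. Both terms vanish outside A, where χ is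
    -- locally equal to 1.
    have e : gradient m U (M f) - gradient m ⊤ f = m1.toLp _ + m2.toLp _ := by
      refine Lp.ext ?_
      filter_upwards [Lp.coeFn_sub (gradient m U (M f)) (gradient m ⊤ f), (hM f).2,
        Lp.coeFn_add (m1.toLp _) (m2.toLp _), m1.coeFn_toLp, m2.coeFn_toLp] with x a1 a2 a3 a4 a5
      rw [a1, a3, Pi.sub_apply, Pi.add_apply, a2, a4, a5, sub_smul, one_smul]
      abel
    have b3 : ‖m1.toLp _‖ ≤ C * δ' * ‖g‖ := by
      refine norm_Lp_le_of_ae_le_indicator hAm (by positivity) ?_ b1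
      filter_upwards [m1.coeFn_toLp] with x a1
      rw [a1, norm_smul]
      by_cases hx : x ∈ A
      · rw [indicator_of_mem hx]
        exact mul_le_of_le_one_left (norm_nonneg _) (h1' x)
      · rw [(hA1 x hx).eq_of_nhds, Complex.ofReal_one, sub_self, norm_zero, zero_mul]
        exact norm_nonneg _
    have b4 : ‖m2.toLp _‖ ≤ δp * ‖g‖ := by
      refine norm_Lp_le_of_ae_le_indicator hAm (by positivity) ?_ b2
      filter_upwards [m2.coeFn_toLp] with x a1
      rw [a1]
      by_cases hx : x ∈ A
      · rw [indicator_of_mem hx]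
      · rw [realDifferential_eq_zero (hA1 x hx), coords_zero, smul_zero, norm_zero]
        exact norm_nonneg _
    -- Extension by zero does not change the gradient of u, so both forms are inner products with
    -- the same du and their difference is estimated by Cauchy-Schwarz.
    rw [form_eq, form_eq, gradient_extendZero, ← inner_sub_left, e]
    refine (norm_inner_le_norm _ _).trans (mul_le_mul ?_ (norm_gradient_le u) (norm_nonneg _)
      (mul_nonneg (hδ'.le.trans hmax) (norm_nonneg _)))
    calc _ ≤ C * δ' * ‖g‖ + δp * ‖g‖ := (norm_add_le _ _).trans (add_le_add b3 b4)
      _ = (C * δ' + δp) * ‖g‖ := by ring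
      _ ≤ _ := mul_le_mul_of_nonneg_right (le_max_right _ _) (norm_nonneg _)

end Comparison

end Obstacle

end

theorem mainTheorem2 {m : ℕ} (hm : 2 ≤ m) {X : Type*} [EMetricSpace X] [CompleteSpace X]
    [SecondCountableTopology X] [MeasurableSpace X] [BorelSpace X]
    [ChartedSpace (EuclideanSpace ℝ (Fin m)) X] [IsManifold (𝓡 m) ∞ X]
    [RiemannianBundle (fun x : X => TangentSpace (𝓡 m) x)]
    [IsContMDiffRiemannianBundle (𝓡 m) ∞ (EuclideanSpace ℝ (Fin m))
      (fun x : X => TangentSpace (𝓡 m) x)]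
    [IsRiemannianManifold (𝓡 m) X]
    (k : ℝ) (hk : 2 ≤ k) (ε₀ : ℝ) (hε₀ : 0 < ε₀) (B : ℝ → Closeds X)
    (χ : ℝ → X → ℝ) (δ' : ℝ → ℝ) (C : ℝ) (δp : ℝ → ℝ)
    (hB : Obstacle.IsDirichletFading m k ε₀ B χ δ' C δp) :
    ∀ ε ∈ Ioc 0 ε₀,
      Obstacle.QuasiUnitarilyEquivalent
        (Obstacle.embedding m (⊤ : Opens X)) (Obstacle.embedding m (B ε).compl)
        (max (δ' ε) (C * δ' ε + δp ε)) k := by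
  intro ε hε
  obtain ⟨K, hK⟩ := hB.lipschitz ε hε
  exact Obstacle.quasiUnitarilyEquivalent_of_cutoff hK (hB.mem_Icc ε hε) (hB.tsupport_subset ε hε)
    hk (hB.nonConcentrating ε hε) hB.ellipticallyRegular (hB.moderateDecay ε hε)
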